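/- Let $\xi$ be a real random variable of mean zero and variance one such that, for some constants $K,C_0>0$, $\mathbf P(|\xi|\ge s)\le C_0\exp(-s^2/K)$ for all $s\ge 0$. For $n\ge 1$ let $A_1,A_2,\dots$ be independent random $n\times n$ matrices whose entries are iid copies of $\frac{1}{\sqrt n}\xi$, and put $B_N=A_N\cdots A_2A_1$. All norms are Euclidean. For a nonzero $x\in\mathbb R^n$ and $\kappa,\gamma>0$ let $$\mathrm{LCD}_{\kappa,\gamma}(x)=\inf\{\theta>0:\ \operatorname{dist}(\theta x,\mathbb Z^n)<\min(\gamma\|\theta x\|,\kappa)\},$$ and for $c>0$ let $$\mathcal S=\mathcal S_{n,c}=\{x\in S^{n-1}:\ \mathrm{LCD}_{\kappa,\gamma}(x)\ge D\},\qquad \gamma=\tfrac12,\quad \kappa=n^c,\quad D=\exp(n^c).$$ **Lemma.** There is an absolute constant $c_0>0$ such that for every $0<c<c_0$ and all $K,C_0>0$ there is a constant $c'>0$, depending only on $c$, $K$ and $C_0$, for which the following holds. For every $\xi$ as above, all $n\ge1$ and $N\ge 1$, every fixed (deterministic) vector $x_0\in\mathcal S_{n,c}$ (in particular, every element of a net $\mathcal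 N_{start}\subset\mathcal S_{n,c}$ of the sphere), and every $t\ge 1/n$, $$\mathbf P\Big(\Big|\frac1N\log\|B_Nx_0\|\Big|\ge t\Big)\le \exp\big(-c'\min\{t^2,t\}\,N n^{1-2c}\big)+N n^{-c'n},$$ where $\log 0=-\infty$, so that the event on the left contains the event $B_Nx_0=0$. -/

import Mathlib

open MeasureTheory ProbabilityTheory

noncomputable section

namespace LyapunovTop

/-- `ξ` has mean zero, variance one, and the tail `P(|ξ| ≥ s) ≤ C₀ exp(-s² / K)` for all `s ≥ 0`. -/
structure IsSubgaussianAtom {Ω₀ : Type*} [MeasurableSpace Ω₀] (P₀ : Measure Ω₀) (ξ : Ω₀ → ℝ)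
    (K C₀ : ℝ) : Prop where
  aemeasurable : AEMeasurable ξ P₀
  mean_eq_zero : ∫ ω, ξ ω ∂P₀ = 0
  variance_eq_one : variance ξ P₀ = 1
  tail_le : ∀ s : ℝ, 0 ≤ s → P₀.real {ω | s ≤ |ξ ω|} ≤ C₀ * Real.exp (-(s ^ 2 / K))

/-- The integer lattice `ℤⁿ` inside Euclidean space `ℝⁿ`. -/
def intLattice (n : ℕ) : Set (EuclideanSpace ℝ (Fin n)) :=
  Set.range fun p : Fin n → ℤ => WithLp.toLp 2 fun i => (p i : ℝ)

/-- The least common denominator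
`LCD_{κ,γ}(x) = inf {θ > 0 : dist(θ x, ℤⁿ) < min(γ ‖θ x‖, κ)}`, an extended real number
(so that the infimum of the empty set is `+∞`). -/
def LCD {n : ℕ} (κ γ : ℝ) (x : EuclideanSpace ℝ (Fin n)) : EReal :=
  ⨅ (θ : ℝ) (_ : 0 < θ ∧ Metric.infDist (θ • x) (intLattice n) < min (γ * ‖θ • x‖) κ), (θ : EReal)

/-- The set `𝒮 ⊂ S^{n-1}` of unstructured unit vectors: those with `LCD_{κ,γ}(x) ≥ D`, where
`γ = 1/2`, `κ = n^c` and `D = exp(n^c)`. -/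
def unstructured (n : ℕ) (c : ℝ) : Set (EuclideanSpace ℝ (Fin n)) :=
  {x | ‖x‖ = 1 ∧ ((Real.exp ((n : ℝ) ^ c) : ℝ) : EReal) ≤ LCD ((n : ℝ) ^ c) (1 / 2) x}

/-- The `k`-th random matrix (counted from `k = 0`); its entries are those of `X k`, divided
by `√n`. -/
def scaledMatrix {Ω : Type*} {n : ℕ} (X : ℕ × Fin n × Fin n → Ω → ℝ) (k : ℕ) (ω : Ω) :
    Matrix (Fin n) (Fin n) ℝ :=
  Matrix.of fun i j => X (k, i, j) ω / Real.sqrt n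

/-- The product `B_N = A_N ⋯ A_2 A_1` of the first `N` matrices, the newest factor on the left. -/
def matrixProduct {Ω : Type*} {n : ℕ} (X : ℕ × Fin n × Fin n → Ω → ℝ) :
    ℕ → Ω → Matrix (Fin n) (Fin n) ℝ
  | 0, _ => 1
  | N + 1, ω => scaledMatrix X N ω * matrixProduct X N ω

/-- The vector `B_N x`. -/
def orbit {Ω : Type*} {n : ℕ} (X : ℕ × Fin n × Fin n → Ω → ℝ) (x : EuclideanSpace ℝ (Fin n))
    (N : ℕ) (ω : Ω) : EuclideanSpace ℝ (Fin n) :=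
  WithLp.toLp 2 (Matrix.mulVec (matrixProduct X N ω) x.ofLp)

/-- The event `|N⁻¹ log ‖B_N x‖| ≥ t`, with the convention `log 0 = -∞`: it contains all outcomes
with `B_N x = 0` (this must be said, because `Real.log 0 = 0`). -/
def deviationEvent {Ω : Type*} {n : ℕ} (X : ℕ × Fin n × Fin n → Ω → ℝ)
    (x : EuclideanSpace ℝ (Fin n)) (N : ℕ) (t : ℝ) : Set Ω :=
  {ω | orbit X x N ω = 0 ∨ t ≤ |1 / (N : ℝ) * Real.log ‖orbit X x N ω‖|}

end LyapunovTop

end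

/-!
Along the orbit only the direction of `B_k x₀` and the norm of its image under the next matrix
matter. The proof follows the Markov chain `chainState` of directions, together with the
accumulated logarithms of the norms, clamped at a level `L` so that every step is bounded
(`logStep`). Given the direction `x`, the coordinates of the next unscaled image are iid with law
`rowLaw μ x`, which is sub-Gaussian with the same parameters for every unit vector `x`
(`rowLaw_isNormalizedSubgaussian`, `lintegral_chain`).

*Degenerate images.* A step has a logarithm out of control only if the image is much too short or
much too long, and short images are unlikely as long as the direction has some energy in its
coordinates of size at most `n^{-c}` (`tailEnergy`). An unstructured vector has energy at least
`1/16` there (`tailEnergy_of_unstructured`): otherwise rounding its large coordinates would produce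
a small denominator. Energy can only be lost with super-exponentially small probability
(`degenerate_prob_pow`), and a negative power of the energy, with exponent of order `n`, is a
Lyapunov function of the chain (`lyapunov_step`). Restarting the chain at `x₀` after a degenerate
image, one finds that the chain follows the orbit for `N` steps up to an event of probability
`N n^{-kn}` (`prob_untracked_le`), the second term of the bound.

*Concentration.* By Bernstein's inequality the logarithmic steps are sub-Gaussian at rate
`n / (log n)²`. Their conditional drift is about `-(κ - 1) / (4n)`, where `κ` is the fourth moment of
`rowLaw μ x`; the drift must be below `t`, which may be as small as `1/n`. In a flat direction `κ` is close
to `3` and the drift at most `3 / (4n)` (`drift_le`), and directions after the first are flat with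
overwhelming probability. An exponential supermartingale gives the tail bound `chain_tail`. The
factor `n^{-2c}` in the claim absorbs the logarithm, and the constant in front of the exponential
too, except when `t² N n / (log n)²` is bounded.

*Slow regime.* In that case the claim is a lower bound, of order `t² N n^{1-2c}`, for the
probability that the log-norm is below `t N` (`slow_regime_lower`). Recentred by its drift, the
log-norm behaves like a random walk with variance `1 / (2n)` per step, and rescaled bumps of
shrinking width, which are subsolutions of the heat equation (`heat_inequality`), give a
submartingale. It shows that before the last step the walk is within `W` of its centre with
probability of order `W² / (W² + N/n)`, for `W` of order at least `1 / √n` (`centred_chain_lower`).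
When the target is not wider than `1 / √n`, the last step has to hit it: `‖A x‖²` falls on both
sides of any level near its mean with fair probability (`both_sides_row`), and resampling the
matrix piece by piece changes it little each time, so that it must come close to the level
(`crossing`). Hence a single step comes close to a given level with probability of nearly the
expected order (`near_level_prob`).

In bounded dimension the claim is trivial for two or more factors, since the second term then
exceeds one; one factor is treated by the second moment of `‖A x‖²` (`deviation_le_of_small_dim`).
-/

namespace LyapunovTop

open Real Filter Topology

/-! ### Exponential moments of sub-Gaussian variables -/

lemma exp_le_add_exp_sq (z : ℝ) : exp z ≤ z + exp (z ^ 2) := by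
  have h1 := add_one_le_exp (z ^ 2)
  by_cases hz : |z| ≤ 1
  · have := (abs_le.1 (abs_exp_sub_one_sub_id_le hz)).2
    linarith
  · rcases lt_abs.1 (not_le.1 hz) with h | h
    · have : exp z ≤ exp (z ^ 2) := exp_le_exp.2 (by nlinarith)
      linarith
    · have : exp z ≤ 1 := exp_le_one_iff.2 (by linarith)
      nlinarith

lemma exp_mul_le_one_add {θ w : ℝ} (h0 : 0 ≤ θ) (h1 : θ ≤ 1) :
    exp (θ * w) ≤ 1 + θ * (exp w - 1) := by
  have := rpow_one_add_le_one_add_mul_self (s := exp w - 1) (by linarith [exp_pos w]) h0 h1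
  rwa [add_sub_cancel, ← exp_mul, mul_comm w] at this

section

variable {Ω : Type*} [MeasurableSpace Ω] {P : Measure Ω} [IsProbabilityMeasure P] {X : Ω → ℝ}

/-- The layer cake formula turns a Gaussian tail into a Gaussian exponential moment. -/
lemma exp_sq_moment_of_tail (hX : AEMeasurable X P) {K C : ℝ} (hK : 0 < K) (hC : 0 ≤ C)
    (tail : ∀ s, 0 ≤ s → P.real {ω | s ≤ |X ω|} ≤ C * exp (-(s ^ 2 / K))) :
    Integrable (fun ω => exp (X ω ^ 2 / (2 * K))) P ∧
      ∫ ω, exp (X ω ^ 2 / (2 * K)) ∂P ≤ 1 + C := by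
  have hder : ∀ x : ℝ, HasDerivAt (fun x => exp (x ^ 2 / (2 * K)))
      (x / K * exp (x ^ 2 / (2 * K))) x := by
    intro x
    have := ((hasDerivAt_pow 2 x).div_const (2 * K)).exp
    convert this using 1
    simp; field_simp
  have hint : ∀ t : ℝ, ∫ s in (0 : ℝ)..t, s / K * exp (s ^ 2 / (2 * K)) =
      exp (t ^ 2 / (2 * K)) - 1 := by
    intro t
    rw [intervalIntegral.integral_eq_sub_of_hasDerivAt (fun x _ => hder x)
      (by apply Continuous.intervalIntegrable; fun_prop)]
    simp
  have hder' : ∀ x ∈ Set.Ici (0 : ℝ), HasDerivAt (fun x => -C * exp (-(x ^ 2 / (2 * K))))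
      (C * (x / K * exp (-(x ^ 2 / (2 * K))))) x := by
    intro x _
    have := (((hasDerivAt_pow 2 x).div_const (2 * K)).fun_neg.exp).const_mul (-C)
    refine this.congr_deriv ?_
    simp only [Nat.cast_ofNat, Nat.add_one_sub_one, pow_one]
    field_simp
  have hnn : ∀ x ∈ Set.Ioi (0 : ℝ), 0 ≤ C * (x / K * exp (-(x ^ 2 / (2 * K)))) := by
    intro x hx
    have : 0 < x := hx
    positivity
  have hlim : Tendsto (fun x => -C * exp (-(x ^ 2 / (2 * K)))) atTop (𝓝 0) := by
    have : Tendsto (fun x : ℝ => exp (-(x ^ 2 / (2 * K)))) atTop (𝓝 0) :=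
      tendsto_exp_neg_atTop_nhds_zero.comp
        ((tendsto_pow_atTop two_ne_zero).atTop_div_const (by positivity))
    simpa using this.const_mul (-C)
  have hI := integrableOn_Ioi_deriv_of_nonneg' hder' hnn hlim
  have hIv := integral_Ioi_of_hasDerivAt_of_nonneg' hder' hnn hlim
  have key : ∫⁻ ω, ENNReal.ofReal (exp (X ω ^ 2 / (2 * K)) - 1) ∂P ≤ ENNReal.ofReal C := by
    have h1 := lintegral_comp_eq_lintegral_meas_le_mul (f := fun ω => |X ω|)
      (g := fun s => s / K * exp (s ^ 2 / (2 * K))) P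
      (ae_of_all _ fun ω => abs_nonneg _) (by fun_prop)
      (fun t _ => by apply Continuous.intervalIntegrable; fun_prop)
      (by
        filter_upwards [ae_restrict_mem measurableSet_Ioi] with t ht
        have : (0 : ℝ) < t := ht
        positivity)
    simp only [hint, sq_abs] at h1
    rw [h1]
    have h2 : ∫⁻ t in Set.Ioi (0 : ℝ), P {a | t ≤ |X a|} *
          ENNReal.ofReal (t / K * exp (t ^ 2 / (2 * K))) ≤
        ∫⁻ t in Set.Ioi (0 : ℝ), ENNReal.ofReal (C * (t / K * exp (-(t ^ 2 / (2 * K))))) := by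
      refine setLIntegral_mono' measurableSet_Ioi fun t ht => ?_
      have ht0 : (0 : ℝ) < t := ht
      have h3 : P {a | t ≤ |X a|} ≤ ENNReal.ofReal (C * exp (-(t ^ 2 / K))) := by
        rw [← ofReal_measureReal]
        exact ENNReal.ofReal_le_ofReal (tail t ht0.le)
      refine (mul_le_mul_left h3 _).trans ?_
      rw [← ENNReal.ofReal_mul (by positivity)]
      apply ENNReal.ofReal_le_ofReal
      apply le_of_eq
      have : exp (-(t ^ 2 / (2 * K))) = exp (-(t ^ 2 / K)) * exp (t ^ 2 / (2 * K)) := by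
        rw [← exp_add]; congr 1; field_simp; ring
      rw [this]; ring
    refine h2.trans ?_
    rw [← ofReal_integral_eq_lintegral_ofReal hI
      (by filter_upwards [ae_restrict_mem measurableSet_Ioi] with t ht using hnn t ht), hIv]
    simp
  have hnn2 : ∀ ω, 0 ≤ exp (X ω ^ 2 / (2 * K)) - 1 := fun ω => by
    have : 0 ≤ X ω ^ 2 / (2 * K) := by positivity
    linarith [add_one_le_exp (X ω ^ 2 / (2 * K))]
  have hint1 : Integrable (fun ω => exp (X ω ^ 2 / (2 * K)) - 1) P := by
    refine ⟨by fun_prop, ?_⟩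
    rw [hasFiniteIntegral_iff_ofReal (ae_of_all _ hnn2)]
    exact key.trans_lt ENNReal.ofReal_lt_top
  have hint2 : Integrable (fun ω => exp (X ω ^ 2 / (2 * K))) P := by
    refine (hint1.add (integrable_const (1 : ℝ))).congr (ae_of_all _ fun ω => ?_)
    simp
  refine ⟨hint2, ?_⟩
  have h5 : ∫ ω, (exp (X ω ^ 2 / (2 * K)) - 1) ∂P ≤ C := by
    rw [integral_eq_lintegral_of_nonneg_ae (ae_of_all _ hnn2) hint1.aestronglyMeasurable]
    exact ENNReal.toReal_le_of_le_ofReal hC key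
  rw [integral_sub hint2 (integrable_const _)] at h5
  simp at h5
  linarith

/-- Lowering the exponent brings an exponential moment close to one. -/
lemma exp_sq_moment_mul (hX : AEMeasurable X P) {b C θ : ℝ} (hb : 0 ≤ b)
    (hi : Integrable (fun ω => exp (b * X ω ^ 2)) P) (hC : ∫ ω, exp (b * X ω ^ 2) ∂P ≤ 1 + C)
    (h0 : 0 ≤ θ) (h1 : θ ≤ 1) :
    Integrable (fun ω => exp (θ * (b * X ω ^ 2))) P ∧
      ∫ ω, exp (θ * (b * X ω ^ 2)) ∂P ≤ 1 + θ * C := by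
  have hi' : Integrable (fun ω => exp (θ * (b * X ω ^ 2))) P := by
    refine hi.mono' (by fun_prop) (ae_of_all _ fun ω => ?_)
    rw [norm_of_nonneg (exp_pos _).le]
    apply exp_le_exp.2
    have : 0 ≤ b * X ω ^ 2 := by positivity
    nlinarith
  refine ⟨hi', ?_⟩
  have hi1 : Integrable (fun ω => θ * (exp (b * X ω ^ 2) - 1)) P :=
    (hi.sub (integrable_const _)).const_mul _
  calc ∫ ω, exp (θ * (b * X ω ^ 2)) ∂P ≤ ∫ ω, (1 + θ * (exp (b * X ω ^ 2) - 1)) ∂P :=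
        integral_mono hi' ((integrable_const _).add hi1)
          fun ω => exp_mul_le_one_add h0 h1
    _ = 1 + θ * (∫ ω, exp (b * X ω ^ 2) ∂P - 1) := by
        rw [integral_add (integrable_const _) hi1, integral_const_mul,
          integral_sub hi (integrable_const _)]
        simp
    _ ≤ 1 + θ * C := by nlinarith

/-- A Gaussian tail gives an exponential moment of the square that is at most `2`. -/
lemma exp_sq_moment_le_two_of_tail (hX : AEMeasurable X P) {K C : ℝ} (hK : 0 < K) (hC : 1 ≤ C)
    (tail : ∀ s, 0 ≤ s → P.real {ω | s ≤ |X ω|} ≤ C * exp (-(s ^ 2 / K))) :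
    Integrable (fun ω => exp (1 / (2 * K * C) * X ω ^ 2)) P ∧
      ∫ ω, exp (1 / (2 * K * C) * X ω ^ 2) ∂P ≤ 2 := by
  obtain ⟨h1, h2⟩ := exp_sq_moment_of_tail hX hK (by linarith) tail
  have e1 : ∀ ω, X ω ^ 2 / (2 * K) = 1 / (2 * K) * X ω ^ 2 := fun ω => by ring
  simp only [e1] at h1 h2
  have hC0 : 0 < C := by linarith
  obtain ⟨h3, h4⟩ := exp_sq_moment_mul hX (by positivity) h1 h2 (θ := 1 / C) (by positivity)
    (by rw [div_le_one hC0]; exact hC)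
  have e2 : ∀ ω, 1 / C * (1 / (2 * K) * X ω ^ 2) = 1 / (2 * K * C) * X ω ^ 2 := fun ω => by
    field_simp
  simp only [e2] at h3 h4
  refine ⟨h3, h4.trans (le_of_eq ?_)⟩
  field_simp; norm_num

lemma integrable_of_exp_sq (hX : AEMeasurable X P) {b : ℝ} (hb : 0 < b)
    (hi : Integrable (fun ω => exp (b * X ω ^ 2)) P) (k : ℕ) :
    Integrable (fun ω => X ω ^ k) P := by
  refine ((integrable_const (1 : ℝ)).add (hi.const_mul (k.factorial / b ^ k))).mono'
    (by fun_prop) (ae_of_all _ fun ω => ?_)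
  have h1 := pow_div_factorial_le_exp (x := b * X ω ^ 2) (by positivity) k
  have h2 : (X ω ^ k) ^ 2 ≤ k.factorial / b ^ k * exp (b * X ω ^ 2) := by
    rw [div_le_iff₀ (by positivity)] at h1
    rw [div_mul_eq_mul_div, le_div_iff₀ (by positivity)]
    calc (X ω ^ k) ^ 2 * b ^ k = (b * X ω ^ 2) ^ k := by ring
      _ ≤ _ := by linarith
  rw [Real.norm_eq_abs, Pi.add_apply]
  have : |X ω ^ k| ≤ 1 + (X ω ^ k) ^ 2 := by
    rw [← sq_abs (X ω ^ k)]; nlinarith [sq_nonneg (|X ω ^ k| - 1), abs_nonneg (X ω ^ k)]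
  linarith

lemma integral_pow_le_of_exp_sq (hX : AEMeasurable X P) {b : ℝ} (hb : 0 < b)
    (hi : Integrable (fun ω => exp (b * X ω ^ 2)) P) (h2 : ∫ ω, exp (b * X ω ^ 2) ∂P ≤ 2)
    (k : ℕ) : ∫ ω, X ω ^ (2 * k) ∂P ≤ 2 * k.factorial / b ^ k := by
  calc ∫ ω, X ω ^ (2 * k) ∂P ≤ ∫ ω, k.factorial / b ^ k * exp (b * X ω ^ 2) ∂P := by
        refine integral_mono (integrable_of_exp_sq hX hb hi _) (hi.const_mul _) fun ω => ?_
        have h1 := pow_div_factorial_le_exp (x := b * X ω ^ 2) (by positivity) k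
        rw [div_le_iff₀ (by positivity)] at h1
        show _ ≤ k.factorial / b ^ k * exp (b * X ω ^ 2)
        rw [div_mul_eq_mul_div, le_div_iff₀ (by positivity)]
        calc X ω ^ (2 * k) * b ^ k = (b * X ω ^ 2) ^ k := by rw [pow_mul]; ring
          _ ≤ _ := by linarith
    _ = k.factorial / b ^ k * ∫ ω, exp (b * X ω ^ 2) ∂P := integral_const_mul _ _
    _ ≤ k.factorial / b ^ k * 2 := by gcongr
    _ = _ := by ring

/-- A centred variable whose square has an exponential moment is sub-Gaussian. -/
lemma mgf_le_of_exp_sq (hX : AEMeasurable X P) {b : ℝ} (hb : 0 < b)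
    (hi : Integrable (fun ω => exp (b * X ω ^ 2)) P) (h2 : ∫ ω, exp (b * X ω ^ 2) ∂P ≤ 2)
    (h0 : ∫ ω, X ω ∂P = 0) (l : ℝ) :
    Integrable (fun ω => exp (l * X ω)) P ∧ ∫ ω, exp (l * X ω) ∂P ≤ exp (l ^ 2 / b) := by
  have hpt : ∀ ω, l * X ω ≤ l ^ 2 / (2 * b) + 1 / 2 * (b * X ω ^ 2) := fun ω => by
    have : l ^ 2 / (2 * b) + 1 / 2 * (b * X ω ^ 2) - l * X ω = (l - b * X ω) ^ 2 / (2 * b) := by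
      field_simp; ring
    have h : 0 ≤ (l - b * X ω) ^ 2 / (2 * b) := by positivity
    linarith
  obtain ⟨g1, g2⟩ := exp_sq_moment_mul hX hb.le hi (C := 1) (by linarith) (θ := 1 / 2)
    (by norm_num) (by norm_num)
  have hint : Integrable (fun ω => exp (l * X ω)) P := by
    refine (g1.const_mul (exp (l ^ 2 / (2 * b)))).mono' (by fun_prop) (ae_of_all _ fun ω => ?_)
    rw [norm_of_nonneg (exp_pos _).le, ← exp_add]
    exact exp_le_exp.2 (hpt ω)
  refine ⟨hint, ?_⟩
  by_cases hl : l ^ 2 ≤ b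
  · have hθ : l ^ 2 / b ≤ 1 := by rwa [div_le_one hb]
    obtain ⟨g3, g4⟩ := exp_sq_moment_mul hX hb.le hi (C := 1) (by linarith) (θ := l ^ 2 / b)
      (by positivity) hθ
    have e : ∀ ω, l ^ 2 / b * (b * X ω ^ 2) = (l * X ω) ^ 2 := fun ω => by field_simp
    simp only [e] at g3 g4
    have hX1 : Integrable X P := by simpa using integrable_of_exp_sq hX hb hi 1
    calc ∫ ω, exp (l * X ω) ∂P ≤ ∫ ω, (l * X ω + exp ((l * X ω) ^ 2)) ∂P :=
          integral_mono hint ((hX1.const_mul l).add g3) fun ω => exp_le_add_exp_sq _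
      _ = ∫ ω, exp ((l * X ω) ^ 2) ∂P := by
          rw [integral_add (hX1.const_mul l) g3, integral_const_mul, h0]; simp
      _ ≤ l ^ 2 / b + 1 := by linarith
      _ ≤ _ := add_one_le_exp _
  · push Not at hl
    calc ∫ ω, exp (l * X ω) ∂P
        ≤ ∫ ω, exp (l ^ 2 / (2 * b)) * exp (1 / 2 * (b * X ω ^ 2)) ∂P := by
          refine integral_mono hint (g1.const_mul _) fun ω => ?_
          show _ ≤ exp (l ^ 2 / (2 * b)) * exp (1 / 2 * (b * X ω ^ 2))
          rw [← exp_add]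
          exact exp_le_exp.2 (hpt ω)
      _ = exp (l ^ 2 / (2 * b)) * ∫ ω, exp (1 / 2 * (b * X ω ^ 2)) ∂P := integral_const_mul _ _
      _ ≤ exp (l ^ 2 / (2 * b)) * exp (1 / 2) := by
          gcongr
          linarith [add_one_le_exp (1 / 2 : ℝ)]
      _ = exp (l ^ 2 / (2 * b) + 1 / 2) := (exp_add _ _).symm
      _ ≤ exp (l ^ 2 / b) := by
          apply exp_le_exp.2
          have : 1 ≤ l ^ 2 / b := by rw [le_div_iff₀ hb]; linarith
          have e : l ^ 2 / (2 * b) = (l ^ 2 / b) / 2 := by field_simp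
          linarith

/-- The moment generating function of a variable, centred at its mean. -/
lemma mgf_sub_mean_le_of_exp_sq (hX : AEMeasurable X P) {b : ℝ} (hb : 0 < b)
    (hi : Integrable (fun ω => exp (b * X ω ^ 2)) P) (h2 : ∫ ω, exp (b * X ω ^ 2) ∂P ≤ 2)
    (l : ℝ) :
    Integrable (fun ω => exp (l * (X ω - ∫ ω, X ω ∂P))) P ∧
      ∫ ω, exp (l * (X ω - ∫ ω, X ω ∂P)) ∂P ≤ exp (8 * l ^ 2 / b) := by
  set m := ∫ ω, X ω ∂P with hm
  have hX1 : Integrable X P := by simpa using integrable_of_exp_sq hX hb hi 1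
  have hX2 := integrable_of_exp_sq hX hb hi 2
  obtain ⟨g1, g2⟩ := exp_sq_moment_mul hX hb.le hi (C := 1) (by linarith) (θ := 1 / 4)
    (by norm_num) (by norm_num)
  have hm2 : m ^ 2 ≤ 1 / b := by
    have h3 : ∫ ω, (1 + b * X ω ^ 2) ∂P ≤ 2 := by
      refine le_trans (integral_mono ((integrable_const _).add (hX2.const_mul b)) hi fun ω => ?_) h2
      linarith [add_one_le_exp (b * X ω ^ 2)]
    rw [integral_add (integrable_const _) (hX2.const_mul b), integral_const_mul] at h3
    simp at h3
    have h4 : 0 ≤ ∫ ω, (X ω - m) ^ 2 ∂P := integral_nonneg fun ω => sq_nonneg _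
    have e : ∀ ω, (X ω - m) ^ 2 = X ω ^ 2 - 2 * m * X ω + m ^ 2 := fun ω => by ring
    simp only [e] at h4
    have hX3 : Integrable (fun ω => X ω ^ 2 - 2 * m * X ω) P := hX2.sub (hX1.const_mul _)
    rw [integral_add hX3 (integrable_const _), integral_sub hX2 (hX1.const_mul _),
      integral_const_mul, ← hm] at h4
    simp at h4
    rw [le_div_iff₀ hb]
    nlinarith
  have hpt : ∀ ω, b / 8 * (X ω - m) ^ 2 ≤ 1 / 4 + 1 / 4 * (b * X ω ^ 2) := fun ω => by
    have h5 : b * m ^ 2 ≤ 1 := by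
      rw [le_div_iff₀ hb] at hm2; linarith
    nlinarith [mul_nonneg hb.le (sq_nonneg (X ω + m))]
  have hY : AEMeasurable (fun ω => X ω - m) P := by fun_prop
  have i3 : Integrable (fun ω => exp (b / 8 * (X ω - m) ^ 2)) P := by
    refine (g1.const_mul (exp (1 / 4))).mono' (by fun_prop) (ae_of_all _ fun ω => ?_)
    rw [norm_of_nonneg (exp_pos _).le, ← exp_add]
    exact exp_le_exp.2 (hpt ω)
  have i4 : ∫ ω, exp (b / 8 * (X ω - m) ^ 2) ∂P ≤ 2 := by
    calc ∫ ω, exp (b / 8 * (X ω - m) ^ 2) ∂P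
        ≤ ∫ ω, exp (1 / 4) * exp (1 / 4 * (b * X ω ^ 2)) ∂P := by
          refine integral_mono i3 (g1.const_mul _) fun ω => ?_
          show _ ≤ exp (1 / 4) * exp (1 / 4 * (b * X ω ^ 2))
          rw [← exp_add]
          exact exp_le_exp.2 (hpt ω)
      _ = exp (1 / 4) * ∫ ω, exp (1 / 4 * (b * X ω ^ 2)) ∂P := integral_const_mul _ _
      _ ≤ exp (1 / 4) * (1 + 1 / 4 * 1) := by gcongr
      _ ≤ 2 := by
          have := (abs_le.1 (abs_exp_sub_one_sub_id_le (x := 1 / 4) (by norm_num [abs_le]))).2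
          linarith
  have h0 : ∫ ω, (X ω - m) ∂P = 0 := by
    rw [integral_sub hX1 (integrable_const _), ← hm]; simp
  have := mgf_le_of_exp_sq hY (b := b / 8) (by positivity) i3 i4 h0 l
  convert this using 3
  field_simp

end

/-! ### Normalized sub-Gaussian laws and linear forms -/

section

variable {Ω : Type*} [MeasurableSpace Ω] {P : Measure Ω} [IsProbabilityMeasure P]

lemma integrable_pow_of_memLp {X : Ω → ℝ} (h : MemLp X 4 P) {k : ℕ} (hk : k ≤ 4) :
    Integrable (fun ω => X ω ^ k) P := by
  have h1 : MemLp X (k : ENNReal) P := h.mono_exponent (by exact_mod_cast hk)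
  refine h1.integrable_norm_pow'.mono (by have := h.aestronglyMeasurable; fun_prop)
    (ae_of_all _ fun ω => by simp)

/-- Moments of a sum of two independent variables, the second one centred. -/
lemma moments_add {S Y : Ω → ℝ} (hS : MemLp S 4 P) (hY : MemLp Y 4 P) (hi : IndepFun S Y P)
    (hS0 : ∫ ω, S ω ∂P = 0) (hY0 : ∫ ω, Y ω ∂P = 0) :
    ∫ ω, (S ω + Y ω) ∂P = 0 ∧
    ∫ ω, (S ω + Y ω) ^ 2 ∂P = ∫ ω, S ω ^ 2 ∂P + ∫ ω, Y ω ^ 2 ∂P ∧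
    ∫ ω, (S ω + Y ω) ^ 3 ∂P = ∫ ω, S ω ^ 3 ∂P + ∫ ω, Y ω ^ 3 ∂P ∧
    ∫ ω, (S ω + Y ω) ^ 4 ∂P =
      ∫ ω, S ω ^ 4 ∂P + 6 * ((∫ ω, S ω ^ 2 ∂P) * ∫ ω, Y ω ^ 2 ∂P) + ∫ ω, Y ω ^ 4 ∂P := by
  have s (k : ℕ) (hk : k ≤ 4) := integrable_pow_of_memLp hS hk
  have y (k : ℕ) (hk : k ≤ 4) := integrable_pow_of_memLp hY hk
  have ind (a b : ℕ) : IndepFun (fun ω => S ω ^ a) (fun ω => Y ω ^ b) P :=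
    hi.comp (φ := fun x => x ^ a) (ψ := fun x => x ^ b) (by fun_prop) (by fun_prop)
  have pint (a b : ℕ) (ha : a ≤ 4) (hb : b ≤ 4) :
      Integrable (fun ω => S ω ^ a * Y ω ^ b) P := (ind a b).integrable_mul (s a ha) (y b hb)
  have pval (a b : ℕ) (ha : a ≤ 4) (hb : b ≤ 4) :
      ∫ ω, S ω ^ a * Y ω ^ b ∂P = (∫ ω, S ω ^ a ∂P) * ∫ ω, Y ω ^ b ∂P :=
    (ind a b).integral_fun_mul_eq_mul_integral (s a ha).aestronglyMeasurable
      (y b hb).aestronglyMeasurable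
  have s1 : Integrable S P := by simpa using s 1 (by norm_num)
  have y1 : Integrable Y P := by simpa using y 1 (by norm_num)
  have s2 := s 2 (by norm_num)
  have s3 := s 3 (by norm_num)
  have s4 := s 4 (by norm_num)
  have y2 := y 2 (by norm_num)
  have y3 := y 3 (by norm_num)
  have y4 := y 4 (by norm_num)
  have p11 := pval 1 1 (by norm_num) (by norm_num)
  have p12 := pval 1 2 (by norm_num) (by norm_num)
  have p21 := pval 2 1 (by norm_num) (by norm_num)
  have p13 := pval 1 3 (by norm_num) (by norm_num)
  have p31 := pval 3 1 (by norm_num) (by norm_num)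
  have p22 := pval 2 2 (by norm_num) (by norm_num)
  have q11 := pint 1 1 (by norm_num) (by norm_num)
  have q12 := pint 1 2 (by norm_num) (by norm_num)
  have q21 := pint 2 1 (by norm_num) (by norm_num)
  have q13 := pint 1 3 (by norm_num) (by norm_num)
  have q31 := pint 3 1 (by norm_num) (by norm_num)
  have q22 := pint 2 2 (by norm_num) (by norm_num)
  simp only [pow_one, hS0, hY0, mul_zero, zero_mul] at p11 p12 p21 p13 p31 q11 q12 q21 q13 q31
  refine ⟨?_, ?_, ?_, ?_⟩
  · rw [integral_add s1 y1, hS0, hY0, add_zero]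
  · have e : ∀ ω, (S ω + Y ω) ^ 2 = S ω ^ 2 + (2 * (S ω * Y ω) + Y ω ^ 2) := fun ω => by ring
    have i1 : Integrable (fun ω => 2 * (S ω * Y ω) + Y ω ^ 2) P := (q11.const_mul 2).add y2
    simp only [e]
    rw [integral_add s2 i1, integral_add (q11.const_mul 2) y2, integral_const_mul, p11]
    ring
  · have e : ∀ ω, (S ω + Y ω) ^ 3 =
        S ω ^ 3 + (3 * (S ω ^ 2 * Y ω) + (3 * (S ω * Y ω ^ 2) + Y ω ^ 3)) := fun ω => by ring
    have i1 : Integrable (fun ω => 3 * (S ω * Y ω ^ 2) + Y ω ^ 3) P := (q12.const_mul 3).add y3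
    have i2 : Integrable (fun ω => 3 * (S ω ^ 2 * Y ω) + (3 * (S ω * Y ω ^ 2) + Y ω ^ 3)) P :=
      (q21.const_mul 3).add i1
    simp only [e]
    rw [integral_add s3 i2, integral_add (q21.const_mul 3) i1, integral_add (q12.const_mul 3) y3,
      integral_const_mul, integral_const_mul, p21, p12]
    ring
  · have e : ∀ ω, (S ω + Y ω) ^ 4 = S ω ^ 4 + (4 * (S ω ^ 3 * Y ω) +
        (6 * (S ω ^ 2 * Y ω ^ 2) + (4 * (S ω * Y ω ^ 3) + Y ω ^ 4))) := fun ω => by ring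
    have i1 : Integrable (fun ω => 4 * (S ω * Y ω ^ 3) + Y ω ^ 4) P := (q13.const_mul 4).add y4
    have i2 : Integrable (fun ω => 6 * (S ω ^ 2 * Y ω ^ 2) + (4 * (S ω * Y ω ^ 3) + Y ω ^ 4)) P :=
      (q22.const_mul 6).add i1
    have i3 : Integrable (fun ω => 4 * (S ω ^ 3 * Y ω) +
        (6 * (S ω ^ 2 * Y ω ^ 2) + (4 * (S ω * Y ω ^ 3) + Y ω ^ 4))) P :=
      (q31.const_mul 4).add i2
    simp only [e]
    rw [integral_add s4 i3, integral_add (q31.const_mul 4) i2, integral_add (q22.const_mul 6) i1,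
      integral_add (q13.const_mul 4) y4, integral_const_mul, integral_const_mul,
      integral_const_mul, p31, p13, p22]
    ring

/-- The first four moments of a sum of independent centred variables. -/
lemma moments_sum {ι : Type*} {Z : ι → Ω → ℝ} (hind : iIndepFun Z P)
    (hm : ∀ i, AEMeasurable (Z i) P) (h4 : ∀ i, MemLp (Z i) 4 P)
    (h0 : ∀ i, ∫ ω, Z i ω ∂P = 0) (s : Finset ι) :
    ∫ ω, ∑ i ∈ s, Z i ω ∂P = 0 ∧
    ∫ ω, (∑ i ∈ s, Z i ω) ^ 2 ∂P = ∑ i ∈ s, ∫ ω, Z i ω ^ 2 ∂P ∧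
    ∫ ω, (∑ i ∈ s, Z i ω) ^ 3 ∂P = ∑ i ∈ s, ∫ ω, Z i ω ^ 3 ∂P ∧
    ∫ ω, (∑ i ∈ s, Z i ω) ^ 4 ∂P = 3 * (∑ i ∈ s, ∫ ω, Z i ω ^ 2 ∂P) ^ 2 +
      ∑ i ∈ s, (∫ ω, Z i ω ^ 4 ∂P - 3 * (∫ ω, Z i ω ^ 2 ∂P) ^ 2) := by
  classical
  induction s using Finset.induction_on with
  | empty => simp
  | insert a s ha ih =>
    have hS : MemLp (fun ω => ∑ i ∈ s, Z i ω) 4 P := memLp_finsetSum s fun i _ => h4 i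
    have hi : IndepFun (fun ω => ∑ i ∈ s, Z i ω) (Z a) P := by
      have := hind.indepFun_finsetSum_of_notMem₀ hm ha
      convert this using 1
      ext ω; simp
    obtain ⟨a1, a2, a3, a4⟩ := moments_add hS (h4 a) hi ih.1 (h0 a)
    simp only [Finset.sum_insert ha]
    simp only [add_comm (Z a _)]
    refine ⟨a1, ?_, ?_, ?_⟩
    · rw [a2, ih.2.1]; ring
    · rw [a3, ih.2.2.1]; ring
    · rw [a4, ih.2.1, ih.2.2.2]; ring

end

/-- A probability law on the line with mean zero, variance one, and
`∫ exp (b x²) ≤ 2`. -/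
structure IsNormalizedSubgaussian (b : ℝ) (γ : Measure ℝ) : Prop where
  prob : IsProbabilityMeasure γ
  mean : ∫ x, x ∂γ = 0
  sq : ∫ x, x ^ 2 ∂γ = 1
  int_exp : Integrable (fun x => exp (b * x ^ 2)) γ
  exp_le : ∫ x, exp (b * x ^ 2) ∂γ ≤ 2

lemma memLp_four_of_integrable {Ω : Type*} [MeasurableSpace Ω] {P : Measure Ω} {X : Ω → ℝ}
    (hX : AEStronglyMeasurable X P) (h : Integrable (fun ω => X ω ^ 4) P) : MemLp X 4 P := by
  rw [← integrable_norm_rpow_iff hX (by norm_num) (by norm_num)]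
  refine h.congr (ae_of_all _ fun ω => ?_)
  simp only [ENNReal.toReal_ofNat, Real.norm_eq_abs]
  rw [show (4 : ℝ) = ((4 : ℕ) : ℝ) by norm_num, rpow_natCast]
  exact (Even.pow_abs (by decide) _).symm

namespace IsNormalizedSubgaussian

variable {b : ℝ} {γ : Measure ℝ}

lemma integrable_pow (h : IsNormalizedSubgaussian b γ) (hb : 0 < b) (k : ℕ) :
    Integrable (fun x => x ^ k) γ :=
  have := h.prob
  integrable_of_exp_sq (X := fun x => x) aemeasurable_id hb h.int_exp k

lemma memLp_four (h : IsNormalizedSubgaussian b γ) (hb : 0 < b) : MemLp (fun x : ℝ => x) 4 γ :=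
  memLp_four_of_integrable (by fun_prop) (h.integrable_pow hb 4)

lemma integral_pow_le (h : IsNormalizedSubgaussian b γ) (hb : 0 < b) (k : ℕ) :
    ∫ x, x ^ (2 * k) ∂γ ≤ 2 * k.factorial / b ^ k :=
  have := h.prob
  integral_pow_le_of_exp_sq (X := fun x => x) aemeasurable_id hb h.int_exp h.exp_le k

/-- Normalization forces `b ≤ 1`. -/
lemma le_one (h : IsNormalizedSubgaussian b γ) (hb : 0 < b) : b ≤ 1 := by
  have := h.prob
  have h1 : ∫ x, (1 + b * x ^ 2) ∂γ ≤ 2 := by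
    refine le_trans (integral_mono ((integrable_const _).add
      ((h.integrable_pow hb 2).const_mul b)) h.int_exp fun x => ?_) h.exp_le
    show 1 + b * x ^ 2 ≤ _
    linarith [add_one_le_exp (b * x ^ 2)]
  rw [integral_add (integrable_const _) ((h.integrable_pow hb 2).const_mul b),
    integral_const_mul, h.sq] at h1
  simp at h1
  linarith

lemma hasSubgaussianMGF (h : IsNormalizedSubgaussian b γ) (hb : 0 < b) :
    HasSubgaussianMGF (fun x : ℝ => x) ⟨2 / b, by positivity⟩ γ := by
  have := h.prob
  have h1 := mgf_le_of_exp_sq (X := fun x : ℝ => x) aemeasurable_id hb h.int_exp h.exp_le h.mean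
  refine ⟨fun t => (h1 t).1, fun t => (h1 t).2.trans (le_of_eq ?_)⟩
  congr 1
  show t ^ 2 / b = 2 / b * t ^ 2 / 2
  ring

end IsNormalizedSubgaussian

/-- The law of the linear form `∑ⱼ ξⱼ yⱼ` in independent variables `ξⱼ` of law `μ`. -/
noncomputable def rowLaw {n : ℕ} (μ : Measure ℝ) (y : Fin n → ℝ) : Measure ℝ :=
  (Measure.pi fun _ : Fin n => μ).map fun a => ∑ j, a j * y j

section rowLaw

variable {n : ℕ} {μ : Measure ℝ} {b : ℝ}

lemma measurable_linForm (y : Fin n → ℝ) : Measurable fun a : Fin n → ℝ => ∑ j, a j * y j := by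
  fun_prop

instance [IsProbabilityMeasure μ] (y : Fin n → ℝ) : IsProbabilityMeasure (rowLaw μ y) :=
  Measure.isProbabilityMeasure_map (measurable_linForm y).aemeasurable

lemma iIndepFun_coord_mul [IsProbabilityMeasure μ] (y : Fin n → ℝ) :
    iIndepFun (fun j (a : Fin n → ℝ) => a j * y j) (Measure.pi fun _ : Fin n => μ) :=
  iIndepFun_pi (X := fun j t => t * y j) (μ := fun _ => μ) fun j => by fun_prop

lemma rowLaw_moments (hμ : IsNormalizedSubgaussian b μ) (hb : 0 < b) (y : Fin n → ℝ) :
    ∫ x, x ∂(rowLaw μ y) = 0 ∧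
    ∫ x, x ^ 2 ∂(rowLaw μ y) = ∑ j, y j ^ 2 ∧
    ∫ x, x ^ 3 ∂(rowLaw μ y) = (∫ x, x ^ 3 ∂μ) * ∑ j, y j ^ 3 ∧
    ∫ x, x ^ 4 ∂(rowLaw μ y) =
      3 * (∑ j, y j ^ 2) ^ 2 + (∫ x, x ^ 4 ∂μ - 3) * ∑ j, y j ^ 4 := by
  have := hμ.prob
  have hpow (j : Fin n) (k : ℕ) : ∫ a : Fin n → ℝ, (a j * y j) ^ k ∂(Measure.pi fun _ => μ) =
      (∫ x, x ^ k ∂μ) * y j ^ k := by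
    rw [integral_comp_eval (μ := fun _ : Fin n => μ) (i := j) (f := fun x => (x * y j) ^ k)
      (by fun_prop), ← integral_mul_const]
    simp only [mul_pow]
  have h4 : ∀ j, MemLp (fun a : Fin n → ℝ => a j * y j) 4 (Measure.pi fun _ => μ) := fun j => by
    refine memLp_four_of_integrable
      ((measurable_pi_apply j).mul_const _).aestronglyMeasurable ?_
    simp only [mul_pow]
    exact (integrable_comp_eval (μ := fun _ : Fin n => μ) (i := j) (f := fun x => x ^ 4)
      (hμ.integrable_pow hb 4)).mul_const _
  have h0 : ∀ j, ∫ a : Fin n → ℝ, a j * y j ∂(Measure.pi fun _ => μ) = 0 := fun j => by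
    simpa [hμ.mean] using hpow j 1
  obtain ⟨a1, a2, a3, a4⟩ := moments_sum (iIndepFun_coord_mul (μ := μ) y)
    (fun j => ((measurable_pi_apply j).mul_const _).aemeasurable) h4 h0 Finset.univ
  simp only [hpow, hμ.sq, one_mul] at a2 a3 a4
  have hmap (k : ℕ) : ∫ x, x ^ k ∂(rowLaw μ y) =
      ∫ a : Fin n → ℝ, (∑ j, a j * y j) ^ k ∂(Measure.pi fun _ => μ) :=
    integral_map (measurable_linForm y).aemeasurable (by fun_prop)
  refine ⟨?_, ?_, ?_, ?_⟩
  · simpa using (hmap 1).trans (by simpa using a1)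
  · rw [hmap, a2]
  · rw [hmap, a3, Finset.mul_sum]
  · rw [hmap, a4, Finset.mul_sum]
    congr 1
    exact Finset.sum_congr rfl fun j _ => by ring

/-- Linear forms have Gaussian tails at the scale of the Euclidean norm of the coefficients. -/
lemma rowLaw_tail (hμ : IsNormalizedSubgaussian b μ) (hb : 0 < b) (y : Fin n → ℝ) {v : ℝ}
    (hy : ∑ j, y j ^ 2 ≤ v) {s : ℝ} (hs : 0 ≤ s) :
    (rowLaw μ y).real {x | s ≤ |x|} ≤ 2 * exp (-(s ^ 2 / (4 / b * v))) := by
  have := hμ.prob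
  set c0 : NNReal := ⟨2 / b, by positivity⟩ with hc0
  have hj : ∀ j ∈ (Finset.univ : Finset (Fin n)), HasSubgaussianMGF
      (fun a : Fin n → ℝ => a j * y j) (⟨y j ^ 2, sq_nonneg _⟩ * c0) (Measure.pi fun _ => μ) := by
    intro j _
    have h1 : HasSubgaussianMGF (fun a : Fin n → ℝ => a j) c0 (Measure.pi fun _ => μ) := by
      refine HasSubgaussianMGF.of_map (Y := fun a : Fin n → ℝ => a j) (X := fun x : ℝ => x)
        (measurable_pi_apply j).aemeasurable ?_
      rw [(measurePreserving_eval (fun _ : Fin n => μ) j).map_eq]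
      exact hμ.hasSubgaussianMGF hb
    have := h1.const_mul (y j)
    simpa only [mul_comm] using this
  have hsum := HasSubgaussianMGF.sum_of_iIndepFun (iIndepFun_coord_mul (μ := μ) y) hj
  set c : NNReal := ∑ j, ⟨y j ^ 2, sq_nonneg _⟩ * c0 with hc
  have hcv : (c : ℝ) = 2 / b * ∑ j, y j ^ 2 := by
    rw [hc, NNReal.coe_sum, Finset.mul_sum]
    refine Finset.sum_congr rfl fun j _ => ?_
    show y j ^ 2 * (2 / b) = _
    ring
  have hbound : exp (-s ^ 2 / (2 * c)) ≤ exp (-(s ^ 2 / (4 / b * v))) ∨ (c : ℝ) = 0 := by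
    by_cases hc1 : (c : ℝ) = 0
    · exact Or.inr hc1
    · left
      have : 0 < (c : ℝ) := lt_of_le_of_ne c.2 (Ne.symm hc1)
      apply exp_le_exp.2
      rw [neg_div, neg_le_neg_iff]
      have h3 : (2 * c : ℝ) ≤ 4 / b * v := by
        rw [hcv, show 4 / b * v = 2 * (2 / b * v) by ring]
        gcongr
      gcongr
  have hS : MeasurableSet {x : ℝ | s ≤ |x|} := measurableSet_le measurable_const (by fun_prop)
  have e1 : (rowLaw μ y).real {x | s ≤ |x|} =
      (Measure.pi fun _ : Fin n => μ).real {a | s ≤ |∑ j, a j * y j|} := by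
    rw [rowLaw, map_measureReal_apply (measurable_linForm y) hS]; rfl
  rw [e1]
  rcases hbound with hbound | h0
  · have hsub : {a : Fin n → ℝ | s ≤ |∑ j, a j * y j|} ⊆
        {a | s ≤ ∑ j, a j * y j} ∪ {a | s ≤ (-fun a : Fin n → ℝ => ∑ j, a j * y j) a} := by
      intro a ha
      rcases le_abs.1 (show s ≤ |∑ j, a j * y j| from ha) with h | h
      · exact Or.inl h
      · exact Or.inr h
    have := hsum.measure_ge_le hs
    have := hsum.neg.measure_ge_le hs
    calc _ ≤ _ := measureReal_mono hsub
      _ ≤ _ := measureReal_union_le _ _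
      _ ≤ _ := by linarith
  -- The form vanishes identically; the sub-Gaussian bound with parameter zero is a division by zero
  -- and gives nothing.
  · have hz : ∑ j, y j ^ 2 = 0 := by
      rw [hcv] at h0
      rcases mul_eq_zero.1 h0 with h | h
      · have : 0 < 2 / b := by positivity
        linarith
      · exact h
    have hy0 : ∀ j, y j = 0 := fun j => by
      have := (Finset.sum_eq_zero_iff_of_nonneg fun j _ => sq_nonneg (y j)).1 hz j (Finset.mem_univ _)
      exact pow_eq_zero_iff (two_ne_zero) |>.1 this
    simp only [hy0, mul_zero, Finset.sum_const_zero, abs_zero]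
    by_cases hs0 : s = 0
    · subst hs0
      simp
    · have : ¬ s ≤ 0 := fun h => hs0 (le_antisymm h hs)
      simp only [this, Set.ofPred_false, measureReal_empty]
      positivity

/-- Unit linear forms inherit normalization and sub-Gaussianity from the entries. -/
lemma rowLaw_isNormalizedSubgaussian (hμ : IsNormalizedSubgaussian b μ) (hb : 0 < b)
    {x : Fin n → ℝ} (hx : ∑ j, x j ^ 2 = 1) :
    IsNormalizedSubgaussian (b / 16) (rowLaw μ x) := by
  have := hμ.prob
  obtain ⟨a1, a2, -, -⟩ := rowLaw_moments hμ hb x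
  have h := exp_sq_moment_le_two_of_tail (P := rowLaw μ x) (X := fun x => x) aemeasurable_id
    (K := 4 / b) (C := 2) (by positivity) (by norm_num)
    (fun s hs => by simpa using rowLaw_tail hμ hb x hx.le hs)
  have e : 1 / (2 * (4 / b) * 2) = b / 16 := by field_simp; norm_num
  rw [e] at h
  exact ⟨inferInstance, a1, a2.trans hx, h.1, h.2⟩

/-- The coordinates of `z y`, for a matrix `z` with independent entries of law `μ`, are
independent with law `rowLaw μ y`. -/
lemma map_mulVec_pi [IsProbabilityMeasure μ] {m : ℕ} (y : Fin n → ℝ) :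
    (Measure.pi fun _ : Fin m × Fin n => μ).map (fun z i => ∑ j, z (i, j) * y j) =
      Measure.pi fun _ : Fin m => rowLaw μ y := by
  have h1 := Measure.infinitePi_map_curry (fun (_ : Fin m) (_ : Fin n) => μ)
  rw [Measure.infinitePi_eq_pi, Measure.infinitePi_eq_pi] at h1
  simp only [Measure.infinitePi_eq_pi] at h1
  have h2 := Measure.pi_map_pi (μ := fun _ : Fin m => Measure.pi fun _ : Fin n => μ)
    (f := fun _ a => ∑ j, a j * y j) (fun i => (measurable_linForm y).aemeasurable)
  rw [← h1, Measure.map_map (by fun_prop) (MeasurableEquiv.measurable _)] at h2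
  exact h2

end rowLaw

/-! ### Bernstein's inequality for the squared norm -/

lemma exp_le_quadratic (z : ℝ) : exp z ≤ 1 + z + z ^ 2 * exp |z| := by
  have h1 := one_le_exp (abs_nonneg z)
  by_cases hz : |z| ≤ 1
  · have := (abs_le.1 (abs_exp_sub_one_sub_id_le hz)).2
    nlinarith [sq_nonneg z]
  · rcases lt_abs.1 (not_le.1 hz) with h | h
    · rw [abs_of_pos (by linarith)]
      have : exp z ≤ z ^ 2 * exp z := le_mul_of_one_le_left (exp_pos z).le (by nlinarith)
      linarith
    · have : exp z ≤ 1 := exp_le_one_iff.2 (by linarith)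
      nlinarith [sq_nonneg z]

/-- The constant in the quadratic bound for the log moment generating function of `x² - 1`. -/
noncomputable def sqMgfConst (b : ℝ) : ℝ := 2 * (32 / b ^ 2 + 1) * exp (1 / 4)

lemma sqMgfConst_pos {b : ℝ} : 0 < sqMgfConst b := by unfold sqMgfConst; positivity

section

variable {b : ℝ} {γ : Measure ℝ}

lemma sq_sub_one_mgf (h : IsNormalizedSubgaussian b γ) (hb : 0 < b) {l : ℝ} (hl : |l| ≤ b / 4) :
    Integrable (fun x => exp (l * (x ^ 2 - 1))) γ ∧
      ∫ x, exp (l * (x ^ 2 - 1)) ∂γ ≤ exp (sqMgfConst b * l ^ 2) := by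
  have := h.prob
  have hb1 := h.le_one hb
  have hpt : ∀ x : ℝ, exp (l * (x ^ 2 - 1)) ≤
      1 + l * (x ^ 2 - 1) + l ^ 2 * (sqMgfConst b / 2) * exp (b * x ^ 2) := by
    intro x
    refine (exp_le_quadratic _).trans ?_
    have h1 : |l * (x ^ 2 - 1)| ≤ 1 / 4 + b * x ^ 2 / 4 := by
      rw [abs_mul]
      have : |x ^ 2 - 1| ≤ x ^ 2 + 1 := by
        rw [abs_le]; constructor <;> nlinarith [sq_nonneg x]
      calc |l| * |x ^ 2 - 1| ≤ b / 4 * (x ^ 2 + 1) := by gcongr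
        _ ≤ _ := by nlinarith
    have h2 : (x ^ 2 - 1) ^ 2 ≤ (32 / b ^ 2 + 1) * exp (b * x ^ 2 / 4) := by
      have h3 := pow_div_factorial_le_exp (x := b * x ^ 2 / 4) (by positivity) 2
      have h4 : (1 : ℝ) ≤ exp (b * x ^ 2 / 4) := one_le_exp (by positivity)
      have h5 : x ^ 4 ≤ 32 / b ^ 2 * exp (b * x ^ 2 / 4) := by
        have e : (b * x ^ 2 / 4) ^ 2 / (Nat.factorial 2 : ℝ) = b ^ 2 / 32 * x ^ 4 := by
          simp [Nat.factorial]; ring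
        rw [e] at h3
        calc x ^ 4 = 32 / b ^ 2 * (b ^ 2 / 32 * x ^ 4) := by field_simp
          _ ≤ _ := by gcongr
      nlinarith [sq_nonneg x]
    have h6 : (l * (x ^ 2 - 1)) ^ 2 * exp |l * (x ^ 2 - 1)| ≤
        l ^ 2 * (sqMgfConst b / 2) * exp (b * x ^ 2) := by
      calc (l * (x ^ 2 - 1)) ^ 2 * exp |l * (x ^ 2 - 1)|
          ≤ (l ^ 2 * ((32 / b ^ 2 + 1) * exp (b * x ^ 2 / 4))) * exp (1 / 4 + b * x ^ 2 / 4) := by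
            rw [mul_pow]; gcongr
        _ = l ^ 2 * (sqMgfConst b / 2) * exp (b * x ^ 2 / 4 + b * x ^ 2 / 4) := by
            rw [exp_add, exp_add, sqMgfConst]; ring
        _ ≤ _ := by
            have := sqMgfConst_pos (b := b)
            gcongr
            nlinarith [mul_nonneg hb.le (sq_nonneg x)]
    linarith
  have i2 := h.integrable_pow hb 2
  have i3 : Integrable (fun x : ℝ => 1 + l * (x ^ 2 - 1)) γ :=
    (integrable_const _).add ((i2.sub (integrable_const _)).const_mul _)
  have i4 := h.int_exp.const_mul (l ^ 2 * (sqMgfConst b / 2))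
  have i5 : Integrable (fun x : ℝ =>
      1 + l * (x ^ 2 - 1) + l ^ 2 * (sqMgfConst b / 2) * exp (b * x ^ 2)) γ := i3.add i4
  have i6 : Integrable (fun x => exp (l * (x ^ 2 - 1))) γ := by
    refine i5.mono' (by fun_prop) (ae_of_all _ fun x => ?_)
    rw [norm_of_nonneg (exp_pos _).le]
    exact hpt x
  refine ⟨i6, ?_⟩
  calc ∫ x, exp (l * (x ^ 2 - 1)) ∂γ
      ≤ ∫ x, (1 + l * (x ^ 2 - 1) + l ^ 2 * (sqMgfConst b / 2) * exp (b * x ^ 2)) ∂γ :=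
        integral_mono i6 i5 hpt
    _ = 1 + l ^ 2 * (sqMgfConst b / 2) * ∫ x, exp (b * x ^ 2) ∂γ := by
        rw [integral_add i3 i4, integral_const_mul]
        congr 1
        have i7 : Integrable (fun x : ℝ => l * (x ^ 2 - 1)) γ :=
          (i2.sub (integrable_const _)).const_mul _
        rw [integral_add (integrable_const _) i7, integral_const_mul,
          integral_sub i2 (integrable_const _), h.sq]
        simp
    _ ≤ 1 + l ^ 2 * (sqMgfConst b / 2) * 2 := by
        have := sqMgfConst_pos (b := b)
        gcongr
        exact h.exp_le
    _ = sqMgfConst b * l ^ 2 + 1 := by ring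
    _ ≤ _ := add_one_le_exp _

variable {n : ℕ}

lemma block_mgf (h : IsNormalizedSubgaussian b γ) (hb : 0 < b) (J : Finset (Fin n)) {l : ℝ}
    (hl : |l| ≤ b / 4) :
    Integrable (fun y : Fin n → ℝ => exp (l * ∑ i ∈ J, (y i ^ 2 - 1))) (Measure.pi fun _ => γ) ∧
      ∫ y : Fin n → ℝ, exp (l * ∑ i ∈ J, (y i ^ 2 - 1)) ∂(Measure.pi fun _ => γ) ≤
        exp (sqMgfConst b * l ^ 2 * J.card) := by
  classical
  have := h.prob
  obtain ⟨g1, g2⟩ := sq_sub_one_mgf h hb hl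
  have e : ∀ y : Fin n → ℝ, exp (l * ∑ i ∈ J, (y i ^ 2 - 1)) =
      ∏ i, (if i ∈ J then exp (l * (y i ^ 2 - 1)) else 1) := fun y => by
    rw [Finset.mul_sum, exp_sum, Finset.prod_ite_mem, Finset.univ_inter]
  have hf : ∀ i : Fin n, Integrable (fun x : ℝ => if i ∈ J then exp (l * (x ^ 2 - 1)) else 1) γ :=
    fun i => by
      by_cases hi : i ∈ J
      · simpa [hi] using g1
      · simp [hi]
  simp only [e]
  refine ⟨Integrable.fintype_prod_dep (f := fun i x => if i ∈ J then exp (l * (x ^ 2 - 1)) else 1)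
    hf, ?_⟩
  rw [integral_fintype_prod_eq_prod (𝕜 := ℝ)
    (fun i (x : ℝ) => if i ∈ J then exp (l * (x ^ 2 - 1)) else 1)]
  have e2 : ∀ i : Fin n, ∫ x, (if i ∈ J then exp (l * (x ^ 2 - 1)) else 1) ∂γ =
      if i ∈ J then ∫ x, exp (l * (x ^ 2 - 1)) ∂γ else 1 := fun i => by
    by_cases hi : i ∈ J
    · simp [hi]
    · simp [hi]
  simp only [e2]
  rw [Finset.prod_ite_mem, Finset.univ_inter, Finset.prod_const, mul_comm, exp_nat_mul]
  gcongr

/-- The exponential rate in Bernstein's inequality for sums of `x² - 1`. -/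
noncomputable def bernsteinConst (b : ℝ) : ℝ := min (1 / (4 * sqMgfConst b)) (b / 8)

lemma bernsteinConst_pos (hb : 0 < b) : 0 < bernsteinConst b := by
  have := sqMgfConst_pos (b := b)
  unfold bernsteinConst
  positivity

/-- Bernstein's inequality for a block of squared coordinates. -/
lemma bernstein (h : IsNormalizedSubgaussian b γ) (hb : 0 < b) (J : Finset (Fin n)) {k : ℝ}
    (hk : 0 < k) (hJ : (J.card : ℝ) ≤ k) {u : ℝ} (hu : 0 ≤ u) :
    (Measure.pi fun _ : Fin n => γ).real {y | u ≤ |∑ i ∈ J, (y i ^ 2 - 1)|} ≤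
      2 * exp (-(bernsteinConst b * min (u ^ 2 / k) u)) := by
  have := h.prob
  have hC := sqMgfConst_pos (b := b)
  set C := sqMgfConst b with hCdef
  -- The optimal Chernoff parameter, truncated where the moment generating function ceases to be
  -- controlled.
  set l := min (u / (2 * C * k)) (b / 4) with hldef
  have hl0 : 0 ≤ l := le_min (by positivity) (by positivity)
  have hlb : |l| ≤ b / 4 := by rw [abs_of_nonneg hl0]; exact min_le_right _ _
  have hexp : exp (-l * u) * exp (C * l ^ 2 * J.card) ≤
      exp (-(bernsteinConst b * min (u ^ 2 / k) u)) := by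
    rw [← exp_add]
    apply exp_le_exp.2
    have h1 : C * l ^ 2 * J.card ≤ l * u / 2 := by
      have h2 : l ≤ u / (2 * C * k) := min_le_left _ _
      rw [le_div_iff₀ (by positivity)] at h2
      calc C * l ^ 2 * J.card ≤ C * l ^ 2 * k := by gcongr
        _ = l * (l * (2 * C * k)) / 2 := by ring
        _ ≤ l * u / 2 := by gcongr
    have h3 : bernsteinConst b * min (u ^ 2 / k) u ≤ l * u / 2 := by
      have hm : 0 ≤ min (u ^ 2 / k) u := le_min (by positivity) hu
      have hc1 : bernsteinConst b ≤ 1 / (4 * C) := min_le_left _ _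
      have hc2 : bernsteinConst b ≤ b / 8 := min_le_right _ _
      rcases min_cases (u / (2 * C * k)) (b / 4) with ⟨he, -⟩ | ⟨he, -⟩
      · rw [hldef, he]
        calc bernsteinConst b * min (u ^ 2 / k) u ≤ 1 / (4 * C) * (u ^ 2 / k) := by
              gcongr; exact min_le_left _ _
          _ = _ := by field_simp; ring
      · rw [hldef, he]
        calc bernsteinConst b * min (u ^ 2 / k) u ≤ b / 8 * u := by
              gcongr; exact min_le_right _ _
          _ = _ := by ring
    linarith
  have t1 := measure_ge_le_exp_mul_mgf (X := fun y : Fin n → ℝ => ∑ i ∈ J, (y i ^ 2 - 1))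
    (μ := Measure.pi fun _ : Fin n => γ) u hl0 (block_mgf h hb J hlb).1
  have t2 := measure_ge_le_exp_mul_mgf (X := fun y : Fin n → ℝ => -∑ i ∈ J, (y i ^ 2 - 1))
    (μ := Measure.pi fun _ : Fin n => γ) u hl0 (by
      have := (block_mgf h hb J (l := -l) (by rwa [abs_neg])).1
      simpa only [neg_mul_comm] using this)
  have b1 : mgf (fun y : Fin n → ℝ => ∑ i ∈ J, (y i ^ 2 - 1)) (Measure.pi fun _ : Fin n => γ) l ≤
      exp (C * l ^ 2 * J.card) := (block_mgf h hb J hlb).2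
  have b2 : mgf (fun y : Fin n → ℝ => -∑ i ∈ J, (y i ^ 2 - 1)) (Measure.pi fun _ : Fin n => γ) l ≤
      exp (C * l ^ 2 * J.card) := by
    have := (block_mgf h hb J (l := -l) (by rwa [abs_neg])).2
    simp only [neg_mul_comm, neg_sq] at this
    exact this
  have hsub : {y : Fin n → ℝ | u ≤ |∑ i ∈ J, (y i ^ 2 - 1)|} ⊆
      {y | u ≤ ∑ i ∈ J, (y i ^ 2 - 1)} ∪ {y | u ≤ -∑ i ∈ J, (y i ^ 2 - 1)} := by
    intro a ha
    exact le_abs.1 (show u ≤ |∑ i ∈ J, (a i ^ 2 - 1)| from ha)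
  have p := exp_pos (-l * u)
  calc _ ≤ _ := measureReal_mono hsub
    _ ≤ _ := measureReal_union_le _ _
    _ ≤ exp (-l * u) * exp (C * l ^ 2 * J.card) + exp (-l * u) * exp (C * l ^ 2 * J.card) := by
        gcongr
        · exact t1.trans (by gcongr)
        · exact t2.trans (by gcongr)
    _ ≤ _ := by linarith

/-- The relative error `|y|² / n - 1` of the squared Euclidean norm. -/
noncomputable def sqErr (y : Fin n → ℝ) : ℝ := (∑ i, y i ^ 2) / n - 1

lemma measurable_sqErr : Measurable (sqErr (n := n)) := by unfold sqErr; fun_prop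

lemma sqErr_eq (hn : 0 < n) (y : Fin n → ℝ) : (n : ℝ) * sqErr y = ∑ i, (y i ^ 2 - 1) := by
  have : (n : ℝ) ≠ 0 := by positivity
  simp [sqErr, mul_sub, mul_div_cancel₀ _ this]

lemma sqErr_tail (h : IsNormalizedSubgaussian b γ) (hb : 0 < b) (hn : 0 < n) {v : ℝ}
    (hv : 0 ≤ v) :
    (Measure.pi fun _ : Fin n => γ).real {y | v ≤ |sqErr y|} ≤
      2 * exp (-(bernsteinConst b * n * min (v ^ 2) v)) := by
  have hn' : (0 : ℝ) < n := by positivity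
  have := bernstein h hb (Finset.univ : Finset (Fin n)) hn' (by simp) (u := n * v) (by positivity)
  have e : {y : Fin n → ℝ | n * v ≤ |∑ i, (y i ^ 2 - 1)|} = {y | v ≤ |sqErr y|} := by
    ext y
    simp only [Set.mem_ofPred_eq, ← sqErr_eq hn, abs_mul, abs_of_pos hn']
    exact mul_le_mul_iff_right₀ hn'
  rw [e] at this
  convert this using 3
  have e2 : ((n : ℝ) * v) ^ 2 / n = n * v ^ 2 := by field_simp
  rw [e2, ← mul_min_of_nonneg _ _ hn'.le]
  ring

/-- A bound for the even moments of `√n · sqErr`. -/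
noncomputable def sqErrMomentConst (b : ℝ) (k : ℕ) : ℝ :=
  2 * (2 * k).factorial * (4 / b) ^ (2 * k) * exp (sqMgfConst b * (b / 4) ^ 2)

lemma sqErr_pow_integrable_and_le (h : IsNormalizedSubgaussian b γ) (hb : 0 < b) (hn : 0 < n)
    (k : ℕ) :
    Integrable (fun y : Fin n → ℝ => sqErr y ^ (2 * k)) (Measure.pi fun _ => γ) ∧
    ∫ y : Fin n → ℝ, sqErr y ^ (2 * k) ∂(Measure.pi fun _ => γ) ≤
      sqErrMomentConst b k / n ^ k := by
  have := h.prob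
  have hn' : (0 : ℝ) < n := by positivity
  have hn1 : (1 : ℝ) ≤ n := by exact_mod_cast hn
  have hs : 0 < √(n : ℝ) := sqrt_pos.2 hn'
  have hss : √(n : ℝ) * √n = n := mul_self_sqrt hn'.le
  -- At this scale the exponential moment of the sum is bounded independently of `n`.
  set l := b / 4 / √(n : ℝ) with hl
  have hl0 : 0 < l := by positivity
  have hlb : |l| ≤ b / 4 := by
    rw [abs_of_pos hl0]
    exact div_le_self (by positivity) (by rw [one_le_sqrt]; exact hn1)
  obtain ⟨f1, f2⟩ := block_mgf h hb (Finset.univ : Finset (Fin n)) hlb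
  obtain ⟨g1, g2⟩ := block_mgf h hb (Finset.univ : Finset (Fin n)) (l := -l) (by rwa [abs_neg])
  have hval : sqMgfConst b * l ^ 2 * ((Finset.univ : Finset (Fin n)).card : ℝ) =
      sqMgfConst b * (b / 4) ^ 2 := by
    rw [hl, div_pow, sq_sqrt hn'.le, Finset.card_univ, Fintype.card_fin]
    field_simp
  rw [neg_sq, hval] at g2
  rw [hval] at f2
  set A := (2 * k).factorial * (4 / b) ^ (2 * k) / (n : ℝ) ^ k with hA
  have hA0 : 0 ≤ A := by positivity
  have hpt : ∀ y : Fin n → ℝ, sqErr y ^ (2 * k) ≤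
      A * (exp (l * ∑ i, (y i ^ 2 - 1)) + exp (-l * ∑ i, (y i ^ 2 - 1))) := by
    intro y
    rw [← sqErr_eq hn y]
    set z := l * (n * sqErr y) with hz
    have h1 : |z| ^ (2 * k) / (2 * k).factorial ≤ exp |z| :=
      pow_div_factorial_le_exp _ (abs_nonneg z) (2 * k)
    have h2 : exp |z| ≤ exp z + exp (-z) := by
      rcases abs_cases z with ⟨h, -⟩ | ⟨h, -⟩ <;> rw [h]
      · linarith [exp_pos (-z)]
      · linarith [exp_pos z]
    have h3 : |z| ^ (2 * k) = z ^ (2 * k) := Even.pow_abs (even_two_mul k) z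
    have hz2 : z ^ (2 * k) = (b / 4) ^ (2 * k) * n ^ k * sqErr y ^ (2 * k) := by
      have : z = b / 4 * √(n : ℝ) * sqErr y := by
        calc z = b / 4 * (n / √(n : ℝ)) * sqErr y := by rw [hz, hl]; ring
          _ = _ := by rw [div_sqrt]
      rw [this, mul_pow, mul_pow, pow_mul (√(n : ℝ)), sq_sqrt hn'.le]
    rw [h3, hz2, div_le_iff₀ (by positivity)] at h1
    have h4 : sqErr y ^ (2 * k) = A / (2 * k).factorial *
        ((b / 4) ^ (2 * k) * n ^ k * sqErr y ^ (2 * k)) := by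
      rw [hA, div_pow, div_pow]
      field_simp
    rw [h4, neg_mul]
    calc A / (2 * k).factorial * ((b / 4) ^ (2 * k) * n ^ k * sqErr y ^ (2 * k))
        ≤ A / (2 * k).factorial * (exp |z| * (2 * k).factorial) := by gcongr
      _ = A * exp |z| := by field_simp
      _ ≤ _ := by gcongr
  have i1 : Integrable (fun y : Fin n → ℝ => A * (exp (l * ∑ i, (y i ^ 2 - 1)) +
      exp (-l * ∑ i, (y i ^ 2 - 1)))) (Measure.pi fun _ => γ) := (f1.add g1).const_mul A
  have hnn : ∀ y : Fin n → ℝ, 0 ≤ sqErr y ^ (2 * k) := fun y =>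
    Even.pow_nonneg (even_two_mul k) _
  have i2 : Integrable (fun y : Fin n → ℝ => sqErr y ^ (2 * k)) (Measure.pi fun _ => γ) := by
    refine i1.mono' (measurable_sqErr.pow_const _).aestronglyMeasurable (ae_of_all _ fun y => ?_)
    rw [norm_of_nonneg (hnn y)]
    exact hpt y
  refine ⟨i2, (integral_mono i2 i1 hpt).trans ?_⟩
  rw [integral_const_mul, integral_add f1 g1]
  calc _ ≤ A * (exp (sqMgfConst b * (b / 4) ^ 2) + exp (sqMgfConst b * (b / 4) ^ 2)) := by gcongr
    _ = _ := by rw [sqErrMomentConst, hA]; ring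

lemma integrable_sqErr_pow (h : IsNormalizedSubgaussian b γ) (hb : 0 < b) (hn : 0 < n) (k : ℕ) :
    Integrable (fun y : Fin n → ℝ => |sqErr y| ^ k) (Measure.pi fun _ => γ) := by
  have := h.prob
  refine ((integrable_const (1 : ℝ)).add (sqErr_pow_integrable_and_le h hb hn k).1).mono'
    (measurable_sqErr.abs.pow_const _).aestronglyMeasurable (ae_of_all _ fun y => ?_)
  rw [Real.norm_eq_abs, abs_of_nonneg (by positivity), Pi.add_apply, mul_comm 2 k, pow_mul,
    ← sq_abs (sqErr y ^ k), abs_pow]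
  nlinarith [sq_nonneg (|sqErr y| ^ k - 1), abs_nonneg (sqErr y), pow_nonneg (abs_nonneg (sqErr y)) k]

lemma sqErr_abs_cube_le (h : IsNormalizedSubgaussian b γ) (hb : 0 < b) (hn : 0 < n) :
    ∫ y : Fin n → ℝ, |sqErr y| ^ 3 ∂(Measure.pi fun _ => γ) ≤
      (sqErrMomentConst b 1 + sqErrMomentConst b 2) / (n * √n) := by
  have := h.prob
  have hn' : (0 : ℝ) < n := by positivity
  have hs : 0 < √(n : ℝ) := sqrt_pos.2 hn'
  have hss : √(n : ℝ) * √n = n := mul_self_sqrt hn'.le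
  obtain ⟨i1, b1⟩ := sqErr_pow_integrable_and_le (n := n) h hb hn 1
  obtain ⟨i2, b2⟩ := sqErr_pow_integrable_and_le (n := n) h hb hn 2
  have i3 : Integrable (fun y : Fin n → ℝ => 1 / √(n : ℝ) * sqErr y ^ (2 * 1) +
      √(n : ℝ) * sqErr y ^ (2 * 2)) (Measure.pi fun _ => γ) := (i1.const_mul _).add (i2.const_mul _)
  calc ∫ y : Fin n → ℝ, |sqErr y| ^ 3 ∂(Measure.pi fun _ => γ)
      ≤ ∫ y : Fin n → ℝ, (1 / √(n : ℝ) * sqErr y ^ (2 * 1) + √(n : ℝ) * sqErr y ^ (2 * 2))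
          ∂(Measure.pi fun _ => γ) := by
        refine integral_mono (integrable_sqErr_pow h hb hn 3) i3 fun y => ?_
        show |sqErr y| ^ 3 ≤ 1 / √(n : ℝ) * sqErr y ^ (2 * 1) + √(n : ℝ) * sqErr y ^ (2 * 2)
        have e1 : sqErr y ^ (2 * 1) = |sqErr y| ^ 2 := by rw [sq_abs]
        have e2 : sqErr y ^ (2 * 2) = |sqErr y| ^ 4 := (Even.pow_abs (by decide) _).symm
        rw [e1, e2]
        set a := |sqErr y|
        have ha : 0 ≤ a := abs_nonneg _
        -- The cube is bounded by a weighted mean of the square and the fourth power.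
        have e3 : 1 / √(n : ℝ) * a ^ 2 + √(n : ℝ) * a ^ 4 - a ^ 3 =
            a ^ 2 * ((1 - √(n : ℝ) * a) ^ 2 + √(n : ℝ) * a) / √(n : ℝ) := by
          field_simp; ring
        have : 0 ≤ a ^ 2 * ((1 - √(n : ℝ) * a) ^ 2 + √(n : ℝ) * a) / √(n : ℝ) := by positivity
        linarith
    _ = 1 / √(n : ℝ) * ∫ y : Fin n → ℝ, sqErr y ^ (2 * 1) ∂(Measure.pi fun _ => γ) +
        √(n : ℝ) * ∫ y : Fin n → ℝ, sqErr y ^ (2 * 2) ∂(Measure.pi fun _ => γ) := by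
        rw [integral_add (i1.const_mul _) (i2.const_mul _), integral_const_mul, integral_const_mul]
    _ ≤ 1 / √(n : ℝ) * (sqErrMomentConst b 1 / n ^ 1) +
        √(n : ℝ) * (sqErrMomentConst b 2 / n ^ 2) := by gcongr
    _ = _ := by
        have : (n : ℝ) ^ 2 = n * (√n * √n) := by rw [hss]; ring
        rw [this]
        field_simp

lemma sqErr_mean_and_sq (h : IsNormalizedSubgaussian b γ) (hb : 0 < b) (hn : 0 < n) :
    ∫ y : Fin n → ℝ, sqErr y ∂(Measure.pi fun _ => γ) = 0 ∧
    ∫ y : Fin n → ℝ, sqErr y ^ 2 ∂(Measure.pi fun _ => γ) = (∫ x, x ^ 4 ∂γ - 1) / n := by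
  have := h.prob
  have hn' : (n : ℝ) ≠ 0 := by positivity
  have hind : iIndepFun (fun i (y : Fin n → ℝ) => y i ^ 2 - 1) (Measure.pi fun _ => γ) :=
    iIndepFun_pi (X := fun _ x => x ^ 2 - 1) (μ := fun _ => γ) fun j => by fun_prop
  have hmeas : ∀ i, Measurable (fun y : Fin n → ℝ => y i ^ 2 - 1) := fun i =>
    ((measurable_pi_apply i).pow_const 2).sub_const 1
  have hint (k : ℕ) : Integrable (fun x : ℝ => (x ^ 2 - 1) ^ k) γ := by
    have : Integrable (fun x : ℝ => (2 : ℝ) ^ k * (x ^ (2 * k) + 1)) γ :=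
      ((h.integrable_pow hb (2 * k)).add (integrable_const _)).const_mul _
    refine this.mono' (by fun_prop) (ae_of_all _ fun x => ?_)
    rw [Real.norm_eq_abs, abs_pow]
    have h1 : |x ^ 2 - 1| ≤ 2 * max (x ^ 2) 1 := by
      rw [abs_le]; constructor <;> nlinarith [le_max_left (x ^ 2) 1, le_max_right (x ^ 2) 1]
    have h2 : max (x ^ 2) 1 ^ k ≤ x ^ (2 * k) + 1 := by
      rw [pow_mul]
      rcases max_cases (x ^ 2) 1 with ⟨h, -⟩ | ⟨h, -⟩ <;> rw [h]
      · linarith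
      · simp only [one_pow]; linarith [pow_nonneg (sq_nonneg x) k]
    calc |x ^ 2 - 1| ^ k ≤ (2 * max (x ^ 2) 1) ^ k := by gcongr
      _ = 2 ^ k * max (x ^ 2) 1 ^ k := by rw [mul_pow]
      _ ≤ _ := by gcongr
  have h4 : ∀ i, MemLp (fun y : Fin n → ℝ => y i ^ 2 - 1) 4 (Measure.pi fun _ => γ) := fun i =>
    memLp_four_of_integrable (hmeas i).aestronglyMeasurable
      (integrable_comp_eval (μ := fun _ : Fin n => γ) (i := i) (f := fun x => (x ^ 2 - 1) ^ 4)
        (hint 4))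
  have h0 : ∀ i, ∫ y : Fin n → ℝ, (y i ^ 2 - 1) ∂(Measure.pi fun _ => γ) = 0 := fun i => by
    rw [integral_comp_eval (μ := fun _ : Fin n => γ) (i := i) (f := fun x => x ^ 2 - 1)
      (by fun_prop), integral_sub (h.integrable_pow hb 2) (integrable_const _), h.sq]
    simp
  have h2 : ∀ i, ∫ y : Fin n → ℝ, (y i ^ 2 - 1) ^ 2 ∂(Measure.pi fun _ => γ) =
      ∫ x, x ^ 4 ∂γ - 1 := fun i => by
    rw [integral_comp_eval (μ := fun _ : Fin n => γ) (i := i) (f := fun x => (x ^ 2 - 1) ^ 2)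
      (by fun_prop)]
    have e : ∀ x : ℝ, (x ^ 2 - 1) ^ 2 = x ^ 4 - 2 * x ^ 2 + 1 := fun x => by ring
    have i1 : Integrable (fun x : ℝ => x ^ 4 - 2 * x ^ 2) γ :=
      (h.integrable_pow hb 4).sub ((h.integrable_pow hb 2).const_mul 2)
    simp only [e]
    rw [integral_add i1 (integrable_const _), integral_sub (h.integrable_pow hb 4)
      ((h.integrable_pow hb 2).const_mul 2), integral_const_mul, h.sq]
    simp; ring
  obtain ⟨a1, a2, -, -⟩ := moments_sum hind (fun i => (hmeas i).aemeasurable) h4 h0 Finset.univ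
  have e : ∀ y : Fin n → ℝ, sqErr y = (1 / n) * ∑ i, (y i ^ 2 - 1) := fun y => by
    rw [← sqErr_eq hn]; field_simp
  simp only [e, mul_pow]
  rw [integral_const_mul, integral_const_mul, a1, a2]
  refine ⟨by simp, ?_⟩
  simp only [h2]
  simp
  field_simp

end

/-! ### The clamped logarithm of the norm -/

/-- `log √q` with `q` clamped to `[e^{-2L}, e^{2L}]`. -/
noncomputable def clampLog (L q : ℝ) : ℝ := log (max (exp (-(2 * L))) (min (exp (2 * L)) q)) / 2

lemma measurable_clampLog (L : ℝ) : Measurable (clampLog L) := by unfold clampLog; fun_prop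

lemma abs_clampLog_le {L : ℝ} (hL : 0 ≤ L) (q : ℝ) : |clampLog L q| ≤ L := by
  have h0 := exp_pos (-(2 * L))
  have h1 : exp (-(2 * L)) ≤ max (exp (-(2 * L))) (min (exp (2 * L)) q) := le_max_left _ _
  have h2 : max (exp (-(2 * L))) (min (exp (2 * L)) q) ≤ exp (2 * L) :=
    max_le (exp_le_exp.2 (by linarith)) (min_le_left _ _)
  have h3 := log_le_log h0 h1
  have h4 := log_le_log (h0.trans_le h1) h2
  rw [log_exp] at h3 h4
  rw [clampLog, abs_le]
  constructor <;> linarith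

lemma clampLog_eq {L q : ℝ} (h1 : exp (-(2 * L)) ≤ q) (h2 : q ≤ exp (2 * L)) :
    clampLog L q = log q / 2 := by
  rw [clampLog, min_eq_right h2, max_eq_right h1]

lemma clampLog_eq_of_near_one {L u : ℝ} (hL : 1 ≤ L) (hu : |u| ≤ 1 / 2) :
    clampLog L (1 + u) = log (1 + u) / 2 := by
  obtain ⟨h1, h2⟩ := abs_le.1 hu
  apply clampLog_eq
  · have : exp (-(2 * L)) ≤ exp (-1) := exp_le_exp.2 (by linarith)
    have h3 : exp (-1 : ℝ) ≤ 1 / 2 := by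
      rw [exp_neg, inv_le_comm₀ (exp_pos 1) (by norm_num)]
      have := add_one_le_exp (1 : ℝ); norm_num at this ⊢; linarith
    linarith
  · have := add_one_le_exp (2 * L)
    linarith

lemma abs_clampLog_le_of_near_one {L u : ℝ} (hL : 1 ≤ L) (hu : |u| ≤ 1 / 2) :
    |clampLog L (1 + u)| ≤ |u| := by
  rw [clampLog_eq_of_near_one hL hu]
  obtain ⟨h1, h2⟩ := abs_le.1 hu
  have hp : 0 < 1 + u := by linarith
  have a1 := log_le_sub_one_of_pos hp
  have a2 := one_sub_inv_le_log_of_pos hp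
  have a3 : -(2 * |u|) ≤ 1 - (1 + u)⁻¹ := by
    have e : 1 - (1 + u)⁻¹ = u / (1 + u) := by field_simp; ring
    rw [e, le_div_iff₀ hp]
    rcases abs_cases u with ⟨h, _⟩ | ⟨h, _⟩ <;> rw [h] <;> nlinarith
  rw [abs_le]
  constructor
  · linarith
  · linarith [le_abs_self u, abs_nonneg u]

lemma abs_clampLog_le_min {L : ℝ} (hL : 1 ≤ L) (u : ℝ) :
    |clampLog L (1 + u)| ≤ 4 * L * min |u| 1 := by
  by_cases hu : |u| ≤ 1 / 2
  · rw [min_eq_left (by linarith)]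
    have := abs_clampLog_le_of_near_one hL hu
    nlinarith [abs_nonneg u]
  · have h1 := abs_clampLog_le (by linarith : 0 ≤ L) (1 + u)
    have h2 : 1 / 2 ≤ min |u| 1 := le_min (by linarith) (by norm_num)
    nlinarith

lemma abs_clampLog_le_abs {L : ℝ} (hL : 1 ≤ L) (u : ℝ) :
    |clampLog L (1 + u)| ≤ 4 * L * |u| :=
  (abs_clampLog_le_min hL u).trans (by gcongr; exact min_le_left _ _)

lemma clampLog_taylor {L : ℝ} (hL : 1 ≤ L) (u : ℝ) :
    |clampLog L (1 + u) - (u / 2 - u ^ 2 / 4)| ≤ 16 * L * |u| ^ 3 := by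
  by_cases hu : |u| ≤ 1 / 2
  · rw [clampLog_eq_of_near_one hL hu]
    have h1 := abs_log_sub_add_sum_range_le (x := -u) (by rw [abs_neg]; linarith) 2
    simp only [Finset.sum_range_succ, Finset.sum_range_zero, sub_neg_eq_add, abs_neg] at h1
    norm_num at h1
    have h2 : |u| ^ 3 / (1 - |u|) ≤ 2 * |u| ^ 3 := by
      rw [div_le_iff₀ (by linarith)]
      have : 0 ≤ |u| ^ 3 := by positivity
      nlinarith
    have e : log (1 + u) / 2 - (u / 2 - u ^ 2 / 4) = (-u + u ^ 2 / 2 + log (1 + u)) / 2 := by ring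
    rw [e, abs_div, abs_two]
    have : 0 ≤ |u| ^ 3 := by positivity
    nlinarith
  · push Not at hu
    have h1 := abs_clampLog_le (by linarith : 0 ≤ L) (1 + u)
    set a := |u| with ha
    have h2 : 1 / 8 ≤ a ^ 3 := by
      calc (1 / 8 : ℝ) = (1 / 2) ^ 3 := by norm_num
        _ ≤ a ^ 3 := by gcongr
    have h6 : 1 / 4 ≤ a ^ 2 := by nlinarith
    have h3 : a ≤ 4 * a ^ 3 := by
      have : a * (1 / 4) ≤ a * a ^ 2 := by gcongr
      calc a = 4 * (a * (1 / 4)) := by ring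
        _ ≤ 4 * (a * a ^ 2) := by gcongr
        _ = _ := by ring
    have h4 : u ^ 2 ≤ 2 * a ^ 3 := by
      rw [← sq_abs u, ← ha]
      have : 1 / 2 * a ^ 2 ≤ a * a ^ 2 := by gcongr
      calc a ^ 2 = 2 * (1 / 2 * a ^ 2) := by ring
        _ ≤ 2 * (a * a ^ 2) := by gcongr
        _ = _ := by ring
    have h5 : |u / 2 - u ^ 2 / 4| ≤ a / 2 + u ^ 2 / 4 := by
      refine (abs_sub _ _).trans ?_
      rw [abs_div, abs_div, abs_two, abs_of_nonneg (sq_nonneg u)]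
      norm_num [ha]
    calc |clampLog L (1 + u) - (u / 2 - u ^ 2 / 4)| ≤ L + (a / 2 + u ^ 2 / 4) :=
          (abs_sub _ _).trans (add_le_add h1 h5)
      _ ≤ 16 * L * a ^ 3 := by nlinarith

lemma clampLog_sq_taylor {L : ℝ} (hL : 1 ≤ L) (u : ℝ) :
    |clampLog L (1 + u) ^ 2 - u ^ 2 / 4| ≤ 40 * L ^ 2 * |u| ^ 3 := by
  have h3 : 0 ≤ |u| ^ 3 := by positivity
  by_cases hu : |u| ≤ 1 / 2
  · have h1 := abs_clampLog_le_of_near_one hL hu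
    have h2 := clampLog_taylor hL u
    set a := clampLog L (1 + u)
    have e : a ^ 2 - u ^ 2 / 4 = (a - u / 2) * (a + u / 2) := by ring
    have h4 : |a - u / 2| ≤ 9 * L * |u| ^ 2 := by
      have : a - u / 2 = (a - (u / 2 - u ^ 2 / 4)) + -(u ^ 2 / 4) := by ring
      rw [this]
      refine (abs_add_le _ _).trans ?_
      rw [abs_neg, abs_of_nonneg (by positivity : 0 ≤ u ^ 2 / 4)]
      have h6 : |u| ^ 3 ≤ 1 / 2 * |u| ^ 2 := by
        rw [pow_succ, mul_comm]; gcongr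
      have h7 : 16 * L * |u| ^ 3 ≤ 16 * L * (1 / 2 * |u| ^ 2) := by gcongr
      have h8 : 1 * |u| ^ 2 ≤ L * |u| ^ 2 := by gcongr
      have h9 := sq_abs u
      linarith
    have h5 : |a + u / 2| ≤ 2 * |u| := by
      refine (abs_add_le _ _).trans ?_
      rw [abs_div, abs_two]
      linarith [abs_nonneg u]
    rw [e, abs_mul]
    calc |a - u / 2| * |a + u / 2| ≤ (9 * L * |u| ^ 2) * (2 * |u|) := by gcongr
      _ = 18 * L * |u| ^ 3 := by ring
      _ ≤ 40 * L ^ 2 * |u| ^ 3 := by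
          apply mul_le_mul_of_nonneg_right _ h3
          nlinarith
  · push Not at hu
    have h1 := abs_clampLog_le (by linarith : 0 ≤ L) (1 + u)
    have h2 : 1 / 8 ≤ |u| ^ 3 := by
      calc (1 / 8 : ℝ) = (1 / 2) ^ 3 := by norm_num
        _ ≤ |u| ^ 3 := by gcongr
    have h4 : u ^ 2 ≤ 2 * |u| ^ 3 := by rw [← sq_abs u]; nlinarith [abs_nonneg u]
    have h5 : clampLog L (1 + u) ^ 2 ≤ L ^ 2 := by
      rw [← sq_abs]; gcongr
    have h6 : 1 * |u| ^ 3 ≤ L ^ 2 * |u| ^ 3 := by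
      gcongr
      nlinarith
    have h7 : L ^ 2 * (1 / 8) ≤ L ^ 2 * |u| ^ 3 := by gcongr
    rw [abs_le]
    constructor <;> linarith [sq_nonneg u, sq_nonneg (clampLog L (1 + u))]

section

variable {b : ℝ} {γ : Measure ℝ} {n : ℕ}

/-- The clamped logarithm of `|y| / √n`. -/
noncomputable def logStep (L : ℝ) (y : Fin n → ℝ) : ℝ := clampLog L (1 + sqErr y)

lemma measurable_logStep (L : ℝ) : Measurable (logStep (n := n) L) :=
  (measurable_clampLog L).comp (measurable_const.add measurable_sqErr)

/-- The sub-Gaussian rate of `logStep`. -/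
noncomputable def logRate (b L : ℝ) (n : ℕ) : ℝ := bernsteinConst b * n / (64 * L ^ 2)

lemma logRate_pos (hb : 0 < b) {L : ℝ} (hL : 0 < L) (hn : 0 < n) : 0 < logRate b L n := by
  have := bernsteinConst_pos hb
  unfold logRate
  positivity

lemma logStep_exp_sq (h : IsNormalizedSubgaussian b γ) (hb : 0 < b) (hn : 0 < n) {L : ℝ}
    (hL : 1 ≤ L) :
    Integrable (fun y : Fin n → ℝ => exp (logRate b L n * logStep L y ^ 2))
      (Measure.pi fun _ => γ) ∧
    ∫ y : Fin n → ℝ, exp (logRate b L n * logStep L y ^ 2) ∂(Measure.pi fun _ => γ) ≤ 2 := by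
  have := h.prob
  have hc := bernsteinConst_pos hb
  have hn' : (0 : ℝ) < n := by positivity
  have hL0 : 0 < L := by linarith
  have ht := exp_sq_moment_le_two_of_tail (P := Measure.pi fun _ : Fin n => γ)
    (X := logStep L) (measurable_logStep L).aemeasurable
    (K := 16 * L ^ 2 / (bernsteinConst b * n)) (C := 2) (by positivity) (by norm_num) ?_
  · have e : 1 / (2 * (16 * L ^ 2 / (bernsteinConst b * n)) * 2) = logRate b L n := by
      rw [logRate]; field_simp; norm_num
    rwa [e] at ht
  · intro s hs
    by_cases hs1 : s / (4 * L) ≤ 1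
    · have h1 := sqErr_tail h hb hn (v := s / (4 * L)) (by positivity)
      refine (measureReal_mono ?_).trans (h1.trans (le_of_eq ?_))
      · intro y hy
        have h2 : s ≤ |logStep L y| := hy
        show s / (4 * L) ≤ |sqErr y|
        rw [div_le_iff₀ (by positivity)]
        have h3 := abs_clampLog_le_abs hL (sqErr y)
        rw [logStep] at h2
        linarith
      · have h4 : 0 ≤ s / (4 * L) := by positivity
        rw [min_eq_left (by nlinarith)]
        congr 2
        field_simp
        norm_num
    · have : {y : Fin n → ℝ | s ≤ |logStep L y|} = ∅ := by
        ext y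
        simp only [Set.mem_ofPred_eq, Set.mem_empty_iff_false, iff_false, not_le]
        have h1 := abs_clampLog_le hL0.le (1 + sqErr y)
        rw [not_le, lt_div_iff₀ (by positivity)] at hs1
        rw [logStep]
        linarith
      rw [this, measureReal_empty]
      positivity

lemma integrable_logStep (h : IsNormalizedSubgaussian b γ) {L : ℝ}
    (hL : 0 ≤ L) (k : ℕ) :
    Integrable (fun y : Fin n → ℝ => logStep L y ^ k) (Measure.pi fun _ => γ) := by
  have := h.prob
  refine (integrable_const (L ^ k)).mono' ((measurable_logStep L).pow_const k).aestronglyMeasurable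
    (ae_of_all _ fun y => ?_)
  rw [Real.norm_eq_abs, abs_pow]
  gcongr
  exact abs_clampLog_le hL _

/-- The moment generating function of the centred logarithmic step. -/
lemma logStep_mgf (h : IsNormalizedSubgaussian b γ) (hb : 0 < b) (hn : 0 < n) {L : ℝ}
    (hL : 1 ≤ L) (l : ℝ) :
    Integrable (fun y : Fin n → ℝ =>
      exp (l * (logStep L y - ∫ y : Fin n → ℝ, logStep L y ∂(Measure.pi fun _ => γ))))
      (Measure.pi fun _ => γ) ∧
    ∫ y : Fin n → ℝ, exp (l * (logStep L y - ∫ y : Fin n → ℝ, logStep L y ∂(Measure.pi fun _ => γ)))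
      ∂(Measure.pi fun _ => γ) ≤ exp (8 * l ^ 2 / logRate b L n) := by
  have := h.prob
  obtain ⟨h1, h2⟩ := logStep_exp_sq (n := n) h hb hn hL
  exact mgf_sub_mean_le_of_exp_sq (measurable_logStep L).aemeasurable
    (logRate_pos hb (by linarith) hn) h1 h2 l

/-- The constant in the third order error bounds for `logStep`. -/
noncomputable def cubeConst (b : ℝ) : ℝ := sqErrMomentConst b 1 + sqErrMomentConst b 2

lemma sqErrMomentConst_pos (hb : 0 < b) (k : ℕ) : 0 < sqErrMomentConst b k := by
  unfold sqErrMomentConst; positivity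

lemma cubeConst_pos (hb : 0 < b) : 0 < cubeConst b :=
  add_pos (sqErrMomentConst_pos hb 1) (sqErrMomentConst_pos hb 2)

/-- The drift of the logarithmic step, up to third order. -/
lemma logStep_mean (h : IsNormalizedSubgaussian b γ) (hb : 0 < b) (hn : 0 < n) {L : ℝ}
    (hL : 1 ≤ L) :
    |∫ y : Fin n → ℝ, logStep L y ∂(Measure.pi fun _ => γ) + (∫ x, x ^ 4 ∂γ - 1) / (4 * n)| ≤
      16 * L * (cubeConst b / (n * √n)) := by
  have := h.prob
  have hn' : (0 : ℝ) < n := by positivity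
  obtain ⟨m1, m2⟩ := sqErr_mean_and_sq (n := n) h hb hn
  have i0 : Integrable (fun y : Fin n → ℝ => logStep L y) (Measure.pi fun _ => γ) := by
    simpa using integrable_logStep (n := n) h (by linarith : 0 ≤ L) 1
  have i1 : Integrable (fun y : Fin n → ℝ => sqErr y) (Measure.pi fun _ => γ) := by
    have := integrable_sqErr_pow h hb hn 1
    simp only [pow_one] at this
    exact (integrable_norm_iff measurable_sqErr.aestronglyMeasurable).1 this
  have i2 : Integrable (fun y : Fin n → ℝ => sqErr y ^ 2) (Measure.pi fun _ => γ) := by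
    simpa using (sqErr_pow_integrable_and_le (n := n) h hb hn 1).1
  have i3 : Integrable (fun y : Fin n → ℝ => sqErr y / 2 - sqErr y ^ 2 / 4)
    (Measure.pi fun _ => γ) := (i1.div_const 2).sub (i2.div_const 4)
  have e : ∫ y : Fin n → ℝ, logStep L y ∂(Measure.pi fun _ => γ) + (∫ x, x ^ 4 ∂γ - 1) / (4 * n) =
      ∫ y : Fin n → ℝ, (logStep L y - (sqErr y / 2 - sqErr y ^ 2 / 4))
        ∂(Measure.pi fun _ => γ) := by
    rw [integral_sub i0 i3, integral_sub (i1.div_const 2) (i2.div_const 4), integral_div,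
      integral_div, m1, m2]
    ring
  rw [e]
  calc _ ≤ ∫ y : Fin n → ℝ, |logStep L y - (sqErr y / 2 - sqErr y ^ 2 / 4)|
        ∂(Measure.pi fun _ => γ) := abs_integral_le_integral_abs
    _ ≤ ∫ y : Fin n → ℝ, 16 * L * |sqErr y| ^ 3 ∂(Measure.pi fun _ => γ) :=
        integral_mono (i0.sub i3).abs ((integrable_sqErr_pow h hb hn 3).const_mul _)
          fun y => clampLog_taylor hL _
    _ = 16 * L * ∫ y : Fin n → ℝ, |sqErr y| ^ 3 ∂(Measure.pi fun _ => γ) := integral_const_mul _ _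
    _ ≤ _ := by
        gcongr
        exact sqErr_abs_cube_le h hb hn

/-- The second moment of the logarithmic step, up to third order. -/
lemma logStep_sq_mean (h : IsNormalizedSubgaussian b γ) (hb : 0 < b) (hn : 0 < n) {L : ℝ}
    (hL : 1 ≤ L) :
    |∫ y : Fin n → ℝ, logStep L y ^ 2 ∂(Measure.pi fun _ => γ) - (∫ x, x ^ 4 ∂γ - 1) / (4 * n)| ≤
      40 * L ^ 2 * (cubeConst b / (n * √n)) := by
  have := h.prob
  have hn' : (0 : ℝ) < n := by positivity
  obtain ⟨m1, m2⟩ := sqErr_mean_and_sq (n := n) h hb hn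
  have i0 := integrable_logStep (n := n) h (by linarith : 0 ≤ L) 2
  have i2 : Integrable (fun y : Fin n → ℝ => sqErr y ^ 2) (Measure.pi fun _ => γ) := by
    simpa using (sqErr_pow_integrable_and_le (n := n) h hb hn 1).1
  have i3 : Integrable (fun y : Fin n → ℝ => sqErr y ^ 2 / 4)
    (Measure.pi fun _ => γ) := i2.div_const 4
  have e : ∫ y : Fin n → ℝ, logStep L y ^ 2 ∂(Measure.pi fun _ => γ) -
      (∫ x, x ^ 4 ∂γ - 1) / (4 * n) =
      ∫ y : Fin n → ℝ, (logStep L y ^ 2 - sqErr y ^ 2 / 4) ∂(Measure.pi fun _ => γ) := by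
    rw [integral_sub i0 i3, integral_div, m2]
    ring
  rw [e]
  calc _ ≤ ∫ y : Fin n → ℝ, |logStep L y ^ 2 - sqErr y ^ 2 / 4|
        ∂(Measure.pi fun _ => γ) := abs_integral_le_integral_abs
    _ ≤ ∫ y : Fin n → ℝ, 40 * L ^ 2 * |sqErr y| ^ 3 ∂(Measure.pi fun _ => γ) :=
        integral_mono (i0.sub i3).abs ((integrable_sqErr_pow h hb hn 3).const_mul _)
          fun y => clampLog_sq_taylor hL _
    _ = 40 * L ^ 2 * ∫ y : Fin n → ℝ, |sqErr y| ^ 3 ∂(Measure.pi fun _ => γ) :=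
        integral_const_mul _ _
    _ ≤ _ := by
        gcongr
        exact sqErr_abs_cube_le h hb hn

end

/-! ### Small ball estimates for linear forms -/

lemma cos_le_quartic (z : ℝ) : cos z ≤ 1 - z ^ 2 / 2 + z ^ 4 / 2 := by
  have e : |z| ^ 4 = z ^ 4 := Even.pow_abs (by decide) z
  by_cases hz : |z| ≤ 1
  · have := (abs_le.1 (cos_bound hz)).2
    have h4 : 0 ≤ z ^ 4 := by positivity
    rw [e] at this
    linarith
  · have h1 : 1 ≤ z ^ 2 := by rw [← sq_abs]; nlinarith
    have h2 : z ^ 2 ≤ z ^ 4 := by nlinarith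
    linarith [cos_le_one z]

lemma abs_sin_sub_le_cube (z : ℝ) : |sin z - z| ≤ 2 * |z| ^ 3 := by
  by_cases hz : |z| ≤ 1
  · have h1 := sin_bound hz
    have e : sin z - z = (sin z - (z - z ^ 3 / 6)) + -(z ^ 3 / 6) := by ring
    have h2 : |z| ^ 5 ≤ |z| ^ 3 := pow_le_pow_of_le_one (abs_nonneg z) hz (by norm_num)
    have h3 : |-(z ^ 3 / 6)| = |z| ^ 3 / 6 := by rw [abs_neg, abs_div, abs_pow]; norm_num
    rw [e]
    refine (abs_add_le _ _).trans ?_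
    rw [h3]
    have : 0 ≤ |z| ^ 3 := by positivity
    linarith
  · push Not at hz
    have h1 : |z| ≤ |z| ^ 3 := by nlinarith [mul_pos (by linarith : 0 < |z|) (by linarith : 0 < |z|)]
    calc |sin z - z| ≤ |sin z| + |z| := abs_sub _ _
      _ ≤ 1 + |z| := by gcongr; exact abs_sin_le_one z
      _ ≤ _ := by linarith

section

variable {b : ℝ} {μ γ : Measure ℝ} {n : ℕ}

/-- The characteristic function of a normalized sub-Gaussian law decays like that of a Gaussian
near the origin. -/
lemma norm_charFun_le (h : IsNormalizedSubgaussian b μ) (hb : 0 < b) {t : ℝ}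
    (ht : |t| ≤ b ^ 2 / 48) : ‖charFun μ t‖ ≤ exp (-(t ^ 2 / 4)) := by
  have := h.prob
  have hb1 := h.le_one hb
  have i2 := h.integrable_pow hb 2
  have i4 := h.integrable_pow hb 4
  have hM : ∫ x, x ^ 4 ∂μ ≤ 4 / b ^ 2 := by
    have := h.integral_pow_le hb 2
    norm_num [Nat.factorial] at this
    exact this
  have hbd : ∀ x : ℝ, ‖Complex.exp (t * x * Complex.I)‖ ≤ 1 := fun x => by
    rw [← Complex.ofReal_mul, Complex.norm_exp_ofReal_mul_I]
  have hint : Integrable (fun x : ℝ => Complex.exp (t * x * Complex.I)) μ :=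
    (integrable_const (1 : ℝ)).mono' (by fun_prop) (ae_of_all _ hbd)
  have hre : (charFun μ t).re = ∫ x, cos (t * x) ∂μ := by
    rw [charFun_apply_real, ← RCLike.re_eq_complex_re, ← integral_re hint]
    refine integral_congr_ae (ae_of_all _ fun x => ?_)
    simp only [RCLike.re_eq_complex_re]
    rw [← Complex.ofReal_mul, Complex.exp_ofReal_mul_I_re]
  have him : (charFun μ t).im = ∫ x, sin (t * x) ∂μ := by
    rw [charFun_apply_real, ← RCLike.im_eq_complex_im, ← integral_im hint]
    refine integral_congr_ae (ae_of_all _ fun x => ?_)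
    simp only [RCLike.im_eq_complex_im]
    rw [← Complex.ofReal_mul, Complex.exp_ofReal_mul_I_im]
  have icos : Integrable (fun x => cos (t * x)) μ :=
    (integrable_const (1 : ℝ)).mono' (by fun_prop) (ae_of_all _ fun x => abs_cos_le_one _)
  have isin : Integrable (fun x => sin (t * x)) μ :=
    (integrable_const (1 : ℝ)).mono' (by fun_prop) (ae_of_all _ fun x => abs_sin_le_one _)
  have ix : Integrable (fun x : ℝ => t * x) μ := by
    simpa using (h.integrable_pow hb 1).const_mul t
  -- The real part is `1 - t² / 2` up to fourth order, because the law has variance one.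
  have hre2 : |(charFun μ t).re| ≤ 1 - t ^ 2 / 2 + t ^ 4 * (2 / b ^ 2) := by
    have ht1 : |t| ≤ 1 := ht.trans (by nlinarith)
    have ht2 : t ^ 2 ≤ 1 := by rw [← sq_abs]; nlinarith [abs_nonneg t]
    have u1 : ∫ x, cos (t * x) ∂μ ≤ 1 - t ^ 2 / 2 + t ^ 4 * (2 / b ^ 2) := by
      have j1 : Integrable (fun x : ℝ => 1 - t ^ 2 / 2 * x ^ 2) μ :=
        (integrable_const _).sub (i2.const_mul _)
      calc ∫ x, cos (t * x) ∂μ ≤ ∫ x, (1 - t ^ 2 / 2 * x ^ 2 + t ^ 4 / 2 * x ^ 4) ∂μ :=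
            integral_mono icos (j1.add (i4.const_mul _)) fun x => by
              have := cos_le_quartic (t * x)
              show cos (t * x) ≤ 1 - t ^ 2 / 2 * x ^ 2 + t ^ 4 / 2 * x ^ 4
              calc _ ≤ _ := this
                _ = _ := by ring
        _ = 1 - t ^ 2 / 2 + t ^ 4 / 2 * ∫ x, x ^ 4 ∂μ := by
            rw [integral_add j1 (i4.const_mul _), integral_sub (integrable_const _)
              (i2.const_mul _), integral_const_mul, integral_const_mul, h.sq]
            simp
        _ ≤ 1 - t ^ 2 / 2 + t ^ 4 / 2 * (4 / b ^ 2) := by gcongr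
        _ = _ := by ring
    have u2 : 1 - t ^ 2 / 2 ≤ ∫ x, cos (t * x) ∂μ := by
      have j1 : Integrable (fun x : ℝ => 1 - t ^ 2 / 2 * x ^ 2) μ :=
        (integrable_const _).sub (i2.const_mul _)
      calc 1 - t ^ 2 / 2 = ∫ x, (1 - t ^ 2 / 2 * x ^ 2) ∂μ := by
            rw [integral_sub (integrable_const _) (i2.const_mul _), integral_const_mul, h.sq]
            simp
        _ ≤ _ := integral_mono j1 icos fun x => by
            have := one_sub_sq_div_two_le_cos (x := t * x)
            show 1 - t ^ 2 / 2 * x ^ 2 ≤ cos (t * x)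
            calc _ = 1 - (t * x) ^ 2 / 2 := by ring
              _ ≤ _ := this
    rw [hre, abs_of_nonneg (by linarith)]
    exact u1
  -- Since the mean is zero, `sin` may be replaced by `sin z - z`, so the imaginary part is of third
  -- order.
  have him2 : |(charFun μ t).im| ≤ |t| ^ 3 * (10 / b ^ 2) := by
    have e : ∫ x, sin (t * x) ∂μ = ∫ x, (sin (t * x) - t * x) ∂μ := by
      rw [integral_sub isin ix, integral_const_mul, h.mean]; simp
    rw [him, e]
    calc |∫ x, (sin (t * x) - t * x) ∂μ| ≤ ∫ x, |sin (t * x) - t * x| ∂μ :=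
          abs_integral_le_integral_abs
      _ ≤ ∫ x, 2 * |t| ^ 3 * (x ^ 2 + x ^ 4) ∂μ := by
          refine integral_mono (isin.sub ix).abs ((i2.add i4).const_mul _) fun x => ?_
          show |sin (t * x) - t * x| ≤ 2 * |t| ^ 3 * (x ^ 2 + x ^ 4)
          refine (abs_sin_sub_le_cube _).trans ?_
          rw [abs_mul, mul_pow, ← mul_assoc]
          gcongr
          have e1 : x ^ 2 = |x| ^ 2 := (sq_abs x).symm
          have e2 : x ^ 4 = |x| ^ 4 := (Even.pow_abs (by decide) x).symm
          rw [e1, e2]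
          nlinarith [sq_nonneg (|x| * (1 - |x|)), pow_nonneg (abs_nonneg x) 3]
      _ = 2 * |t| ^ 3 * (1 + ∫ x, x ^ 4 ∂μ) := by
          rw [integral_const_mul, integral_add i2 i4, h.sq]
      _ ≤ 2 * |t| ^ 3 * (1 / b ^ 2 + 4 / b ^ 2) := by
          gcongr
          rw [le_div_iff₀ (by positivity)]
          nlinarith
      _ = _ := by ring
  -- The range of `t` is chosen so that the error terms eat at most half of `t² / 2`.
  have h4 : t ^ 4 * (2 / b ^ 2) + |t| ^ 3 * (10 / b ^ 2) ≤ t ^ 2 / 4 := by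
    have e1 : t ^ 2 = |t| ^ 2 := (sq_abs t).symm
    have e2 : t ^ 4 = |t| ^ 4 := (Even.pow_abs (by decide) t).symm
    rw [e1, e2]
    set a := |t|
    have ha : 0 ≤ a := abs_nonneg t
    have ha1 : a ≤ 1 := ht.trans (by nlinarith)
    have : a ^ 4 ≤ a ^ 3 := pow_le_pow_of_le_one ha ha1 (by norm_num)
    calc a ^ 4 * (2 / b ^ 2) + a ^ 3 * (10 / b ^ 2)
        ≤ a ^ 3 * (2 / b ^ 2) + a ^ 3 * (10 / b ^ 2) := by gcongr
      _ = a ^ 2 * (12 / b ^ 2) * a := by ring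
      _ ≤ a ^ 2 * (12 / b ^ 2) * (b ^ 2 / 48) := by gcongr
      _ = _ := by field_simp; ring
  calc ‖charFun μ t‖ ≤ |(charFun μ t).re| + |(charFun μ t).im| := Complex.norm_le_abs_re_add_abs_im _
    _ ≤ -(t ^ 2 / 4) + 1 := by linarith
    _ ≤ _ := add_one_le_exp _

lemma integral_exp_neg_sq_gaussian_le {a : ℝ} (ha : 0 < a) :
    ∫ z, exp (-a * z ^ 2) ∂(gaussianReal 0 1) ≤ 1 / √(2 * a) := by
  rw [integral_gaussianReal_eq_integral_smul one_ne_zero]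
  have i1 : Integrable (fun z : ℝ => (√(2 * π))⁻¹ * exp (-a * z ^ 2)) :=
    (integrable_exp_neg_mul_sq ha).const_mul _
  calc ∫ z, gaussianPDFReal 0 1 z • exp (-a * z ^ 2)
      ≤ ∫ z, (√(2 * π))⁻¹ * exp (-a * z ^ 2) := by
        refine integral_mono_of_nonneg (ae_of_all _ fun z => ?_) i1 (ae_of_all _ fun z => ?_)
        · exact mul_nonneg (gaussianPDFReal_nonneg _ _ _) (exp_pos _).le
        · show gaussianPDFReal 0 1 z * exp (-a * z ^ 2) ≤ _
          refine mul_le_mul_of_nonneg_right ?_ (exp_pos _).le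
          simp only [gaussianPDFReal, NNReal.coe_one, mul_one, sub_zero]
          refine mul_le_of_le_one_right (by positivity) (exp_le_one_iff.2 ?_)
          have : 0 ≤ z ^ 2 := sq_nonneg z
          rw [neg_div]
          linarith [div_nonneg this (by norm_num : (0 : ℝ) ≤ 2)]
    _ = (√(2 * π))⁻¹ * √(π / a) := by rw [integral_const_mul, integral_gaussian]
    _ = 1 / √(2 * a) := by
        rw [one_div, ← sqrt_inv, ← sqrt_inv, ← sqrt_mul (by positivity)]
        congr 1
        field_simp

/-- Averaging the characteristic function over a Gaussian frequency gives the Laplace transform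
of the square. -/
lemma integral_exp_neg_sq_le_charFun [IsProbabilityMeasure γ] (s : ℝ) :
    ∫ x, exp (-((s * x) ^ 2 / 2)) ∂γ ≤ ∫ z, ‖charFun γ (s * z)‖ ∂(gaussianReal 0 1) := by
  have h1 : ∀ x : ℝ, ((exp (-((s * x) ^ 2 / 2)) : ℝ) : ℂ) =
      ∫ z, Complex.exp (s * x * z * Complex.I) ∂(gaussianReal 0 1) := fun x => by
    have := charFun_gaussianReal (μ := 0) (v := 1) (s * x)
    rw [charFun_apply_real] at this
    push_cast at this
    rw [this]
    push_cast
    congr 1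
    simp
  have hint : Integrable (fun p : ℝ × ℝ => Complex.exp (s * p.1 * p.2 * Complex.I))
      (γ.prod (gaussianReal 0 1)) := by
    refine (integrable_const (1 : ℝ)).mono' (by fun_prop) (ae_of_all _ fun p => ?_)
    rw [← Complex.ofReal_mul, ← Complex.ofReal_mul, Complex.norm_exp_ofReal_mul_I]
  have h2 : ((∫ x, exp (-((s * x) ^ 2 / 2)) ∂γ : ℝ) : ℂ) =
      ∫ z, charFun γ (s * z) ∂(gaussianReal 0 1) := by
    rw [← integral_complex_ofReal]
    simp only [h1]
    rw [integral_integral_swap hint]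
    refine integral_congr_ae (ae_of_all _ fun z => ?_)
    simp only [charFun_apply_real]
    refine integral_congr_ae (ae_of_all _ fun x => ?_)
    simp only
    congr 1
    push_cast
    ring
  calc ∫ x, exp (-((s * x) ^ 2 / 2)) ∂γ ≤ ‖((∫ x, exp (-((s * x) ^ 2 / 2)) ∂γ : ℝ) : ℂ)‖ := by
        rw [Complex.norm_real]; exact le_abs_self _
    _ = ‖∫ z, charFun γ (s * z) ∂(gaussianReal 0 1)‖ := by rw [h2]
    _ ≤ _ := norm_integral_le_integral_norm _

/-- The energy `∑ xⱼ²` over the coordinates with `|xⱼ| ≤ δ`. -/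
noncomputable def tailEnergy (δ : ℝ) (x : Fin n → ℝ) : ℝ := ∑ j, if |x j| ≤ δ then x j ^ 2 else 0

lemma tailEnergy_nonneg (δ : ℝ) (x : Fin n → ℝ) : 0 ≤ tailEnergy δ x :=
  Finset.sum_nonneg fun j _ => by split_ifs <;> positivity

lemma measurable_tailEnergy (δ : ℝ) : Measurable (tailEnergy (n := n) δ) := by
  unfold tailEnergy
  refine Finset.measurable_fun_sum _ fun j _ => Measurable.ite ?_ (by fun_prop) measurable_const
  exact measurableSet_le (by fun_prop) measurable_const

lemma charFun_rowLaw [IsProbabilityMeasure μ] (x : Fin n → ℝ) (t : ℝ) :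
    charFun (rowLaw μ x) t = ∏ j, charFun μ (t * x j) := by
  rw [charFun_apply_real, rowLaw, integral_map (measurable_linForm x).aemeasurable (by fun_prop)]
  simp only [charFun_apply_real]
  rw [← integral_fintype_prod_eq_prod (𝕜 := ℂ)
    (fun j (a : ℝ) => Complex.exp (((t * x j : ℝ) : ℂ) * a * Complex.I))]
  refine integral_congr_ae (ae_of_all _ fun a => ?_)
  simp only
  rw [← Complex.exp_sum]
  congr 1
  push_cast
  rw [Finset.mul_sum, Finset.sum_mul]
  exact Finset.sum_congr rfl fun j _ => by ring

lemma norm_charFun_rowLaw_le (h : IsNormalizedSubgaussian b μ) (hb : 0 < b) (x : Fin n → ℝ)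
    {δ t : ℝ} (ht : |t| * δ ≤ b ^ 2 / 48) :
    ‖charFun (rowLaw μ x) t‖ ≤ exp (-(t ^ 2 * tailEnergy δ x / 4)) := by
  have := h.prob
  have e : -(t ^ 2 * tailEnergy δ x / 4) =
      ∑ j, -(t ^ 2 * (if |x j| ≤ δ then x j ^ 2 else 0) / 4) := by
    rw [tailEnergy, Finset.mul_sum, Finset.sum_div, Finset.sum_neg_distrib]
  rw [charFun_rowLaw, norm_prod, e, exp_sum]
  refine Finset.prod_le_prod (fun j _ => norm_nonneg _) fun j _ => ?_
  split_ifs with hj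
  · refine (norm_charFun_le h hb ?_).trans (le_of_eq ?_)
    · rw [abs_mul]
      exact le_trans (by gcongr) ht
    · rw [mul_pow]
  · simpa using norm_charFun_le_one (μ := μ) (t * x j)

/-- Small ball estimate in Laplace form: the linear form with coefficients `x` is spread out at
scale `√(tailEnergy δ x)`, down to resolution `δ`. -/
lemma laplace_sq_le (h : IsNormalizedSubgaussian b μ) (hb : 0 < b) (x : Fin n → ℝ)
    {δ l : ℝ} (hl : 0 < l) (hx : 0 < tailEnergy δ x) :
    ∫ g, exp (-l * g ^ 2) ∂(rowLaw μ x) ≤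
      1 / √(l * tailEnergy δ x) + 2 * l * δ ^ 2 * (48 / b ^ 2) ^ 2 := by
  have := h.prob
  set E := tailEnergy δ x
  set s := √(2 * l)
  have hs : s ^ 2 = 2 * l := sq_sqrt (by positivity)
  have h1 := integral_exp_neg_sq_le_charFun (γ := rowLaw μ x) s
  have e1 : ∀ g : ℝ, -((s * g) ^ 2 / 2) = -l * g ^ 2 := fun g => by rw [mul_pow, hs]; ring
  simp only [e1] at h1
  refine h1.trans ?_
  have hz2 : Integrable (fun z : ℝ => z ^ 2) (gaussianReal 0 1) := by
    simpa using (memLp_id_gaussianReal (μ := 0) (v := 1) 2).integrable_sq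
  have hv : ∫ z : ℝ, z ^ 2 ∂(gaussianReal 0 1) = 1 := by
    have := variance_fun_id_gaussianReal (μ := 0) (v := 1)
    rw [variance_eq_integral (by fun_prop)] at this
    simpa using this
  have i1 : Integrable (fun z : ℝ => exp (-(l * E / 2) * z ^ 2)) (gaussianReal 0 1) := by
    refine (integrable_const (1 : ℝ)).mono' (by fun_prop) (ae_of_all _ fun z => ?_)
    rw [norm_of_nonneg (exp_pos _).le, exp_le_one_iff]
    have : 0 ≤ l * E / 2 * z ^ 2 := by positivity
    linarith
  set K := 2 * l * δ ^ 2 * (48 / b ^ 2) ^ 2 with hK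
  -- At the frequencies beyond the reach of the Gaussian bound, the trivial bound one is at most `K
  -- z²`.
  have hpt : ∀ z : ℝ, ‖charFun (rowLaw μ x) (s * z)‖ ≤ exp (-(l * E / 2) * z ^ 2) + K * z ^ 2 := by
    intro z
    by_cases hz : |s * z| * δ ≤ b ^ 2 / 48
    · have h2 := norm_charFun_rowLaw_le h hb x hz
      have e2 : -((s * z) ^ 2 * tailEnergy δ x / 4) = -(l * E / 2) * z ^ 2 := by
        rw [mul_pow, hs]; ring
      rw [e2] at h2
      have : 0 ≤ K * z ^ 2 := by positivity
      linarith
    · push Not at hz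
      have h3 : (1 : ℝ) ≤ K * z ^ 2 := by
        have h4 : 1 ≤ |s * z| * δ * (48 / b ^ 2) := by
          calc (1 : ℝ) = b ^ 2 / 48 * (48 / b ^ 2) := by field_simp
            _ ≤ _ := by gcongr
        have h5 : K * z ^ 2 = (|s * z| * δ * (48 / b ^ 2)) ^ 2 := by
          rw [mul_pow, mul_pow, sq_abs, mul_pow, hs, hK]; ring
        rw [h5]
        exact one_le_pow₀ h4
      have := norm_charFun_le_one (μ := rowLaw μ x) (s * z)
      linarith [exp_pos (-(l * E / 2) * z ^ 2)]
  have hm : ∫ z, ‖charFun (rowLaw μ x) (s * z)‖ ∂(gaussianReal 0 1) ≤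
      ∫ z, (exp (-(l * E / 2) * z ^ 2) + K * z ^ 2) ∂(gaussianReal 0 1) :=
    integral_mono_of_nonneg (ae_of_all _ fun z => norm_nonneg _) (i1.add (hz2.const_mul K))
      (ae_of_all _ hpt)
  refine hm.trans ?_
  rw [integral_add i1 (hz2.const_mul K), integral_const_mul, hv, mul_one]
  have := integral_exp_neg_sq_gaussian_le (a := l * E / 2) (by positivity)
  rw [show 2 * (l * E / 2) = l * E by ring] at this
  linarith

end

/-! ### Degenerate images -/

section

variable {b : ℝ} {μ γ : Measure ℝ} {n : ℕ}

/-- Chernoff bound for the lower tail of the energy carried by the moderate coordinates of an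
iid vector. -/
lemma tailEnergy_lower_tail [IsProbabilityMeasure γ] {M l : ℝ} (hl : 0 ≤ l) (v : ℝ) :
    (Measure.pi fun _ : Fin n => γ).real {y | tailEnergy M y ≤ v * n} ≤
      (exp (l * v) * (∫ g, exp (-l * g ^ 2) ∂γ + γ.real {g | M ≤ |g|})) ^ n := by
  set f : ℝ → ℝ := fun g => exp (-l * if |g| ≤ M then g ^ 2 else 0) with hf
  have hite : Measurable fun g : ℝ => if |g| ≤ M then g ^ 2 else 0 :=
    Measurable.ite (measurableSet_le (by fun_prop) measurable_const) (by fun_prop) measurable_const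
  have hfm : Measurable f := by
    exact (hite.const_mul (-l)).exp
  have hbd : ∀ y : Fin n → ℝ, ‖exp (-l * tailEnergy M y)‖ ≤ 1 := fun y => by
    rw [norm_of_nonneg (exp_pos _).le, exp_le_one_iff]
    have := mul_nonneg hl (tailEnergy_nonneg M y)
    linarith
  have hint : Integrable (fun y : Fin n → ℝ => exp (-l * tailEnergy M y))
      (Measure.pi fun _ => γ) :=
    (integrable_const (1 : ℝ)).mono'
      ((measurable_tailEnergy M).const_mul (-l)).exp.aestronglyMeasurable (ae_of_all _ hbd)
  have h1 := measure_le_le_exp_mul_mgf (X := fun y : Fin n → ℝ => tailEnergy M y) (v * n)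
    (neg_nonpos.2 hl) hint
  have e1 : mgf (fun y : Fin n → ℝ => tailEnergy M y) (Measure.pi fun _ => γ) (-l) =
      (∫ g, f g ∂γ) ^ n := by
    rw [mgf]
    have := integral_fintype_prod_eq_pow (ι := Fin n) (𝕜 := ℝ) f (μ := γ)
    rw [Fintype.card_fin] at this
    rw [← this]
    refine integral_congr_ae (ae_of_all _ fun y => ?_)
    simp only [tailEnergy, hf]
    rw [Finset.mul_sum, exp_sum]
  rw [e1, neg_neg] at h1
  have e2 : exp (l * (v * n)) = exp (l * v) ^ n := by
    rw [← exp_nat_mul]; congr 1; ring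
  rw [e2, ← mul_pow] at h1
  refine h1.trans ?_
  have hms : MeasurableSet {g : ℝ | M ≤ |g|} := measurableSet_le measurable_const (by fun_prop)
  have i1 : Integrable (fun g : ℝ => exp (-l * g ^ 2)) γ := by
    refine (integrable_const (1 : ℝ)).mono' (by fun_prop) (ae_of_all _ fun z => ?_)
    rw [norm_of_nonneg (exp_pos _).le, exp_le_one_iff]
    have : 0 ≤ l * z ^ 2 := by positivity
    linarith
  have i2 : Integrable ({g : ℝ | M ≤ |g|}.indicator fun _ => (1 : ℝ)) γ :=
    (integrable_const (1 : ℝ)).indicator hms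
  have h2 : ∫ g, f g ∂γ ≤ ∫ g, exp (-l * g ^ 2) ∂γ + γ.real {g | M ≤ |g|} := by
    have e3 : γ.real {g | M ≤ |g|} = ∫ g, {g : ℝ | M ≤ |g|}.indicator (fun _ => (1 : ℝ)) g ∂γ := by
      rw [integral_indicator hms]; simp
    rw [e3, ← integral_add i1 i2]
    refine integral_mono_of_nonneg (ae_of_all _ fun g => (exp_pos _).le) (i1.add i2)
      (ae_of_all _ fun g => ?_)
    simp only [hf]
    split_ifs with h
    · have : 0 ≤ {g : ℝ | M ≤ |g|}.indicator (fun _ => (1 : ℝ)) g :=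
        Set.indicator_nonneg (fun _ _ => zero_le_one) _
      linarith
    · rw [Set.indicator_of_mem (show g ∈ {g : ℝ | M ≤ |g|} from (not_le.1 h).le)]
      simp only [mul_zero, exp_zero]
      linarith [exp_pos (-l * g ^ 2)]
  have h3 : 0 ≤ ∫ g, f g ∂γ := integral_nonneg fun g => (exp_pos _).le
  gcongr

lemma laplace_sq_le_exp (h : IsNormalizedSubgaussian b γ) (hb : 0 < b) {l : ℝ} (hl : 0 ≤ l)
    (hl2 : l ≤ b ^ 2 / 4) : ∫ g, exp (-l * g ^ 2) ∂γ ≤ exp (-(l / 2)) := by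
  have := h.prob
  have i2 := h.integrable_pow hb 2
  have i4 := h.integrable_pow hb 4
  have hM : ∫ x, x ^ 4 ∂γ ≤ 4 / b ^ 2 := by
    have := h.integral_pow_le hb 2
    norm_num [Nat.factorial] at this
    exact this
  have j1 : Integrable (fun g : ℝ => 1 - l * g ^ 2) γ := (integrable_const _).sub (i2.const_mul _)
  calc ∫ g, exp (-l * g ^ 2) ∂γ ≤ ∫ g, (1 - l * g ^ 2 + l ^ 2 / 2 * g ^ 4) ∂γ := by
        refine integral_mono_of_nonneg (ae_of_all _ fun g => (exp_pos _).le)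
          (j1.add (i4.const_mul _)) (ae_of_all _ fun g => ?_)
        show exp (-l * g ^ 2) ≤ 1 - l * g ^ 2 + l ^ 2 / 2 * g ^ 4
        have hz : 0 ≤ l * g ^ 2 := by positivity
        have hq := quadratic_le_exp_of_nonneg hz
        have e1 : exp (-l * g ^ 2) * exp (l * g ^ 2) = 1 := by rw [← exp_add]; simp
        have e2 : 1 - l * g ^ 2 + l ^ 2 / 2 * g ^ 4 =
            1 - l * g ^ 2 + (l * g ^ 2) ^ 2 / 2 := by ring
        rw [e2]
        have e3 : -l * g ^ 2 = -(l * g ^ 2) := by ring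
        rw [e3] at e1 ⊢
        generalize l * g ^ 2 = z at *
        have h3 : 0 ≤ 1 - z + z ^ 2 / 2 := by nlinarith [sq_nonneg (z - 1)]
        have h4 : 1 ≤ (1 - z + z ^ 2 / 2) * (1 + z + z ^ 2 / 2) := by nlinarith [sq_nonneg (z ^ 2)]
        have h5 : 1 ≤ (1 - z + z ^ 2 / 2) * exp z := h4.trans (by gcongr)
        have h6 := exp_pos z
        exact le_of_mul_le_mul_right (e1.le.trans h5) h6
    _ = 1 - l + l ^ 2 / 2 * ∫ x, x ^ 4 ∂γ := by
        rw [integral_add j1 (i4.const_mul _), integral_sub (integrable_const _) (i2.const_mul _),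
          integral_const_mul, integral_const_mul, h.sq]
        simp
    _ ≤ 1 - l + l ^ 2 / 2 * (4 / b ^ 2) := by gcongr
    _ = 1 - l + l * (l * (2 / b ^ 2)) := by ring
    _ ≤ 1 - l + l * (b ^ 2 / 4 * (2 / b ^ 2)) := by gcongr
    _ = 1 - l + l * (1 / 2) := by field_simp; ring
    _ ≤ _ := by
        have := add_one_le_exp (-(l / 2))
        linarith

/-- The direction `y / ‖y‖` of a vector (zero for `y = 0`). -/
noncomputable def dir (y : Fin n → ℝ) : Fin n → ℝ := fun i => y i / √(∑ i, y i ^ 2)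

lemma measurable_dir : Measurable (dir (n := n)) := by
  unfold dir
  fun_prop

lemma sum_dir_sq {y : Fin n → ℝ} (hy : 0 < ∑ i, y i ^ 2) : ∑ i, dir y i ^ 2 = 1 := by
  simp only [dir, div_pow, sq_sqrt hy.le]
  rw [← Finset.sum_div, div_self hy.ne']

lemma tailEnergy_le_sum (δ : ℝ) (y : Fin n → ℝ) : tailEnergy δ y ≤ ∑ i, y i ^ 2 := by
  refine Finset.sum_le_sum fun i _ => ?_
  split_ifs
  · exact le_rfl
  · positivity

lemma tailEnergy_le_mul_dir {δ M : ℝ} {y : Fin n → ℝ} (hy : 0 < ∑ i, y i ^ 2)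
    (hM : M ≤ δ * √(∑ i, y i ^ 2)) :
    tailEnergy M y ≤ (∑ i, y i ^ 2) * tailEnergy δ (dir y) := by
  have hs : 0 < √(∑ i, y i ^ 2) := sqrt_pos.2 hy
  unfold tailEnergy
  rw [Finset.mul_sum]
  refine Finset.sum_le_sum fun i _ => ?_
  split_ifs with h1 h2 h2
  · rw [dir, div_pow, sq_sqrt hy.le, mul_div_cancel₀ _ hy.ne']
  · refine absurd ?_ h2
    rw [dir, abs_div, abs_of_pos hs, div_le_iff₀ hs]
    exact h1.trans hM
  · rw [dir, div_pow, sq_sqrt hy.le, mul_div_cancel₀ _ hy.ne']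
    positivity
  · simp

/-- The vectors that are either much shorter than `√n` or whose direction has energy less
than `q` in its small coordinates. -/
def degenerate (n : ℕ) (c q : ℝ) : Set (Fin n → ℝ) :=
  {y | ∑ i, y i ^ 2 < (n : ℝ) ^ (-(c / 2)) * n ∨ tailEnergy ((n : ℝ) ^ (-c)) (dir y) < q}

lemma measurableSet_degenerate (n : ℕ) (c q : ℝ) : MeasurableSet (degenerate n c q) :=
  (measurableSet_lt (f := fun y : Fin n → ℝ => ∑ i, y i ^ 2) (by fun_prop) measurable_const).union
    (measurableSet_lt ((measurable_tailEnergy _).comp measurable_dir) measurable_const)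

lemma degenerate_subset {c q T : ℝ} (hn : 0 < n) (hc : c ≤ 1 / 5) (hT : 1 ≤ T)
    (hq : (n : ℝ) ^ (-(c / 2)) ≤ q) :
    degenerate n c q ⊆ {y | tailEnergy ((n : ℝ) ^ (1 / 4 : ℝ)) y ≤ q * T * n} ∪
      {y | T - 1 ≤ |sqErr y|} := by
  intro y hy
  have hn' : (0 : ℝ) < n := by positivity
  have hn1 : (1 : ℝ) ≤ n := by exact_mod_cast hn
  have hq0 : 0 < q := lt_of_lt_of_le (by positivity) hq
  by_cases hT2 : T * n < ∑ i, y i ^ 2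
  · right
    show T - 1 ≤ |sqErr y|
    refine le_trans ?_ (le_abs_self _)
    rw [sqErr]
    have : T < (∑ i, y i ^ 2) / n := by rwa [lt_div_iff₀ hn']
    linarith
  · left
    push Not at hT2
    show tailEnergy _ y ≤ q * T * n
    by_cases h0 : ∑ i, y i ^ 2 < (n : ℝ) ^ (-(c / 2)) * n
    · refine (tailEnergy_le_sum _ y).trans (h0.le.trans ?_)
      calc (n : ℝ) ^ (-(c / 2)) * n ≤ q * n := by gcongr
        _ ≤ q * T * n := by gcongr; nlinarith
    · have h2 : tailEnergy ((n : ℝ) ^ (-c)) (dir y) < q := hy.resolve_left h0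
      push Not at h0
      have hpos : 0 < ∑ i, y i ^ 2 := lt_of_lt_of_le (by positivity) h0
      -- Here `c ≤ 1 / 5` is used: a coordinate of `y` of size `n^(1/4)` is small relative to `‖y‖`.
      have hM : (n : ℝ) ^ (1 / 4 : ℝ) ≤ (n : ℝ) ^ (-c) * √(∑ i, y i ^ 2) := by
        calc (n : ℝ) ^ (1 / 4 : ℝ) ≤ (n : ℝ) ^ (-c + (1 - c / 2) / 2) :=
              rpow_le_rpow_of_exponent_le hn1 (by linarith)
          _ = (n : ℝ) ^ (-c) * √((n : ℝ) ^ (-(c / 2)) * n) := by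
              rw [rpow_add hn']
              congr 1
              rw [sqrt_eq_rpow, ← rpow_add_one hn'.ne', ← rpow_mul hn'.le]
              congr 1; ring
          _ ≤ _ := by gcongr
      calc tailEnergy _ y ≤ (∑ i, y i ^ 2) * tailEnergy ((n : ℝ) ^ (-c)) (dir y) :=
            tailEnergy_le_mul_dir hpos hM
        _ ≤ (T * n) * q := by
            gcongr
            exact tailEnergy_nonneg _ _
        _ = _ := by ring

/-- Probability that one step produces a degenerate vector, before the parameters `T` and `l`
are chosen. -/
lemma degenerate_prob_le (h : IsNormalizedSubgaussian b γ) (hb : 0 < b) {c q T l : ℝ} (hn : 0 < n)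
    (hc : c ≤ 1 / 5) (hT : 1 ≤ T) (hq : (n : ℝ) ^ (-(c / 2)) ≤ q) (hl : 0 ≤ l) :
    (Measure.pi fun _ : Fin n => γ).real (degenerate n c q) ≤
      (exp (l * (q * T)) * (∫ g, exp (-l * g ^ 2) ∂γ +
        γ.real {g | (n : ℝ) ^ (1 / 4 : ℝ) ≤ |g|})) ^ n +
      2 * exp (-(bernsteinConst b * n * min ((T - 1) ^ 2) (T - 1))) := by
  have := h.prob
  refine (measureReal_mono (degenerate_subset hn hc hT hq)).trans
    ((measureReal_union_le _ _).trans (add_le_add ?_ ?_))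
  · exact tailEnergy_lower_tail hl _
  · exact sqErr_tail h hb hn (by linarith)

end

section

variable {b : ℝ} {μ γ : Measure ℝ} {n : ℕ}

lemma IsNormalizedSubgaussian.tail_le (h : IsNormalizedSubgaussian b γ) (hb : 0 < b) {M : ℝ}
    (hM : 0 ≤ M) : γ.real {g | M ≤ |g|} ≤ 2 * exp (-(b * M ^ 2)) := by
  have := h.prob
  have h1 := mul_meas_ge_le_integral_of_nonneg (μ := γ) (f := fun x => exp (b * x ^ 2))
    (ae_of_all _ fun x => (exp_pos _).le) h.int_exp (exp (b * M ^ 2))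
  have h2 : γ.real {g | M ≤ |g|} ≤ γ.real {x | exp (b * M ^ 2) ≤ exp (b * x ^ 2)} := by
    refine measureReal_mono fun g hg => ?_
    have : M ≤ |g| := hg
    show exp (b * M ^ 2) ≤ exp (b * g ^ 2)
    rw [← sq_abs g]
    gcongr
  rw [exp_neg, ← div_eq_mul_inv, le_div_iff₀ (exp_pos _)]
  calc _ = exp (b * M ^ 2) * γ.real {g | M ≤ |g|} := mul_comm _ _
    _ ≤ exp (b * M ^ 2) * γ.real {x | exp (b * M ^ 2) ≤ exp (b * x ^ 2)} := by gcongr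
    _ ≤ _ := h1.trans h.exp_le

lemma tendsto_natCast_rpow_neg {a : ℝ} (ha : 0 < a) :
    Tendsto (fun n : ℕ => (n : ℝ) ^ (-a)) atTop (𝓝 0) :=
  (tendsto_rpow_neg_atTop ha).comp tendsto_natCast_atTop_atTop

lemma tendsto_natCast_rpow {a : ℝ} (ha : 0 < a) :
    Tendsto (fun n : ℕ => (n : ℝ) ^ a) atTop atTop :=
  (tendsto_rpow_atTop ha).comp tendsto_natCast_atTop_atTop

/-- Stretched exponentials beat powers. -/
lemma tendsto_rpow_mul_exp_neg_rpow {k a s : ℝ} (hk : 0 < k) (ha : 0 < a) :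
    Tendsto (fun n : ℕ => (n : ℝ) ^ s * exp (-(k * (n : ℝ) ^ a))) atTop (𝓝 0) := by
  have h1 := (tendsto_rpow_mul_exp_neg_mul_atTop_nhds_zero (s / a) k hk).comp
    (tendsto_natCast_rpow ha)
  refine h1.congr fun n => ?_
  simp only [Function.comp_apply]
  rw [← rpow_mul (Nat.cast_nonneg n), mul_div_cancel₀ _ ha.ne', neg_mul]

lemma tail_quarter_le (h : IsNormalizedSubgaussian b γ) (hb : 0 < b) :
    γ.real {g | (n : ℝ) ^ (1 / 4 : ℝ) ≤ |g|} ≤ 2 * exp (-(b * (n : ℝ) ^ (1 / 2 : ℝ))) := by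
  refine (h.tail_le hb (by positivity)).trans (le_of_eq ?_)
  rw [← rpow_natCast, ← rpow_mul (Nat.cast_nonneg n)]
  norm_num

/-- Whatever the current direction is, one step is degenerate at a fixed level with exponentially
small probability. -/
lemma degenerate_prob_exp {c : ℝ} (hb : 0 < b) (hc : c ≤ 1 / 5) :
    ∃ k > 0, ∀ᶠ n : ℕ in atTop, ∀ γ : Measure ℝ, IsNormalizedSubgaussian b γ →
      ∀ q : ℝ, (n : ℝ) ^ (-(c / 2)) ≤ q → q ≤ 1 / 32 →
        (Measure.pi fun _ : Fin n => γ).real (degenerate n c q) ≤ 3 * exp (-(k * n)) := by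
  have hB := bernsteinConst_pos hb
  set l := b ^ 2 / 4 with hl
  have hl0 : 0 < l := by positivity
  have hd : 0 < exp (-(l / 8)) * (exp (-(l / 4)) - exp (-(3 * l / 8))) :=
    mul_pos (exp_pos _) (sub_pos.2 (exp_lt_exp.2 (by linarith)))
  have ht := (tendsto_rpow_mul_exp_neg_rpow (s := 0) hb (by norm_num : (0 : ℝ) < 1 / 2)).const_mul 2
  rw [mul_zero] at ht
  refine ⟨min (l / 4) (3 * bernsteinConst b), by positivity, ?_⟩
  filter_upwards [ht.eventually_le_const hd, eventually_gt_atTop 0] with n hτ hn γ h q hq hq2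
  rw [rpow_zero, one_mul] at hτ
  have hn' : (0 : ℝ) < n := by positivity
  -- With `q ≤ 1 / 32` and `T = 4` the Chernoff factor `exp (l / 8)` is beaten by the Laplace
  -- transform `exp (-l / 2)`.
  have h1 := degenerate_prob_le h hb hn hc (T := 4) (by norm_num) hq hl0.le
  have hq0 : 0 < q := lt_of_lt_of_le (by positivity) hq
  have h2 : exp (l * (q * 4)) * (∫ g, exp (-l * g ^ 2) ∂γ +
      γ.real {g | (n : ℝ) ^ (1 / 4 : ℝ) ≤ |g|}) ≤ exp (-(l / 4)) := by
    calc _ ≤ exp (l / 8) * (exp (-(l / 2)) +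
          exp (-(l / 8)) * (exp (-(l / 4)) - exp (-(3 * l / 8)))) := by
          gcongr
          · nlinarith
          · exact laplace_sq_le_exp h hb hl0.le le_rfl
          · exact (tail_quarter_le h hb).trans hτ
      _ = exp (l / 8) * exp (-(l / 2)) + exp (l / 8) * exp (-(l / 8)) *
          (exp (-(l / 4)) - exp (-(3 * l / 8))) := by ring
      _ = _ := by
        rw [← exp_add, ← exp_add, show l / 8 + -(l / 2) = -(3 * l / 8) by ring,
          show l / 8 + -(l / 8) = 0 by ring, exp_zero]
        ring
  have h3 : min ((4 - 1 : ℝ) ^ 2) (4 - 1) = 3 := by norm_num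
  rw [h3] at h1
  have hk1 : exp (-(l / 4)) ^ n ≤ exp (-(min (l / 4) (3 * bernsteinConst b) * n)) := by
    rw [← exp_nat_mul, exp_le_exp]
    have := mul_le_mul_of_nonneg_right (min_le_left (l / 4) (3 * bernsteinConst b)) hn'.le
    linarith
  have hk2 : exp (-(bernsteinConst b * n * 3)) ≤
      exp (-(min (l / 4) (3 * bernsteinConst b) * n)) := by
    rw [exp_le_exp]
    have := mul_le_mul_of_nonneg_right (min_le_right (l / 4) (3 * bernsteinConst b)) hn'.le
    linarith
  have h4 : 0 ≤ exp (l * (q * 4)) * (∫ g, exp (-l * g ^ 2) ∂γ +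
      γ.real {g | (n : ℝ) ^ (1 / 4 : ℝ) ≤ |g|}) :=
    mul_nonneg (exp_pos _).le
      (add_nonneg (integral_nonneg fun g => (exp_pos _).le) measureReal_nonneg)
  have h5 := pow_le_pow_left₀ h4 h2 n
  linarith

/-- If the current direction has energy `e` in its small coordinates, then energy
`q = θ⁴ e` is reached with super-exponentially small probability `(C θ)ⁿ`. -/
lemma degenerate_prob_pow {c : ℝ} (hb : 0 < b) (hc0 : 0 < c) (hc : c ≤ 1 / 5) :
    ∃ C ≥ 1, ∀ᶠ n : ℕ in atTop, ∀ μ : Measure ℝ, IsNormalizedSubgaussian b μ →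
      ∀ x : Fin n → ℝ, ∑ j, x j ^ 2 = 1 →
      ∀ θ : ℝ, 0 < θ → θ ≤ 1 / 2 →
        (n : ℝ) ^ (-(c / 2)) ≤ θ ^ 4 * tailEnergy ((n : ℝ) ^ (-c)) x →
        (Measure.pi fun _ : Fin n => rowLaw μ x).real
          (degenerate n c (θ ^ 4 * tailEnergy ((n : ℝ) ^ (-c)) x)) ≤ 3 * (C * θ) ^ n := by
  have hb16 : 0 < b / 16 := by positivity
  have hB := bernsteinConst_pos hb16
  set B := bernsteinConst (b / 16) with hBdef
  set D := 2 * (48 / b ^ 2) ^ 2 with hD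
  have hD0 : 0 < D := by positivity
  refine ⟨3 * exp 1 + 2 / B, ?_, ?_⟩
  · have := add_one_le_exp (1 : ℝ)
    have : 0 < 2 / B := by positivity
    linarith
  have ht := (tendsto_rpow_mul_exp_neg_rpow (s := c / 8) hb16
    (by norm_num : (0 : ℝ) < 1 / 2)).const_mul 2
  have ht2 := (tendsto_natCast_rpow_neg (a := 3 * c / 2) (by positivity)).const_mul D
  rw [mul_zero] at ht ht2
  filter_upwards [ht.eventually_le_const zero_lt_one, ht2.eventually_le_const zero_lt_one,
    eventually_gt_atTop 0] with n hτ hδ hn μ hμ x hx θ hθ hθ2 hq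
  have := hμ.prob
  have hn' : (0 : ℝ) < n := by positivity
  set e := tailEnergy ((n : ℝ) ^ (-c)) x with he
  have he1 : e ≤ 1 := hx ▸ tailEnergy_le_sum _ x
  set q := θ ^ 4 * e with hqdef
  have hq0 : 0 < q := lt_of_lt_of_le (by positivity) hq
  have he0 : 0 < e := by
    rcases (tailEnergy_nonneg ((n : ℝ) ^ (-c)) x).eq_or_lt with h0 | h0
    · rw [← he] at h0; rw [hqdef, ← h0] at hq0; simp at hq0
    · exact h0
  have hrow := rowLaw_isNormalizedSubgaussian hμ hb hx
  -- These choices make the Chernoff factor `exp (l q T)` equal to `e`, and the Laplace transform of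
  -- the square of order `θ`.
  set T := 1 / θ ^ 2 with hT
  have hT4 : 4 ≤ T := by
    rw [hT, le_div_iff₀ (by positivity)]; nlinarith
  set l := θ ^ 2 / q with hl
  have hl0 : 0 < l := by positivity
  have h1 := degenerate_prob_le hrow hb16 hn hc (T := T) (by linarith) hq hl0.le
  have e1 : l * (q * T) = 1 := by rw [hl, hT]; field_simp
  have h2 := laplace_sq_le hμ hb x hl0 he0 (δ := (n : ℝ) ^ (-c))
  have e2 : 1 / √(l * tailEnergy ((n : ℝ) ^ (-c)) x) = θ := by
    have : l * e = (1 / θ) ^ 2 := by rw [hl, hqdef]; field_simp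
    rw [← he, this, sqrt_sq (by positivity), one_div_one_div]
  -- The resolution `n^(-c)` is negligible, because `q ≥ n^(-c/2)`.
  have h3 : 2 * l * ((n : ℝ) ^ (-c)) ^ 2 * (48 / b ^ 2) ^ 2 ≤ θ := by
    have e3 : ((n : ℝ) ^ (-c)) ^ 2 = (n : ℝ) ^ (-(3 * c / 2)) * (n : ℝ) ^ (-(c / 2)) := by
      rw [← rpow_natCast, ← rpow_mul hn'.le, ← rpow_add hn']
      congr 1; push_cast; ring
    rw [e3, hl]
    calc _ = θ * (D * (n : ℝ) ^ (-(3 * c / 2))) * θ * ((n : ℝ) ^ (-(c / 2)) / q) := by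
          rw [hD]; ring
      _ ≤ θ * 1 * 1 * 1 := by
          gcongr
          · linarith
          · exact (div_le_one hq0).2 hq
      _ = θ := by ring
  have h4 : (rowLaw μ x).real {g | (n : ℝ) ^ (1 / 4 : ℝ) ≤ |g|} ≤ θ := by
    refine (tail_quarter_le hrow hb16).trans ?_
    have h5 : (n : ℝ) ^ (-(c / 8)) ≤ θ := by
      have h6 : (n : ℝ) ^ (-(c / 2)) ≤ θ ^ 4 := hq.trans (by
        calc q = θ ^ 4 * e := rfl
          _ ≤ θ ^ 4 * 1 := by gcongr
          _ = _ := mul_one _)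
      have h7 : ((n : ℝ) ^ (-(c / 8))) ^ 4 = (n : ℝ) ^ (-(c / 2)) := by
        rw [← rpow_natCast, ← rpow_mul hn'.le]; congr 1; push_cast; ring
      rw [← h7] at h6
      exact le_of_pow_le_pow_left₀ (by norm_num) hθ.le h6
    refine le_trans ?_ h5
    rw [rpow_neg hn'.le, ← one_div, le_div_iff₀ (by positivity)]
    calc _ = 2 * ((n : ℝ) ^ (c / 8) * exp (-(b / 16 * (n : ℝ) ^ (1 / 2 : ℝ)))) := by ring
      _ ≤ 1 := hτ
  have h5 : exp (l * (q * T)) * (∫ g, exp (-l * g ^ 2) ∂(rowLaw μ x) +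
      (rowLaw μ x).real {g | (n : ℝ) ^ (1 / 4 : ℝ) ≤ |g|}) ≤ (3 * exp 1 + 2 / B) * θ := by
    rw [e1]
    rw [e2] at h2
    calc _ ≤ exp 1 * (θ + θ + θ) := by gcongr; linarith
      _ = (3 * exp 1 + 0) * θ := by ring
      _ ≤ _ := by gcongr; positivity
  have h6 : exp (-(B * n * min ((T - 1) ^ 2) (T - 1))) ≤ ((3 * exp 1 + 2 / B) * θ) ^ n := by
    have hmin : T / 2 ≤ min ((T - 1) ^ 2) (T - 1) := le_min (by nlinarith) (by linarith)
    have h7 : exp (-(B * (T / 2))) ≤ 2 / B * θ := by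
      have hz : 0 < B * (T / 2) := by positivity
      have h8 : B * (T / 2) ≤ exp (B * (T / 2)) := by linarith [add_one_le_exp (B * (T / 2))]
      calc exp (-(B * (T / 2))) = 1 / exp (B * (T / 2)) := by rw [exp_neg, one_div]
        _ ≤ 1 / (B * (T / 2)) := by gcongr
        _ = 2 / B * θ * θ := by rw [hT]; field_simp
        _ ≤ 2 / B * θ * 1 := by gcongr; linarith
        _ = _ := mul_one _
    calc exp (-(B * n * min ((T - 1) ^ 2) (T - 1))) ≤ exp (-(B * n * (T / 2))) := by gcongr
      _ = exp (-(B * (T / 2))) ^ n := by rw [← exp_nat_mul]; congr 1; ring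
      _ ≤ (2 / B * θ) ^ n := by gcongr
      _ ≤ _ := by gcongr; linarith [exp_pos (1 : ℝ)]
  have h7 : 0 ≤ exp (l * (q * T)) * (∫ g, exp (-l * g ^ 2) ∂(rowLaw μ x) +
      (rowLaw μ x).real {g | (n : ℝ) ^ (1 / 4 : ℝ) ≤ |g|}) :=
    mul_nonneg (exp_pos _).le
      (add_nonneg (integral_nonneg fun g => (exp_pos _).le) measureReal_nonneg)
  have h8 := pow_le_pow_left₀ h7 h5 n
  linarith

/-- The two regimes combined: one step contracts the energy by a factor `q / e` with probability
at most a small multiple of a power `(q / 2e)^(ηn)`. -/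
lemma degenerate_prob_le_rpow {c : ℝ} (hb : 0 < b) (hc0 : 0 < c) (hc : c ≤ 1 / 5) :
    ∃ k > 0, ∃ η > (0 : ℝ), ∀ᶠ n : ℕ in atTop, ∀ μ : Measure ℝ, IsNormalizedSubgaussian b μ →
      ∀ x : Fin n → ℝ, ∑ j, x j ^ 2 = 1 →
      (n : ℝ) ^ (-(c / 2)) ≤ tailEnergy ((n : ℝ) ^ (-c)) x →
      ∀ q : ℝ, (n : ℝ) ^ (-(c / 2)) ≤ q → q ≤ 1 / 32 →
        (Measure.pi fun _ : Fin n => rowLaw μ x).real (degenerate n c q) ≤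
          3 * exp (-(k * n)) * (q / (2 * tailEnergy ((n : ℝ) ^ (-c)) x)) ^ (η * n) := by
  obtain ⟨k₁, hk₁, h1⟩ := degenerate_prob_exp (b := b / 16) (by positivity) hc
  obtain ⟨C, hC, h2⟩ := degenerate_prob_pow hb hc0 hc
  -- At contraction factors above `θ₀⁴` the exponential bound is used, below it the power `(C θ)ⁿ`;
  -- the exponent `η` is small enough for the former to dominate the power at the threshold.
  set θ₀ := min (1 / 2) ((1 / (2 * exp 1 * C)) ^ 2) with hθ₀
  have hθ₀pos : 0 < θ₀ := by positivity
  have hθ₀half : θ₀ ≤ 1 / 2 := min_le_left _ _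
  have hlog : 0 < log (2 / θ₀ ^ 4) := by
    refine log_pos ?_
    rw [lt_div_iff₀ (by positivity)]
    have : θ₀ ^ 4 ≤ (1 / 2) ^ 4 := by gcongr
    norm_num at this ⊢
    linarith
  set η := min (1 / 8) (k₁ / (2 * log (2 / θ₀ ^ 4))) with hη
  have hηpos : 0 < η := by positivity
  refine ⟨min (k₁ / 2) 1, by positivity, η, hηpos, ?_⟩
  filter_upwards [h1, h2, eventually_gt_atTop 0] with n h1 h2 hn μ hμ x hx hex q hq hq2
  have hn' : (0 : ℝ) < n := by positivity
  set e := tailEnergy ((n : ℝ) ^ (-c)) x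
  have he0 : 0 < e := lt_of_lt_of_le (by positivity) hex
  have hq0 : 0 < q := lt_of_lt_of_le (by positivity) hq
  by_cases hcase : θ₀ ^ 4 * e ≤ q
  · refine (h1 _ (rowLaw_isNormalizedSubgaussian hμ hb hx) q hq hq2).trans ?_
    rw [mul_assoc]
    gcongr
    have h3 : exp (-(k₁ / 2 * n)) ≤ (q / (2 * e)) ^ (η * n) := by
      calc exp (-(k₁ / 2 * n)) ≤ exp (log (θ₀ ^ 4 / 2) * (η * n)) := by
            rw [exp_le_exp]
            have e1 : log (θ₀ ^ 4 / 2) = - log (2 / θ₀ ^ 4) := by rw [← log_inv, inv_div]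
            rw [e1]
            have h4 : log (2 / θ₀ ^ 4) * η ≤ k₁ / 2 := by
              calc log (2 / θ₀ ^ 4) * η ≤ log (2 / θ₀ ^ 4) * (k₁ / (2 * log (2 / θ₀ ^ 4))) := by
                    gcongr; exact min_le_right _ _
                _ = k₁ / 2 := by field_simp
            nlinarith
        _ = (θ₀ ^ 4 / 2) ^ (η * n) := by rw [rpow_def_of_pos (by positivity)]
        _ ≤ _ := by
            refine rpow_le_rpow (by positivity) ?_ (by positivity)
            rw [le_div_iff₀ (by positivity)]
            linarith
    calc exp (-(k₁ * n)) = exp (-(k₁ / 2 * n)) * exp (-(k₁ / 2 * n)) := by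
          rw [← exp_add]; congr 1; ring
      _ ≤ exp (-(min (k₁ / 2) 1 * n)) * (q / (2 * e)) ^ (η * n) := by
          gcongr
          exact min_le_left _ _
  · push Not at hcase
    set θ := (q / e) ^ (1 / 4 : ℝ) with hθ
    have hθpos : 0 < θ := by positivity
    have hθ4 : θ ^ 4 = q / e := by
      rw [hθ, ← rpow_natCast, ← rpow_mul (by positivity)]; norm_num
    have hθle : θ ≤ θ₀ := by
      have : θ ^ 4 ≤ θ₀ ^ 4 := by rw [hθ4, div_le_iff₀ he0]; exact hcase.le
      exact le_of_pow_le_pow_left₀ (by norm_num) hθ₀pos.le this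
    have hθe : θ ^ 4 * e = q := by rw [hθ4]; field_simp
    have h3 := h2 μ hμ x hx θ hθpos (hθle.trans hθ₀half) (by rw [hθe]; exact hq)
    rw [hθe] at h3
    refine h3.trans ?_
    rw [mul_assoc]
    gcongr
    -- Half of the power of `θ` absorbs the constant `C`, the other half gives the bound.
    have hs : 0 < √θ := sqrt_pos.2 hθpos
    have hss : √θ ^ 2 = θ := sq_sqrt hθpos.le
    have h4 : 2 * C * √θ ≤ exp (-1) := by
      have h5 : √θ ≤ 1 / (2 * exp 1 * C) := by
        rw [sqrt_le_left (by positivity)]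
        exact hθle.trans (min_le_right _ _)
      calc 2 * C * √θ ≤ 2 * C * (1 / (2 * exp 1 * C)) := by gcongr
        _ = exp (-1) := by rw [exp_neg]; field_simp
    have h5 : (√θ / 2) ^ n ≤ (q / (2 * e)) ^ (η * n) := by
      have e3 : q / (2 * e) = θ ^ 4 / 2 := by rw [hθ4]; field_simp
      have hle1 : θ ^ 4 / 2 ≤ 1 := by
        have : θ ^ 4 ≤ 1 := pow_le_one₀ hθpos.le (by linarith)
        linarith
      have h6 : √θ / 2 ≤ (θ ^ 4 / 2) ^ (1 / 8 : ℝ) := by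
        have e4 : ((√θ / 2) ^ 8) ^ (1 / 8 : ℝ) = √θ / 2 := by
          rw [← rpow_natCast, ← rpow_mul (by positivity)]; norm_num
        rw [← e4]
        gcongr
        rw [div_pow, show √θ ^ 8 = (√θ ^ 2) ^ 4 by ring, hss]
        gcongr
        norm_num
      calc (√θ / 2) ^ n ≤ ((θ ^ 4 / 2) ^ (1 / 8 : ℝ)) ^ n := by gcongr
        _ = (θ ^ 4 / 2) ^ (1 / 8 * (n : ℝ)) := by
            rw [← rpow_natCast, ← rpow_mul (by positivity)]
        _ ≤ (θ ^ 4 / 2) ^ (η * n) := by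
            refine rpow_le_rpow_of_exponent_ge (by positivity) hle1 ?_
            gcongr
            exact min_le_left _ _
        _ = _ := by rw [e3]
    calc (C * θ) ^ n = (2 * C * √θ) ^ n * (√θ / 2) ^ n := by
          rw [← mul_pow]; congr 1
          calc C * θ = C * √θ ^ 2 := by rw [hss]
            _ = _ := by ring
      _ ≤ exp (-1) ^ n * (q / (2 * e)) ^ (η * n) := by gcongr
      _ ≤ exp (-(min (k₁ / 2) 1 * n)) * (q / (2 * e)) ^ (η * n) := by
          gcongr
          rw [← exp_nat_mul, exp_le_exp]
          have := mul_le_mul_of_nonneg_right (min_le_right (k₁ / 2) 1) hn'.le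
          linarith

end

/-! ### A Lyapunov function for the directions -/

section

variable {b : ℝ} {μ γ : Measure ℝ} {n : ℕ}

/-- The next direction of the chain: the direction of `y`, except that the chain restarts at `x₀`
when `y` is degenerate. -/
noncomputable def advance (c : ℝ) (x₀ y : Fin n → ℝ) : Fin n → ℝ :=
  open Classical in if y ∈ degenerate n c ((n : ℝ) ^ (-(c / 2))) then x₀ else dir y

lemma measurable_advance (c : ℝ) (x₀ : Fin n → ℝ) : Measurable (advance c x₀) := by
  classical
  exact Measurable.ite (measurableSet_degenerate _ _ _) measurable_const measurable_dir

/-- The directions visited by the chain: unit vectors with a minimal energy in their small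
coordinates. -/
def Admissible (c : ℝ) (x : Fin n → ℝ) : Prop :=
  ∑ j, x j ^ 2 = 1 ∧ (n : ℝ) ^ (-(c / 2)) ≤ tailEnergy ((n : ℝ) ^ (-c)) x

lemma sum_sq_pos_of_notMem_degenerate (hn : 0 < n) {c q : ℝ} {y : Fin n → ℝ}
    (hy : y ∉ degenerate n c q) : 0 < ∑ i, y i ^ 2 := by
  have : (0 : ℝ) < n := by positivity
  have h1 : ¬ (∑ i, y i ^ 2 < (n : ℝ) ^ (-(c / 2)) * n) := fun h => hy (Or.inl h)
  exact lt_of_lt_of_le (by positivity) (not_lt.1 h1)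

lemma admissible_advance (hn : 0 < n) {c : ℝ} {x₀ : Fin n → ℝ} (h0 : Admissible c x₀)
    (y : Fin n → ℝ) : Admissible c (advance c x₀ y) := by
  unfold advance
  split_ifs with h
  · exact h0
  · exact ⟨sum_dir_sq (sum_sq_pos_of_notMem_degenerate hn h), not_lt.1 fun h' => h (Or.inr h')⟩

/-- A level of the dyadic decomposition of the range of the energy. -/
lemma exists_dyadic_level {E : ℝ} (hE : 0 < E) (hE2 : E < 1 / 32) :
    ∃ j : ℕ, 1 / 32 * (1 / 2) ^ j / 2 ≤ E ∧ E < 1 / 32 * (1 / 2) ^ j := by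
  classical
  have hex : ∃ j : ℕ, 1 / 32 * (1 / 2 : ℝ) ^ j / 2 ≤ E := by
    obtain ⟨j, hj⟩ := exists_pow_lt_of_lt_one hE (by norm_num : (1 / 2 : ℝ) < 1)
    refine ⟨j, ?_⟩
    have : (0 : ℝ) < (1 / 2) ^ j := by positivity
    linarith
  refine ⟨Nat.find hex, Nat.find_spec hex, ?_⟩
  rcases h : Nat.find hex with _ | m
  · simpa using hE2
  · have h1 := Nat.find_min hex (m := m) (by omega)
    push Not at h1
    calc E < _ := h1
      _ = _ := by ring

/-- The negative power of the energy in the small coordinates is a Lyapunov function of the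
chain. -/
lemma lyapunov_step {c : ℝ} (hb : 0 < b) (hc0 : 0 < c) (hc : c ≤ 1 / 5) :
    ∃ η > (0 : ℝ), ∀ᶠ n : ℕ in atTop, ∀ μ : Measure ℝ, IsNormalizedSubgaussian b μ →
      ∀ x₀ : Fin n → ℝ, 1 / 32 ≤ tailEnergy ((n : ℝ) ^ (-c)) x₀ →
      ∀ x : Fin n → ℝ, Admissible c x →
        (Integrable (fun y => tailEnergy ((n : ℝ) ^ (-c)) (advance c x₀ y) ^ (-(η * n)))
          (Measure.pi fun _ : Fin n => rowLaw μ x)) ∧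
        (∫ y, tailEnergy ((n : ℝ) ^ (-c)) (advance c x₀ y) ^ (-(η * n))
          ∂(Measure.pi fun _ : Fin n => rowLaw μ x) ≤
            32 ^ (η * n) + 1 / 2 * tailEnergy ((n : ℝ) ^ (-c)) x ^ (-(η * n))) ∧
        (Measure.pi fun _ : Fin n => rowLaw μ x).real (degenerate n c ((n : ℝ) ^ (-(c / 2)))) ≤
          ((n : ℝ) ^ (-(c / 2))) ^ (η * n) * tailEnergy ((n : ℝ) ^ (-c)) x ^ (-(η * n)) := by
  obtain ⟨k, hk, η, hη, h1⟩ := degenerate_prob_le_rpow hb hc0 hc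
  refine ⟨η, hη, ?_⟩
  have ht := (tendsto_rpow_mul_exp_neg_rpow (s := 1) hk one_pos).const_mul 3
  rw [mul_zero] at ht
  filter_upwards [h1, ht.eventually_le_const (by norm_num : (0 : ℝ) < 1 / 2),
    eventually_gt_atTop 0, (tendsto_natCast_rpow_neg (a := c / 2) (by positivity)).eventually_le_const
      (by norm_num : (0 : ℝ) < 1 / 32)] with n h1 hk2 hn hq32 μ hμ x₀ hx₀ x hx
  have hn1 : (1 : ℝ) ≤ n := by exact_mod_cast hn
  have hn' : (0 : ℝ) < n := by positivity
  have := hμ.prob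
  simp only [rpow_one] at hk2
  set δ := (n : ℝ) ^ (-c)
  set qs := (n : ℝ) ^ (-(c / 2)) with hqs
  have hqs0 : 0 < qs := by positivity
  set e := tailEnergy δ x
  have he0 : 0 < e := lt_of_lt_of_le hqs0 hx.2
  set s := η * n with hs
  have hs0 : 0 < s := by positivity
  set π' := Measure.pi fun _ : Fin n => rowLaw μ x
  -- The one-step estimate, with the level moved to the left-hand side.
  have hP : ∀ q, qs ≤ q → q ≤ 1 / 32 →
      (q / 2) ^ (-s) * π'.real (degenerate n c q) ≤ 3 * exp (-(k * n)) * e ^ (-s) := by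
    intro q hq hq2
    have hq0 : 0 < q := lt_of_lt_of_le hqs0 hq
    have h2 := h1 μ hμ x hx.1 hx.2 q hq hq2
    calc (q / 2) ^ (-s) * π'.real (degenerate n c q)
        ≤ (q / 2) ^ (-s) * (3 * exp (-(k * n)) * (q / (2 * e)) ^ s) := by gcongr
      _ = 3 * exp (-(k * n)) * ((q / 2) ^ (-s) * (q / 2 * e⁻¹) ^ s) := by
          rw [show q / (2 * e) = q / 2 * e⁻¹ by field_simp]; ring
      _ = _ := by
          rw [mul_rpow (by positivity) (by positivity), ← mul_assoc ((q / 2) ^ (-s)),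
            ← rpow_add (by positivity), inv_rpow he0.le, ← rpow_neg he0.le]
          simp
  set V : (Fin n → ℝ) → ℝ := fun y => tailEnergy δ (advance c x₀ y) ^ (-s) with hV
  have hVm : Measurable V :=
    (((measurable_tailEnergy δ).comp (measurable_advance c x₀)).pow_const _)
  have hadv : ∀ y, qs ≤ tailEnergy δ (advance c x₀ y) := by
    intro y
    unfold advance
    split_ifs with h
    · exact hq32.trans hx₀
    · exact not_lt.1 fun h' => h (Or.inr h')
  have hVb : ∀ y, ‖V y‖ ≤ qs ^ (-s) := by
    intro y
    rw [norm_of_nonneg (rpow_nonneg (tailEnergy_nonneg _ _) _)]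
    exact rpow_le_rpow_of_nonpos hqs0 (hadv y) (by linarith)
  have hVi : Integrable V π' := (integrable_const (qs ^ (-s))).mono' hVm.aestronglyMeasurable
    (ae_of_all _ hVb)
  refine ⟨hVi, ?_, ?_⟩
  -- The Lyapunov function is dominated by a sum over the dyadic levels between `n^(-c/2)` and `1 /
  -- 32`; there are fewer than `n` of them, and each contributes `3 exp (-k n) e^(-s)`.
  · set lev : ℕ → ℝ := fun j => 1 / 32 * (1 / 2) ^ j with hlev
    set J := (Finset.range n).filter fun j => qs ≤ lev j with hJ
    set g : (Fin n → ℝ) → ℝ := fun y => 32 ^ s +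
      ∑ j ∈ J, (degenerate n c (lev j)).indicator (fun _ => (lev j / 2) ^ (-s)) y with hg
    have hlev0 : ∀ j, 0 < lev j := fun j => by positivity
    have hterm : ∀ j ∈ J, Integrable
        (fun y => (degenerate n c (lev j)).indicator (fun _ => (lev j / 2) ^ (-s)) y) π' :=
      fun j _ => (integrable_const _).indicator (measurableSet_degenerate _ _ _)
    have hgi : Integrable g π' := (integrable_const _).add (integrable_finsetSum _ hterm)
    have hpt : ∀ y, V y ≤ g y := by
      intro y
      have hnn : ∀ j ∈ J,
          0 ≤ (degenerate n c (lev j)).indicator (fun _ => (lev j / 2) ^ (-s)) y := fun j _ =>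
        Set.indicator_nonneg (fun _ _ => rpow_nonneg (by linarith [hlev0 j]) _) _
      by_cases hE : 1 / 32 ≤ tailEnergy δ (advance c x₀ y)
      · have h2 : V y ≤ 32 ^ s := by
          calc V y ≤ (1 / 32 : ℝ) ^ (-s) := rpow_le_rpow_of_nonpos (by norm_num) hE (by linarith)
            _ = _ := by rw [rpow_neg (by norm_num), one_div, inv_rpow (by norm_num), inv_inv]
        have := Finset.sum_nonneg hnn
        simp only [hg]
        linarith
      · push Not at hE
        obtain ⟨j, hj1, hj2⟩ := exists_dyadic_level (lt_of_lt_of_le hqs0 (hadv y)) hE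
        have hdir : advance c x₀ y = dir y := by
          unfold advance at hE ⊢
          split_ifs at hE ⊢ with h
          · exact absurd hx₀ (not_le.2 hE)
          · rfl
        have hjq : qs ≤ lev j := (hadv y).trans hj2.le
        have hjn : j < n := by
          have h3 : (j : ℝ) < 2 ^ j := by exact_mod_cast Nat.lt_two_pow_self
          have h4 : (n : ℝ) ^ (-(1 : ℝ)) ≤ (1 / 2) ^ j := by
            calc (n : ℝ) ^ (-(1 : ℝ)) ≤ qs := rpow_le_rpow_of_exponent_le hn1 (by linarith)
              _ ≤ 1 / 32 * (1 / 2) ^ j := hjq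
              _ ≤ 1 * (1 / 2) ^ j := by gcongr; norm_num
              _ = _ := one_mul _
          rw [rpow_neg_one, one_div, inv_pow] at h4
          have h5 : (2 : ℝ) ^ j ≤ n := (inv_le_inv₀ hn' (by positivity)).1 h4
          exact_mod_cast h3.trans_le h5
        have hjJ : j ∈ J := Finset.mem_filter.2 ⟨Finset.mem_range.2 hjn, hjq⟩
        have hmem : y ∈ degenerate n c (lev j) := Or.inr (by rw [hdir] at hj2; exact hj2)
        have h3 := Finset.single_le_sum hnn hjJ
        rw [Set.indicator_of_mem hmem] at h3
        have h4 : V y ≤ (lev j / 2) ^ (-s) :=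
          rpow_le_rpow_of_nonpos (by linarith [hlev0 j]) hj1 (by linarith)
        have h5 : (0 : ℝ) ≤ 32 ^ s := by positivity
        simp only [hg]
        linarith
    calc ∫ y, V y ∂π' ≤ ∫ y, g y ∂π' := integral_mono hVi hgi hpt
      _ = 32 ^ s + ∑ j ∈ J, (lev j / 2) ^ (-s) * π'.real (degenerate n c (lev j)) := by
          simp only [hg]
          rw [integral_add (integrable_const _) (integrable_finsetSum _ hterm),
            integral_finsetSum _ hterm]
          simp only [integral_const, probReal_univ, smul_eq_mul, one_mul]
          congr 1
          refine Finset.sum_congr rfl fun j _ => ?_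
          rw [integral_indicator (measurableSet_degenerate _ _ _)]
          simp [mul_comm]
      _ ≤ 32 ^ s + ∑ j ∈ J, 3 * exp (-(k * n)) * e ^ (-s) := by
          refine add_le_add le_rfl (Finset.sum_le_sum fun j hj => ?_)
          refine hP _ (Finset.mem_filter.1 hj).2 ?_
          have : (1 / 2 : ℝ) ^ j ≤ 1 := pow_le_one₀ (by norm_num) (by norm_num)
          simp only [hlev]
          linarith
      _ ≤ 32 ^ s + n * (3 * exp (-(k * n)) * e ^ (-s)) := by
          rw [Finset.sum_const, nsmul_eq_mul]
          gcongr
          calc J.card ≤ (Finset.range n).card := Finset.card_filter_le _ _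
            _ = n := Finset.card_range n
      _ = 32 ^ s + 3 * (n * exp (-(k * n))) * e ^ (-s) := by ring
      _ ≤ _ := by gcongr
  · have h2 := h1 μ hμ x hx.1 hx.2 qs le_rfl hq32
    refine h2.trans ?_
    have h3 : 3 * exp (-(k * n)) ≤ 1 := by
      have : 3 * (1 * exp (-(k * n))) ≤ 3 * (n * exp (-(k * n))) := by gcongr
      linarith
    calc _ ≤ 1 * (qs / (2 * e)) ^ s := by gcongr
      _ ≤ 1 * (qs * e⁻¹) ^ s := by
          gcongr
          rw [div_le_iff₀ (by positivity)]
          field_simp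
          norm_num
      _ = _ := by
          rw [one_mul, mul_rpow hqs0.le (by positivity), inv_rpow he0.le, ← rpow_neg he0.le]

end

/-! ### The chain of directions -/

section

variable {n : ℕ}

/-- The chain of pairs (direction, accumulated clamped log-norm) driven by an array `a`;
the `k`-th matrix has entries `a (k, i, j)`. -/
noncomputable def chainState (c L : ℝ) (x₀ : Fin n → ℝ) (a : ℕ × Fin n × Fin n → ℝ) :
    ℕ → (Fin n → ℝ) × ℝ
  | 0 => (x₀, 0)
  | k + 1 =>
    (advance c x₀ fun i => ∑ j, a (k, i, j) * (chainState c L x₀ a k).1 j,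
      (chainState c L x₀ a k).2 + logStep L fun i => ∑ j, a (k, i, j) * (chainState c L x₀ a k).1 j)

/-- The image of the current direction under the next (unscaled) matrix. -/
noncomputable def chainImage (c L : ℝ) (x₀ : Fin n → ℝ) (a : ℕ × Fin n × Fin n → ℝ) (k : ℕ) :
    Fin n → ℝ :=
  fun i => ∑ j, a (k, i, j) * (chainState c L x₀ a k).1 j

variable {c L : ℝ} {x₀ : Fin n → ℝ}

lemma chainState_succ (a : ℕ × Fin n × Fin n → ℝ) (k : ℕ) :
    chainState c L x₀ a (k + 1) = (advance c x₀ (chainImage c L x₀ a k),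
      (chainState c L x₀ a k).2 + logStep L (chainImage c L x₀ a k)) := rfl

lemma measurable_chainState (k : ℕ) : Measurable fun a => chainState c L x₀ a k := by
  induction k with
  | zero => exact measurable_const
  | succ k ih =>
    have h1 : Measurable fun a => chainImage c L x₀ a k := by
      refine measurable_pi_lambda _ fun i => Finset.measurable_fun_sum _ fun j _ => ?_
      exact (measurable_pi_apply _).mul ((measurable_pi_apply j).comp ih.fst)
    exact ((measurable_advance c x₀).comp h1).prodMk (ih.snd.add ((measurable_logStep L).comp h1))

lemma measurable_chainImage (k : ℕ) : Measurable fun a => chainImage c L x₀ a k := by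
  refine measurable_pi_lambda _ fun i => Finset.measurable_fun_sum _ fun j _ => ?_
  exact (measurable_pi_apply _).mul ((measurable_pi_apply j).comp (measurable_chainState k).fst)

lemma chainState_congr {a a' : ℕ × Fin n × Fin n → ℝ} {k : ℕ}
    (h : ∀ e : ℕ × Fin n × Fin n, e.1 < k → a e = a' e) :
    chainState c L x₀ a k = chainState c L x₀ a' k := by
  induction k with
  | zero => rfl
  | succ k ih =>
    have h1 := ih fun e he => h e (by omega)
    have h2 : chainImage c L x₀ a k = chainImage c L x₀ a' k := by
      funext i
      simp only [chainImage, h1]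
      exact Finset.sum_congr rfl fun j _ => by rw [h (k, i, j) (by simp)]
    rw [chainState_succ, chainState_succ, h1, h2]

lemma admissible_chainState (hn : 0 < n) (h0 : Admissible c x₀) (a : ℕ × Fin n × Fin n → ℝ)
    (k : ℕ) : Admissible c (chainState c L x₀ a k).1 := by
  cases k with
  | zero => exact h0
  | succ k => exact admissible_advance hn h0 _

variable {Ω : Type*} [MeasurableSpace Ω] {P : Measure Ω} [IsProbabilityMeasure P]
  {X : ℕ × Fin n × Fin n → Ω → ℝ} {μ : Measure ℝ}

/-- The state at time `k` and the `k`-th matrix are independent. -/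
lemma map_chainState_matrix (hX : ∀ e, Measurable (X e)) (hi : iIndepFun X P)
    (hμ : ∀ e, P.map (X e) = μ) (k : ℕ) :
    P.map (fun ω => (chainState c L x₀ (fun e => X e ω) k,
        fun e : Fin n × Fin n => X (k, e) ω)) =
      (P.map fun ω => chainState c L x₀ (fun e => X e ω) k).prod
        (Measure.pi fun _ : Fin n × Fin n => μ) := by
  classical
  -- The state at time `k` is a function of the entries with time index below `k`.
  set S : Finset (ℕ × Fin n × Fin n) := Finset.range k ×ˢ Finset.univ
  set T : Finset (ℕ × Fin n × Fin n) := {k} ×ˢ Finset.univ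
  have hST : Disjoint S T := by
    rw [Finset.disjoint_left]
    intro e h1 h2
    have h3 := Finset.mem_range.1 (Finset.mem_product.1 h1).1
    have h4 := Finset.mem_singleton.1 (Finset.mem_product.1 h2).1
    omega
  have h1 := hi.indepFun_finset S T hST hX
  set φ : (S → ℝ) → (Fin n → ℝ) × ℝ := fun u =>
    chainState c L x₀ (fun e => if h : e ∈ S then u ⟨e, h⟩ else 0) k
  set ψ : (T → ℝ) → (Fin n × Fin n → ℝ) := fun u e => u ⟨(k, e), by simp [T]⟩
  have hφ : Measurable φ := by
    refine (measurable_chainState k).comp (measurable_pi_lambda _ fun e => ?_)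
    by_cases h : e ∈ S
    · simp only [h, dite_true]; exact measurable_pi_apply _
    · simp only [h, dite_false]; exact measurable_const
  have hψ : Measurable ψ := measurable_pi_lambda _ fun e => measurable_pi_apply _
  have h2 := h1.comp hφ hψ
  have e1 : (φ ∘ fun ω (i : S) => X i ω) = fun ω => chainState c L x₀ (fun e => X e ω) k := by
    funext ω
    refine chainState_congr fun e he => ?_
    have : e ∈ S := Finset.mem_product.2 ⟨Finset.mem_range.2 he, Finset.mem_univ _⟩
    simp [this]
  have e2 : (ψ ∘ fun ω (i : T) => X i ω) = fun ω (e : Fin n × Fin n) => X (k, e) ω := rfl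
  rw [e1, e2] at h2
  have m1 : Measurable fun ω => chainState c L x₀ (fun e => X e ω) k :=
    (measurable_chainState k).comp (measurable_pi_lambda _ hX)
  have m2 : Measurable fun ω (e : Fin n × Fin n) => X (k, e) ω :=
    measurable_pi_lambda _ fun e => hX _
  rw [(indepFun_iff_map_prod_eq_prod_map_map m1.aemeasurable m2.aemeasurable).1 h2]
  congr 1
  have h3 : iIndepFun (fun e : Fin n × Fin n => X (k, e)) P :=
    hi.precomp (g := fun e : Fin n × Fin n => ((k, e) : ℕ × Fin n × Fin n))
      (Prod.mk_right_injective k)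
  have h4 := (iIndepFun_iff_map_fun_eq_pi_map fun e => (hX (k, e)).aemeasurable).1 h3
  rw [h4]
  simp only [hμ]

variable [IsProbabilityMeasure μ]

/-- The Markov property, integrated: given the state at time `k`, the coordinates of the image
vector are iid with law `rowLaw μ x`, where `x` is the current direction. -/
lemma lintegral_chain (hX : ∀ e, Measurable (X e)) (hi : iIndepFun X P)
    (hμ : ∀ e, P.map (X e) = μ) (k : ℕ) {f : ((Fin n → ℝ) × ℝ) × (Fin n → ℝ) → ENNReal}
    (hf : Measurable f) :
    ∫⁻ ω, f (chainState c L x₀ (fun e => X e ω) k, chainImage c L x₀ (fun e => X e ω) k) ∂P =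
      ∫⁻ ω, ∫⁻ y, f (chainState c L x₀ (fun e => X e ω) k, y)
        ∂(Measure.pi fun _ : Fin n => rowLaw μ (chainState c L x₀ (fun e => X e ω) k).1) ∂P := by
  have m1 : Measurable fun ω => chainState c L x₀ (fun e => X e ω) k :=
    (measurable_chainState k).comp (measurable_pi_lambda _ hX)
  have m2 : Measurable fun ω (e : Fin n × Fin n) => X (k, e) ω :=
    measurable_pi_lambda _ fun e => hX _
  set g : ((Fin n → ℝ) × ℝ) × (Fin n × Fin n → ℝ) → ENNReal := fun p =>
    f (p.1, fun i => ∑ j, p.2 (i, j) * p.1.1 j) with hg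
  have hgm : Measurable g := by
    refine hf.comp (measurable_fst.prodMk (measurable_pi_lambda _ fun i => ?_))
    refine Finset.measurable_fun_sum _ fun j _ => ?_
    exact ((measurable_pi_apply _).comp measurable_snd).mul
      ((measurable_pi_apply j).comp measurable_fst.fst)
  calc _ = ∫⁻ ω, g (chainState c L x₀ (fun e => X e ω) k, fun e => X (k, e) ω) ∂P := rfl
    _ = ∫⁻ p, g p ∂(P.map fun ω => (chainState c L x₀ (fun e => X e ω) k,
          fun e : Fin n × Fin n => X (k, e) ω)) :=
        (lintegral_map hgm (m1.prodMk m2)).symm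
    _ = ∫⁻ w, ∫⁻ z, g (w, z) ∂(Measure.pi fun _ : Fin n × Fin n => μ)
          ∂(P.map fun ω => chainState c L x₀ (fun e => X e ω) k) := by
        rw [map_chainState_matrix hX hi hμ, lintegral_prod _ hgm.aemeasurable]
    _ = ∫⁻ ω, ∫⁻ z, g (chainState c L x₀ (fun e => X e ω) k, z)
          ∂(Measure.pi fun _ : Fin n × Fin n => μ) ∂P :=
        lintegral_map hgm.lintegral_prod_right' m1
    _ = _ := by
        refine lintegral_congr fun ω => ?_
        rw [← map_mulVec_pi]
        exact (lintegral_map (f := fun y => f (chainState c L x₀ (fun e => X e ω) k, y))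
          (hf.comp measurable_prodMk_left) (by fun_prop)).symm

/-- The images after which the chain may lose track of the matrix product: degenerate ones, and
those whose norm is clamped. -/
def untracked (n : ℕ) (c L : ℝ) : Set (Fin n → ℝ) :=
  degenerate n c ((n : ℝ) ^ (-(c / 2))) ∪
    {y | 1 + sqErr y < exp (-(2 * L)) ∨ exp (2 * L) < 1 + sqErr y}

lemma measurableSet_untracked (n : ℕ) (c L : ℝ) : MeasurableSet (untracked n c L) :=
  (measurableSet_degenerate _ _ _).union
    ((measurableSet_lt (measurable_const.add measurable_sqErr) measurable_const).union
      (measurableSet_lt measurable_const (measurable_const.add measurable_sqErr)))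

/-- Along tracked trajectories the chain describes the matrix product applied to `x₀`. -/
lemma orbit_eq_of_tracked {Ω : Type*} (hn : 0 < n) (X : ℕ × Fin n × Fin n → Ω → ℝ)
    (x : EuclideanSpace ℝ (Fin n)) (ω : Ω) {N : ℕ}
    (h : ∀ k < N, chainImage c L x.ofLp (fun e => X e ω) k ∉ untracked n c L) :
    (orbit X x N ω).ofLp = exp (chainState c L x.ofLp (fun e => X e ω) N).2 •
      (chainState c L x.ofLp (fun e => X e ω) N).1 := by
  have hn' : (0 : ℝ) < n := by positivity
  induction N with
  | zero => simp [orbit, matrixProduct, chainState]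
  | succ N ih =>
    have h1 := ih fun k hk => h k (by omega)
    have h2 := h N (by omega)
    set p := chainState c L x.ofLp (fun e => X e ω) N with hp
    set y := chainImage c L x.ofLp (fun e => X e ω) N with hy
    rw [chainState_succ, ← hp, ← hy]
    have h3 : y ∉ degenerate n c ((n : ℝ) ^ (-(c / 2))) := fun h' => h2 (Or.inl h')
    have h4 : exp (-(2 * L)) ≤ 1 + sqErr y := not_lt.1 fun h' => h2 (Or.inr (Or.inl h'))
    have h5 : 1 + sqErr y ≤ exp (2 * L) := not_lt.1 fun h' => h2 (Or.inr (Or.inr h'))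
    have hpos := sum_sq_pos_of_notMem_degenerate hn h3
    have e1 : exp (logStep L y) = √(∑ i, y i ^ 2) / √n := by
      have h6 : 1 + sqErr y = (∑ i, y i ^ 2) / n := by rw [sqErr]; ring
      rw [logStep, clampLog_eq h4 h5, h6, ← sqrt_div hpos.le, sqrt_eq_rpow,
        rpow_def_of_pos (by positivity)]
      congr 1; ring
    have e2 : (orbit X x (N + 1) ω).ofLp =
        (scaledMatrix X N ω).mulVec (orbit X x N ω).ofLp := by
      simp [orbit, matrixProduct, Matrix.mulVec_mulVec]
    rw [e2, h1]
    funext i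
    simp only [Matrix.mulVec, dotProduct, scaledMatrix, Matrix.of_apply, Pi.smul_apply,
      smul_eq_mul, advance, if_neg h3, dir, exp_add, e1]
    have e3 : y i = ∑ j, X (N, i, j) ω * p.1 j := rfl
    have hs : √(∑ i, y i ^ 2) ≠ 0 := (sqrt_pos.2 hpos).ne'
    have hsn : √(n : ℝ) ≠ 0 := (sqrt_pos.2 hn').ne'
    have e4 : exp p.2 * (√(∑ i, y i ^ 2) / √n) * (y i / √(∑ i, y i ^ 2)) =
        exp p.2 / √n * y i := by
      generalize √(∑ i, y i ^ 2) = r at hs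
      field_simp
    rw [e4, e3, Finset.mul_sum]
    refine Finset.sum_congr rfl fun j _ => ?_
    field_simp

end

/-! ### Tracked trajectories and flat directions -/

section

variable {b : ℝ} {n : ℕ} {c L : ℝ} {x₀ : Fin n → ℝ}
  {Ω : Type*} [MeasurableSpace Ω] {P : Measure Ω} [IsProbabilityMeasure P]
  {X : ℕ × Fin n × Fin n → Ω → ℝ} {μ : Measure ℝ}

lemma measurable_chainImage_comp (hX : ∀ e, Measurable (X e)) (k : ℕ) :
    Measurable fun ω => chainImage c L x₀ (fun e => X e ω) k :=
  (measurable_chainImage k).comp (measurable_pi_lambda _ hX)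

lemma measurable_chainState_comp (hX : ∀ e, Measurable (X e)) (k : ℕ) :
    Measurable fun ω => chainState c L x₀ (fun e => X e ω) k :=
  (measurable_chainState k).comp (measurable_pi_lambda _ hX)

variable [IsProbabilityMeasure μ]

/-- The probability that the `k`-th image falls into `A`. -/
lemma prob_chainImage (hX : ∀ e, Measurable (X e)) (hi : iIndepFun X P)
    (hμ : ∀ e, P.map (X e) = μ) (k : ℕ) {A : Set (Fin n → ℝ)} (hA : MeasurableSet A) :
    P {ω | chainImage c L x₀ (fun e => X e ω) k ∈ A} =
      ∫⁻ ω, (Measure.pi fun _ : Fin n => rowLaw μ (chainState c L x₀ (fun e => X e ω) k).1) A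
        ∂P := by
  have h := lintegral_chain (c := c) (L := L) (x₀ := x₀) hX hi hμ k
    (f := fun p => A.indicator 1 p.2) ((measurable_one.indicator hA).comp measurable_snd)
  have e : (fun ω => A.indicator (1 : (Fin n → ℝ) → ENNReal)
      (chainImage c L x₀ (fun e => X e ω) k)) =
      {ω | chainImage c L x₀ (fun e => X e ω) k ∈ A}.indicator 1 := rfl
  simp only [lintegral_indicator_one hA] at h
  have hm : MeasurableSet {ω | chainImage c L x₀ (fun e => X e ω) k ∈ A} :=
    measurable_chainImage_comp hX k hA
  rw [← h, e, lintegral_indicator_one hm]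

lemma prob_chainImage_le (hn : 0 < n) (h0 : Admissible c x₀) (hX : ∀ e, Measurable (X e))
    (hi : iIndepFun X P) (hμ : ∀ e, P.map (X e) = μ) (k : ℕ) {A : Set (Fin n → ℝ)}
    (hA : MeasurableSet A) {ε : ℝ}
    (h : ∀ x : Fin n → ℝ, Admissible c x → (Measure.pi fun _ : Fin n => rowLaw μ x).real A ≤ ε) :
    P.real {ω | chainImage c L x₀ (fun e => X e ω) k ∈ A} ≤ ε := by
  have hε : 0 ≤ ε := measureReal_nonneg.trans (h x₀ h0)
  rw [measureReal_def, prob_chainImage hX hi hμ k hA]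
  refine ENNReal.toReal_le_of_le_ofReal hε ?_
  calc _ ≤ ∫⁻ _, ENNReal.ofReal ε ∂P := by
        refine lintegral_mono fun ω => ?_
        rw [← ofReal_measureReal]
        exact ENNReal.ofReal_le_ofReal (h _ (admissible_chainState hn h0 _ k))
    _ = _ := by simp

/-- Along the chain the Lyapunov function stays bounded in mean. -/
lemma lintegral_lyapunov_le {s V₀ : ℝ} (hV₀ : 0 ≤ V₀) (hn : 0 < n) (h0 : Admissible c x₀)
    (h0V : tailEnergy ((n : ℝ) ^ (-c)) x₀ ^ (-s) ≤ V₀)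
    (hX : ∀ e, Measurable (X e)) (hi : iIndepFun X P) (hμ : ∀ e, P.map (X e) = μ)
    (h : ∀ x : Fin n → ℝ, Admissible c x →
      Integrable (fun y => tailEnergy ((n : ℝ) ^ (-c)) (advance c x₀ y) ^ (-s))
        (Measure.pi fun _ : Fin n => rowLaw μ x) ∧
      ∫ y, tailEnergy ((n : ℝ) ^ (-c)) (advance c x₀ y) ^ (-s)
          ∂(Measure.pi fun _ : Fin n => rowLaw μ x) ≤
        V₀ + 1 / 2 * tailEnergy ((n : ℝ) ^ (-c)) x ^ (-s)) (k : ℕ) :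
    ∫⁻ ω, ENNReal.ofReal
        (tailEnergy ((n : ℝ) ^ (-c)) (chainState c L x₀ (fun e => X e ω) k).1 ^ (-s)) ∂P ≤
      ENNReal.ofReal (2 * V₀) := by
  have hnn : ∀ x : Fin n → ℝ, 0 ≤ tailEnergy ((n : ℝ) ^ (-c)) x ^ (-s) := fun x =>
    rpow_nonneg (tailEnergy_nonneg _ _) _
  induction k with
  | zero =>
    simp only [chainState, lintegral_const, measure_univ, mul_one]
    exact ENNReal.ofReal_le_ofReal (by linarith)
  | succ k ih =>
    have hm : Measurable fun p : ((Fin n → ℝ) × ℝ) × (Fin n → ℝ) =>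
        ENNReal.ofReal (tailEnergy ((n : ℝ) ^ (-c)) (advance c x₀ p.2) ^ (-s)) :=
      ((((measurable_tailEnergy _).comp (measurable_advance c x₀)).comp
        measurable_snd).pow_const _).ennreal_ofReal
    have h1 := lintegral_chain (c := c) (L := L) (x₀ := x₀) hX hi hμ k hm
    simp only [chainState_succ]
    rw [h1]
    calc _ ≤ ∫⁻ ω, (ENNReal.ofReal V₀ + ENNReal.ofReal (1 / 2) * ENNReal.ofReal
          (tailEnergy ((n : ℝ) ^ (-c)) (chainState c L x₀ (fun e => X e ω) k).1 ^ (-s))) ∂P := by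
          refine lintegral_mono fun ω => ?_
          obtain ⟨h2, h3⟩ := h _ (admissible_chainState (L := L) hn h0 (fun e => X e ω) k)
          simp only
          rw [← ofReal_integral_eq_lintegral_ofReal h2 (ae_of_all _ fun y => hnn _),
            ← ENNReal.ofReal_mul (by norm_num), ← ENNReal.ofReal_add hV₀
              (mul_nonneg (by norm_num) (hnn _))]
          exact ENNReal.ofReal_le_ofReal h3
      _ ≤ ENNReal.ofReal V₀ + ENNReal.ofReal (1 / 2) * ENNReal.ofReal (2 * V₀) := by
          rw [lintegral_add_left measurable_const, lintegral_const_mul _ ?_]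
          · simp only [lintegral_const, measure_univ, mul_one]
            gcongr
          · exact (((measurable_tailEnergy _).comp
              (measurable_chainState_comp hX k).fst).pow_const _).ennreal_ofReal
      _ = _ := by
          rw [← ENNReal.ofReal_mul (by norm_num), ← ENNReal.ofReal_add hV₀ (by linarith)]
          congr 1; ring

end

section

variable {b : ℝ}

/-- The chain is tracked for `N` steps up to an event of probability `N n^(-k n)`. -/
lemma prob_untracked_le {c : ℝ} (hb : 0 < b) (hc0 : 0 < c) (hc : c ≤ 1 / 5) :
    ∃ k > (0 : ℝ), ∀ᶠ n : ℕ in atTop, ∀ μ : Measure ℝ, IsNormalizedSubgaussian b μ →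
      ∀ x₀ : Fin n → ℝ, Admissible c x₀ → 1 / 32 ≤ tailEnergy ((n : ℝ) ^ (-c)) x₀ →
      ∀ (Ω : Type*) [MeasurableSpace Ω] (P : Measure Ω) [IsProbabilityMeasure P]
        (X : ℕ × Fin n × Fin n → Ω → ℝ), (∀ e, Measurable (X e)) → iIndepFun X P →
        (∀ e, P.map (X e) = μ) → ∀ N : ℕ,
        P.real {ω | ∃ m < N, chainImage c (c / 4 * log n) x₀ (fun e => X e ω) m ∈
          untracked n c (c / 4 * log n)} ≤ N * (n : ℝ) ^ (-(k * n)) := by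
  obtain ⟨η, hη, h1⟩ := lyapunov_step hb hc0 hc
  have hb16 : 0 < b / 16 := by positivity
  have hB := bernsteinConst_pos hb16
  set B := bernsteinConst (b / 16)
  refine ⟨c * η / 4, by positivity, ?_⟩
  have ht := (tendsto_rpow_mul_exp_neg_rpow (k := B / 2) (a := c / 2) (s := c * η / 4)
    (by positivity) (by positivity)).const_mul 4
  rw [mul_zero] at ht
  filter_upwards [h1, ht.eventually_le_const zero_lt_one, eventually_gt_atTop 0,
    (tendsto_natCast_rpow (a := c * η / 4) (by positivity)).eventually_ge_atTop (4 * 32 ^ η),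
    (tendsto_natCast_rpow (a := c / 2) (by positivity)).eventually_ge_atTop 2]
    with n h1 hexp hn hpow hpow2 μ hμ x₀ h0 h032 Ω _ P _ X hX hi hlaw N
  have := hμ.prob
  have hn' : (0 : ℝ) < n := by positivity
  have hn1 : (1 : ℝ) ≤ n := by exact_mod_cast hn
  set L := c / 4 * log n with hL
  have heL : exp (2 * L) = (n : ℝ) ^ (c / 2) := by
    rw [rpow_def_of_pos hn', hL]; congr 1; ring
  have heL' : exp (-(2 * L)) = (n : ℝ) ^ (-(c / 2)) := by
    rw [rpow_def_of_pos hn', hL]; congr 1; ring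
  set s := η * n with hs
  -- An untracked image is either degenerate or much longer than `√n`; the former is controlled by
  -- the Lyapunov function, the latter by Bernstein's inequality.
  set U : Set (Fin n → ℝ) := {y | (n : ℝ) ^ (c / 2) / 2 ≤ |sqErr y|} with hU
  have hUm : MeasurableSet U := measurableSet_le measurable_const measurable_sqErr.abs
  have hsub : untracked n c L ⊆ degenerate n c ((n : ℝ) ^ (-(c / 2))) ∪ U := by
    rintro y (hy | hy | hy)
    · exact Or.inl hy
    · left; left
      rw [heL'] at hy
      have e1 : 1 + sqErr y = (∑ i, y i ^ 2) / n := by rw [sqErr]; ring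
      rwa [e1, div_lt_iff₀ hn'] at hy
    · right
      rw [heL] at hy
      show (n : ℝ) ^ (c / 2) / 2 ≤ |sqErr y|
      refine le_trans ?_ (le_abs_self _)
      linarith
  have hdeg : ∀ m, P.real {ω | chainImage c L x₀ (fun e => X e ω) m ∈
      degenerate n c ((n : ℝ) ^ (-(c / 2)))} ≤
      ((n : ℝ) ^ (-(c / 2))) ^ s * (2 * 32 ^ s) := by
    intro m
    have hV := lintegral_lyapunov_le (s := s) (V₀ := 32 ^ s) (L := L) (by positivity) hn h0 (by
      calc _ ≤ (1 / 32 : ℝ) ^ (-s) := rpow_le_rpow_of_nonpos (by norm_num) h032 (by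
              have : 0 < s := by positivity
              linarith)
        _ = _ := by rw [rpow_neg (by norm_num), one_div, inv_rpow (by norm_num), inv_inv])
      hX hi hlaw (fun x hx => ⟨(h1 μ hμ x₀ h032 x hx).1, (h1 μ hμ x₀ h032 x hx).2.1⟩) m
    rw [measureReal_def, prob_chainImage hX hi hlaw m (measurableSet_degenerate _ _ _)]
    refine ENNReal.toReal_le_of_le_ofReal (by positivity) ?_
    calc _ ≤ ∫⁻ ω, ENNReal.ofReal (((n : ℝ) ^ (-(c / 2))) ^ s) * ENNReal.ofReal
          (tailEnergy ((n : ℝ) ^ (-c)) (chainState c L x₀ (fun e => X e ω) m).1 ^ (-s)) ∂P := by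
          refine lintegral_mono fun ω => ?_
          simp only
          rw [← ofReal_measureReal, ← ENNReal.ofReal_mul (by positivity)]
          exact ENNReal.ofReal_le_ofReal
            (h1 μ hμ x₀ h032 _ (admissible_chainState hn h0 _ m)).2.2
      _ ≤ ENNReal.ofReal (((n : ℝ) ^ (-(c / 2))) ^ s) * ENNReal.ofReal (2 * 32 ^ s) := by
          rw [lintegral_const_mul _ ?_]
          · gcongr
          · exact (((measurable_tailEnergy _).comp
              (measurable_chainState_comp hX m).fst).pow_const _).ennreal_ofReal
      _ = _ := by rw [← ENNReal.ofReal_mul (by positivity)]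
  have hUp : ∀ m, P.real {ω | chainImage c L x₀ (fun e => X e ω) m ∈ U} ≤
      2 * exp (-(B * n * ((n : ℝ) ^ (c / 2) / 2))) := by
    intro m
    refine prob_chainImage_le hn h0 hX hi hlaw m hUm fun x hx => ?_
    refine (sqErr_tail (rowLaw_isNormalizedSubgaussian hμ hb hx.1) hb16 hn
      (by positivity)).trans (le_of_eq ?_)
    rw [min_eq_right]
    have : 1 ≤ (n : ℝ) ^ (c / 2) / 2 := by linarith
    nlinarith
  -- Half of the exponent `c η n / 2` pays for the factor `32^(η n)`.
  have hb1 : ((n : ℝ) ^ (-(c / 2))) ^ s * (2 * 32 ^ s) ≤ 1 / 2 * (n : ℝ) ^ (-(c * η / 4 * n)) := by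
    have e1 : ((n : ℝ) ^ (-(c / 2))) ^ s =
        (n : ℝ) ^ (-(c * η / 4 * n)) * (((n : ℝ) ^ (c * η / 4)) ^ n)⁻¹ := by
      rw [← rpow_mul hn'.le, ← rpow_natCast, ← rpow_mul hn'.le, ← rpow_neg hn'.le,
        ← rpow_add hn', hs]
      congr 1; ring
    have e2 : (32 : ℝ) ^ s = (32 ^ η) ^ n := by
      rw [hs, rpow_mul (by norm_num), rpow_natCast]
    have h2 : 4 * (32 ^ η) ^ n ≤ ((n : ℝ) ^ (c * η / 4)) ^ n := by
      calc 4 * ((32 : ℝ) ^ η) ^ n ≤ 4 ^ n * ((32 : ℝ) ^ η) ^ n := by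
            gcongr
            exact le_self_pow₀ (by norm_num) (by omega)
        _ = (4 * 32 ^ η) ^ n := (mul_pow _ _ _).symm
        _ ≤ _ := by gcongr
    have h3 : 0 < ((n : ℝ) ^ (c * η / 4)) ^ n := by positivity
    rw [e1, e2]
    calc _ = 1 / 2 * (n : ℝ) ^ (-(c * η / 4 * n)) *
          ((4 * (32 ^ η) ^ n) / ((n : ℝ) ^ (c * η / 4)) ^ n) := by ring
      _ ≤ 1 / 2 * (n : ℝ) ^ (-(c * η / 4 * n)) * 1 := by
          gcongr
          exact (div_le_one h3).2 h2
      _ = _ := mul_one _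
  have hb2 : 2 * exp (-(B * n * ((n : ℝ) ^ (c / 2) / 2))) ≤
      1 / 2 * (n : ℝ) ^ (-(c * η / 4 * n)) := by
    have h2 : (4 * ((n : ℝ) ^ (c * η / 4) * exp (-(B / 2 * (n : ℝ) ^ (c / 2))))) ^ n ≤ 1 :=
      pow_le_one₀ (by positivity) hexp
    have e1 : (4 * ((n : ℝ) ^ (c * η / 4) * exp (-(B / 2 * (n : ℝ) ^ (c / 2))))) ^ n =
        4 ^ n * ((n : ℝ) ^ (c * η / 4 * n) * exp (-(B * n * ((n : ℝ) ^ (c / 2) / 2)))) := by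
      rw [mul_pow, mul_pow, ← exp_nat_mul, rpow_mul hn'.le, rpow_natCast]
      congr 3; ring
    rw [e1] at h2
    have h3 : (4 : ℝ) ≤ 4 ^ n := le_self_pow₀ (by norm_num) (by omega)
    rw [rpow_neg hn'.le, ← div_eq_mul_inv, le_div_iff₀ (by positivity)]
    have h4 : 4 * ((n : ℝ) ^ (c * η / 4 * n) * exp (-(B * n * ((n : ℝ) ^ (c / 2) / 2)))) ≤ 1 :=
      le_trans (by gcongr) h2
    linarith
  have hU2 : {ω | ∃ m < N, chainImage c L x₀ (fun e => X e ω) m ∈ untracked n c L} ⊆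
      ⋃ m ∈ Finset.range N, {ω | chainImage c L x₀ (fun e => X e ω) m ∈ untracked n c L} := by
    rintro ω ⟨m, hm, h⟩
    exact Set.mem_biUnion (Finset.mem_range.2 hm) h
  calc _ ≤ ∑ m ∈ Finset.range N,
        P.real {ω | chainImage c L x₀ (fun e => X e ω) m ∈ untracked n c L} :=
        (measureReal_mono hU2 (measure_ne_top _ _)).trans (measureReal_biUnion_finset_le _ _)
    _ ≤ ∑ m ∈ Finset.range N, (n : ℝ) ^ (-(c * η / 4 * n)) := by
        refine Finset.sum_le_sum fun m _ => ?_
        have hsub2 : {ω | chainImage c L x₀ (fun e => X e ω) m ∈ untracked n c L} ⊆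
            {ω | chainImage c L x₀ (fun e => X e ω) m ∈
              degenerate n c ((n : ℝ) ^ (-(c / 2)))} ∪
            {ω | chainImage c L x₀ (fun e => X e ω) m ∈ U} := fun ω hω => hsub hω
        have h2 := (measureReal_mono (μ := P) hsub2).trans (measureReal_union_le _ _)
        linarith [hdeg m, hUp m]
    _ = _ := by rw [Finset.sum_const, Finset.card_range, nsmul_eq_mul]

/-- Images after which the next direction may fail to be flat, or which are untracked at a
constant clamping level. -/
def irregular (n : ℕ) (c : ℝ) : Set (Fin n → ℝ) :=
  untracked n c 1 ∪ {y | ∃ i, (n : ℝ) ^ (1 / 4 : ℝ) / 4 ≤ |y i|}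

/-- A vector is flat if all its coordinates are at most `n^(-1/4)`. -/
def Flat {n : ℕ} (x : Fin n → ℝ) : Prop := ∀ j, |x j| ≤ (n : ℝ) ^ (-(1 / 4) : ℝ)

lemma measurableSet_flat (n : ℕ) : MeasurableSet {x : Fin n → ℝ | Flat x} := by
  have : {x : Fin n → ℝ | Flat x} = ⋂ j, {x | |x j| ≤ (n : ℝ) ^ (-(1 / 4) : ℝ)} := by
    ext x; simp [Flat]
  rw [this]
  exact MeasurableSet.iInter fun j => measurableSet_le (by fun_prop) measurable_const

lemma measurableSet_irregular (n : ℕ) (c : ℝ) : MeasurableSet (irregular n c) := by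
  refine (measurableSet_untracked _ _ _).union ?_
  have : {y : Fin n → ℝ | ∃ i, (n : ℝ) ^ (1 / 4 : ℝ) / 4 ≤ |y i|} =
      ⋃ i, {y | (n : ℝ) ^ (1 / 4 : ℝ) / 4 ≤ |y i|} := by ext x; simp
  rw [this]
  exact MeasurableSet.iUnion fun j => measurableSet_le measurable_const (by fun_prop)

lemma flat_advance {n : ℕ} (hn : 0 < n) {c : ℝ} {x₀ y : Fin n → ℝ} (hy : y ∉ irregular n c) :
    Flat (advance c x₀ y) := by
  have hn' : (0 : ℝ) < n := by positivity
  have h1 : y ∉ degenerate n c ((n : ℝ) ^ (-(c / 2))) := fun h => hy (Or.inl (Or.inl h))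
  have h2 : exp (-(2 * 1)) ≤ 1 + sqErr y := not_lt.1 fun h => hy (Or.inl (Or.inr (Or.inl h)))
  have h3 : ∀ i, |y i| < (n : ℝ) ^ (1 / 4 : ℝ) / 4 := fun i =>
    not_le.1 fun h => hy (Or.inr ⟨i, h⟩)
  have hpos := sum_sq_pos_of_notMem_degenerate hn h1
  have hs := sqrt_pos.2 hpos
  intro j
  rw [advance, if_neg h1, dir, abs_div, abs_of_pos hs, div_le_iff₀ hs]
  have e1 : 1 + sqErr y = (∑ i, y i ^ 2) / n := by rw [sqErr]; ring
  rw [e1, le_div_iff₀ hn'] at h2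
  have h4 : √n / 4 ≤ √(∑ i, y i ^ 2) := by
    refine le_sqrt_of_sq_le ?_
    rw [div_pow, sq_sqrt hn'.le]
    refine le_trans ?_ h2
    have h5 : (1 / 16 : ℝ) ≤ exp (-(2 * 1)) := by
      have e2 : exp (-(2 * 1)) = (exp 1 ^ 2)⁻¹ := by rw [← exp_nat_mul, ← exp_neg]; norm_num
      rw [e2, one_div]
      gcongr
      have := exp_one_lt_d9
      have := exp_pos 1
      nlinarith
    calc (n : ℝ) / 4 ^ 2 = 1 / 16 * n := by ring
      _ ≤ _ := by gcongr
  calc |y j| ≤ (n : ℝ) ^ (1 / 4 : ℝ) / 4 := (h3 j).le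
    _ = (n : ℝ) ^ (-(1 / 4) : ℝ) * (√n / 4) := by
        rw [sqrt_eq_rpow, ← mul_div_assoc, ← rpow_add hn']; norm_num
    _ ≤ _ := by gcongr

lemma irregular_prob_le {c : ℝ} (hb : 0 < b) (hc0 : 0 < c) (hc : c ≤ 1 / 5) :
    ∀ᶠ n : ℕ in atTop, ∀ μ : Measure ℝ, IsNormalizedSubgaussian b μ →
      ∀ x : Fin n → ℝ, ∑ j, x j ^ 2 = 1 →
        (Measure.pi fun _ : Fin n => rowLaw μ x).real (irregular n c) ≤
          exp (-((n : ℝ) ^ (1 / 4 : ℝ))) := by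
  have hb16 : 0 < b / 16 := by positivity
  have hB := bernsteinConst_pos hb16
  set B := bernsteinConst (b / 16)
  obtain ⟨k, hk, h1⟩ := degenerate_prob_exp hb16 hc
  -- Each of the three error terms is eventually at most a third of the bound.
  have key : ∀ {K a s : ℝ}, 0 < K → 1 / 4 < a →
      ∀ᶠ n : ℕ in atTop, 3 * ((n : ℝ) ^ s * (3 * exp (-(K * (n : ℝ) ^ a)))) ≤
        exp (-((n : ℝ) ^ (1 / 4 : ℝ))) := by
    intro K a s hK ha
    have t1 := (tendsto_rpow_mul_exp_neg_rpow (k := K / 2) (a := a) (s := s) (by positivity)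
      (by linarith)).const_mul 9
    rw [mul_zero] at t1
    have t2 := tendsto_natCast_rpow (a := a - 1 / 4) (by linarith)
    filter_upwards [t1.eventually_le_const zero_lt_one, t2.eventually_ge_atTop (2 / K),
      eventually_gt_atTop 0] with n h1 h2 hn
    have hn' : (0 : ℝ) < n := by positivity
    have h3 : (n : ℝ) ^ (1 / 4 : ℝ) ≤ K / 2 * (n : ℝ) ^ a := by
      have e1 : (n : ℝ) ^ a = (n : ℝ) ^ (a - 1 / 4) * (n : ℝ) ^ (1 / 4 : ℝ) := by
        rw [← rpow_add hn']; congr 1; ring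
      rw [e1]
      calc (n : ℝ) ^ (1 / 4 : ℝ) = K / 2 * (2 / K * (n : ℝ) ^ (1 / 4 : ℝ)) := by field_simp
        _ ≤ _ := by gcongr
    have e2 : exp (-(K * (n : ℝ) ^ a)) =
        exp (-(K / 2 * (n : ℝ) ^ a)) * exp (-(K / 2 * (n : ℝ) ^ a)) := by
      rw [← exp_add]; congr 1; ring
    calc _ = 9 * ((n : ℝ) ^ s * exp (-(K / 2 * (n : ℝ) ^ a))) * exp (-(K / 2 * (n : ℝ) ^ a)) := by
          rw [e2]; ring
      _ ≤ 1 * exp (-((n : ℝ) ^ (1 / 4 : ℝ))) := by gcongr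
      _ = _ := one_mul _
  filter_upwards [h1, key (s := 0) hk (by norm_num : (1 / 4 : ℝ) < 1),
    key (K := B * (1 / 4)) (s := 0) (by positivity) (by norm_num : (1 / 4 : ℝ) < 1),
    key (K := b / 16 * (1 / 16)) (s := 1) (by positivity) (by norm_num : (1 / 4 : ℝ) < 1 / 2),
    eventually_gt_atTop 0,
    (tendsto_natCast_rpow_neg (a := c / 2) (by positivity)).eventually_le_const
      (by norm_num : (0 : ℝ) < 1 / 32)]
    with n h1 k1 k2 k3 hn hq32 μ hμ x hx
  have := hμ.prob
  have hn' : (0 : ℝ) < n := by positivity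
  have hrow := rowLaw_isNormalizedSubgaussian hμ hb hx
  simp only [rpow_zero, one_mul, rpow_one] at k1 k2 k3
  set π' := Measure.pi fun _ : Fin n => rowLaw μ x
  have hsub : irregular n c ⊆ degenerate n c ((n : ℝ) ^ (-(c / 2))) ∪
      ({y | 1 / 2 ≤ |sqErr y|} ∪
        ⋃ i ∈ (Finset.univ : Finset (Fin n)), {y | (n : ℝ) ^ (1 / 4 : ℝ) / 4 ≤ |y i|}) := by
    rintro y ((hy | hy | hy) | ⟨i, hi⟩)
    · exact Or.inl hy
    -- Clamping at level one is inactive as soon as `|sqErr y| < 1 / 2`.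
    · right; left
      show 1 / 2 ≤ |sqErr y|
      have : exp (-(2 * 1) : ℝ) ≤ 1 / 2 := by
        rw [exp_neg, inv_le_comm₀ (exp_pos _) (by norm_num)]
        have h := add_one_le_exp (2 * 1 : ℝ)
        norm_num at h ⊢
        linarith
      have hy' : sqErr y < -(1 / 2) := by
        have h : 1 + sqErr y < 1 / 2 := lt_of_lt_of_le hy this
        linarith
      rw [abs_of_neg (hy'.trans (by norm_num))]
      linarith
    · right; left
      show 1 / 2 ≤ |sqErr y|
      have h : 2 * 1 + 1 < 1 + sqErr y := lt_of_le_of_lt (add_one_le_exp (2 * 1 : ℝ)) hy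
      refine le_trans ?_ (le_abs_self _)
      linarith
    · right; right
      exact Set.mem_biUnion (Finset.mem_univ i) hi
  have p1 := h1 _ hrow _ le_rfl hq32
  have p2 := sqErr_tail hrow hb16 hn (v := 1 / 2) (by norm_num)
  have p3 : ∀ i : Fin n, π'.real {y | (n : ℝ) ^ (1 / 4 : ℝ) / 4 ≤ |y i|} ≤
      2 * exp (-(b / 16 * (1 / 16) * (n : ℝ) ^ (1 / 2 : ℝ))) := by
    intro i
    have e1 : π'.real {y | (n : ℝ) ^ (1 / 4 : ℝ) / 4 ≤ |y i|} =
        (rowLaw μ x).real {g | (n : ℝ) ^ (1 / 4 : ℝ) / 4 ≤ |g|} := by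
      have := (measurePreserving_eval (fun _ : Fin n => rowLaw μ x) i).measureReal_preimage
        (s := {g | (n : ℝ) ^ (1 / 4 : ℝ) / 4 ≤ |g|})
        (measurableSet_le measurable_const (by fun_prop)).nullMeasurableSet
      exact this
    rw [e1]
    refine (hrow.tail_le hb16 (by positivity)).trans (le_of_eq ?_)
    rw [div_pow, ← rpow_natCast, ← rpow_mul hn'.le]
    norm_num
    ring
  calc π'.real (irregular n c) ≤ _ := measureReal_mono hsub (measure_ne_top _ _)
    _ ≤ 3 * exp (-(k * n)) + (2 * exp (-(B * n * min ((1 / 2) ^ 2) (1 / 2))) +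
        ∑ i : Fin n, 2 * exp (-(b / 16 * (1 / 16) * (n : ℝ) ^ (1 / 2 : ℝ)))) := by
        refine (measureReal_union_le _ _).trans (add_le_add p1
          ((measureReal_union_le _ _).trans (add_le_add p2 ?_)))
        exact (measureReal_biUnion_finset_le _ _).trans (Finset.sum_le_sum fun i _ => p3 i)
    _ ≤ exp (-((n : ℝ) ^ (1 / 4 : ℝ))) := by
        rw [Finset.sum_const, Finset.card_univ, Fintype.card_fin, nsmul_eq_mul]
        have e1 : min ((1 / 2 : ℝ) ^ 2) (1 / 2) = 1 / 4 := by norm_num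
        rw [e1, show B * n * (1 / 4) = B * (1 / 4) * n by ring]
        have q1 := exp_pos (-(B * (1 / 4) * n))
        have q2 : 0 < n * exp (-(b / 16 * (1 / 16) * (n : ℝ) ^ (1 / 2 : ℝ))) := by positivity
        linarith

end

/-! ### The drift of the log-norm -/

section

variable {b : ℝ} {n : ℕ} {μ : Measure ℝ}

lemma fourth_moment_le (h : IsNormalizedSubgaussian b μ) (hb : 0 < b) :
    ∫ x, x ^ 4 ∂μ ≤ 4 / b ^ 2 := by
  have := h.integral_pow_le hb 2
  norm_num [Nat.factorial] at this
  exact this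

lemma rowLaw_fourth_moment_le (h : IsNormalizedSubgaussian b μ) (hb : 0 < b) {x : Fin n → ℝ}
    (hx : ∑ j, x j ^ 2 = 1) : ∫ g, g ^ 4 ∂(rowLaw μ x) ≤ 1024 / b ^ 2 := by
  refine (fourth_moment_le (rowLaw_isNormalizedSubgaussian h hb hx) (by positivity)).trans
    (le_of_eq ?_)
  rw [div_pow]
  field_simp
  norm_num

/-- In a flat direction the fourth moment is nearly Gaussian. -/
lemma abs_rowLaw_fourth_moment_sub_three_le (h : IsNormalizedSubgaussian b μ) (hb : 0 < b)
    (hn : 0 < n) {x : Fin n → ℝ} (hx : ∑ j, x j ^ 2 = 1) (hf : Flat x) :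
    |∫ g, g ^ 4 ∂(rowLaw μ x) - 3| ≤ 4 / b ^ 2 / √n := by
  have hn' : (0 : ℝ) < n := by positivity
  have hb1 := h.le_one hb
  have h4 := (rowLaw_moments h hb x).2.2.2
  rw [hx] at h4
  have hk := fourth_moment_le h hb
  have hk0 : 0 ≤ ∫ x, x ^ 4 ∂μ := integral_nonneg fun x => by positivity
  have hs0 : 0 ≤ ∑ j, x j ^ 4 := Finset.sum_nonneg fun j _ => by positivity
  have h4b : 4 ≤ 4 / b ^ 2 := by
    rw [le_div_iff₀ (by positivity)]
    have : b ^ 2 ≤ 1 := pow_le_one₀ hb.le hb1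
    linarith
  have hs : ∑ j, x j ^ 4 ≤ 1 / √n := by
    have e1 : ((n : ℝ) ^ (-(1 / 4) : ℝ)) ^ 2 = 1 / √n := by
      rw [← rpow_natCast, ← rpow_mul hn'.le, sqrt_eq_rpow, one_div (_ ^ _), ← rpow_neg hn'.le]
      norm_num
    calc ∑ j, x j ^ 4 ≤ ∑ j, 1 / √n * x j ^ 2 := by
          refine Finset.sum_le_sum fun j _ => ?_
          have : x j ^ 2 ≤ 1 / √n := by
            rw [← e1, ← sq_abs]
            gcongr
            exact hf j
          calc x j ^ 4 = x j ^ 2 * x j ^ 2 := by ring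
            _ ≤ _ := by gcongr
      _ = 1 / √n := by rw [← Finset.mul_sum, hx, mul_one]
  have e2 : ∫ g, g ^ 4 ∂(rowLaw μ x) - 3 = (∫ x, x ^ 4 ∂μ - 3) * ∑ j, x j ^ 4 := by
    rw [h4]; ring
  rw [e2, abs_mul, abs_of_nonneg hs0]
  calc |∫ x, x ^ 4 ∂μ - 3| * ∑ j, x j ^ 4 ≤ 4 / b ^ 2 * (1 / √n) := by
        gcongr
        rw [abs_le]
        constructor <;> linarith
    _ = _ := by ring

lemma tendsto_log_div_sqrt : Tendsto (fun n : ℕ => log n / √(n : ℝ)) atTop (𝓝 0) := by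
  have h := (isLittleO_log_rpow_atTop (r := 1 / 2) (by norm_num)).tendsto_div_nhds_zero
  refine (h.comp tendsto_natCast_atTop_atTop).congr fun n => ?_
  simp [sqrt_eq_rpow]

lemma tendsto_inv_sqrt : Tendsto (fun n : ℕ => 1 / √(n : ℝ)) atTop (𝓝 0) := by
  refine (tendsto_natCast_rpow_neg (a := 1 / 2) (by norm_num)).congr fun n => ?_
  rw [rpow_neg (Nat.cast_nonneg n), sqrt_eq_rpow, one_div (_ ^ _)]

/-- The drift of the logarithmic norm is `O(1/n)`, and at most `3/(4n)` in flat directions. -/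
lemma drift_le {c : ℝ} (hb : 0 < b) (hc0 : 0 < c) :
    ∀ᶠ n : ℕ in atTop, ∀ μ : Measure ℝ, IsNormalizedSubgaussian b μ →
      ∀ x : Fin n → ℝ, ∑ j, x j ^ 2 = 1 →
        |∫ y : Fin n → ℝ, logStep (c / 4 * log n) y ∂(Measure.pi fun _ => rowLaw μ x)| ≤
          1024 / b ^ 2 / n ∧
        (Flat x → |∫ y : Fin n → ℝ, logStep (c / 4 * log n) y ∂(Measure.pi fun _ => rowLaw μ x)| ≤
          3 / 4 / n) := by
  have hK := cubeConst_pos (b := b / 16) (by positivity)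
  set K := cubeConst (b / 16)
  have t1 := tendsto_log_div_sqrt.const_mul (16 * (c / 4) * K)
  have t2 := tendsto_inv_sqrt.const_mul (4 / b ^ 2)
  rw [mul_zero] at t1 t2
  have t3 : Tendsto (fun n : ℕ => c / 4 * log (n : ℝ)) atTop atTop :=
    (tendsto_log_atTop.comp tendsto_natCast_atTop_atTop).const_mul_atTop (by positivity)
  filter_upwards [t1.eventually_le_const (by norm_num : (0 : ℝ) < 1 / 8),
    t2.eventually_le_const (by norm_num : (0 : ℝ) < 1 / 8), eventually_gt_atTop 0,
    t3.eventually_ge_atTop 1] with n h1 h2 hn hL μ hμ x hx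
  have hn' : (0 : ℝ) < n := by positivity
  have hs : 0 < √(n : ℝ) := sqrt_pos.2 hn'
  have hb1 := hμ.le_one hb
  have hrow := rowLaw_isNormalizedSubgaussian hμ hb hx
  have h3 := logStep_mean (n := n) hrow (by positivity) hn hL
  set m := ∫ y : Fin n → ℝ, logStep (c / 4 * log n) y ∂(Measure.pi fun _ => rowLaw μ x)
  set κ := ∫ g, g ^ 4 ∂(rowLaw μ x) with hκ
  have e1 : 16 * (c / 4 * log n) * (K / (n * √n)) ≤ 1 / 8 / n := by
    calc _ = 16 * (c / 4) * K * (log n / √n) / n := by field_simp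
      _ ≤ _ := by gcongr
  have h4 := abs_le.1 (h3.trans e1)
  have hB : 4 ≤ 4 / b ^ 2 := by
    rw [le_div_iff₀ (by positivity)]
    have : b ^ 2 ≤ 1 := pow_le_one₀ hb.le hb1
    linarith
  constructor
  · have hκ0 : 0 ≤ κ := integral_nonneg fun x => by positivity
    have hκ1 := rowLaw_fourth_moment_le hμ hb hx
    rw [← hκ] at hκ1
    have e2 : (κ - 1) / (4 * n) = (κ / 4 - 1 / 4) / n := by field_simp
    have e3 : (κ / 4 - 1 / 4) / n ≤ (256 / b ^ 2) / n := by
      gcongr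
      calc κ / 4 - 1 / 4 ≤ (1024 / b ^ 2) / 4 := by linarith
        _ = _ := by ring
    have e4 : (-(1 / 4)) / n ≤ (κ / 4 - 1 / 4) / n := by gcongr; linarith
    have e5 : (256 / b ^ 2) / n + 1 / 8 / n ≤ 1024 / b ^ 2 / n := by
      rw [← add_div]
      gcongr
      have : 1024 / b ^ 2 = 256 / b ^ 2 + 192 * (4 / b ^ 2) := by ring
      linarith
    have e6 : 1 / 4 / n + 1 / 8 / n ≤ 1024 / b ^ 2 / n := by
      rw [← add_div]
      gcongr
      have : 1024 / b ^ 2 = 256 * (4 / b ^ 2) := by ring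
      linarith
    rw [e2] at h4
    rw [neg_div] at e4
    rw [abs_le]
    constructor <;> linarith
  · intro hf
    have h5 := abs_rowLaw_fourth_moment_sub_three_le hμ hb hn hx hf
    rw [← hκ] at h5
    have h6 : |κ - 3| ≤ 1 / 8 := h5.trans (by
      calc _ = 4 / b ^ 2 * (1 / √n) := by ring
        _ ≤ _ := h2)
    have h7 := abs_le.1 h6
    have e2 : (κ - 1) / (4 * n) = (κ / 4 - 1 / 4) / n := by field_simp
    have e3 : (κ / 4 - 1 / 4) / n ≤ (5 / 8) / n := by gcongr; linarith
    have e4 : 0 ≤ (κ / 4 - 1 / 4) / n := div_nonneg (by linarith) hn'.le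
    rw [e2] at h4
    have e5 : 5 / 8 / n + 1 / 8 / (n : ℝ) = 3 / 4 / n := by ring
    have e6 : 0 ≤ 5 / 8 / (n : ℝ) := by positivity
    rw [abs_le]
    constructor <;> linarith

variable {c L : ℝ} {x₀ : Fin n → ℝ}
  {Ω : Type*} [MeasurableSpace Ω] {P : Measure Ω} [IsProbabilityMeasure P]
  {X : ℕ × Fin n × Fin n → Ω → ℝ}

open Classical in
/-- Indicator of the directions that are not flat. -/
noncomputable def notFlat (x : Fin n → ℝ) : ℝ := if Flat x then 0 else 1

lemma measurable_notFlat : Measurable (notFlat (n := n)) := by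
  classical
  exact Measurable.ite (measurableSet_flat n) measurable_const measurable_const

lemma notFlat_nonneg (x : Fin n → ℝ) : 0 ≤ notFlat x := by
  unfold notFlat; split_ifs <;> norm_num

lemma notFlat_le_one (x : Fin n → ℝ) : notFlat x ≤ 1 := by
  unfold notFlat; split_ifs <;> norm_num

/-- Exponential supermartingale bound for the accumulated log-norm; the weight `D` charges a
non-flat direction in advance for the excess drift of the step that follows it. -/
lemma exp_chain_tail [IsProbabilityMeasure μ] {l D r : ℝ} (hD : 0 ≤ D) (hn : 0 < n)
    (h0 : Admissible c x₀)
    (hX : ∀ e, Measurable (X e)) (hi : iIndepFun X P) (hμ : ∀ e, P.map (X e) = μ)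
    (h : ∀ x : Fin n → ℝ, Admissible c x →
      Integrable (fun y => exp (l * logStep L y + D * notFlat (advance c x₀ y)))
        (Measure.pi fun _ : Fin n => rowLaw μ x) ∧
      ∫ y, exp (l * logStep L y + D * notFlat (advance c x₀ y))
          ∂(Measure.pi fun _ : Fin n => rowLaw μ x) ≤ exp (D * notFlat x + r)) (N : ℕ) (T : ℝ) :
    P.real {ω | T ≤ l * (chainState c L x₀ (fun e => X e ω) N).2} ≤
      exp (D + N * r - T) := by
  set F : (Fin n → ℝ) × ℝ → ENNReal := fun p => ENNReal.ofReal (exp (l * p.2 + D * notFlat p.1))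
    with hF
  have hFm : Measurable F :=
    ((measurable_snd.const_mul l).add
      ((measurable_notFlat.comp measurable_fst).const_mul D)).exp.ennreal_ofReal
  -- The initial direction need not be flat, which costs the factor `exp D`.
  have key : ∀ k : ℕ, ∫⁻ ω, F (chainState c L x₀ (fun e => X e ω) k) ∂P ≤
      ENNReal.ofReal (exp (D + k * r)) := by
    intro k
    induction k with
    | zero =>
      simp only [chainState, hF, lintegral_const, measure_univ, mul_one]
      refine ENNReal.ofReal_le_ofReal (exp_le_exp.2 ?_)
      have := mul_le_mul_of_nonneg_left (notFlat_le_one x₀) hD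
      simp
      linarith
    | succ k ih =>
      have hm : Measurable fun p : ((Fin n → ℝ) × ℝ) × (Fin n → ℝ) =>
          F (advance c x₀ p.2, p.1.2 + logStep L p.2) :=
        hFm.comp (((measurable_advance c x₀).comp measurable_snd).prodMk
          (measurable_fst.snd.add ((measurable_logStep L).comp measurable_snd)))
      have h1 := lintegral_chain (c := c) (L := L) (x₀ := x₀) hX hi hμ k hm
      simp only [chainState_succ]
      simp only at h1
      rw [h1]
      calc _ ≤ ∫⁻ ω, ENNReal.ofReal (exp r) * F (chainState c L x₀ (fun e => X e ω) k) ∂P := by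
            refine lintegral_mono fun ω => ?_
            set p := chainState c L x₀ (fun e => X e ω) k with hp
            obtain ⟨h2, h3⟩ := h p.1 (admissible_chainState hn h0 _ k)
            have e1 : ∀ y, F (advance c x₀ y, p.2 + logStep L y) =
                ENNReal.ofReal (exp (l * p.2)) *
                  ENNReal.ofReal (exp (l * logStep L y + D * notFlat (advance c x₀ y))) := by
              intro y
              rw [← ENNReal.ofReal_mul (exp_pos _).le, ← exp_add]
              simp only [hF]
              congr 2; ring
            simp only [e1]
            rw [lintegral_const_mul _ (by
                exact (((measurable_logStep L).const_mul l).add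
                  ((measurable_notFlat.comp (measurable_advance c x₀)).const_mul
                    D)).exp.ennreal_ofReal),
              ← ofReal_integral_eq_lintegral_ofReal h2 (ae_of_all _ fun y => (exp_pos _).le)]
            simp only [hF]
            rw [← ENNReal.ofReal_mul (exp_pos _).le, ← ENNReal.ofReal_mul (exp_pos _).le]
            refine ENNReal.ofReal_le_ofReal ?_
            calc _ ≤ exp (l * p.2) * exp (D * notFlat p.1 + r) := by gcongr
              _ = _ := by rw [← exp_add, ← exp_add]; congr 1; ring
        _ ≤ ENNReal.ofReal (exp r) * ENNReal.ofReal (exp (D + k * r)) := by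
            have hm2 : Measurable fun ω => F (chainState c L x₀ (fun e => X e ω) k) :=
              hFm.comp (measurable_chainState_comp hX k)
            rw [lintegral_const_mul _ hm2]
            gcongr
        _ = _ := by
            rw [← ENNReal.ofReal_mul (exp_pos _).le, ← exp_add]
            congr 2; push_cast; ring
  rw [measureReal_def]
  refine ENNReal.toReal_le_of_le_ofReal (exp_pos _).le ?_
  have h1 : P {ω | T ≤ l * (chainState c L x₀ (fun e => X e ω) N).2} ≤
      P {ω | ENNReal.ofReal (exp T) ≤ F (chainState c L x₀ (fun e => X e ω) N)} := by
    refine measure_mono fun ω hω => ?_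
    refine ENNReal.ofReal_le_ofReal (exp_le_exp.2 ?_)
    have h2 : T ≤ l * (chainState c L x₀ (fun e => X e ω) N).2 := hω
    have := mul_nonneg hD (notFlat_nonneg (chainState c L x₀ (fun e => X e ω) N).1)
    linarith
  have h2 := meas_ge_le_lintegral_div
    (hFm.comp (measurable_chainState_comp (c := c) (L := L) (x₀ := x₀) hX N)).aemeasurable
    (μ := P) (ε := ENNReal.ofReal (exp T)) (by simp [exp_pos]) (by simp)
  refine h1.trans (h2.trans ?_)
  calc _ ≤ ENNReal.ofReal (exp (D + N * r)) / ENNReal.ofReal (exp T) := by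
        gcongr
        exact key N
    _ = _ := by
        rw [← ENNReal.ofReal_div_of_pos (exp_pos _), ← exp_sub]

end

/-! ### Upper tail of the log-norm -/

section

variable {b : ℝ} {n : ℕ} {μ γ : Measure ℝ} {c L : ℝ}

lemma logStep_exp_le (h : IsNormalizedSubgaussian b γ) (hb : 0 < b) (hn : 0 < n) (hL : 1 ≤ L)
    (l : ℝ) :
    Integrable (fun y : Fin n → ℝ => exp (l * logStep L y)) (Measure.pi fun _ => γ) ∧
    ∫ y : Fin n → ℝ, exp (l * logStep L y) ∂(Measure.pi fun _ => γ) ≤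
      exp (l * ∫ y : Fin n → ℝ, logStep L y ∂(Measure.pi fun _ => γ) + 8 * l ^ 2 / logRate b L n) := by
  obtain ⟨h1, h2⟩ := logStep_mgf (n := n) h hb hn hL l
  set m := ∫ y : Fin n → ℝ, logStep L y ∂(Measure.pi fun _ => γ)
  have e : ∀ y : Fin n → ℝ, exp (l * logStep L y) = exp (l * m) * exp (l * (logStep L y - m)) :=
    fun y => by rw [← exp_add]; congr 1; ring
  simp only [e]
  refine ⟨h1.const_mul _, ?_⟩
  rw [integral_const_mul, exp_add]
  gcongr

/-- One step of the exponential supermartingale, taking into account that the next direction is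
flat with overwhelming probability. -/
lemma logStep_exp_notFlat_le (hμ : IsNormalizedSubgaussian b μ) (hb : 0 < b) (hn : 0 < n)
    (hL : 1 ≤ L) {l D m' ε : ℝ} (hD1 : D ≤ 1) {x₀ x : Fin n → ℝ}
    (hx : ∑ j, x j ^ 2 = 1)
    (hirr : (Measure.pi fun _ : Fin n => rowLaw μ x).real (irregular n c) ≤ ε)
    (hm : l * ∫ y : Fin n → ℝ, logStep L y ∂(Measure.pi fun _ => rowLaw μ x) ≤
      D * notFlat x + m') :
    Integrable (fun y => exp (l * logStep L y + D * notFlat (advance c x₀ y)))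
        (Measure.pi fun _ : Fin n => rowLaw μ x) ∧
      ∫ y, exp (l * logStep L y + D * notFlat (advance c x₀ y))
          ∂(Measure.pi fun _ : Fin n => rowLaw μ x) ≤
        exp (D * notFlat x + (m' + 16 * l ^ 2 / logRate (b / 16) L n + 4 * ε)) := by
  have := hμ.prob
  have hrow := rowLaw_isNormalizedSubgaussian hμ hb hx
  obtain ⟨h1, h2⟩ := logStep_exp_le (n := n) hrow (by positivity) hn hL (2 * l)
  set π' := Measure.pi fun _ : Fin n => rowLaw μ x
  set m := ∫ y : Fin n → ℝ, logStep L y ∂π'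
  set R := logRate (b / 16) L n
  have hnf : Measurable fun y : Fin n → ℝ => notFlat (advance c x₀ y) :=
    measurable_notFlat.comp (measurable_advance c x₀)
  set g : (Fin n → ℝ) → ℝ := fun y => 1 + (irregular n c).indicator (fun _ => exp 2) y with hg
  have hgi : Integrable g π' := (integrable_const _).add
    ((integrable_const _).indicator (measurableSet_irregular n c))
  have hgint : ∫ y, g y ∂π' ≤ exp (8 * ε) := by
    simp only [hg]
    rw [integral_add (integrable_const _)
      ((integrable_const _).indicator (measurableSet_irregular n c)),
      integral_indicator (measurableSet_irregular n c)]
    simp only [integral_const, probReal_univ, smul_eq_mul, measureReal_restrict_apply_univ, one_mul]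
    have h8 : exp 2 ≤ (8 : ℝ) := by
      have e2 : exp (2 : ℝ) = exp 1 ^ 2 := by rw [← exp_nat_mul]; norm_num
      have := exp_one_lt_d9
      have := exp_pos 1
      rw [e2]; nlinarith
    have hε0 : 0 ≤ ε := measureReal_nonneg.trans hirr
    calc 1 + π'.real (irregular n c) * exp 2 ≤ 1 + ε * 8 := by gcongr
      _ ≤ _ := by have := add_one_le_exp (8 * ε); linarith
  set A := exp (l * m + 16 * l ^ 2 / R) with hA
  set B := exp (4 * ε) with hB
  have hA0 : 0 < A := exp_pos _
  have hB0 : 0 < B := exp_pos _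
  have hA2 : ∫ y, exp (2 * l * logStep L y) ∂π' ≤ A ^ 2 := by
    refine h2.trans (le_of_eq ?_)
    rw [hA, ← exp_nat_mul]; congr 1; push_cast; ring
  have hB2 : ∫ y, g y ∂π' ≤ B ^ 2 := by
    refine hgint.trans (le_of_eq ?_)
    rw [hB, ← exp_nat_mul]; congr 1; push_cast; ring
  set G : (Fin n → ℝ) → ℝ := fun y =>
    B / A / 2 * exp (2 * l * logStep L y) + A / B / 2 * g y with hG
  have hGi : Integrable G π' := (h1.const_mul _).add (hgi.const_mul _)
  -- The weighted arithmetic-geometric mean inequality, with weights that make it as strong as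
  -- Cauchy-Schwarz after integration.
  have hpt : ∀ y, exp (l * logStep L y + D * notFlat (advance c x₀ y)) ≤ G y := by
    intro y
    have hb' : exp (D * notFlat (advance c x₀ y)) ^ 2 ≤ g y := by
      simp only [hg]
      by_cases hy : y ∈ irregular n c
      · rw [Set.indicator_of_mem hy, ← exp_nat_mul]
        have : exp (((2 : ℕ) : ℝ) * (D * notFlat (advance c x₀ y))) ≤ exp 2 := by
          rw [exp_le_exp]
          push_cast
          have := mul_le_mul hD1 (notFlat_le_one (advance c x₀ y)) (notFlat_nonneg _) zero_le_one
          linarith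
        linarith
      · have hf := flat_advance hn (x₀ := x₀) hy
        rw [Set.indicator_of_notMem hy, notFlat, if_pos hf]
        simp
    have ha' : exp (l * logStep L y) ^ 2 = exp (2 * l * logStep L y) := by
      rw [← exp_nat_mul]; congr 1; push_cast; ring
    rw [exp_add]
    simp only [hG]
    rw [← ha']
    generalize exp (l * logStep L y) = u
    generalize exp (D * notFlat (advance c x₀ y)) = v at hb'
    calc u * v ≤ B / A / 2 * u ^ 2 + A / B / 2 * v ^ 2 := by
          have e1 : B / A / 2 * u ^ 2 + A / B / 2 * v ^ 2 - u * v =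
              (B * u - A * v) ^ 2 / (2 * A * B) := by field_simp; ring
          have : 0 ≤ (B * u - A * v) ^ 2 / (2 * A * B) := by positivity
          linarith
      _ ≤ _ := by gcongr
  have hmeas : Measurable fun y : Fin n → ℝ =>
      exp (l * logStep L y + D * notFlat (advance c x₀ y)) :=
    (((measurable_logStep L).const_mul l).add (hnf.const_mul D)).exp
  have hint : Integrable (fun y => exp (l * logStep L y + D * notFlat (advance c x₀ y))) π' :=
    hGi.mono' hmeas.aestronglyMeasurable (ae_of_all _ fun y => by
      rw [norm_of_nonneg (exp_pos _).le]; exact hpt y)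
  refine ⟨hint, ?_⟩
  calc _ ≤ ∫ y, G y ∂π' := integral_mono hint hGi hpt
    _ = B / A / 2 * ∫ y, exp (2 * l * logStep L y) ∂π' + A / B / 2 * ∫ y, g y ∂π' := by
        simp only [hG]
        rw [integral_add (h1.const_mul _) (hgi.const_mul _), integral_const_mul,
          integral_const_mul]
    _ ≤ B / A / 2 * A ^ 2 + A / B / 2 * B ^ 2 := by gcongr
    _ = A * B := by field_simp; ring
    _ ≤ _ := by
        rw [hA, hB, ← exp_add, exp_le_exp]
        linarith

/-- Upper tail of the accumulated log-norm, for both signs. -/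
lemma chain_tail (hb : 0 < b) (hc0 : 0 < c) (hc : c ≤ 1 / 5) :
    ∀ᶠ n : ℕ in atTop, ∀ μ : Measure ℝ, IsNormalizedSubgaussian b μ →
      ∀ x₀ : Fin n → ℝ, Admissible c x₀ →
      ∀ (Ω : Type*) [MeasurableSpace Ω] (P : Measure Ω) [IsProbabilityMeasure P]
        (X : ℕ × Fin n × Fin n → Ω → ℝ), (∀ e, Measurable (X e)) → iIndepFun X P →
        (∀ e, P.map (X e) = μ) → ∀ N : ℕ, ∀ t : ℝ, 1 / (n : ℝ) ≤ t →
        P.real {ω | t * N ≤ |(chainState c (c / 4 * log n) x₀ (fun e => X e ω) N).2|} ≤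
          6 * exp (-(t ^ 2 * N * logRate (b / 16) (c / 4 * log n) n / 2048)) := by
  have hb16 : 0 < b / 16 := by positivity
  have hBc := bernsteinConst_pos hb16
  set Bc := bernsteinConst (b / 16) with hBcdef
  set Cm := 1024 / b ^ 2 with hCm
  have hCm0 : 0 < Cm := by positivity
  have t3 : Tendsto (fun n : ℕ => c / 4 * log (n : ℝ)) atTop atTop :=
    (tendsto_log_atTop.comp tendsto_natCast_atTop_atTop).const_mul_atTop (by positivity)
  have t4 := (tendsto_rpow_mul_exp_neg_rpow (k := 1) (a := 1 / 4) (s := 2) one_pos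
    (by norm_num)).const_mul (8192 : ℝ)
  rw [mul_zero] at t4
  have t5 : ∀ᶠ n : ℕ in atTop, 1 ≤ logRate (b / 16) (c / 4 * log n) n := by
    have t6 := ((isLittleO_log_rpow_atTop (r := 1 / 2) (by norm_num)).tendsto_div_nhds_zero).comp
      tendsto_natCast_atTop_atTop
    have t7 := (t6.mul t6).const_mul (64 * (c / 4) ^ 2 / Bc)
    simp only [mul_zero] at t7
    filter_upwards [t7.eventually_le_const zero_lt_one, eventually_gt_atTop 1] with n h hn
    have hn' : (0 : ℝ) < n := by positivity
    have hlog : 0 < log (n : ℝ) := log_pos (by exact_mod_cast hn)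
    simp only [Function.comp_apply] at h
    rw [← sqrt_eq_rpow] at h
    have hss : √(n : ℝ) * √n = n := mul_self_sqrt hn'.le
    rw [logRate, ← hBcdef, one_le_div (by positivity)]
    have e1 : 64 * (c / 4) ^ 2 / Bc * (log n / √n * (log n / √n)) =
        64 * (c / 4 * log n) ^ 2 / (Bc * n) := by
      rw [div_mul_div_comm, hss]; field_simp
    rw [e1, div_le_one (by positivity)] at h
    exact h
  have t8 : ∀ᶠ n : ℕ in atTop, Cm ^ 2 * Bc ≤ n := by
    exact tendsto_natCast_atTop_atTop.eventually_ge_atTop _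
  filter_upwards [drift_le hb hc0, irregular_prob_le hb hc0 hc, t3.eventually_ge_atTop 1,
    t4.eventually_le_const zero_lt_one, t5, t8, eventually_gt_atTop 0]
    with n hdrift hirr hL hexp hR1 hnC hn μ hμ x₀ h0 Ω _ P _ X hX hi hlaw N t ht
  have := hμ.prob
  have hn' : (0 : ℝ) < n := by positivity
  have ht0 : 0 < t := lt_of_lt_of_le (by positivity) ht
  set L := c / 4 * log n with hLdef
  set R := logRate (b / 16) L n with hR
  have hRn : R ≤ Bc * n / 64 := by
    rw [hR, logRate]
    gcongr
    nlinarith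
  -- The parameter has either sign and modulus `t R / 128`: the drift, at most `3 / 4` of the gain
  -- `|l| t`, then leaves room for the quadratic term `16 l² / R`.
  have key : ∀ l : ℝ, |l| = t * R / 128 →
      P.real {ω | |l| * (t * N) ≤ l * (chainState c L x₀ (fun e => X e ω) N).2} ≤
        3 * exp (-(t ^ 2 * N * R / 2048)) := by
    intro l hl
    have hl2 : l ^ 2 = (t * R / 128) ^ 2 := by rw [← hl, sq_abs]
    have hl0 : 0 ≤ |l| := abs_nonneg l
    have e16 : 16 * l ^ 2 / R = t ^ 2 * R / 1024 := by rw [hl2]; field_simp; norm_num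
    have hlm : ∀ m B : ℝ, |m| ≤ B → l * m ≤ |l| * B := fun m B h =>
      (le_abs_self _).trans (by rw [abs_mul]; gcongr)
    -- For `t` comparable to `1 / n` the sharp drift in flat directions is needed, and the others
    -- are charged to `D`. For larger `t` the crude drift `Cm / n` is at most `t / 4`.
    by_cases hcase : t ≤ 4 * Cm / n
    · set D := Cm / n * |l| with hD
      have hD0 : 0 ≤ D := by positivity
      have hD1 : D ≤ 1 := by
        rw [hD, hl]
        calc Cm / n * (t * R / 128) ≤ Cm / n * (4 * Cm / n * (Bc * n / 64) / 128) := by gcongr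
          _ = Cm ^ 2 * Bc / n / 2048 := by field_simp; norm_num
          _ ≤ 1 / 2048 := by gcongr; exact (div_le_one hn').2 hnC
          _ ≤ 1 := by norm_num
      set ε := exp (-((n : ℝ) ^ (1 / 4 : ℝ)))
      have h1 := exp_chain_tail (c := c) (L := L) (l := l) (D := D)
        (r := 3 / 4 / n * |l| + 16 * l ^ 2 / R + 4 * ε) hD0 hn h0 hX hi hlaw (fun x hx => by
          refine logStep_exp_notFlat_le hμ hb hn hL hD1 hx.1 (hirr μ hμ x hx.1) ?_
          obtain ⟨d1, d2⟩ := hdrift μ hμ x hx.1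
          by_cases hf : Flat x
          · rw [notFlat, if_pos hf, mul_zero, zero_add, mul_comm]
            rw [mul_comm]
            refine (hlm _ _ (d2 hf)).trans (le_of_eq (mul_comm _ _))
          · rw [notFlat, if_neg hf, mul_one]
            have : 0 ≤ 3 / 4 / (n : ℝ) * |l| := by positivity
            have := hlm _ _ d1
            rw [mul_comm] at this
            linarith) N (|l| * (t * N))
      refine h1.trans ?_
      have hε : 4 * ε ≤ t ^ 2 * R / 2048 := by
        have e1 : 8192 * ε ≤ 1 / (n : ℝ) ^ 2 := by
          rw [le_div_iff₀ (by positivity)]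
          rw [one_mul] at hexp
          calc _ = 8192 * ((n : ℝ) ^ (2 : ℝ) * ε) := by
                rw [show (2 : ℝ) = ((2 : ℕ) : ℝ) by norm_num, rpow_natCast]; ring
            _ ≤ 1 := hexp
        have e2 : 1 / (n : ℝ) ^ 2 ≤ t ^ 2 := by
          rw [← one_div_pow]; gcongr
        have e3 : t ^ 2 * 1 ≤ t ^ 2 * R := by gcongr
        linarith
      have h3 : 3 / 4 / n * |l| ≤ 3 / 4 * t * |l| := by
        gcongr
        calc 3 / 4 / (n : ℝ) = 3 / 4 * (1 / n) := by ring
          _ ≤ _ := by gcongr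
      have h4 : |l| * t = t ^ 2 * R / 128 := by rw [hl]; ring
      have h5 : 3 / 4 / n * |l| + 16 * l ^ 2 / R + 4 * ε - |l| * t ≤ -(t ^ 2 * R / 2048) := by
        rw [e16]
        have e4 : 3 / 4 * t * |l| = 3 / 4 * (t ^ 2 * R / 128) := by rw [← h4]; ring
        have : 0 ≤ t ^ 2 * R := by positivity
        linarith
      calc _ ≤ exp (1 + -(t ^ 2 * N * R / 2048)) := by
            rw [exp_le_exp]
            have := mul_le_mul_of_nonneg_left h5 (Nat.cast_nonneg (α := ℝ) N)
            linarith
        _ = exp 1 * exp (-(t ^ 2 * N * R / 2048)) := exp_add _ _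
        _ ≤ _ := by gcongr; linarith [exp_one_lt_d9]
    · push Not at hcase
      have h1 := exp_chain_tail (c := c) (L := L) (l := l) (D := 0)
        (r := Cm / n * |l| + 8 * l ^ 2 / R) le_rfl hn h0 hX hi hlaw (fun x hx => by
          have hrow := rowLaw_isNormalizedSubgaussian hμ hb hx.1
          obtain ⟨a1, a2⟩ := logStep_exp_le (n := n) hrow hb16 hn hL l
          simp only [zero_mul, add_zero, zero_add]
          refine ⟨a1, a2.trans (exp_le_exp.2 ?_)⟩
          have := hlm _ _ (hdrift μ hμ x hx.1).1
          rw [mul_comm (Cm / n)]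
          linarith) N (|l| * (t * N))
      refine h1.trans ?_
      have h3 : Cm / n * |l| ≤ 1 / 4 * t * |l| := by
        gcongr
        calc Cm / (n : ℝ) = 1 / 4 * (4 * Cm / n) := by ring
          _ ≤ _ := by gcongr
      have h4 : |l| * t = t ^ 2 * R / 128 := by rw [hl]; ring
      have h5 : Cm / n * |l| + 8 * l ^ 2 / R - |l| * t ≤ -(t ^ 2 * R / 2048) := by
        have e5 : 8 * l ^ 2 / R = 16 * l ^ 2 / R / 2 := by ring
        rw [e5, e16]
        have e4 : 1 / 4 * t * |l| = 1 / 4 * (t ^ 2 * R / 128) := by rw [← h4]; ring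
        have : 0 ≤ t ^ 2 * R := by positivity
        linarith
      calc _ ≤ exp (-(t ^ 2 * N * R / 2048)) := by
            rw [exp_le_exp]
            have := mul_le_mul_of_nonneg_left h5 (Nat.cast_nonneg (α := ℝ) N)
            linarith
        _ ≤ _ := by linarith [exp_pos (-(t ^ 2 * N * R / 2048))]
  have hl0 : 0 < t * R / 128 := by positivity
  have k1 := key (t * R / 128) (abs_of_pos hl0)
  have k2 := key (-(t * R / 128)) (by rw [abs_neg, abs_of_pos hl0])
  rw [abs_of_pos hl0] at k1
  rw [abs_neg, abs_of_pos hl0] at k2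
  have hsub : {ω | t * N ≤ |(chainState c L x₀ (fun e => X e ω) N).2|} ⊆
      {ω | t * R / 128 * (t * N) ≤ t * R / 128 * (chainState c L x₀ (fun e => X e ω) N).2} ∪
      {ω | t * R / 128 * (t * N) ≤ -(t * R / 128) * (chainState c L x₀ (fun e => X e ω) N).2} := by
    intro ω hω
    rcases le_abs.1 (show t * N ≤ |(chainState c L x₀ (fun e => X e ω) N).2| from hω) with h | h
    · exact Or.inl (mul_le_mul_of_nonneg_left h hl0.le)
    · right
      show t * R / 128 * (t * N) ≤ _
      rw [neg_mul, ← mul_neg]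
      exact mul_le_mul_of_nonneg_left h hl0.le
  have := (measureReal_mono (μ := P) hsub).trans (measureReal_union_le _ _)
  linarith

end

/-! ### Unstructured vectors -/

/-- Unstructured vectors carry a fixed share of their energy in small coordinates: otherwise
rounding the large coordinates of `θ x`, for `θ = 3/2 n^c`, would exhibit a small common
denominator. -/
lemma tailEnergy_of_unstructured {n : ℕ} (hn : 0 < n) {c : ℝ}
    {x : EuclideanSpace ℝ (Fin n)} (hx : x ∈ unstructured n c) :
    ∑ j, x.ofLp j ^ 2 = 1 ∧ 1 / 16 ≤ tailEnergy ((n : ℝ) ^ (-c)) x.ofLp := by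
  obtain ⟨hx1, hx2⟩ := hx
  have hn' : (0 : ℝ) < n := by positivity
  have hsum : ∑ j, x.ofLp j ^ 2 = 1 := by
    rw [← EuclideanSpace.real_norm_sq_eq, hx1]; norm_num
  refine ⟨hsum, ?_⟩
  by_contra hE
  push Not at hE
  set z := (n : ℝ) ^ c with hz
  have hz0 : 0 < z := by positivity
  set θ := 3 / 2 * z with hθ
  have hθ0 : 0 < θ := by positivity
  have hδ : (n : ℝ) ^ (-c) = 1 / z := by rw [rpow_neg hn'.le, one_div]
  -- The lattice point: small coordinates are replaced by zero, at the cost of their energy; the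
  -- others are rounded, and exceed `3 / 2` in size after scaling, so rounding costs at most a ninth
  -- of their energy.
  set p : Fin n → ℤ := fun j =>
    if |x.ofLp j| ≤ (n : ℝ) ^ (-c) then 0 else round (θ * x.ofLp j) with hp
  have hterm : ∀ j, (θ * x.ofLp j - p j) ^ 2 ≤ θ ^ 2 * (x.ofLp j ^ 2 / 9 +
      if |x.ofLp j| ≤ (n : ℝ) ^ (-c) then x.ofLp j ^ 2 else 0) := by
    intro j
    simp only [hp]
    split_ifs with h
    · have : 0 ≤ θ ^ 2 * (x.ofLp j ^ 2 / 9) := by positivity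
      simp only [Int.cast_zero, sub_zero, mul_pow]
      linarith
    · push Not at h
      rw [hδ, div_lt_iff₀ hz0] at h
      have h1 : (θ * x.ofLp j - round (θ * x.ofLp j)) ^ 2 ≤ (1 / 2) ^ 2 := by
        rw [← sq_abs]
        gcongr
        exact abs_sub_round _
      have h2 : 1 ≤ (|x.ofLp j| * z) ^ 2 := one_le_pow₀ h.le
      rw [mul_pow, sq_abs] at h2
      have h3 : θ ^ 2 * (x.ofLp j ^ 2 / 9 + 0) = 1 / 4 * (x.ofLp j ^ 2 * z ^ 2) := by
        rw [hθ]; ring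
      rw [h3]
      linarith
  have hdist : dist (θ • x) (WithLp.toLp 2 fun j => (p j : ℝ)) < θ / 2 := by
    rw [EuclideanSpace.dist_eq, sqrt_lt' (by positivity)]
    calc ∑ j, dist ((θ • x).ofLp j) (p j : ℝ) ^ 2
        = ∑ j, (θ * x.ofLp j - p j) ^ 2 := by
          refine Finset.sum_congr rfl fun j _ => ?_
          rw [Real.dist_eq, sq_abs]; rfl
      _ ≤ ∑ j, θ ^ 2 * (x.ofLp j ^ 2 / 9 +
          if |x.ofLp j| ≤ (n : ℝ) ^ (-c) then x.ofLp j ^ 2 else 0) :=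
          Finset.sum_le_sum fun j _ => hterm j
      _ = θ ^ 2 * (1 / 9 + tailEnergy ((n : ℝ) ^ (-c)) x.ofLp) := by
          rw [← Finset.mul_sum, Finset.sum_add_distrib, ← Finset.sum_div, hsum, tailEnergy]
      _ < θ ^ 2 * (1 / 9 + 1 / 16) := by gcongr
      _ ≤ (θ / 2) ^ 2 := by nlinarith [sq_nonneg θ]
  have hinf : Metric.infDist (θ • x) (intLattice n) < min (1 / 2 * ‖θ • x‖) z := by
    refine (Metric.infDist_le_dist_of_mem
      (show WithLp.toLp 2 (fun j => (p j : ℝ)) ∈ intLattice n from ⟨p, rfl⟩)).trans_lt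
      (hdist.trans_le (le_min ?_ ?_))
    · rw [norm_smul, hx1, norm_of_nonneg hθ0.le]; linarith
    · rw [hθ]; linarith
  have hle : LCD z (1 / 2) x ≤ (θ : EReal) := iInf₂_le θ ⟨hθ0, hinf⟩
  have h1 := EReal.coe_le_coe_iff.1 (hx2.trans hle)
  -- The denominator `3/2 z` is below `D = exp z`.
  have h2 := quadratic_le_exp_of_nonneg hz0.le
  rw [hθ] at h1
  nlinarith [sq_nonneg (z - 1)]

/-! ### Resampling and level crossing -/

section

variable {ι : Type*} [Fintype ι] {γ : Measure ℝ} [IsProbabilityMeasure γ]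

/-- Mixing the coordinates of two independent iid families along a fixed set of indices gives
again an iid family. -/
lemma map_mix_pi (p : ι → Prop) [DecidablePred p] :
    ((Measure.pi fun _ : ι => γ).prod (Measure.pi fun _ : ι => γ)).map
      (fun q e => if p e then q.2 e else q.1 e) = Measure.pi fun _ : ι => γ := by
  have hm : Measurable fun (q : (ι → ℝ) × (ι → ℝ)) e => if p e then q.2 e else q.1 e := by
    refine measurable_pi_lambda _ fun e => ?_
    by_cases h : p e
    · simp only [h, if_true]; exact (measurable_pi_apply e).comp measurable_snd
    · simp only [h, if_false]; exact (measurable_pi_apply e).comp measurable_fst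
  refine (Measure.pi_eq fun s hs => ?_).symm
  rw [Measure.map_apply hm (MeasurableSet.univ_pi hs)]
  have e1 : (fun (q : (ι → ℝ) × (ι → ℝ)) e => if p e then q.2 e else q.1 e) ⁻¹' Set.univ.pi s =
      (Set.univ.pi fun e => if p e then Set.univ else s e) ×ˢ
        (Set.univ.pi fun e => if p e then s e else Set.univ) := by
    ext q
    simp only [Set.mem_preimage, Set.mem_pi, Set.mem_univ, true_imp_iff, Set.mem_prod]
    constructor
    · intro h
      constructor <;> intro e <;> have := h e <;> by_cases hp : p e <;> simp_all
    · rintro ⟨h1, h2⟩ e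
      have := h1 e
      have := h2 e
      by_cases hp : p e <;> simp_all
  rw [e1, Measure.prod_prod, Measure.pi_pi, Measure.pi_pi, ← Finset.prod_mul_distrib]
  refine Finset.prod_congr rfl fun e _ => ?_
  by_cases hp : p e <;> simp [hp]

/-- The family that follows the second argument in the cells below `m` and the first argument in
the others. -/
def hybrid (cell : ι → ℕ) (m : ℕ) (q : (ι → ℝ) × (ι → ℝ)) : ι → ℝ :=
  fun e => if cell e < m then q.2 e else q.1 e

omit [Fintype ι] in
lemma measurable_hybrid (cell : ι → ℕ) (m : ℕ) : Measurable (hybrid cell m) := by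
  refine measurable_pi_lambda _ fun e => ?_
  unfold hybrid
  by_cases h : cell e < m
  · simp only [h, if_true]; exact (measurable_pi_apply e).comp measurable_snd
  · simp only [h, if_false]; exact (measurable_pi_apply e).comp measurable_fst

lemma measurePreserving_hybrid (cell : ι → ℕ) (m : ℕ) :
    MeasurePreserving (hybrid cell m)
      ((Measure.pi fun _ : ι => γ).prod (Measure.pi fun _ : ι => γ)) (Measure.pi fun _ : ι => γ) :=
  ⟨measurable_hybrid cell m, map_mix_pi fun e => cell e < m⟩

/-- Crossing lemma: if resampling one cell of an iid family changes `f` by more than `H` only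
rarely, then `f` takes values within `H` of any level `l` that it crosses with a fair
probability. -/
lemma crossing {f : (ι → ℝ) → ℝ} (hf : Measurable f) {cell : ι → ℕ} {B : ℕ}
    (hB : ∀ e, cell e < B) (l H : ℝ) :
    (Measure.pi fun _ : ι => γ).real {z | f z < l} *
        (Measure.pi fun _ : ι => γ).real {z | l ≤ f z} ≤
      B * (Measure.pi fun _ : ι => γ).real {z | |f z - l| ≤ H} +
      ∑ m ∈ Finset.range B,
        ((Measure.pi fun _ : ι => γ).prod (Measure.pi fun _ : ι => γ)).real
          {q | H < |f (hybrid cell (m + 1) q) - f (hybrid cell m q)|} := by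
  set π' := Measure.pi fun _ : ι => γ
  have h0 : ∀ q, hybrid cell 0 q = q.1 := fun q => by funext e; simp [hybrid]
  have hBq : ∀ q, hybrid cell B q = q.2 := fun q => by funext e; simp [hybrid, hB e]
  have hsub : {z | f z < l} ×ˢ {z | l ≤ f z} ⊆ ⋃ m ∈ Finset.range B,
      ({q | |f (hybrid cell m q) - l| ≤ H} ∪
        {q | H < |f (hybrid cell (m + 1) q) - f (hybrid cell m q)|}) := by
    rintro q ⟨h1, h2⟩
    have h1' : f q.1 < l := h1
    have h2' : l ≤ f q.2 := h2
    -- The first hybrid at which `f` has reached the level: the previous one is below it, so either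
    -- the step between the two exceeds `H` or both are within `H` of the level.
    classical
    have hex : ∃ m, l ≤ f (hybrid cell m q) := ⟨B, by rwa [hBq]⟩
    obtain ⟨m, hm⟩ : ∃ m, Nat.find hex = m + 1 := by
      rcases h : Nat.find hex with _ | m
      · have := Nat.find_spec hex
        rw [h, h0] at this
        exact absurd h1' (not_lt.2 this)
      · exact ⟨m, rfl⟩
    have h3 : l ≤ f (hybrid cell (m + 1) q) := hm ▸ Nat.find_spec hex
    have h4 : f (hybrid cell m q) < l := not_le.1 (Nat.find_min hex (by omega))
    have h5 : m < B := by
      have : Nat.find hex ≤ B := Nat.find_min' hex (by rwa [hBq])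
      omega
    refine Set.mem_biUnion (Finset.mem_range.2 h5) ?_
    by_cases h6 : H < |f (hybrid cell (m + 1) q) - f (hybrid cell m q)|
    · exact Or.inr h6
    · left
      show |f (hybrid cell m q) - l| ≤ H
      push Not at h6
      have h7 := (abs_le.1 h6).2
      rw [abs_le]
      constructor <;> linarith
  have h1 := measureReal_mono (μ := π'.prod π') hsub (measure_ne_top _ _)
  rw [measureReal_prod_prod] at h1
  refine h1.trans ((measureReal_biUnion_finset_le _ _).trans ?_)
  have h2 : ∀ m ∈ Finset.range B, (π'.prod π').real ({q | |f (hybrid cell m q) - l| ≤ H} ∪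
      {q | H < |f (hybrid cell (m + 1) q) - f (hybrid cell m q)|}) ≤
      π'.real {z | |f z - l| ≤ H} +
        (π'.prod π').real {q | H < |f (hybrid cell (m + 1) q) - f (hybrid cell m q)|} := by
    intro m _
    refine (measureReal_union_le _ _).trans (add_le_add (le_of_eq ?_) le_rfl)
    exact (measurePreserving_hybrid (γ := γ) cell m).measureReal_preimage
      (s := {z | |f z - l| ≤ H})
      (measurableSet_le (hf.sub_const l).abs measurable_const).nullMeasurableSet
  refine (Finset.sum_le_sum h2).trans (le_of_eq ?_)
  rw [Finset.sum_add_distrib, Finset.sum_const, Finset.card_range, nsmul_eq_mul]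

end

/-! ### Sums that lie far below their mean -/

section

variable {Ω : Type*} [MeasurableSpace Ω] {P : Measure Ω} [IsProbabilityMeasure P]

/-- One-sided Paley-Zygmund inequality: a centred variable with comparable fourth and squared
second moments is well below its mean with a fair probability. -/
lemma prob_le_neg_of_moments {Y : Ω → ℝ} (hY : Measurable Y) (h4 : MemLp Y 4 P)
    (h0 : ∫ ω, Y ω ∂P = 0) {v C : ℝ} (hv : 0 < v) (hC : 0 < C) (h2 : ∫ ω, Y ω ^ 2 ∂P = v)
    (hC4 : ∫ ω, Y ω ^ 4 ∂P ≤ C * v ^ 2) :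
    1 / (16 * C) ≤ P.real {ω | Y ω ≤ -(√v / (8 * √C))} := by
  set σ := √v with hσ
  set K := √C with hK
  have hσ0 : 0 < σ := sqrt_pos.2 hv
  have hK0 : 0 < K := sqrt_pos.2 hC
  have hσ2 : σ ^ 2 = v := sq_sqrt hv.le
  have hK2 : K ^ 2 = C := sq_sqrt hC.le
  have i1 : Integrable Y P := by simpa using integrable_pow_of_memLp h4 (k := 1) (by norm_num)
  have i2 := integrable_pow_of_memLp h4 (k := 2) (by norm_num)
  have i4 := integrable_pow_of_memLp h4 (k := 4) le_rfl
  set S := {ω | Y ω ≤ -(σ / (8 * K))} with hS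
  have hSm : MeasurableSet S := measurableSet_le hY measurable_const
  -- A quartic polynomial in `Y` below the indicator of the event, whose mean is explicit.
  set g : Ω → ℝ := fun ω => 1 / (4 * σ ^ 2 * C) * Y ω ^ 2 + -(1 / (16 * σ ^ 4 * C ^ 2)) * Y ω ^ 4 +
    -(1 / (4 * σ * K)) * Y ω + -(1 / (16 * C)) + -(1 / (16 * σ ^ 2 * C)) * Y ω ^ 2 with hg
  have hpt : ∀ ω, g ω ≤ S.indicator (fun _ => (1 : ℝ)) ω := by
    intro ω
    set y := Y ω with hy
    -- In terms of `r = Y / (√C σ)`, the polynomial is `r² / 4 - r⁴ / 16 - r / 4 - r² / 16`, up to a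
    -- constant, and `r² - r⁴ / 4 ≤ |r|`.
    set r := y / (K * σ) with hr
    have hyr : y = r * (K * σ) := by rw [hr]; field_simp
    have e : g ω = r ^ 2 / 4 - r ^ 4 / 16 - r / 4 - 1 / (16 * C) - r ^ 2 / 16 := by
      simp only [hg, ← hy]
      rw [hyr, ← hK2]
      field_simp
      ring
    have habs : r ^ 2 - r ^ 4 / 4 ≤ |r| := by
      have e2 : r ^ 2 = |r| ^ 2 := (sq_abs r).symm
      have e4 : r ^ 4 = |r| ^ 4 := (Even.pow_abs (by decide) r).symm
      rw [e2, e4]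
      have h := abs_nonneg r
      nlinarith [mul_nonneg h (sq_nonneg (|r| - 1)), mul_nonneg h (sq_nonneg (|r| ^ 2 - 4 / 3)),
        mul_nonneg h (sq_nonneg (|r| - 2 / √3)), pow_nonneg h 3,
        mul_nonneg (mul_nonneg h h) (sq_nonneg (|r| - 1))]
    by_cases hω : ω ∈ S
    · rw [Set.indicator_of_mem hω, e]
      have h1 : |r| / 2 - r ^ 2 / 16 ≤ 1 := by
        rw [← sq_abs r]; nlinarith [sq_nonneg (|r| - 4)]
      have h2 : -r ≤ |r| := neg_le_abs r
      have : 0 < 1 / (16 * C) := by positivity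
      linarith
    · rw [Set.indicator_of_notMem hω, e]
      have h1 : -(σ / (8 * K)) < y := not_le.1 hω
      have h2 : -(1 / (8 * C)) < r := by
        rw [hr, lt_div_iff₀ (by positivity)]
        refine lt_of_eq_of_lt ?_ h1
        rw [← hK2]; field_simp
      have e3 : 1 / (8 * C) = 2 * (1 / (16 * C)) := by field_simp; norm_num
      have hC16 : 0 < 1 / (16 * C) := by positivity
      rw [e3] at h2
      rcases le_total 0 r with h | h
      · rw [abs_of_nonneg h] at habs
        nlinarith [sq_nonneg r]
      · rw [abs_of_nonpos h] at habs
        nlinarith [sq_nonneg r]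
  have j1 : Integrable (fun ω => 1 / (4 * σ ^ 2 * C) * Y ω ^ 2 +
      -(1 / (16 * σ ^ 4 * C ^ 2)) * Y ω ^ 4) P := (i2.const_mul _).add (i4.const_mul _)
  have j2 : Integrable (fun ω => 1 / (4 * σ ^ 2 * C) * Y ω ^ 2 +
      -(1 / (16 * σ ^ 4 * C ^ 2)) * Y ω ^ 4 + -(1 / (4 * σ * K)) * Y ω) P :=
    j1.add (i1.const_mul _)
  have j3 : Integrable (fun ω => 1 / (4 * σ ^ 2 * C) * Y ω ^ 2 +
      -(1 / (16 * σ ^ 4 * C ^ 2)) * Y ω ^ 4 + -(1 / (4 * σ * K)) * Y ω + -(1 / (16 * C))) P :=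
    j2.add (integrable_const _)
  have hgi : Integrable g P := j3.add (i2.const_mul _)
  have hle : ∫ ω, g ω ∂P ≤ P.real S := by
    calc _ ≤ ∫ ω, S.indicator (fun _ => (1 : ℝ)) ω ∂P :=
          integral_mono hgi ((integrable_const _).indicator hSm) hpt
      _ = _ := by rw [integral_indicator hSm]; simp
  refine le_trans ?_ hle
  simp only [hg]
  rw [integral_add j3 (i2.const_mul _), integral_add j2 (integrable_const _),
    integral_add j1 (i1.const_mul _), integral_add (i2.const_mul _) (i4.const_mul _),
    integral_const_mul, integral_const_mul, integral_const_mul, integral_const_mul, h0, h2]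
  simp only [integral_const, probReal_univ, smul_eq_mul, one_mul, mul_zero, add_zero]
  have h5 : -(1 / (16 * σ ^ 4 * C ^ 2)) * (C * v ^ 2) ≤
      -(1 / (16 * σ ^ 4 * C ^ 2)) * ∫ ω, Y ω ^ 4 ∂P := by
    have : 0 ≤ 1 / (16 * σ ^ 4 * C ^ 2) := by positivity
    nlinarith
  have e1 : -(1 / (16 * σ ^ 4 * C ^ 2)) * (C * v ^ 2) = -(1 / (16 * C)) := by
    rw [← hσ2]; field_simp
  have e2 : 1 / (4 * σ ^ 2 * C) * v = 4 * (1 / (16 * C)) := by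
    rw [← hσ2]; field_simp; norm_num
  have e3 : -(1 / (16 * σ ^ 2 * C)) * v = -(1 / (16 * C)) := by
    rw [← hσ2]; field_simp
  rw [e1] at h5
  rw [e2, e3]
  linarith

variable {n : ℕ} {Z : Fin n → Ω → ℝ}

lemma sum_prob_le_neg (hind : iIndepFun Z P) (hm : ∀ i, Measurable (Z i))
    (h4 : ∀ i, MemLp (Z i) 4 P) (h0 : ∀ i, ∫ ω, Z i ω ∂P = 0) {C v : ℝ} (hC : 0 ≤ C) (hv : 0 < v)
    (hv2 : ∀ i, v ≤ ∫ ω, Z i ω ^ 2 ∂P)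
    (hC4 : ∀ i, ∫ ω, Z i ω ^ 4 ∂P ≤ C * (∫ ω, Z i ω ^ 2 ∂P) ^ 2) {J : Finset (Fin n)}
    (hJ : J.Nonempty) :
    1 / (16 * (3 + C)) ≤ P.real {ω | ∑ i ∈ J, Z i ω ≤ -(√(v * J.card) / (8 * √(3 + C)))} := by
  obtain ⟨m1, m2, -, m4⟩ := moments_sum hind (fun i => (hm i).aemeasurable) h4 h0 J
  set V := ∑ i ∈ J, ∫ ω, Z i ω ^ 2 ∂P with hV
  have hnn : ∀ i, 0 ≤ ∫ ω, Z i ω ^ 2 ∂P := fun i => integral_nonneg fun ω => sq_nonneg _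
  have hVv : v * J.card ≤ V := by
    rw [hV, mul_comm, ← nsmul_eq_mul, ← Finset.sum_const]
    exact Finset.sum_le_sum fun i _ => hv2 i
  have hcard : (0 : ℝ) < J.card := by exact_mod_cast hJ.card_pos
  have hV0 : 0 < V := lt_of_lt_of_le (by positivity) hVv
  have hsq : ∑ i ∈ J, (∫ ω, Z i ω ^ 2 ∂P) ^ 2 ≤ V ^ 2 :=
    Finset.sum_sq_le_sq_sum_of_nonneg fun i _ => hnn i
  have hM4 : ∫ ω, (∑ i ∈ J, Z i ω) ^ 4 ∂P ≤ (3 + C) * V ^ 2 := by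
    rw [m4]
    have : ∑ i ∈ J, (∫ ω, Z i ω ^ 4 ∂P - 3 * (∫ ω, Z i ω ^ 2 ∂P) ^ 2) ≤ C * V ^ 2 := by
      calc _ ≤ ∑ i ∈ J, C * (∫ ω, Z i ω ^ 2 ∂P) ^ 2 := Finset.sum_le_sum fun i _ => by
            have := hC4 i
            have := sq_nonneg (∫ ω, Z i ω ^ 2 ∂P)
            linarith
        _ = C * ∑ i ∈ J, (∫ ω, Z i ω ^ 2 ∂P) ^ 2 := by rw [Finset.mul_sum]
        _ ≤ _ := by gcongr
    linarith
  refine (prob_le_neg_of_moments (Y := fun ω => ∑ i ∈ J, Z i ω)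
    (Finset.measurable_fun_sum _ fun i _ => hm i) (memLp_finsetSum _ fun i _ => h4 i) m1 hV0
    (by linarith : 0 < 3 + C) m2 hM4).trans (measureReal_mono fun ω hω => ?_)
  have h1 : ∑ i ∈ J, Z i ω ≤ -(√V / (8 * √(3 + C))) := hω
  refine h1.trans (neg_le_neg ?_)
  gcongr

lemma card_filter_mod_ge {q g : ℕ} (hg : g < q) :
    n / q ≤ ((Finset.univ : Finset (Fin n)).filter fun i : Fin n => (i : ℕ) % q = g).card := by
  have hq : 0 < q := by omega
  have hlt : ∀ t < n / q, t * q + g < n := fun t ht => by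
    have h1 : (t + 1) * q ≤ n := (Nat.mul_le_mul_right q ht).trans (Nat.div_mul_le_self n q)
    nlinarith
  calc n / q = (Finset.univ : Finset (Fin (n / q))).card := by simp
    _ ≤ _ := by
      refine Finset.card_le_card_of_injOn (fun t => (⟨t * q + g, hlt t t.2⟩ : Fin n)) ?_ ?_
      · intro t _
        simp [Nat.add_mod, Nat.mod_eq_of_lt hg]
      · intro s _ t _ h
        have h1 : (s : ℕ) * q + g = t * q + g := by exact Fin.mk.inj_iff.1 h
        have h2 : (s : ℕ) * q = t * q := by omega
        exact Fin.ext (Nat.eq_of_mul_eq_mul_right hq h2)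

/-- Splitting the summands into `q` groups that are all well below their means, the whole sum is
at most a large multiple of `-√n` with a probability bounded below. -/
lemma sum_prob_le_neg_groups (hind : iIndepFun Z P) (hm : ∀ i, Measurable (Z i))
    (h4 : ∀ i, MemLp (Z i) 4 P) (h0 : ∀ i, ∫ ω, Z i ω ∂P = 0) {C v : ℝ} (hC : 0 ≤ C) (hv : 0 < v)
    (hv2 : ∀ i, v ≤ ∫ ω, Z i ω ^ 2 ∂P)
    (hC4 : ∀ i, ∫ ω, Z i ω ^ 4 ∂P ≤ C * (∫ ω, Z i ω ^ 2 ∂P) ^ 2) {q : ℕ} (hq : 0 < q)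
    (hqn : q ≤ n) :
    (1 / (16 * (3 + C))) ^ q ≤
      P.real {ω | ∑ i, Z i ω ≤ -(q * (√(v * (n / (2 * q))) / (8 * √(3 + C))))} := by
  set s := √(v * (n / (2 * q))) / (8 * √(3 + C)) with hs
  -- The group of `i` is `i % q`; the groups are added one at a time.
  have hstep : ∀ m ≤ q, (1 / (16 * (3 + C))) ^ m ≤ P.real {ω |
      ∑ i ∈ (Finset.univ : Finset (Fin n)).filter (fun i : Fin n => (i : ℕ) % q < m), Z i ω ≤
        -(m * s)} := by
    intro m
    induction m with
    | zero => intro _; simp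
    | succ m ih =>
      intro hmq
      have ih := ih (by omega)
      set S := (Finset.univ : Finset (Fin n)).filter fun i : Fin n => (i : ℕ) % q < m with hS
      set T := (Finset.univ : Finset (Fin n)).filter fun i : Fin n => (i : ℕ) % q = m with hT
      have hdis : Disjoint S T := by
        rw [Finset.disjoint_filter]
        intro i _ h1 h2
        omega
      have hun : (Finset.univ : Finset (Fin n)).filter (fun i : Fin n => (i : ℕ) % q < m + 1) =
          S.disjUnion T hdis := by
        ext i
        simp only [hS, hT, Finset.disjUnion_eq_union, Finset.mem_union, Finset.mem_filter,
          Finset.mem_univ, true_and]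
        omega
      have hcardn : n / q ≤ T.card := card_filter_mod_ge (by omega)
      have hnq1 : 1 ≤ n / q := (Nat.one_le_div_iff hq).2 hqn
      have hTne : T.Nonempty := Finset.card_pos.1 (by omega)
      have hcard : (n : ℝ) / (2 * q) ≤ T.card := by
        have hq' : (0 : ℝ) < q := by positivity
        have h1 : n < (n / q + 1) * q := by
          have := Nat.lt_div_mul_add hq (a := n)
          linarith
        have h2 : n ≤ 2 * (n / q) * q := by nlinarith
        have h3 : (n : ℝ) ≤ 2 * (n / q : ℕ) * q := by exact_mod_cast h2
        have h4 : ((n / q : ℕ) : ℝ) ≤ T.card := by exact_mod_cast hcardn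
        rw [div_le_iff₀ (by positivity)]
        nlinarith
      have hT2 := sum_prob_le_neg hind hm h4 h0 hC hv hv2 hC4 hTne
      have hTs : 1 / (16 * (3 + C)) ≤ P.real {ω | ∑ i ∈ T, Z i ω ≤ -s} := by
        refine hT2.trans (measureReal_mono fun ω hω => ?_)
        have h1 : ∑ i ∈ T, Z i ω ≤ -(√(v * T.card) / (8 * √(3 + C))) := hω
        refine h1.trans (neg_le_neg ?_)
        rw [hs]
        gcongr
      have hi := (hind.indepFun_finset S T hdis hm).comp
        (φ := fun u : S → ℝ => ∑ i, u i) (ψ := fun u : T → ℝ => ∑ i, u i) (by fun_prop)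
        (by fun_prop)
      have e1 : ((fun u : S → ℝ => ∑ i, u i) ∘ fun ω (i : S) => Z i ω) =
          fun ω => ∑ i ∈ S, Z i ω := by
        funext ω
        exact Finset.sum_coe_sort S fun i => Z i ω
      have e2 : ((fun u : T → ℝ => ∑ i, u i) ∘ fun ω (i : T) => Z i ω) =
          fun ω => ∑ i ∈ T, Z i ω := by
        funext ω
        exact Finset.sum_coe_sort T fun i => Z i ω
      rw [e1, e2] at hi
      have hmul := hi.measure_inter_preimage_eq_mul (Set.Iic (-(m * s))) (Set.Iic (-s))
        measurableSet_Iic measurableSet_Iic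
      have hmulr := congrArg ENNReal.toReal hmul
      rw [ENNReal.toReal_mul] at hmulr
      calc (1 / (16 * (3 + C))) ^ (m + 1) = (1 / (16 * (3 + C))) ^ m * (1 / (16 * (3 + C))) :=
            pow_succ _ _
        _ ≤ P.real {ω | ∑ i ∈ S, Z i ω ≤ -(m * s)} * P.real {ω | ∑ i ∈ T, Z i ω ≤ -s} := by
            gcongr
        _ = P.real ((fun ω => ∑ i ∈ S, Z i ω) ⁻¹' Set.Iic (-(m * s)) ∩
              (fun ω => ∑ i ∈ T, Z i ω) ⁻¹' Set.Iic (-s)) := hmulr.symm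
        _ ≤ _ := by
            refine measureReal_mono fun ω hω => ?_
            have h1 : ∑ i ∈ S, Z i ω ≤ -(m * s) := hω.1
            have h2 : ∑ i ∈ T, Z i ω ≤ -s := hω.2
            show ∑ i ∈ (Finset.univ : Finset (Fin n)).filter (fun i : Fin n => (i : ℕ) % q < m + 1),
              Z i ω ≤ -(((m + 1 : ℕ) : ℝ) * s)
            rw [hun, Finset.sum_disjUnion]
            push_cast
            linarith
  have h1 := hstep q le_rfl
  have e1 : (Finset.univ : Finset (Fin n)).filter (fun i : Fin n => (i : ℕ) % q < q) = Finset.univ := by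
    ext i
    simp [Nat.mod_lt _ hq]
  rwa [e1] at h1

end

/-! ### Squared norms on both sides of a level -/

section

variable {b : ℝ} {γ : Measure ℝ} {n : ℕ}

/-- The centred square of a shifted and scaled variable, `(h + τ g)² - h² - τ²`. -/
noncomputable def shiftedSq (h τ g : ℝ) : ℝ := 2 * h * τ * g + τ ^ 2 * (g ^ 2 - 1)

/-- The constant in the comparison of the fourth and second moments of `shiftedSq`. -/
noncomputable def shiftedSqConst (b : ℝ) : ℝ := 512 / b ^ 2 + 64 * (48 / b ^ 4 + 1)

lemma shiftedSqConst_pos (hb : 0 < b) : 0 < shiftedSqConst b := by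
  unfold shiftedSqConst; positivity

lemma measurable_shiftedSq (h τ : ℝ) : Measurable (shiftedSq h τ) := by
  unfold shiftedSq; fun_prop

/-- If the first four moments of `g` are nearly Gaussian, the shifted squares are centred, have a
variance bounded below and a comparable fourth moment, whatever the shift is. -/
lemma shiftedSq_moments (hγ : IsNormalizedSubgaussian b γ) (hb : 0 < b)
    (h3 : |∫ g, g ^ 3 ∂γ| ≤ 1 / 8) (h4 : |∫ g, g ^ 4 ∂γ - 3| ≤ 1 / 8) {τ : ℝ} (hτ : 1 / 4 ≤ τ)
    (h : ℝ) :
    Integrable (fun g => shiftedSq h τ g ^ 4) γ ∧ ∫ g, shiftedSq h τ g ∂γ = 0 ∧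
      1 / 256 ≤ ∫ g, shiftedSq h τ g ^ 2 ∂γ ∧
      ∫ g, shiftedSq h τ g ^ 4 ∂γ ≤ shiftedSqConst b * (∫ g, shiftedSq h τ g ^ 2 ∂γ) ^ 2 := by
  have := hγ.prob
  have hτ0 : 0 < τ := by linarith
  have I := hγ.integrable_pow hb
  have i1 : Integrable (fun g : ℝ => g) γ := by simpa using I 1
  have i2 : Integrable (fun g : ℝ => g ^ 2 - 1) γ := (I 2).sub (integrable_const _)
  have e2 : ∀ g : ℝ, shiftedSq h τ g ^ 2 = (4 * h ^ 2 * τ ^ 2 * g ^ 2 +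
      4 * h * τ ^ 3 * (g ^ 3 - g)) + τ ^ 4 * (g ^ 4 - 2 * g ^ 2 + 1) := fun g => by
    unfold shiftedSq; ring
  have j31 : Integrable (fun g : ℝ => g ^ 3 - g) γ := (I 3).sub i1
  have j42 : Integrable (fun g : ℝ => g ^ 4 - 2 * g ^ 2) γ := (I 4).sub ((I 2).const_mul 2)
  have j421 : Integrable (fun g : ℝ => g ^ 4 - 2 * g ^ 2 + 1) γ := j42.add (integrable_const _)
  have j1 : Integrable (fun g : ℝ => 4 * h ^ 2 * τ ^ 2 * g ^ 2 + 4 * h * τ ^ 3 * (g ^ 3 - g)) γ :=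
    ((I 2).const_mul _).add (j31.const_mul _)
  have hv : ∫ g, shiftedSq h τ g ^ 2 ∂γ = 4 * h ^ 2 * τ ^ 2 + 4 * h * τ ^ 3 * ∫ g, g ^ 3 ∂γ +
      τ ^ 4 * (∫ g, g ^ 4 ∂γ - 1) := by
    simp only [e2]
    rw [integral_add j1 (j421.const_mul _), integral_add ((I 2).const_mul _) (j31.const_mul _),
      integral_const_mul, integral_const_mul, integral_const_mul, integral_sub (I 3) i1,
      integral_add j42 (integrable_const _), integral_sub (I 4) ((I 2).const_mul 2),
      integral_const_mul, hγ.sq, hγ.mean]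
    simp only [integral_const, probReal_univ, smul_eq_mul, one_mul]
    ring
  have h4' := abs_le.1 h4
  have h3' := abs_le.1 h3
  -- For a Gaussian `g` the variance is `4 h² τ² + 2 τ⁴`; the near-Gaussian third and fourth moments
  -- lose at most half of it.
  have hvl : 2 * h ^ 2 * τ ^ 2 + τ ^ 4 ≤ ∫ g, shiftedSq h τ g ^ 2 ∂γ := by
    rw [hv]
    set m3 := ∫ g, g ^ 3 ∂γ
    have c1 : -(1 / 4) * (h ^ 2 * τ ^ 2 + τ ^ 4) ≤ 4 * h * τ ^ 3 * m3 := by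
      have c2 : |4 * h * τ ^ 3 * m3| ≤ 1 / 4 * (h ^ 2 * τ ^ 2 + τ ^ 4) := by
        have c3 : |4 * h * τ ^ 3 * m3| = 4 * (|h| * τ * τ ^ 2) * |m3| := by
          rw [abs_mul, abs_mul, abs_mul, abs_of_pos (by positivity : 0 < τ ^ 3),
            abs_of_pos (by norm_num : (0 : ℝ) < 4)]
          ring
        rw [c3]
        calc 4 * (|h| * τ * τ ^ 2) * |m3| ≤ 4 * (|h| * τ * τ ^ 2) * (1 / 8) := by gcongr
          _ ≤ _ := by
            rw [← sq_abs h]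
            nlinarith [sq_nonneg (|h| * τ - τ ^ 2)]
      linarith [(abs_le.1 c2).1]
    have c4 : τ ^ 4 * (15 / 8) ≤ τ ^ 4 * (∫ g, g ^ 4 ∂γ - 1) := by gcongr; linarith
    have c5 : 0 ≤ h ^ 2 * τ ^ 2 := by positivity
    have c6 : 0 ≤ τ ^ 4 := by positivity
    linarith
  have e4 : ∀ g : ℝ, shiftedSq h τ g ^ 4 ≤
      128 * h ^ 4 * τ ^ 4 * g ^ 4 + 64 * τ ^ 8 * (g ^ 8 + 1) := by
    intro g
    have a1 : ∀ u w : ℝ, (u + w) ^ 4 ≤ 8 * (u ^ 4 + w ^ 4) := fun u w => by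
      nlinarith [sq_nonneg (u ^ 2 - w ^ 2), sq_nonneg (u - w), sq_nonneg (u + w),
        mul_nonneg (sq_nonneg (u - w)) (sq_nonneg (u + w)), sq_nonneg (u * (u - w)),
        sq_nonneg (w * (u - w)), sq_nonneg ((u - w) ^ 2)]
    calc shiftedSq h τ g ^ 4 ≤ 8 * ((2 * h * τ * g) ^ 4 + (τ ^ 2 * (g ^ 2 - 1)) ^ 4) := a1 _ _
      _ = 128 * h ^ 4 * τ ^ 4 * g ^ 4 + 8 * τ ^ 8 * (g ^ 2 + -1) ^ 4 := by ring
      _ ≤ 128 * h ^ 4 * τ ^ 4 * g ^ 4 + 8 * τ ^ 8 * (8 * ((g ^ 2) ^ 4 + (-1) ^ 4)) := by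
          gcongr; exact a1 _ _
      _ = _ := by ring
  have j8 : Integrable (fun g : ℝ => g ^ 8 + 1) γ := (I 8).add (integrable_const _)
  have jb : Integrable (fun g : ℝ =>
      128 * h ^ 4 * τ ^ 4 * g ^ 4 + 64 * τ ^ 8 * (g ^ 8 + 1)) γ :=
    ((I 4).const_mul _).add (j8.const_mul _)
  have hi4 : Integrable (fun g => shiftedSq h τ g ^ 4) γ :=
    jb.mono' ((measurable_shiftedSq h τ).pow_const 4).aestronglyMeasurable
      (ae_of_all _ fun g => by
        rw [norm_of_nonneg (Even.pow_nonneg (by decide) _)]; exact e4 g)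
  refine ⟨hi4, ?_, ?_, ?_⟩
  · unfold shiftedSq
    rw [integral_add (i1.const_mul _) (i2.const_mul _), integral_const_mul, integral_const_mul,
      integral_sub (I 2) (integrable_const _), hγ.sq, hγ.mean]
    simp
  · refine le_trans ?_ hvl
    have : (1 / 4 : ℝ) ^ 4 ≤ τ ^ 4 := by gcongr
    have : 0 ≤ 2 * h ^ 2 * τ ^ 2 := by positivity
    norm_num at *
    linarith
  · have hM4 := fourth_moment_le hγ hb
    have hM8 : ∫ g, g ^ 8 ∂γ ≤ 48 / b ^ 4 := by
      have := hγ.integral_pow_le hb 4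
      norm_num [Nat.factorial] at this
      exact this
    calc ∫ g, shiftedSq h τ g ^ 4 ∂γ
        ≤ ∫ g, (128 * h ^ 4 * τ ^ 4 * g ^ 4 + 64 * τ ^ 8 * (g ^ 8 + 1)) ∂γ :=
          integral_mono hi4 jb e4
      _ = 128 * h ^ 4 * τ ^ 4 * ∫ g, g ^ 4 ∂γ + 64 * τ ^ 8 * (∫ g, g ^ 8 ∂γ + 1) := by
          rw [integral_add ((I 4).const_mul _) (j8.const_mul _), integral_const_mul,
            integral_const_mul, integral_add (I 8) (integrable_const _)]
          simp
      _ ≤ 128 * h ^ 4 * τ ^ 4 * (4 / b ^ 2) + 64 * τ ^ 8 * (48 / b ^ 4 + 1) := by gcongr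
      _ = (h ^ 4 * τ ^ 4) * (512 / b ^ 2) + τ ^ 8 * (64 * (48 / b ^ 4 + 1)) := by ring
      _ ≤ (h ^ 4 * τ ^ 4 + τ ^ 8) * (512 / b ^ 2) +
          (h ^ 4 * τ ^ 4 + τ ^ 8) * (64 * (48 / b ^ 4 + 1)) := by
          have : 0 ≤ τ ^ 8 := by positivity
          have : 0 ≤ h ^ 4 * τ ^ 4 := by positivity
          gcongr <;> linarith
      _ = shiftedSqConst b * (h ^ 4 * τ ^ 4 + τ ^ 8) := by unfold shiftedSqConst; ring
      _ ≤ shiftedSqConst b * (2 * h ^ 2 * τ ^ 2 + τ ^ 4) ^ 2 := by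
          have := shiftedSqConst_pos hb
          gcongr
          have : 0 ≤ h ^ 2 * τ ^ 6 := by positivity
          have : 0 ≤ h ^ 4 * τ ^ 4 := by positivity
          nlinarith
      _ ≤ _ := by
          have := shiftedSqConst_pos hb
          gcongr

/-- The squared norm of a shifted iid vector falls on both sides of any level within `O(√n)` of
`n` with a probability bounded below. -/
lemma both_sides_prob (hb : 0 < b) {A : ℝ} (hA : 0 ≤ A) :
    ∃ p > 0, ∀ᶠ n : ℕ in atTop, ∀ γ : Measure ℝ, IsNormalizedSubgaussian b γ →
      |∫ g, g ^ 3 ∂γ| ≤ 1 / 8 → |∫ g, g ^ 4 ∂γ - 3| ≤ 1 / 8 →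
      ∀ τ : ℝ, 1 / 4 ≤ τ → ∀ h : Fin n → ℝ, |∑ i, h i ^ 2 + n * τ ^ 2 - n| ≤ A * √n →
      ∀ l : ℝ, |l - n| ≤ A * √n →
        p ≤ (Measure.pi fun _ : Fin n => γ).real {g | ∑ i, (h i + τ * g i) ^ 2 < l} ∧
        p ≤ (Measure.pi fun _ : Fin n => γ).real {g | l ≤ ∑ i, (h i + τ * g i) ^ 2} := by
  have hC := shiftedSqConst_pos hb
  set C := shiftedSqConst b
  -- The number of groups is such that the sum falls below `-(2 A + 1) √n`, beyond the distance from
  -- its mean to the level.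
  obtain ⟨q, hq⟩ := exists_nat_ge ((2 * A + 1) ^ 2 * (64 * (3 + C)) * 512)
  have hq0' : (0 : ℝ) < q := lt_of_lt_of_le (by positivity) hq
  have hq0 : 0 < q := by exact_mod_cast hq0'
  refine ⟨(1 / (16 * (3 + C))) ^ q, by positivity, ?_⟩
  filter_upwards [eventually_ge_atTop q] with n hqn γ hγ h3 h4 τ hτ h hh l hl
  have := hγ.prob
  have hn : 0 < n := by omega
  have hn' : (0 : ℝ) < n := by positivity
  have hsn : 0 < √(n : ℝ) := sqrt_pos.2 hn'
  have hs : (2 * A + 1) * √n ≤ q * (√(1 / 256 * (n / (2 * q))) / (8 * √(3 + C))) := by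
    have h1 : 0 < √(3 + C) := sqrt_pos.2 (by linarith)
    rw [← mul_div_assoc, le_div_iff₀ (by positivity)]
    refine abs_le_of_sq_le_sq' ?_ (by positivity) |>.2
    have e1 : (q * √(1 / 256 * (n / (2 * q)))) ^ 2 = q * n / 512 := by
      rw [mul_pow, sq_sqrt (by positivity)]; field_simp; norm_num
    have e2 : ((2 * A + 1) * √n * (8 * √(3 + C))) ^ 2 =
        (2 * A + 1) ^ 2 * (64 * (3 + C)) * n := by
      rw [mul_pow, mul_pow, mul_pow, sq_sqrt hn'.le, sq_sqrt (by linarith)]; ring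
    rw [e1, e2, le_div_iff₀ (by norm_num)]
    calc _ = (2 * A + 1) ^ 2 * (64 * (3 + C)) * 512 * n := by ring
      _ ≤ _ := by gcongr
  have key := fun i => shiftedSq_moments hγ hb h3 h4 hτ (h i)
  have hmeas : ∀ i, Measurable fun g : Fin n → ℝ => shiftedSq (h i) τ (g i) := fun i =>
    (measurable_shiftedSq _ _).comp (measurable_pi_apply i)
  have hind : iIndepFun (fun i (g : Fin n → ℝ) => shiftedSq (h i) τ (g i))
      (Measure.pi fun _ => γ) :=
    iIndepFun_pi (X := fun i x => shiftedSq (h i) τ x) (μ := fun _ => γ) fun j =>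
      (measurable_shiftedSq _ _).aemeasurable
  have hM4 : ∀ i, MemLp (fun g : Fin n → ℝ => shiftedSq (h i) τ (g i)) 4
      (Measure.pi fun _ => γ) := fun i =>
    memLp_four_of_integrable (hmeas i).aestronglyMeasurable
      (integrable_comp_eval (μ := fun _ : Fin n => γ) (i := i)
        (f := fun x => shiftedSq (h i) τ x ^ 4) (key i).1)
  have c1 : ∀ i, ∫ g : Fin n → ℝ, shiftedSq (h i) τ (g i) ∂(Measure.pi fun _ => γ) = 0 := fun i =>
    by rw [integral_comp_eval (μ := fun _ : Fin n => γ) (i := i)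
        (f := fun x => shiftedSq (h i) τ x) (measurable_shiftedSq _ _).aestronglyMeasurable,
        (key i).2.1]
  have c2 : ∀ i, ∫ g : Fin n → ℝ, shiftedSq (h i) τ (g i) ^ 2 ∂(Measure.pi fun _ => γ) =
      ∫ x, shiftedSq (h i) τ x ^ 2 ∂γ := fun i =>
    integral_comp_eval (μ := fun _ : Fin n => γ) (i := i)
        (f := fun x => shiftedSq (h i) τ x ^ 2)
        ((measurable_shiftedSq _ _).pow_const 2).aestronglyMeasurable
  have c4 : ∀ i, ∫ g : Fin n → ℝ, shiftedSq (h i) τ (g i) ^ 4 ∂(Measure.pi fun _ => γ) =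
      ∫ x, shiftedSq (h i) τ x ^ 4 ∂γ := fun i =>
    integral_comp_eval (μ := fun _ : Fin n => γ) (i := i)
        (f := fun x => shiftedSq (h i) τ x ^ 4)
        ((measurable_shiftedSq _ _).pow_const 4).aestronglyMeasurable
  have hsum : ∀ g : Fin n → ℝ, ∑ i, (h i + τ * g i) ^ 2 =
      ∑ i, shiftedSq (h i) τ (g i) + (∑ i, h i ^ 2 + n * τ ^ 2) := by
    intro g
    have e1 : ∀ i, (h i + τ * g i) ^ 2 = shiftedSq (h i) τ (g i) + (h i ^ 2 + τ ^ 2) := fun i => by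
      unfold shiftedSq; ring
    simp only [e1, Finset.sum_add_distrib, Finset.sum_const, Finset.card_univ, Fintype.card_fin,
      nsmul_eq_mul]
  have hh' := abs_le.1 hh
  have hl' := abs_le.1 hl
  constructor
  · refine (sum_prob_le_neg_groups hind hmeas hM4 c1 hC.le (by norm_num : (0 : ℝ) < 1 / 256)
      (fun i => by rw [c2]; exact (key i).2.2.1)
      (fun i => by rw [c2, c4]; exact (key i).2.2.2) hq0 hqn).trans
      (measureReal_mono fun g hg => ?_)
    have hg' : ∑ i, shiftedSq (h i) τ (g i) ≤
      -(q * (√(1 / 256 * (n / (2 * q))) / (8 * √(3 + C)))) := hg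
    show ∑ i, (h i + τ * g i) ^ 2 < l
    rw [hsum]
    linarith
  · refine (sum_prob_le_neg_groups (Z := fun i (g : Fin n → ℝ) => -shiftedSq (h i) τ (g i))
      (hind.comp (fun _ x => -x) fun _ => measurable_neg) (fun i => (hmeas i).neg)
      (fun i => (hM4 i).neg) (fun i => by rw [integral_neg, c1, neg_zero]) hC.le
      (by norm_num : (0 : ℝ) < 1 / 256)
      (fun i => by simp only [neg_sq]; rw [c2]; exact (key i).2.2.1)
      (fun i => by
        simp only [neg_sq, Even.neg_pow (show Even 4 by decide)]
        rw [c2, c4]; exact (key i).2.2.2) hq0 hqn).trans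
      (measureReal_mono fun g hg => ?_)
    have hg' : ∑ i, -shiftedSq (h i) τ (g i) ≤
      -(q * (√(1 / 256 * (n / (2 * q))) / (8 * √(3 + C)))) := hg
    rw [Finset.sum_neg_distrib] at hg'
    show l ≤ ∑ i, (h i + τ * g i) ^ 2
    rw [hsum]
    linarith

end

section

variable {n : ℕ} {b : ℝ} {μ : Measure ℝ}

/-- The part of `x` made of the coordinates of size at most `δ`. -/
noncomputable def lowPart (δ : ℝ) (x : Fin n → ℝ) : Fin n → ℝ :=
  fun j => if |x j| ≤ δ then x j else 0

/-- The part of `x` made of the coordinates of size more than `δ`. -/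
noncomputable def highPart (δ : ℝ) (x : Fin n → ℝ) : Fin n → ℝ :=
  fun j => if |x j| ≤ δ then 0 else x j

lemma sum_lowPart_sq (δ : ℝ) (x : Fin n → ℝ) : ∑ j, lowPart δ x j ^ 2 = tailEnergy δ x :=
  Finset.sum_congr rfl fun j _ => by unfold lowPart; split_ifs <;> simp

lemma sum_highPart_sq (δ : ℝ) (x : Fin n → ℝ) :
    ∑ j, highPart δ x j ^ 2 + tailEnergy δ x = ∑ j, x j ^ 2 := by
  rw [← sum_lowPart_sq, ← Finset.sum_add_distrib]
  refine Finset.sum_congr rfl fun j _ => ?_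
  unfold highPart lowPart; split_ifs <;> simp

lemma abs_lowPart_le {δ : ℝ} (hδ : 0 ≤ δ) (x : Fin n → ℝ) (j : Fin n) : |lowPart δ x j| ≤ δ := by
  unfold lowPart; split_ifs with h
  · exact h
  · simpa using hδ

lemma mul_measureReal_le_prod {α β : Type*} [MeasurableSpace α] [MeasurableSpace β]
    (P : Measure α) (Q : Measure β) [IsProbabilityMeasure P] [IsProbabilityMeasure Q]
    {G : Set α} (hG : MeasurableSet G) {S : Set (α × β)} (hS : MeasurableSet S) {p : ℝ}
    (h : ∀ w ∈ G, p ≤ Q.real {z | (w, z) ∈ S}) : p * P.real G ≤ (P.prod Q).real S := by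
  rcases le_or_gt p 0 with hp | hp
  · exact (mul_nonpos_of_nonpos_of_nonneg hp measureReal_nonneg).trans measureReal_nonneg
  have h1 : ENNReal.ofReal p * P G ≤ (P.prod Q) S := by
    rw [Measure.prod_apply hS, ← setLIntegral_const]
    refine (setLIntegral_mono' hG fun w hw => ?_).trans (setLIntegral_le_lintegral _ _)
    rw [← ofReal_measureReal (measure_ne_top _ _)]
    exact ENNReal.ofReal_le_ofReal (h w hw)
  rw [measureReal_def, measureReal_def, ← ENNReal.toReal_ofReal hp.le, ← ENNReal.toReal_mul]
  exact ENNReal.toReal_mono (measure_ne_top _ _) h1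

/-- Conditioning on the contribution `h` of the large coordinates of the direction. -/
lemma prob_ge_of_shifted [IsProbabilityMeasure μ] (δ : ℝ) (x : Fin n → ℝ) {G : Set (Fin n → ℝ)}
    (hG : MeasurableSet G) {S : Set ℝ} (hS : MeasurableSet S) {p : ℝ}
    (h : ∀ w ∈ G, p ≤ (Measure.pi fun _ : Fin n × Fin n => μ).real
      {z | ∑ i, (w i + ∑ j, z (i, j) * lowPart δ x j) ^ 2 ∈ S}) :
    p * (Measure.pi fun _ : Fin n => rowLaw μ (highPart δ x)).real G ≤
      (Measure.pi fun _ : Fin n => rowLaw μ x).real {y | ∑ i, y i ^ 2 ∈ S} := by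
  classical
  set ν := Measure.pi fun _ : Fin n × Fin n => μ
  have hmul : ∀ y : Fin n → ℝ, Measurable fun (z : Fin n × Fin n → ℝ) (i : Fin n) =>
      ∑ j, z (i, j) * y j := fun y => by fun_prop
  -- A matrix of law `μ` is mixed from two independent ones, which supply the columns of the large
  -- and of the small coordinates.
  have hmix := map_mix_pi (γ := μ) (fun e : Fin n × Fin n => |x e.2| ≤ δ)
  have hm1 : Measurable fun (q : (Fin n × Fin n → ℝ) × (Fin n × Fin n → ℝ)) (e : Fin n × Fin n) =>
      if |x e.2| ≤ δ then q.2 e else q.1 e := by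
    refine measurable_pi_lambda _ fun e => ?_
    by_cases h : |x e.2| ≤ δ
    · simp only [h, if_true]; fun_prop
    · simp only [h, if_false]; fun_prop
  have hS' : MeasurableSet {y : Fin n → ℝ | ∑ i, y i ^ 2 ∈ S} := by
    have : Measurable fun y : Fin n → ℝ => ∑ i, y i ^ 2 := by fun_prop
    exact this hS
  rw [← map_mulVec_pi x, map_measureReal_apply (hmul x) hS', ← map_mulVec_pi (highPart δ x),
    map_measureReal_apply (hmul _) hG]
  nth_rw 2 [← hmix]
  rw [map_measureReal_apply hm1 (hmul x hS')]
  refine mul_measureReal_le_prod ν ν (hmul _ hG) (hm1 (hmul x hS')) fun w hw => ?_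
  refine (h _ hw).trans (le_of_eq ?_)
  congr 1
  ext z
  simp only [Set.mem_ofPred_eq, Set.mem_preimage]
  have : ∀ i, ∑ j, w (i, j) * highPart δ x j + ∑ j, z (i, j) * lowPart δ x j =
      ∑ j, (if |x j| ≤ δ then z (i, j) else w (i, j)) * x j := fun i => by
    rw [← Finset.sum_add_distrib]
    refine Finset.sum_congr rfl fun j _ => ?_
    unfold highPart lowPart; split_ifs <;> simp
  simp only [this]

/-- The contributions of the large coordinates that are typical: their energy is close to its
mean, and none is large. -/
def typicalHead (n : ℕ) (A M τ : ℝ) : Set (Fin n → ℝ) :=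
  {h | |∑ i, h i ^ 2 + n * τ ^ 2 - n| ≤ A * √n ∧ ∀ i, |h i| ≤ M}

lemma measurableSet_typicalHead (A M τ : ℝ) : MeasurableSet (typicalHead n A M τ) := by
  have h1 : Measurable fun h : Fin n → ℝ => |∑ i, h i ^ 2 + n * τ ^ 2 - n| := by fun_prop
  have h2 : ∀ i, Measurable fun h : Fin n → ℝ => |h i| := fun i => by fun_prop
  have e : typicalHead n A M τ =
      {h | |∑ i, h i ^ 2 + n * τ ^ 2 - n| ≤ A * √n} ∩ ⋂ i, {h | |h i| ≤ M} := by
    ext h; simp [typicalHead]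
  rw [e]
  exact (measurableSet_le h1 measurable_const).inter
    (MeasurableSet.iInter fun i => measurableSet_le (h2 i) measurable_const)

lemma typicalHead_prob {a : ℝ} (hb : 0 < b) (ha : 0 < a) :
    ∀ᶠ n : ℕ in atTop, ∀ μ : Measure ℝ, IsNormalizedSubgaussian b μ →
      ∀ (y : Fin n → ℝ) (τ : ℝ), ∑ j, y j ^ 2 + τ ^ 2 = 1 →
        1 / 2 ≤ (Measure.pi fun _ : Fin n => rowLaw μ y).real
          (typicalHead n (8 / b) ((n : ℝ) ^ a / 2) τ) := by
  have ht := (tendsto_rpow_mul_exp_neg_rpow (k := b / 16) (a := 2 * a) (s := 1) (by positivity)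
    (by positivity)).const_mul 2
  rw [mul_zero] at ht
  filter_upwards [ht.eventually_le_const (by norm_num : (0 : ℝ) < 1 / 4), eventually_gt_atTop 0]
    with n hε hn μ hμ y τ hyτ
  have := hμ.prob
  have hn' : (0 : ℝ) < n := by positivity
  have hb1 := hμ.le_one hb
  rw [rpow_one] at hε
  have hy1 : ∑ j, y j ^ 2 ≤ 1 := by nlinarith [sq_nonneg τ]
  set π' := Measure.pi fun _ : Fin n => rowLaw μ y
  obtain ⟨-, m2, -, m4⟩ := rowLaw_moments hμ hb y
  have hκ := fourth_moment_le hμ hb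
  have hκ0 : 0 ≤ ∫ x, x ^ 4 ∂μ := integral_nonneg fun x => by positivity
  have hy4 : ∑ j, y j ^ 4 ≤ 1 := by
    refine le_trans (Finset.sum_le_sum fun j _ => ?_) hy1
    have h1 : y j ^ 2 ≤ 1 :=
      (Finset.single_le_sum (f := fun j => y j ^ 2) (fun j _ => sq_nonneg _)
        (Finset.mem_univ j)).trans hy1
    nlinarith [sq_nonneg (y j)]
  have hy40 : 0 ≤ ∑ j, y j ^ 4 := Finset.sum_nonneg fun j _ => by positivity
  have hy20 : 0 ≤ ∑ j, y j ^ 2 := Finset.sum_nonneg fun j _ => by positivity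
  have h4b : 4 ≤ 4 / b ^ 2 := by
    rw [le_div_iff₀ (by positivity)]
    have : b ^ 2 ≤ 1 := pow_le_one₀ hb.le hb1
    linarith
  have hm4 : ∫ g, g ^ 4 ∂(rowLaw μ y) ≤ 7 / b ^ 2 := by
    rw [m4]
    have e7 : 7 / b ^ 2 = 3 / 4 * (4 / b ^ 2) + 4 / b ^ 2 := by ring
    have e8 : (∑ j, y j ^ 2) ^ 2 ≤ 1 := pow_le_one₀ hy20 hy1
    have e9 : (∫ x, x ^ 4 ∂μ) * ∑ j, y j ^ 4 ≤ ∫ x, x ^ 4 ∂μ := mul_le_of_le_one_right hκ0 hy4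
    nlinarith
  have hL4 : MemLp (fun g : ℝ => g) 4 (rowLaw μ y) := by
    have h1 : MemLp (fun a : Fin n → ℝ => ∑ j, a j * y j) 4 (Measure.pi fun _ => μ) := by
      refine memLp_finsetSum _ fun j _ => ?_
      exact ((hμ.memLp_four hb).comp_measurePreserving
        (measurePreserving_eval (fun _ : Fin n => μ) j)).mul_const (y j)
    exact (memLp_map_measure_iff (by fun_prop) (measurable_linForm y).aemeasurable).2 h1
  have hL2 : MemLp (fun g : ℝ => g ^ 2) 2 (rowLaw μ y) := by
    refine (memLp_two_iff_integrable_sq (by fun_prop)).2 ?_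
    have := integrable_pow_of_memLp hL4 (k := 4) le_rfl
    refine this.congr (ae_of_all _ fun g => ?_)
    ring
  have hvar : variance (∑ i : Fin n, fun h : Fin n → ℝ => (h i) ^ 2) π' ≤ n * (7 / b ^ 2) := by
    rw [variance_sum_pi (X := fun (_ : Fin n) (g : ℝ) => g ^ 2) fun _ => hL2]
    rw [Finset.sum_const, Finset.card_univ, Fintype.card_fin, nsmul_eq_mul]
    gcongr
    refine (variance_le_expectation_sq (by fun_prop)).trans (le_trans (le_of_eq ?_) hm4)
    refine integral_congr_ae (ae_of_all _ fun g => ?_)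
    simp only [Pi.pow_apply]; ring
  have hmean : ∫ h : Fin n → ℝ, (∑ i : Fin n, fun h : Fin n → ℝ => (h i) ^ 2) h ∂π' =
      n * ∑ j, y j ^ 2 := by
    simp only [Finset.sum_apply]
    rw [integral_finsetSum]
    · have : ∀ i, ∫ h : Fin n → ℝ, h i ^ 2 ∂π' = ∑ j, y j ^ 2 := fun i => by
        rw [integral_comp_eval (μ := fun _ : Fin n => rowLaw μ y) (i := i) (f := fun x => x ^ 2)
          (by fun_prop), m2]
      simp [this]
    · intro i _
      exact integrable_comp_eval (μ := fun _ : Fin n => rowLaw μ y) (i := i)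
        (f := fun x => x ^ 2) (integrable_pow_of_memLp hL4 (by norm_num))
  have hML : MemLp (∑ i : Fin n, fun h : Fin n → ℝ => (h i) ^ 2) 2 π' :=
    memLp_finsetSum' _ fun i _ => hL2.comp_measurePreserving
      (measurePreserving_eval (fun _ : Fin n => rowLaw μ y) i)
  -- Chebyshev's inequality for the energy, then a union bound for the coordinates.
  have hch := meas_ge_le_variance_div_sq hML (c := 8 / b * √n) (by positivity)
  have hch' : π'.real {h | 8 / b * √n ≤ |∑ i, h i ^ 2 + n * τ ^ 2 - n|} ≤ 1 / 4 := by
    have e1 : {h : Fin n → ℝ | 8 / b * √n ≤ |∑ i, h i ^ 2 + n * τ ^ 2 - n|} =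
        {h | 8 / b * √n ≤ |(∑ i : Fin n, fun h : Fin n → ℝ => (h i) ^ 2) h -
          ∫ h : Fin n → ℝ, (∑ i : Fin n, fun h : Fin n → ℝ => (h i) ^ 2) h ∂π'|} := by
      ext h
      rw [hmean]
      simp only [Set.mem_ofPred_eq, Finset.sum_apply]
      have : ∑ i, h i ^ 2 + n * τ ^ 2 - n = ∑ i, h i ^ 2 - n * ∑ j, y j ^ 2 := by
        rw [← eq_sub_iff_add_eq'] at hyτ; rw [hyτ]; ring
      rw [this]
    rw [e1, measureReal_def]
    refine ENNReal.toReal_le_of_le_ofReal (by norm_num) (hch.trans (ENNReal.ofReal_le_ofReal ?_))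
    rw [div_le_iff₀ (by positivity), mul_pow, sq_sqrt hn'.le]
    refine hvar.trans (le_of_sub_nonneg ?_)
    have : 1 / 4 * ((8 / b) ^ 2 * n) - n * (7 / b ^ 2) = 9 / b ^ 2 * n := by field_simp; norm_num
    rw [this]; positivity
  have htail : ∀ i : Fin n, π'.real {h | (n : ℝ) ^ a / 2 ≤ |h i|} ≤
      2 * exp (-(b / 16 * (n : ℝ) ^ (2 * a))) := fun i => by
    have h1 := rowLaw_tail hμ hb y hy1 (s := (n : ℝ) ^ a / 2) (by positivity)
    have hs : MeasurableSet {x : ℝ | (n : ℝ) ^ a / 2 ≤ |x|} :=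
      measurableSet_le measurable_const measurable_id.abs
    rw [← (measurePreserving_eval (fun _ : Fin n => rowLaw μ y) i).measureReal_preimage
      hs.nullMeasurableSet] at h1
    refine h1.trans (le_of_eq ?_)
    congr 3
    rw [mul_comm 2 a, rpow_mul hn'.le]
    norm_num
    field_simp
    norm_num
  have hcompl : (typicalHead n (8 / b) ((n : ℝ) ^ a / 2) τ)ᶜ ⊆
      {h | 8 / b * √n ≤ |∑ i, h i ^ 2 + n * τ ^ 2 - n|} ∪
        ⋃ i ∈ (Finset.univ : Finset (Fin n)), {h : Fin n → ℝ | (n : ℝ) ^ a / 2 ≤ |h i|} := by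
    intro h hh
    by_contra hcon
    simp only [Set.mem_union, Set.mem_ofPred_eq, Set.mem_iUnion, not_or, not_exists,
      not_le] at hcon
    exact hh ⟨hcon.1.le, fun i => (hcon.2 i (Finset.mem_univ i)).le⟩
  have h1 := (measureReal_mono (μ := π') hcompl (measure_ne_top _ _)).trans
    (measureReal_union_le _ _)
  have h2 := (measureReal_biUnion_finset_le (μ := π') (Finset.univ : Finset (Fin n))
    fun i => {h : Fin n → ℝ | (n : ℝ) ^ a / 2 ≤ |h i|}).trans
    (Finset.sum_le_sum fun i _ => htail i)
  rw [Finset.sum_const, Finset.card_univ, Fintype.card_fin, nsmul_eq_mul] at h2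
  rw [probReal_compl_eq_one_sub (measurableSet_typicalHead _ _ _)] at h1
  linarith

end

section

variable {b : ℝ}

/-- Linear forms with small coefficients have nearly Gaussian third and fourth moments. -/
lemma rowLaw_moments_near_gaussian {n : ℕ} {μ : Measure ℝ} (h : IsNormalizedSubgaussian b μ)
    (hb : 0 < b) {y : Fin n → ℝ} (hy : ∑ j, y j ^ 2 = 1) {d : ℝ} (hd : ∀ j, |y j| ≤ d)
    (hd1 : 4 / b ^ 2 * d ≤ 1 / 8) :
    |∫ g, g ^ 3 ∂(rowLaw μ y)| ≤ 1 / 8 ∧ |∫ g, g ^ 4 ∂(rowLaw μ y) - 3| ≤ 1 / 8 := by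
  have := h.prob
  have hb1 := h.le_one hb
  have h4b : 4 ≤ 4 / b ^ 2 := by
    rw [le_div_iff₀ (by positivity)]
    have : b ^ 2 ≤ 1 := pow_le_one₀ hb.le hb1
    linarith
  have hκ := fourth_moment_le h hb
  have hκ0 : 0 ≤ ∫ x, x ^ 4 ∂μ := integral_nonneg fun x => by positivity
  obtain ⟨-, -, m3, m4⟩ := rowLaw_moments h hb y
  have hm3 : |∫ x, x ^ 3 ∂μ| ≤ 4 / b ^ 2 := by
    have i24 : Integrable (fun x : ℝ => x ^ 2 / 2 + x ^ 4 / 2) μ :=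
      ((h.integrable_pow hb 2).div_const 2).add ((h.integrable_pow hb 4).div_const 2)
    calc |∫ x, x ^ 3 ∂μ| ≤ ∫ x, |x ^ 3| ∂μ := abs_integral_le_integral_abs
      _ ≤ ∫ x, (x ^ 2 / 2 + x ^ 4 / 2) ∂μ := by
          refine integral_mono (h.integrable_pow hb 3).abs i24 fun x => ?_
          show |x ^ 3| ≤ x ^ 2 / 2 + x ^ 4 / 2
          rw [abs_le]
          constructor <;> nlinarith [mul_nonneg (sq_nonneg x) (sq_nonneg (x + 1)),
            mul_nonneg (sq_nonneg x) (sq_nonneg (x - 1))]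
      _ = 1 / 2 + (∫ x, x ^ 4 ∂μ) / 2 := by
          rw [integral_add ((h.integrable_pow hb 2).div_const 2)
            ((h.integrable_pow hb 4).div_const 2), integral_div, integral_div, h.sq]
      _ ≤ 4 / b ^ 2 := by linarith
  have hd0 : 0 ≤ d := by
    have hne : (Finset.univ : Finset (Fin n)).Nonempty := by
      rw [Finset.nonempty_iff_ne_empty]; intro h0
      rw [h0] at hy; simp at hy
    obtain ⟨j, -⟩ := hne
    exact (abs_nonneg _).trans (hd j)
  have hd2 : d ≤ 1 := by nlinarith
  have s3 : |∑ j, y j ^ 3| ≤ d := by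
    calc |∑ j, y j ^ 3| ≤ ∑ j, |y j ^ 3| := Finset.abs_sum_le_sum_abs _ _
      _ ≤ ∑ j, d * y j ^ 2 := Finset.sum_le_sum fun j _ => by
          rw [abs_pow, show |y j| ^ 3 = |y j| * |y j| ^ 2 by ring, sq_abs]
          gcongr; exact hd j
      _ = d := by rw [← Finset.mul_sum, hy, mul_one]
  have s4 : |∑ j, y j ^ 4| ≤ d := by
    calc |∑ j, y j ^ 4| ≤ ∑ j, |y j ^ 4| := Finset.abs_sum_le_sum_abs _ _
      _ ≤ ∑ j, d * y j ^ 2 := Finset.sum_le_sum fun j _ => by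
          have h1 : |y j| * |y j| ≤ d * 1 :=
            mul_le_mul (hd j) ((hd j).trans hd2) (abs_nonneg _) hd0
          rw [abs_pow, show |y j| ^ 4 = (|y j| * |y j|) * |y j| ^ 2 by ring, sq_abs]
          gcongr; linarith
      _ = d := by rw [← Finset.mul_sum, hy, mul_one]
  constructor
  · rw [m3, abs_mul]
    exact (mul_le_mul hm3 s3 (abs_nonneg _) (by positivity)).trans hd1
  · rw [m4, hy, show 3 * (1 : ℝ) ^ 2 + (∫ x, x ^ 4 ∂μ - 3) * ∑ j, y j ^ 4 - 3 =
      (∫ x, x ^ 4 ∂μ - 3) * ∑ j, y j ^ 4 by ring, abs_mul]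
    refine (mul_le_mul ?_ s4 (abs_nonneg _) (by positivity)).trans hd1
    rw [abs_le]; constructor <;> linarith

/-- With the contribution of the large coordinates fixed and typical, the squared norm of the
image falls on both sides of the level with a probability bounded below. -/
lemma both_sides_shifted {c A : ℝ} (hb : 0 < b) (hc0 : 0 < c) (hA : 0 ≤ A) :
    ∃ p > (0 : ℝ), ∀ᶠ n : ℕ in atTop, ∀ μ : Measure ℝ, IsNormalizedSubgaussian b μ →
      ∀ x : Fin n → ℝ, 1 / 16 ≤ tailEnergy ((n : ℝ) ^ (-c)) x → ∀ M : ℝ,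
      ∀ h ∈ typicalHead n A M (√(tailEnergy ((n : ℝ) ^ (-c)) x)), ∀ l : ℝ, |l - n| ≤ A * √n →
        p ≤ (Measure.pi fun _ : Fin n × Fin n => μ).real
          {z | ∑ i, (h i + ∑ j, z (i, j) * lowPart ((n : ℝ) ^ (-c)) x j) ^ 2 < l} ∧
        p ≤ (Measure.pi fun _ : Fin n × Fin n => μ).real
          {z | l ≤ ∑ i, (h i + ∑ j, z (i, j) * lowPart ((n : ℝ) ^ (-c)) x j) ^ 2} := by
  obtain ⟨p, hp, hev⟩ := both_sides_prob (b := b / 16) (by positivity) hA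
  have ht := (tendsto_natCast_rpow_neg hc0).const_mul (4 / b ^ 2 * 4)
  rw [mul_zero] at ht
  refine ⟨p, hp, ?_⟩
  filter_upwards [hev, ht.eventually_le_const (by norm_num : (0 : ℝ) < 1 / 8)]
    with n hev hd μ hμ x hE M h hh l hl
  have := hμ.prob
  set δ := (n : ℝ) ^ (-c) with hδ
  have hδ0 : 0 ≤ δ := by positivity
  set τ := √(tailEnergy δ x)
  have hτ : 1 / 4 ≤ τ := le_sqrt_of_sq_le (by norm_num; linarith)
  have hτ0 : 0 < τ := by linarith
  -- The unit vector in the direction of the small coordinates has coordinates at most `4 δ`.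
  set u : Fin n → ℝ := fun j => lowPart δ x j / τ with hu
  have hu1 : ∑ j, u j ^ 2 = 1 := by
    simp only [hu, div_pow]
    rw [← Finset.sum_div, sum_lowPart_sq, sq_sqrt (by linarith), div_self (by linarith)]
  have hud : ∀ j, |u j| ≤ 4 * δ := fun j => by
    simp only [hu, abs_div, abs_of_pos hτ0]
    rw [div_le_iff₀ hτ0]
    have := abs_lowPart_le hδ0 x j
    nlinarith
  obtain ⟨g3, g4⟩ := rowLaw_moments_near_gaussian hμ hb hu1 hud (by linarith)
  obtain ⟨r1, r2⟩ := hev (rowLaw μ u) (rowLaw_isNormalizedSubgaussian hμ hb hu1) g3 g4 τ hτ h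
    hh.1 l hl
  have hmul : Measurable fun (z : Fin n × Fin n → ℝ) (i : Fin n) => ∑ j, z (i, j) * u j := by
    fun_prop
  have hF : Measurable fun g : Fin n → ℝ => ∑ i, (h i + τ * g i) ^ 2 := by fun_prop
  have e : ∀ (z : Fin n × Fin n → ℝ) (i : Fin n),
      τ * ∑ j, z (i, j) * u j = ∑ j, z (i, j) * lowPart δ x j := fun z i => by
    rw [Finset.mul_sum]
    refine Finset.sum_congr rfl fun j _ => ?_
    simp only [hu]; field_simp
  rw [← map_mulVec_pi u, map_measureReal_apply hmul (measurableSet_lt hF measurable_const)] at r1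
  rw [← map_mulVec_pi u, map_measureReal_apply hmul (measurableSet_le measurable_const hF)] at r2
  simp only [Set.preimage_ofPred_eq, e] at r1 r2
  exact ⟨r1, r2⟩

/-- The squared norm of the image of a direction that is not concentrated on few coordinates
falls on both sides of any level within `O(√n)` of `n` with a probability bounded below. -/
lemma both_sides_row {c A : ℝ} (hb : 0 < b) (hc0 : 0 < c) (hA : 0 ≤ A) :
    ∃ p > (0 : ℝ), ∀ᶠ n : ℕ in atTop, ∀ μ : Measure ℝ, IsNormalizedSubgaussian b μ →
      ∀ x : Fin n → ℝ, ∑ j, x j ^ 2 = 1 → 1 / 16 ≤ tailEnergy ((n : ℝ) ^ (-c)) x →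
      ∀ l : ℝ, |l - n| ≤ A * √n →
        p ≤ (Measure.pi fun _ : Fin n => rowLaw μ x).real {y | ∑ i, y i ^ 2 < l} ∧
        p ≤ (Measure.pi fun _ : Fin n => rowLaw μ x).real {y | l ≤ ∑ i, y i ^ 2} := by
  obtain ⟨p, hp, hev⟩ := both_sides_shifted (A := max A (8 / b)) hb hc0 (hA.trans (le_max_left _ _))
  refine ⟨p * (1 / 2), by positivity, ?_⟩
  filter_upwards [hev, typicalHead_prob (a := c) hb hc0] with n hev hG μ hμ x hx hE l hl
  have := hμ.prob
  set δ := (n : ℝ) ^ (-c) with hδ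
  have hG' := hG μ hμ (highPart δ x) (√(tailEnergy δ x)) (by
    rw [sq_sqrt (tailEnergy_nonneg _ _), sum_highPart_sq, hx])
  set G := typicalHead n (8 / b) ((n : ℝ) ^ c / 2) (√(tailEnergy δ x)) with hGdef
  have hsub : G ⊆ typicalHead n (max A (8 / b)) ((n : ℝ) ^ c / 2) (√(tailEnergy δ x)) := by
    intro h hh
    refine ⟨hh.1.trans ?_, hh.2⟩
    gcongr; exact le_max_right _ _
  have hl' : |l - n| ≤ max A (8 / b) * √n := hl.trans (by gcongr; exact le_max_left _ _)
  have key := fun h (hh : h ∈ G) => hev μ hμ x hE _ h (hsub hh) l hl'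
  constructor
  · refine le_trans ?_ (prob_ge_of_shifted δ x (measurableSet_typicalHead _ _ _) (p := p)
      (S := Set.Iio l) measurableSet_Iio fun h hh => (key h hh).1)
    gcongr
  · refine le_trans ?_ (prob_ge_of_shifted δ x (measurableSet_typicalHead _ _ _) (p := p)
      (S := Set.Ici l) measurableSet_Ici fun h hh => (key h hh).2)
    gcongr

end

/-! ### Probability of coming close to a level -/

section

variable {b : ℝ}

lemma card_filter_div_le {n k : ℕ} (hk : 0 < k) (m : ℕ) :
    (Finset.univ.filter fun i : Fin n => (i : ℕ) / k = m).card ≤ k := by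
  have h1 : ((Finset.univ.filter fun i : Fin n => (i : ℕ) / k = m).image fun i : Fin n =>
      (i : ℕ)) ⊆ Finset.Ico (m * k) (m * k + k) := by
    intro j hj
    obtain ⟨i, hi, rfl⟩ := Finset.mem_image.1 hj
    have h2 := (Finset.mem_filter.1 hi).2
    rw [Nat.div_eq_iff hk] at h2
    rw [Finset.mem_Ico]
    omega
  have h2 := Finset.card_le_card h1
  rwa [Finset.card_image_of_injective _ Fin.val_injective, Nat.card_Ico,
    Nat.add_sub_cancel_left] at h2

/-- At scales above `n^ε`, the squared norm of the image of a spread direction is `H`-close to a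
level near `n` with a probability of order `H² / n`, up to `n^ε`: the rows are resampled in blocks
of length about `H²`, each of which changes the squared norm by at most `H`. -/
lemma near_level_prob_coarse {c ε A C : ℝ} (hb : 0 < b) (hc0 : 0 < c) (hε : 0 < ε) (hA : 0 ≤ A) :
    ∃ k > (0 : ℝ), ∀ᶠ n : ℕ in atTop, ∀ μ : Measure ℝ, IsNormalizedSubgaussian b μ →
      ∀ x : Fin n → ℝ, ∑ j, x j ^ 2 = 1 → 1 / 16 ≤ tailEnergy ((n : ℝ) ^ (-c)) x →
      ∀ l : ℝ, |l - n| ≤ A * √n → ∀ H : ℝ, (n : ℝ) ^ ε ≤ H → H ≤ C * √n →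
        k * (H ^ 2 / n * (n : ℝ) ^ (-ε)) ≤
          (Measure.pi fun _ : Fin n => rowLaw μ x).real {y | |∑ i, y i ^ 2 - l| ≤ H} := by
  obtain ⟨p, hp, hev⟩ := both_sides_row (A := A) hb hc0 hA
  have hb16 : 0 < b / 16 := by positivity
  have hB0 := bernsteinConst_pos hb16
  have ht := (tendsto_rpow_mul_exp_neg_rpow (k := bernsteinConst (b / 16) / 4) (a := ε) (s := 1)
    (by positivity) hε).const_mul 8
  have ht2 := (tendsto_natCast_rpow_neg hε).const_mul (C ^ 2)
  rw [mul_zero] at ht ht2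
  refine ⟨p ^ 2 / 8, by positivity, ?_⟩
  filter_upwards [hev, ht.eventually_le_const (by positivity : 0 < p ^ 2 / 2),
    ht2.eventually_le_const zero_lt_one, eventually_gt_atTop 0]
    with n hev hexp hC1 hn μ hμ x hx hE l hl H hH1 hH2
  have := hμ.prob
  have hγ := rowLaw_isNormalizedSubgaussian hμ hb hx
  set γ := rowLaw μ x
  set π' := Measure.pi fun _ : Fin n => γ
  have hn' : (0 : ℝ) < n := by positivity
  have hn1 : (1 : ℝ) ≤ n := by exact_mod_cast hn
  rw [rpow_one] at hexp
  have hnε : 1 ≤ (n : ℝ) ^ ε := one_le_rpow hn1 hε.le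
  have hnεi : (n : ℝ) ^ (-ε) * (n : ℝ) ^ ε = 1 := by rw [← rpow_add hn']; simp
  have hnε0 : 0 < (n : ℝ) ^ (-ε) := by positivity
  have hH0 : 0 < H := by linarith
  -- The length of the blocks is the integer part of `s`; the factor `n^(-ε)` makes the fluctuation
  -- of a block smaller than `H` with overwhelming probability.
  set s := H ^ 2 * (n : ℝ) ^ (-ε) with hs
  have hs0 : 0 < s := by positivity
  have hs1 : 1 ≤ s := by
    have h1 : (n : ℝ) ^ ε * (n : ℝ) ^ ε ≤ H ^ 2 := by nlinarith
    calc (1 : ℝ) ≤ (n : ℝ) ^ ε * ((n : ℝ) ^ (-ε) * (n : ℝ) ^ ε) := by rw [hnεi, mul_one]; exact hnε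
      _ = ((n : ℝ) ^ ε * (n : ℝ) ^ ε) * (n : ℝ) ^ (-ε) := by ring
      _ ≤ s := by rw [hs]; gcongr
  have hsn : s ≤ n := by
    calc s ≤ (C * √n) ^ 2 * (n : ℝ) ^ (-ε) := by rw [hs]; gcongr
      _ = C ^ 2 * (n : ℝ) ^ (-ε) * n := by rw [mul_pow, sq_sqrt hn'.le]; ring
      _ ≤ 1 * n := by gcongr
      _ = n := one_mul _
  set k := ⌊s⌋₊ with hk
  have hk1 : 1 ≤ k := Nat.one_le_floor_iff _ |>.2 hs1
  have hks : (k : ℝ) ≤ s := Nat.floor_le hs0.le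
  have hks2 : s / 2 ≤ k := by
    have h1 := Nat.lt_floor_add_one s
    have h2 : (1 : ℝ) ≤ k := by exact_mod_cast hk1
    rw [← hk] at h1
    linarith
  have hk0 : (0 : ℝ) < k := by exact_mod_cast hk1
  set B := n / k + 1 with hB
  have hBle : (B : ℝ) ≤ 4 * (n / s) := by
    have h1 : ((n / k : ℕ) : ℝ) ≤ n / k := Nat.cast_div_le
    have h2 : (1 : ℝ) ≤ n / k := by rw [le_div_iff₀ hk0]; linarith
    have h3 : (n : ℝ) / k ≤ 2 * (n / s) := by
      rw [div_le_iff₀ hk0, ← sub_nonneg]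
      have : 2 * (n / s) * k - n = 2 * n / s * (k - s / 2) := by field_simp
      rw [this]
      exact mul_nonneg (by positivity) (by linarith)
    rw [hB]; push_cast; linarith
  have hBn : (B : ℝ) ≤ 2 * n := by
    have : n / k ≤ n := Nat.div_le_self _ _
    have h1 : B ≤ 2 * n := by omega
    exact_mod_cast h1
  set cell : Fin n → ℕ := fun i => (i : ℕ) / k with hcell
  have hcellB : ∀ i, cell i < B := fun i => by
    have : (i : ℕ) / k ≤ n / k := Nat.div_le_div_right i.2.le
    simp only [hcell, hB]; omega
  have hf : Measurable fun y : Fin n → ℝ => ∑ i, y i ^ 2 := by fun_prop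
  have hcr := crossing (γ := γ) hf hcellB l H
  obtain ⟨r1, r2⟩ := hev μ hμ x hx hE l hl
  -- Resampling a block changes the squared norm by the difference of two independent copies of its
  -- centred energy, so Bernstein's inequality applies.
  have hbad : ∀ m ∈ Finset.range B, (π'.prod π').real
      {q | H < |∑ i, hybrid cell (m + 1) q i ^ 2 - ∑ i, hybrid cell m q i ^ 2|} ≤
      4 * exp (-(bernsteinConst (b / 16) / 4 * (n : ℝ) ^ ε)) := by
    intro m _
    set J := Finset.univ.filter fun i : Fin n => (i : ℕ) / k = m with hJ
    have hJk : (J.card : ℝ) ≤ k := by exact_mod_cast card_filter_div_le hk1 m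
    have hbern := bernstein hγ hb16 J hk0 hJk (u := H / 2) (by positivity)
    have hrate : 2 * exp (-(bernsteinConst (b / 16) * min ((H / 2) ^ 2 / k) (H / 2))) ≤
        2 * exp (-(bernsteinConst (b / 16) / 4 * (n : ℝ) ^ ε)) := by
      have h1 : (n : ℝ) ^ ε / 4 ≤ min ((H / 2) ^ 2 / k) (H / 2) := by
        refine le_min ?_ (by linarith)
        rw [le_div_iff₀ hk0]
        calc (n : ℝ) ^ ε / 4 * k ≤ (n : ℝ) ^ ε / 4 * s := by gcongr
          _ = H ^ 2 / 4 * ((n : ℝ) ^ (-ε) * (n : ℝ) ^ ε) := by rw [hs]; ring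
          _ = (H / 2) ^ 2 := by rw [hnεi]; ring
      have h2 := mul_le_mul_of_nonneg_left h1 hB0.le
      exact mul_le_mul_of_nonneg_left (exp_le_exp.2 (by linarith)) (by norm_num)
    have hS : MeasurableSet {y : Fin n → ℝ | H / 2 ≤ |∑ i ∈ J, (y i ^ 2 - 1)|} :=
      measurableSet_le measurable_const (by fun_prop)
    have hdiff : ∀ q : (Fin n → ℝ) × (Fin n → ℝ),
        ∑ i, hybrid cell (m + 1) q i ^ 2 - ∑ i, hybrid cell m q i ^ 2 =
          ∑ i ∈ J, (q.2 i ^ 2 - 1) - ∑ i ∈ J, (q.1 i ^ 2 - 1) := by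
      intro q
      rw [← Finset.sum_sub_distrib, ← Finset.sum_sub_distrib, hJ, Finset.sum_filter]
      refine Finset.sum_congr rfl fun i _ => ?_
      unfold hybrid
      by_cases h1 : (i : ℕ) / k = m
      · simp [hcell, h1]
      · have h2 : (i : ℕ) / k < m + 1 ↔ (i : ℕ) / k < m := by omega
        simp only [hcell, h1, h2, if_false, sub_self]
    have hsub : {q | H < |∑ i, hybrid cell (m + 1) q i ^ 2 - ∑ i, hybrid cell m q i ^ 2|} ⊆
        Prod.snd ⁻¹' {y : Fin n → ℝ | H / 2 ≤ |∑ i ∈ J, (y i ^ 2 - 1)|} ∪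
        Prod.fst ⁻¹' {y : Fin n → ℝ | H / 2 ≤ |∑ i ∈ J, (y i ^ 2 - 1)|} := by
      intro q hq
      have hq' : H < |∑ i ∈ J, (q.2 i ^ 2 - 1) - ∑ i ∈ J, (q.1 i ^ 2 - 1)| := by
        rw [← hdiff]; exact hq
      by_contra hcon
      simp only [Set.mem_union, Set.mem_preimage, Set.mem_ofPred_eq, not_or, not_le] at hcon
      have := abs_sub (∑ i ∈ J, (q.2 i ^ 2 - 1)) (∑ i ∈ J, (q.1 i ^ 2 - 1))
      linarith
    have h1 := (measureReal_mono (μ := π'.prod π') hsub (measure_ne_top _ _)).trans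
      (measureReal_union_le _ _)
    rw [measurePreserving_snd.measureReal_preimage hS.nullMeasurableSet,
      measurePreserving_fst.measureReal_preimage hS.nullMeasurableSet] at h1
    linarith
  have hsum := Finset.sum_le_sum hbad
  rw [Finset.sum_const, Finset.card_range, nsmul_eq_mul] at hsum
  have hpp : p * p ≤ π'.real {y | ∑ i, y i ^ 2 < l} * π'.real {y | l ≤ ∑ i, y i ^ 2} :=
    mul_le_mul r1 r2 hp.le measureReal_nonneg
  set Q := π'.real {y | |∑ i, y i ^ 2 - l| ≤ H} with hQ
  have h5 : (B : ℝ) * (4 * exp (-(bernsteinConst (b / 16) / 4 * (n : ℝ) ^ ε))) ≤ p ^ 2 / 2 := by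
    refine le_trans ?_ hexp
    calc _ ≤ 2 * n * (4 * exp (-(bernsteinConst (b / 16) / 4 * (n : ℝ) ^ ε))) := by gcongr
      _ = _ := by ring
  have h6 : p ^ 2 / 2 ≤ 4 * (n / s) * Q := by
    have h7 : (B : ℝ) * Q ≤ 4 * (n / s) * Q := by
      gcongr
    nlinarith
  calc p ^ 2 / 8 * (H ^ 2 / n * (n : ℝ) ^ (-ε)) = p ^ 2 / 2 * (s / (4 * n)) := by
        rw [hs]; field_simp; norm_num
    _ ≤ 4 * (n / s) * Q * (s / (4 * n)) := by gcongr
    _ = Q := by field_simp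

end

section

variable {b : ℝ}

/-- Cutting a sequence of weights whenever the partial sums pass a multiple of `δ` gives chunks of
weight at most `δ` plus one weight. -/
lemma chunk_weight_le {n : ℕ} {w : Fin n → ℝ} (hw : ∀ j, 0 ≤ w j) {θ δ : ℝ} (hδ : 0 < δ)
    (hθ0 : 0 ≤ θ) (hθ : ∀ j, w j ≤ θ) (m : ℕ) :
    ∑ j ∈ Finset.univ.filter (fun j => ⌊(∑ i ∈ Finset.univ.filter (· < j), w i) / δ⌋₊ = m), w j ≤
      δ + θ := by
  set pre : Fin n → ℝ := fun j => ∑ i ∈ Finset.univ.filter (· < j), w i with hpre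
  set J := Finset.univ.filter (fun j => ⌊pre j / δ⌋₊ = m) with hJ
  have hp0 : ∀ j, 0 ≤ pre j := fun j => Finset.sum_nonneg fun i _ => hw i
  rcases J.eq_empty_or_nonempty with h0 | hne
  · rw [h0, Finset.sum_empty]; positivity
  set j₁ := J.min' hne
  set j₂ := J.max' hne
  have h1 : ⌊pre j₁ / δ⌋₊ = m := (Finset.mem_filter.1 (J.min'_mem hne)).2
  have h2 : ⌊pre j₂ / δ⌋₊ = m := (Finset.mem_filter.1 (J.max'_mem hne)).2
  have h3 : (m : ℝ) * δ ≤ pre j₁ := by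
    rw [← le_div_iff₀ hδ, ← h1]; exact Nat.floor_le (div_nonneg (hp0 _) hδ.le)
  have h4 : pre j₂ ≤ (m + 1) * δ := by
    rw [← div_le_iff₀ hδ, ← h2]; exact (Nat.lt_floor_add_one _).le
  have h5 : pre j₁ + ∑ j ∈ J, w j ≤ pre j₂ + w j₂ := by
    have hd : Disjoint (Finset.univ.filter (· < j₁)) J := by
      rw [Finset.disjoint_left]
      intro j hj hjJ
      exact absurd (Finset.mem_filter.1 hj).2 (not_lt.2 (J.min'_le j hjJ))
    have hnot : j₂ ∉ Finset.univ.filter (· < j₂) := by simp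
    rw [hpre, add_comm (∑ i ∈ Finset.univ.filter (· < j₂), w i) (w j₂),
      ← Finset.sum_insert hnot, ← Finset.sum_union hd]
    refine Finset.sum_le_sum_of_subset_of_nonneg ?_ fun i _ _ => hw i
    intro j hj
    rcases Finset.mem_union.1 hj with h | h
    · have h6 : j < j₂ := lt_of_lt_of_le (Finset.mem_filter.1 h).2
        (J.min'_le _ (J.max'_mem hne))
      exact Finset.mem_insert_of_mem (Finset.mem_filter.2 ⟨Finset.mem_univ _, h6⟩)
    · rcases (J.le_max' j h).lt_or_eq with h6 | h6
      · exact Finset.mem_insert_of_mem (Finset.mem_filter.2 ⟨Finset.mem_univ _, h6⟩)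
      · exact Finset.mem_insert.2 (Or.inl h6)
  have := hθ j₂
  linarith

lemma matrix_row_tail {n : ℕ} {μ : Measure ℝ} (hμ : IsNormalizedSubgaussian b μ) (hb : 0 < b)
    (y : Fin n → ℝ) {v : ℝ} (hy : ∑ j, y j ^ 2 ≤ v) {s : ℝ} (hs : 0 ≤ s) (i : Fin n) :
    (Measure.pi fun _ : Fin n × Fin n => μ).real {z | s ≤ |∑ j, z (i, j) * y j|} ≤
      2 * exp (-(s ^ 2 / (4 / b * v))) := by
  have := hμ.prob
  have h1 := rowLaw_tail hμ hb y hy hs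
  have hS : MeasurableSet {x : ℝ | s ≤ |x|} := measurableSet_le measurable_const measurable_id.abs
  have hmul : Measurable fun (z : Fin n × Fin n → ℝ) (i : Fin n) => ∑ j, z (i, j) * y j := by
    fun_prop
  rw [← (measurePreserving_eval (fun _ : Fin n => rowLaw μ y) i).measureReal_preimage
    hS.nullMeasurableSet, ← map_mulVec_pi y,
    map_measureReal_apply hmul (measurable_pi_apply i hS)] at h1
  exact h1

/-- Down to bounded scales, the squared norm of the image of a spread direction is close to a
level near `n` with a probability of order `1 / n`, up to `n^c`: each row is resampled in about
`n^c` chunks of energy `n^{-c}`, each of which changes the squared norm by at most `1 / 4`. -/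
lemma near_level_prob_fine {c A : ℝ} (hb : 0 < b) (hc0 : 0 < c) (hA : 0 ≤ A) :
    ∃ k > (0 : ℝ), ∀ᶠ n : ℕ in atTop, ∀ μ : Measure ℝ, IsNormalizedSubgaussian b μ →
      ∀ x : Fin n → ℝ, ∑ j, x j ^ 2 = 1 → 1 / 16 ≤ tailEnergy ((n : ℝ) ^ (-c)) x →
      ∀ l : ℝ, |l - n| ≤ A * √n → ∀ H : ℝ, 1 / 4 ≤ H →
        k * (n : ℝ) ^ (-(1 + c)) ≤
          (Measure.pi fun _ : Fin n => rowLaw μ x).real {y | |∑ i, y i ^ 2 - l| ≤ H} := by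
  obtain ⟨p, hp, hev⟩ := both_sides_shifted (A := max A (8 / b)) hb hc0 (hA.trans (le_max_left _ _))
  have ht := (tendsto_rpow_mul_exp_neg_rpow (k := b / 32) (a := c / 4) (s := 1 + c)
    (by positivity) (by positivity)).const_mul 12
  have ht2 := (tendsto_natCast_rpow_neg (a := c / 8) (by positivity)).const_mul 3
  rw [mul_zero] at ht ht2
  refine ⟨p ^ 2 / 8, by positivity, ?_⟩
  filter_upwards [hev, ht.eventually_le_const (by positivity : 0 < p ^ 2 / 2),
    ht2.eventually_le_const (by norm_num : (0 : ℝ) < 1 / 4),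
    typicalHead_prob (a := c / 8) hb (by positivity), eventually_gt_atTop 0]
    with n hev hexp hsmall hG hn μ hμ x hx hE l hl H hH
  have := hμ.prob
  have hn' : (0 : ℝ) < n := by positivity
  have hn1 : (1 : ℝ) ≤ n := by exact_mod_cast hn
  set δ := (n : ℝ) ^ (-c) with hδ
  have hδ0 : 0 < δ := by positivity
  have hδ1 : δ ≤ 1 := rpow_le_one_of_one_le_of_nonpos hn1 (by linarith)
  have hδi : δ * (n : ℝ) ^ c = 1 := by rw [hδ, ← rpow_add hn']; simp
  set G := typicalHead n (8 / b) ((n : ℝ) ^ (c / 8) / 2) (√(tailEnergy δ x)) with hGdef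
  have hG' := hG μ hμ (highPart δ x) (√(tailEnergy δ x)) (by
    rw [sq_sqrt (tailEnergy_nonneg _ _), sum_highPart_sq, hx])
  set y := lowPart δ x with hy
  have hy1 : ∑ j, y j ^ 2 ≤ 1 := by
    have := sum_highPart_sq δ x
    have h0 : 0 ≤ ∑ j, highPart δ x j ^ 2 := Finset.sum_nonneg fun j _ => sq_nonneg _
    rw [hy, sum_lowPart_sq]; linarith
  have hyd : ∀ j, y j ^ 2 ≤ δ := fun j => by
    rw [← sq_abs]
    have h1 := abs_lowPart_le hδ0.le x j
    have h2 : |y j| ^ 2 ≤ δ ^ 2 := by gcongr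
    nlinarith
  -- The chunks of a row, each of energy at most `2 δ`.
  set q : Fin n → ℕ := fun j => ⌊(∑ i ∈ Finset.univ.filter (· < j), y i ^ 2) / δ⌋₊ with hq
  set K := ⌊(n : ℝ) ^ c⌋₊ + 1 with hK
  have hK0 : 0 < K := Nat.succ_pos _
  have hqK : ∀ j, q j < K := fun j => by
    refine Nat.lt_succ_of_le (Nat.floor_le_floor ?_)
    rw [div_le_iff₀ hδ0, mul_comm, hδi]
    exact (Finset.sum_le_sum_of_subset_of_nonneg (Finset.filter_subset _ _)
      fun i _ _ => sq_nonneg _).trans hy1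
  have hKn : (K : ℝ) ≤ 2 * (n : ℝ) ^ c := by
    have h1 : (⌊(n : ℝ) ^ c⌋₊ : ℝ) ≤ (n : ℝ) ^ c := Nat.floor_le (by positivity)
    have h2 : 1 ≤ (n : ℝ) ^ c := one_le_rpow hn1 hc0.le
    rw [hK]; push_cast; linarith
  have hBn : ((n * K : ℕ) : ℝ) ≤ 2 * (n : ℝ) ^ (1 + c) := by
    push_cast
    rw [rpow_add hn', rpow_one]
    nlinarith
  -- The cells are numbered row by row, and by chunks within a row.
  set cell : Fin n × Fin n → ℕ := fun e => e.1 * K + q e.2 with hcell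
  have hcellB : ∀ e, cell e < n * K := fun e => by
    have h1 : (e.1 : ℕ) + 1 ≤ n := e.1.2
    have h2 := hqK e.2
    calc cell e < e.1 * K + K := by simp only [hcell]; omega
      _ = (e.1 + 1) * K := by ring
      _ ≤ n * K := Nat.mul_le_mul_right _ h1
  set ν := Measure.pi fun _ : Fin n × Fin n => μ with hν
  have hsize : |l - n| ≤ max A (8 / b) * √n := hl.trans (by gcongr; exact le_max_left _ _)
  set E := exp (-(b / 32 * (n : ℝ) ^ (c / 4))) with hEdef
  have key : ∀ h ∈ G, p ^ 2 / 4 * (n : ℝ) ^ (-(1 + c)) ≤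
      ν.real {z | ∑ i, (h i + ∑ j, z (i, j) * y j) ^ 2 ∈ {v : ℝ | |v - l| ≤ H}} := by
    intro h hh
    have hh' : h ∈ typicalHead n (max A (8 / b)) ((n : ℝ) ^ (c / 8) / 2) (√(tailEnergy δ x)) := by
      refine ⟨hh.1.trans ?_, hh.2⟩
      gcongr; exact le_max_right _ _
    obtain ⟨r1, r2⟩ := hev μ hμ x hE _ h hh' l hsize
    set f : (Fin n × Fin n → ℝ) → ℝ := fun z => ∑ i, (h i + ∑ j, z (i, j) * y j) ^ 2 with hfdef
    have hf : Measurable f := by fun_prop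
    have hcr := crossing (γ := μ) hf hcellB l H
    -- Resampling a chunk of row `I` changes the entry `Y` of the image by `d`, hence its square by
    -- `2 Y d + d²`. Here `|Y| ≤ s = n^(c/8)` and `|d| ≤ r = n^(-c/4)` outside a rare event, because
    -- the energy of the chunk is of order `n^(-c)`.
    have hbad : ∀ m ∈ Finset.range (n * K), (ν.prod ν).real
        {w | H < |f (hybrid cell (m + 1) w) - f (hybrid cell m w)|} ≤ 6 * E := by
      intro m hm
      have hm' : m < n * K := Finset.mem_range.1 hm
      have hI : m / K < n := Nat.div_lt_of_lt_mul (by rwa [mul_comm] at hm')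
      set I : Fin n := ⟨m / K, hI⟩ with hIdef
      set J := Finset.univ.filter fun j : Fin n => q j = m % K with hJ
      have hcm : ∀ e : Fin n × Fin n, cell e = m ↔ e.1 = I ∧ e.2 ∈ J := fun e => by
        have h1 := hqK e.2
        rw [hJ, Finset.mem_filter, Fin.ext_iff]
        simp only [hcell, hIdef, Finset.mem_univ, true_and]
        constructor
        · rintro rfl
          constructor
          · rw [mul_comm, Nat.mul_add_div hK0, Nat.div_eq_of_lt h1, add_zero]
          · rw [mul_comm, Nat.mul_add_mod, Nat.mod_eq_of_lt h1]
        · rintro ⟨h2, h3⟩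
          rw [h2, h3]
          exact Nat.div_add_mod' m K
      have hlt : ∀ e : Fin n × Fin n, cell e < m + 1 ↔ cell e < m ∨ (e.1 = I ∧ e.2 ∈ J) :=
        fun e => by rw [← hcm]; omega
      set yJ : Fin n → ℝ := fun j => if j ∈ J then y j else 0 with hyJ
      have hyJ2 : ∑ j, yJ j ^ 2 ≤ 2 * δ := by
        have h1 : ∑ j, yJ j ^ 2 = ∑ j ∈ J, y j ^ 2 := by
          rw [hJ, Finset.sum_filter]
          refine Finset.sum_congr rfl fun j _ => ?_
          simp only [hyJ, hJ, Finset.mem_filter, Finset.mem_univ, true_and]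
          split_ifs <;> simp
        have h2 := chunk_weight_le (w := fun j => y j ^ 2) (fun j => sq_nonneg _) hδ0 hδ0.le hyd
          (m % K)
        rw [h1]
        have h3 : ∑ j ∈ J, y j ^ 2 ≤ δ + δ := h2
        linarith
      have hrow : ∀ (w : (Fin n × Fin n → ℝ) × (Fin n × Fin n → ℝ)) (i : Fin n),
          ∑ j, hybrid cell (m + 1) w (i, j) * y j = ∑ j, hybrid cell m w (i, j) * y j +
            if i = I then ∑ j, w.2 (i, j) * yJ j - ∑ j, w.1 (i, j) * yJ j else 0 := by
        intro w i
        split_ifs with hi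
        · rw [← Finset.sum_sub_distrib, ← Finset.sum_add_distrib]
          refine Finset.sum_congr rfl fun j _ => ?_
          unfold hybrid
          by_cases hj : j ∈ J
          · have h1 : cell (i, j) = m := (hcm _).2 ⟨hi, hj⟩
            simp only [h1, hyJ, hj, if_true, lt_irrefl, if_false, Nat.lt_succ_self]
            ring
          · have h1 : cell (i, j) < m + 1 ↔ cell (i, j) < m := by
              rw [hlt]; simp [hj]
            simp only [h1, hyJ, hj, if_false]
            ring
        · rw [add_zero]
          refine Finset.sum_congr rfl fun j _ => ?_
          unfold hybrid
          have h1 : cell (i, j) < m + 1 ↔ cell (i, j) < m := by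
            rw [hlt]; simp [hi]
          simp only [h1]
      have hdiff : ∀ w, f (hybrid cell (m + 1) w) - f (hybrid cell m w) =
          (h I + ∑ j, hybrid cell m w (I, j) * y j +
            (∑ j, w.2 (I, j) * yJ j - ∑ j, w.1 (I, j) * yJ j)) ^ 2 -
          (h I + ∑ j, hybrid cell m w (I, j) * y j) ^ 2 := by
        intro w
        simp only [hfdef]
        rw [← Finset.sum_sub_distrib, Finset.sum_eq_single I]
        · rw [hrow]; simp only [if_true]; ring
        · intro i _ hi
          rw [hrow]; simp only [hi, if_false]; ring
        · intro h0; exact absurd (Finset.mem_univ I) h0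
      set s := (n : ℝ) ^ (c / 8) with hs
      set r := (n : ℝ) ^ (-(c / 4)) with hr
      have hs0 : 0 < s := by positivity
      have hr0 : 0 < r := by positivity
      have hrs : s * r = (n : ℝ) ^ (-(c / 8)) := by
        rw [hs, hr, ← rpow_add hn']; congr 1; ring
      have hr1 : r ≤ (n : ℝ) ^ (-(c / 8)) :=
        rpow_le_rpow_of_exponent_le hn1 (by linarith)
      have hr2 : r ≤ 1 := rpow_le_one_of_one_le_of_nonpos hn1 (by linarith)
      have hyS : MeasurableSet {z : Fin n × Fin n → ℝ | s / 2 ≤ |∑ j, z (I, j) * y j|} :=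
        measurableSet_le measurable_const (by fun_prop)
      have hdS : MeasurableSet {z : Fin n × Fin n → ℝ | r / 2 ≤ |∑ j, z (I, j) * yJ j|} :=
        measurableSet_le measurable_const (by fun_prop)
      have hsub : {w | H < |f (hybrid cell (m + 1) w) - f (hybrid cell m w)|} ⊆
          (hybrid cell m ⁻¹' {z : Fin n × Fin n → ℝ | s / 2 ≤ |∑ j, z (I, j) * y j|}) ∪
          ((Prod.snd ⁻¹' {z : Fin n × Fin n → ℝ | r / 2 ≤ |∑ j, z (I, j) * yJ j|}) ∪
           (Prod.fst ⁻¹' {z : Fin n × Fin n → ℝ | r / 2 ≤ |∑ j, z (I, j) * yJ j|})) := by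
        intro w hw
        have hw' : H < |f (hybrid cell (m + 1) w) - f (hybrid cell m w)| := hw
        rw [hdiff] at hw'
        by_contra hcon
        simp only [Set.mem_union, Set.mem_preimage, Set.mem_ofPred_eq, not_or, not_le] at hcon
        obtain ⟨h1, h2, h3⟩ := hcon
        set Y := h I + ∑ j, hybrid cell m w (I, j) * y j
        set d := ∑ j, w.2 (I, j) * yJ j - ∑ j, w.1 (I, j) * yJ j
        have hY : |Y| ≤ s := by
          have := abs_add_le (h I) (∑ j, hybrid cell m w (I, j) * y j)
          have := hh.2 I
          linarith
        have hd : |d| ≤ r := by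
          have := abs_sub (∑ j, w.2 (I, j) * yJ j) (∑ j, w.1 (I, j) * yJ j)
          linarith
        have e1 : (Y + d) ^ 2 - Y ^ 2 = 2 * Y * d + d ^ 2 := by ring
        rw [e1] at hw'
        have h4 : |2 * Y * d + d ^ 2| ≤ 2 * (s * r) + r * 1 := by
          refine (abs_add_le _ _).trans (add_le_add ?_ ?_)
          · rw [abs_mul, abs_mul, abs_two, mul_assoc]
            gcongr
          · rw [abs_of_nonneg (sq_nonneg d), ← sq_abs, sq]
            exact mul_le_mul hd (hd.trans hr2) (abs_nonneg _) hr0.le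
        rw [hrs] at h4
        linarith
      have h1 := (measureReal_mono (μ := ν.prod ν) hsub (measure_ne_top _ _)).trans
        ((measureReal_union_le _ _).trans (add_le_add le_rfl (measureReal_union_le _ _)))
      rw [measurePreserving_snd.measureReal_preimage hdS.nullMeasurableSet,
        measurePreserving_fst.measureReal_preimage hdS.nullMeasurableSet,
        (measurePreserving_hybrid (γ := μ) cell m).measureReal_preimage
          hyS.nullMeasurableSet] at h1
      have t1 := matrix_row_tail hμ hb y hy1 (s := s / 2) (by positivity) I
      have t2 := matrix_row_tail hμ hb yJ hyJ2 (s := r / 2) (by positivity) I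
      have b1 : exp (-((s / 2) ^ 2 / (4 / b * 1))) ≤ E := by
        refine exp_le_exp.2 (neg_le_neg ?_)
        have : s ^ 2 = (n : ℝ) ^ (c / 4) := by
          rw [hs, ← rpow_natCast, ← rpow_mul hn'.le]; congr 1; push_cast; ring
        rw [div_pow, this]
        have h5 : 0 ≤ b / 32 * (n : ℝ) ^ (c / 4) := by positivity
        have h6 : (n : ℝ) ^ (c / 4) / 2 ^ 2 / (4 / b * 1) = 2 * (b / 32 * (n : ℝ) ^ (c / 4)) := by
          field_simp; norm_num
        rw [h6]; linarith
      have b2 : exp (-((r / 2) ^ 2 / (4 / b * (2 * δ)))) ≤ E := by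
        refine exp_le_exp.2 (neg_le_neg ?_)
        have e1 : r ^ 2 = (n : ℝ) ^ (c / 2) * δ := by
          rw [hr, hδ, ← rpow_natCast, ← rpow_mul hn'.le, ← rpow_add hn']; congr 1; push_cast; ring
        have e2 : (n : ℝ) ^ (c / 4) ≤ (n : ℝ) ^ (c / 2) :=
          rpow_le_rpow_of_exponent_le hn1 (by linarith)
        have h6 : (r / 2) ^ 2 / (4 / b * (2 * δ)) = b / 32 * (n : ℝ) ^ (c / 2) := by
          rw [div_pow, e1]; field_simp; norm_num
        rw [h6]; gcongr
      linarith
    have hsum := Finset.sum_le_sum hbad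
    rw [Finset.sum_const, Finset.card_range, nsmul_eq_mul] at hsum
    have hpp : p * p ≤ ν.real {z | f z < l} * ν.real {z | l ≤ f z} :=
      mul_le_mul r1 r2 hp.le measureReal_nonneg
    have h5 : ((n * K : ℕ) : ℝ) * (6 * E) ≤ p ^ 2 / 2 := by
      refine le_trans ?_ hexp
      calc _ ≤ 2 * (n : ℝ) ^ (1 + c) * (6 * E) := by
            have : 0 ≤ 6 * E := by positivity
            exact mul_le_mul_of_nonneg_right hBn this
        _ = _ := by ring
    show p ^ 2 / 4 * (n : ℝ) ^ (-(1 + c)) ≤ ν.real {z | |f z - l| ≤ H}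
    set Q := ν.real {z | |f z - l| ≤ H} with hQ
    have hQ0 : 0 ≤ Q := measureReal_nonneg
    have h6 : p ^ 2 / 2 ≤ 2 * (n : ℝ) ^ (1 + c) * Q := by
      have h7 := mul_le_mul_of_nonneg_right hBn hQ0
      nlinarith
    have h8 : (n : ℝ) ^ (1 + c) * (n : ℝ) ^ (-(1 + c)) = 1 := by rw [← rpow_add hn']; simp
    have h9 : 0 < (n : ℝ) ^ (-(1 + c)) := by positivity
    calc p ^ 2 / 4 * (n : ℝ) ^ (-(1 + c)) = p ^ 2 / 2 * ((n : ℝ) ^ (-(1 + c)) / 2) := by ring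
      _ ≤ 2 * (n : ℝ) ^ (1 + c) * Q * ((n : ℝ) ^ (-(1 + c)) / 2) := by gcongr
      _ = (n : ℝ) ^ (1 + c) * (n : ℝ) ^ (-(1 + c)) * Q := by ring
      _ = Q := by rw [h8, one_mul]
  have hS : MeasurableSet {v : ℝ | |v - l| ≤ H} :=
    measurableSet_le (by fun_prop) measurable_const
  have hfin := prob_ge_of_shifted δ x (measurableSet_typicalHead _ _ _) hS key
  refine le_trans ?_ hfin
  have h9 : 0 < (n : ℝ) ^ (-(1 + c)) := by positivity
  have h10 : 0 ≤ p ^ 2 / 4 * (n : ℝ) ^ (-(1 + c)) := by positivity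
  calc p ^ 2 / 8 * (n : ℝ) ^ (-(1 + c)) = p ^ 2 / 4 * (n : ℝ) ^ (-(1 + c)) * (1 / 2) := by ring
    _ ≤ _ := mul_le_mul_of_nonneg_left hG' h10

/-- The squared norm of the image of a spread direction is `H`-close to a level near `n` with
probability at least of order `n^{-2c} H² / n`. -/
lemma near_level_prob {c A C : ℝ} (hb : 0 < b) (hc0 : 0 < c) (hA : 0 ≤ A) :
    ∃ k > (0 : ℝ), ∀ᶠ n : ℕ in atTop, ∀ μ : Measure ℝ, IsNormalizedSubgaussian b μ →
      ∀ x : Fin n → ℝ, ∑ j, x j ^ 2 = 1 → 1 / 16 ≤ tailEnergy ((n : ℝ) ^ (-c)) x →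
      ∀ l : ℝ, |l - n| ≤ A * √n → ∀ H : ℝ, 1 / 4 ≤ H → H ≤ C * √n →
        k * (H ^ 2 / n * (n : ℝ) ^ (-(2 * c))) ≤
          (Measure.pi fun _ : Fin n => rowLaw μ x).real {y | |∑ i, y i ^ 2 - l| ≤ H} := by
  obtain ⟨k₁, hk₁, h1⟩ := near_level_prob_coarse (C := C) hb hc0 (half_pos hc0) hA
  obtain ⟨k₂, hk₂, h2⟩ := near_level_prob_fine hb hc0 hA
  refine ⟨min k₁ k₂, lt_min hk₁ hk₂, ?_⟩
  filter_upwards [h1, h2, eventually_gt_atTop 0] with n h1 h2 hn μ hμ x hx hE l hl H hH hHC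
  have hn' : (0 : ℝ) < n := by positivity
  have hn1 : (1 : ℝ) ≤ n := by exact_mod_cast hn
  rcases le_total ((n : ℝ) ^ (c / 2)) H with hcase | hcase
  · refine le_trans ?_ (h1 μ hμ x hx hE l hl H hcase hHC)
    have : (n : ℝ) ^ (-(2 * c)) ≤ (n : ℝ) ^ (-(c / 2)) :=
      rpow_le_rpow_of_exponent_le hn1 (by linarith)
    gcongr
    exact min_le_left _ _
  · refine le_trans ?_ (h2 μ hμ x hx hE l hl H hH)
    have e1 : H ^ 2 / n * (n : ℝ) ^ (-(2 * c)) ≤ (n : ℝ) ^ (-(1 + c)) := by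
      have e2 : ((n : ℝ) ^ (c / 2)) ^ 2 / n * (n : ℝ) ^ (-(2 * c)) = (n : ℝ) ^ (-(1 + c)) := by
        rw [← rpow_natCast, ← rpow_mul hn'.le, ← rpow_sub_one hn'.ne', ← rpow_add hn']
        congr 1; push_cast; ring
      rw [← e2]
      gcongr
    refine mul_le_mul (min_le_right _ _) e1 (by positivity) hk₂.le

end

/-! ### Bumps and the heat equation -/

/-- A bump supported in `[-1, 1]`. Cutting a cubic power off slightly above zero keeps the
function below a polynomial near every point of its support. -/
noncomputable def bump (z : ℝ) : ℝ := max 0 ((1 - z ^ 2) ^ 3 - 1 / 1000)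

lemma measurable_bump : Measurable bump := by unfold bump; fun_prop

lemma bump_nonneg (z : ℝ) : 0 ≤ bump z := le_max_left _ _

lemma bump_le_one (z : ℝ) : bump z ≤ 1 := by
  refine max_le zero_le_one ?_
  have h1 : (1 - z ^ 2) ^ 3 ≤ 1 ^ 3 := (Odd.strictMono_pow (by decide : Odd 3)).monotone (by
    linarith [sq_nonneg z])
  linarith

lemma lt_of_bump_pos {z : ℝ} (h : 0 < bump z) : 1 / 10 < 1 - z ^ 2 := by
  have h1 : 0 < (1 - z ^ 2) ^ 3 - 1 / 1000 := by
    rcases lt_max_iff.1 h with h | h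
    · exact absurd h (lt_irrefl _)
    · exact h
  refine (Odd.strictMono_pow (by decide : Odd 3)).lt_iff_lt.1 (?_ : (1 / 10 : ℝ) ^ 3 < _)
  linarith

lemma abs_bump_coeff_le {y : ℝ} (hy0 : 0 ≤ y) (hy1 : y ≤ 1) : |12 * y - 15 * y ^ 2| ≤ 3 := by
  rw [abs_le]
  constructor
  · nlinarith [mul_nonneg (by linarith : 0 ≤ 1 - y) (by linarith : 0 ≤ 15 * y + 3)]
  · nlinarith [sq_nonneg (5 * y - 2)]

lemma bump_taylor {z : ℝ} (hz : z ^ 2 ≤ 1) (u : ℝ) :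
    (1 - z ^ 2) ^ 3 - 1 / 1000 - 6 * z * (1 - z ^ 2) ^ 2 * u +
      (12 * (1 - z ^ 2) - 15 * (1 - z ^ 2) ^ 2) * u ^ 2 - 42 * |u| ^ 3 ≤ bump (z + u) := by
  have hz1 : |z| ≤ 1 := abs_le_one_iff_mul_self_le_one.2 (by nlinarith)
  set y := 1 - z ^ 2 with hy
  have hy0 : 0 ≤ y := by linarith
  have hy1 : y ≤ 1 := by linarith [sq_nonneg z]
  have hy2 : y ^ 2 ≤ 1 := pow_le_one₀ hy0 hy1
  have ha : 0 ≤ |u| := abs_nonneg u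
  rcases le_total |u| 1 with hu | hu
  · refine le_trans ?_ (le_max_right _ _)
    have e : (1 - (z + u) ^ 2) ^ 3 = y ^ 3 - 6 * z * y ^ 2 * u + (12 * y - 15 * y ^ 2) * u ^ 2 +
        (12 * y * z * u ^ 3 + 3 * y * u ^ 4 - (2 * z * u + u ^ 2) ^ 3) := by
      rw [hy]; ring
    have b1 : |12 * y * z * u ^ 3| ≤ 12 * |u| ^ 3 := by
      rw [abs_mul, abs_mul, abs_mul, abs_of_nonneg hy0, abs_pow]
      norm_num
      have h1 : y * |z| ≤ 1 := mul_le_one₀ hy1 (abs_nonneg _) hz1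
      have h2 : 0 ≤ |u| ^ 3 := by positivity
      nlinarith
    have b2 : 0 ≤ 3 * y * u ^ 4 := by positivity
    have b3 : |(2 * z * u + u ^ 2) ^ 3| ≤ 27 * |u| ^ 3 := by
      have h1 : |2 * z * u + u ^ 2| ≤ 3 * |u| := by
        refine (abs_add_le _ _).trans ?_
        rw [abs_mul, abs_mul, abs_two, abs_pow]
        nlinarith [abs_nonneg z]
      rw [abs_pow]
      calc |2 * z * u + u ^ 2| ^ 3 ≤ (3 * |u|) ^ 3 := by gcongr
        _ = _ := by ring
    have h2 : 0 ≤ |u| ^ 3 := by positivity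
    rw [e]
    linarith [(abs_le.1 b1).1, (abs_le.1 b3).2]
  · refine le_trans ?_ (bump_nonneg _)
    have b1 : |6 * z * y ^ 2 * u| ≤ 6 * |u| := by
      rw [abs_mul, abs_mul, abs_mul, abs_of_nonneg (sq_nonneg y)]
      norm_num
      have h1 : |z| * y ^ 2 ≤ 1 := mul_le_one₀ hz1 (sq_nonneg _) hy2
      nlinarith
    have b2 : (12 * y - 15 * y ^ 2) * u ^ 2 ≤ 3 * |u| ^ 2 := by
      rw [sq_abs]
      exact mul_le_mul_of_nonneg_right (abs_le.1 (abs_bump_coeff_le hy0 hy1)).2 (sq_nonneg u)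
    have b3 : y ^ 3 ≤ 1 := pow_le_one₀ hy0 hy1
    have h1 : |u| ≤ |u| ^ 3 := le_self_pow₀ hu (by norm_num)
    have h2 : |u| ^ 2 ≤ |u| ^ 3 := pow_le_pow_right₀ hu (by norm_num)
    have h3 : 1 ≤ |u| ^ 3 := one_le_pow₀ hu
    linarith [(abs_le.1 b1).1]

/-- The polynomial inequality that makes the rescaled bumps subsolutions of the heat equation when
the squared width decreases five times as fast as the variance accumulates. -/
lemma heat_inequality {r y : ℝ} (hr : 0 ≤ r) (hr1 : r ≤ 1 / 500) (hy1 : y ≤ 1)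
    (hy : 1 / 10 * (1 + r) ≤ r + y) :
    (((r + y) / (1 + r)) ^ 3 - 1 / 1000) / (1 + r) ≤
      y ^ 3 - 1 / 1000 + r / 5 * (12 * y - 15 * y ^ 2) - r / 20 := by
  have hp : 0 < 1 + r := by linarith
  have hy0 : 9 / 100 ≤ y := by linarith
  have e : (((r + y) / (1 + r)) ^ 3 - 1 / 1000) / (1 + r) =
      ((r + y) ^ 3 - 1 / 1000 * (1 + r) ^ 3) / (1 + r) ^ 4 := by
    field_simp
  rw [e, div_le_iff₀ (by positivity)]
  set B := y ^ 3 - 1 / 1000 + r / 5 * (12 * y - 15 * y ^ 2) - r / 20 with hB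
  have q1 : -1 ≤ 12 / 5 * y - 3 * y ^ 2 - 1 / 20 := by nlinarith
  have q2 : 12 / 5 * y - 3 * y ^ 2 - 1 / 20 ≤ 1 := by nlinarith [sq_nonneg (5 * y - 2)]
  have q3 : 1 / 10 ≤ 4 * y ^ 3 - 6 * y ^ 2 + 12 / 5 * y := by
    nlinarith [mul_nonneg (by linarith : 0 ≤ y - 9 / 100) (sq_nonneg (y - 18 / 25)),
      sq_nonneg (y - 4 / 5)]
  have y3 : 0 ≤ y ^ 3 := by positivity
  have hB1 : -2 ≤ B := by
    have : r * (-1) ≤ r * (12 / 5 * y - 3 * y ^ 2 - 1 / 20) := by gcongr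
    rw [hB]; linarith
  have r2 : 0 ≤ r ^ 2 := sq_nonneg r
  have h1 : B * (1 + 4 * r) - 14 * r ^ 2 ≤ B * (1 + r) ^ 4 := by
    have e2 : (1 + r) ^ 4 = 1 + 4 * r + r ^ 2 * (6 + 4 * r + r ^ 2) := by ring
    have h3 : 6 + 4 * r + r ^ 2 ≤ 7 := by nlinarith
    have h4 : -14 ≤ B * (6 + 4 * r + r ^ 2) := by
      have h0 : 0 ≤ 6 + 4 * r + r ^ 2 := by positivity
      nlinarith
    rw [e2]
    nlinarith
  have h2 : y ^ 3 - 1 / 1000 + r * (4 * y ^ 3 - 6 * y ^ 2 + 12 / 5 * y - 54 / 1000 + 3 * y ^ 2) -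
      4 * r ^ 2 ≤ B * (1 + 4 * r) := by
    have : r ^ 2 * (-1) ≤ r ^ 2 * (12 / 5 * y - 3 * y ^ 2 - 1 / 20) := by gcongr
    rw [hB]
    linarith
  have h3 : (r + y) ^ 3 - 1 / 1000 * (1 + r) ^ 3 ≤
      y ^ 3 + 3 * r * y ^ 2 + 4 * r ^ 2 - 1 / 1000 - 3 / 1000 * r := by
    have : r ^ 2 * y ≤ r ^ 2 * 1 := by gcongr
    have : r ^ 2 * r ≤ r ^ 2 * 1 := by gcongr; linarith
    have : 0 ≤ r ^ 3 := by positivity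
    nlinarith
  have h4 : r * (1 / 10) ≤ r * (4 * y ^ 3 - 6 * y ^ 2 + 12 / 5 * y) := by gcongr
  nlinarith

section

variable {Ω : Type*} [MeasurableSpace Ω] {ρ : Measure Ω} [IsProbabilityMeasure ρ]

/-- One step of the random walk in the bump, under a step whose first three moments are close to
those of a centred Gaussian of variance `v`. -/
lemma bump_step {ξ : Ω → ℝ} (hξ : Measurable ξ) (i1 : Integrable ξ ρ)
    (i2 : Integrable (fun ω => ξ ω ^ 2) ρ) (i3 : Integrable (fun ω => |ξ ω| ^ 3) ρ)
    {a v A : ℝ} (m1 : |∫ ω, ξ ω ∂ρ| ≤ a) (m2 : |∫ ω, ξ ω ^ 2 ∂ρ - v| ≤ a)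
    (m3 : ∫ ω, |ξ ω| ^ 3 ∂ρ ≤ a) (hv : 0 ≤ v) (hA : 0 < A) (hvA : 5 * v / A ≤ 1 / 500)
    (herr : a * (6 / √A + 3 / A + 42 / (A * √A)) ≤ v / (4 * A)) (s : ℝ) :
    bump (s / √(A + 5 * v)) / (A + 5 * v) ≤ ∫ ω, bump ((s + ξ ω) / √A) / A ∂ρ := by
  have hAv : 0 < A + 5 * v := by positivity
  have hsA : 0 < √A := sqrt_pos.2 hA
  -- Outside the support of the wider bump there is nothing to prove.
  rcases (bump_nonneg (s / √(A + 5 * v))).eq_or_lt' with h0 | hpos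
  · rw [h0, zero_div]
    exact integral_nonneg fun ω => div_nonneg (bump_nonneg _) hA.le
  have hlt := lt_of_bump_pos hpos
  have hbump : bump (s / √(A + 5 * v)) = (1 - (s / √(A + 5 * v)) ^ 2) ^ 3 - 1 / 1000 := by
    unfold bump at hpos ⊢
    rcases lt_max_iff.1 hpos with h | h
    · exact absurd h (lt_irrefl _)
    · exact max_eq_right h.le
  rw [hbump]
  rw [div_pow, sq_sqrt hAv.le] at hlt ⊢
  set r := 5 * v / A with hr
  have hr0 : 0 ≤ r := by positivity
  set z := s / √A with hz
  set y := 1 - z ^ 2 with hy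
  have ez : z ^ 2 = s ^ 2 / A := by rw [hz, div_pow, sq_sqrt hA.le]
  have ey : 1 - s ^ 2 / (A + 5 * v) = (r + y) / (1 + r) := by
    rw [hy, ez, hr]; field_simp; ring
  have eA : A + 5 * v = A * (1 + r) := by rw [hr]; field_simp
  have hy1 : y ≤ 1 := by linarith [sq_nonneg z]
  rw [ey] at hlt ⊢
  rw [lt_div_iff₀ (by linarith)] at hlt
  have hheat := heat_inequality hr0 hvA hy1 hlt.le
  have hy0 : 0 ≤ y := by linarith
  have hz2 : z ^ 2 ≤ 1 := by linarith
  have hz1 : |z| ≤ 1 := abs_le_one_iff_mul_self_le_one.2 (by nlinarith)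
  -- Integrate the Taylor lower bound for the bump at scale `√A`. The heat inequality leaves a
  -- margin `v / (4 A)`, which pays for the errors in the three moments.
  set b0 := y ^ 3 - 1 / 1000
  set b1 := 6 * z * y ^ 2 / √A with hb1
  set b2 := (12 * y - 15 * y ^ 2) / A with hb2
  set b3 := 42 / (A * √A) with hb3
  have hpt : ∀ ω, b0 - b1 * ξ ω + b2 * ξ ω ^ 2 - b3 * |ξ ω| ^ 3 ≤ bump ((s + ξ ω) / √A) := by
    intro ω
    have h1 := bump_taylor hz2 (ξ ω / √A)
    rw [add_div]
    refine le_trans (le_of_eq ?_) h1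
    have e3 : √A ^ 3 = A * √A := by
      rw [show √A ^ 3 = √A ^ 2 * √A by ring, sq_sqrt hA.le]
    rw [abs_div, abs_of_pos hsA, div_pow (ξ ω), div_pow |ξ ω|, sq_sqrt hA.le, e3, hb1, hb2, hb3]
    ring
  have j1 : Integrable (fun ω => b0 - b1 * ξ ω) ρ := (integrable_const _).sub (i1.const_mul _)
  have j2 : Integrable (fun ω => b0 - b1 * ξ ω + b2 * ξ ω ^ 2) ρ := j1.add (i2.const_mul _)
  have j3 : Integrable (fun ω => b0 - b1 * ξ ω + b2 * ξ ω ^ 2 - b3 * |ξ ω| ^ 3) ρ :=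
    j2.sub (i3.const_mul _)
  have jb : Integrable (fun ω => bump ((s + ξ ω) / √A)) ρ := by
    refine Integrable.of_bound (C := 1)
      ((measurable_bump.comp ((hξ.const_add s).div_const _)).aestronglyMeasurable)
      (ae_of_all _ fun ω => ?_)
    rw [norm_of_nonneg (bump_nonneg _)]
    exact bump_le_one _
  have hint := integral_mono j3 jb hpt
  rw [integral_sub j2 (i3.const_mul _), integral_add j1 (i2.const_mul _),
    integral_sub (integrable_const _) (i1.const_mul _), integral_const_mul, integral_const_mul,
    integral_const_mul, integral_const, probReal_univ, one_smul] at hint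
  set E1 := ∫ ω, ξ ω ∂ρ
  set E2 := ∫ ω, ξ ω ^ 2 ∂ρ
  set E3 := ∫ ω, |ξ ω| ^ 3 ∂ρ
  have c1 : b1 * E1 ≤ a * (6 / √A) := by
    have h1 : |b1| ≤ 6 / √A := by
      rw [hb1, abs_div, abs_of_pos hsA, abs_mul, abs_mul, abs_of_nonneg (sq_nonneg y)]
      have h2 : |z| * y ^ 2 ≤ 1 := mul_le_one₀ hz1 (sq_nonneg _) (pow_le_one₀ hy0 hy1)
      refine div_le_div_of_nonneg_right ?_ hsA.le
      rw [abs_of_pos (by norm_num : (0 : ℝ) < 6)]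
      linarith
    calc b1 * E1 ≤ |b1 * E1| := le_abs_self _
      _ = |E1| * |b1| := by rw [abs_mul, mul_comm]
      _ ≤ _ := mul_le_mul m1 h1 (abs_nonneg _) ((abs_nonneg _).trans m1)
  have c2 : b2 * v - a * (3 / A) ≤ b2 * E2 := by
    have h1 : |b2| ≤ 3 / A := by
      rw [hb2, abs_div, abs_of_pos hA]
      exact div_le_div_of_nonneg_right (abs_bump_coeff_le hy0 hy1) hA.le
    have h2 : |(E2 - v) * b2| ≤ a * (3 / A) := by
      rw [abs_mul]
      exact mul_le_mul m2 h1 (abs_nonneg _) ((abs_nonneg _).trans m2)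
    have := (abs_le.1 h2).1
    linarith
  have c3 : b3 * E3 ≤ a * b3 := by
    rw [mul_comm]
    have : 0 ≤ b3 := by positivity
    gcongr
  have e5 : b2 * v = r / 5 * (12 * y - 15 * y ^ 2) := by rw [hb2, hr]; ring
  have e6 : r / 20 = v / (4 * A) := by rw [hr]; ring
  rw [integral_div, eA, div_mul_eq_div_div_swap]
  gcongr
  rw [e5] at c2
  rw [e6] at hheat
  linarith

end

/-! ### Moments of the recentred logarithmic step -/

section

variable {b : ℝ} {n : ℕ} {γ : Measure ℝ}

lemma integrable_logStep_abs_cube (h : IsNormalizedSubgaussian b γ) (v : ℝ) :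
    Integrable (fun y : Fin n → ℝ => |logStep 1 y + v| ^ 3) (Measure.pi fun _ => γ) := by
  have := h.prob
  refine Integrable.of_bound (C := (1 + |v|) ^ 3) ?_ (ae_of_all _ fun y => ?_)
  · exact (((measurable_logStep 1).add_const v).abs.pow_const 3).aestronglyMeasurable
  · rw [norm_of_nonneg (by positivity)]
    gcongr
    exact (abs_add_le _ _).trans (add_le_add (abs_clampLog_le zero_le_one _) le_rfl)

/-- The first three moments of the recentred logarithmic step agree with those of a centred
Gaussian of variance `1 / (2n)` up to `O(n^{-3/2})`, when the rows have a nearly Gaussian fourth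
moment. -/
lemma centredStep_moments (h : IsNormalizedSubgaussian b γ) (hb : 0 < b) (hn : 0 < n) {d : ℝ}
    (h4 : |∫ x, x ^ 4 ∂γ - 3| ≤ d / √n) :
    |∫ y : Fin n → ℝ, (logStep 1 y + 1 / (2 * n)) ∂(Measure.pi fun _ => γ)| ≤
      (d + 300 * cubeConst b + 1) / (n * √n) ∧
    |∫ y : Fin n → ℝ, (logStep 1 y + 1 / (2 * n)) ^ 2 ∂(Measure.pi fun _ => γ) -
      1 / (2 * (n : ℝ))| ≤
      (d + 300 * cubeConst b + 1) / (n * √n) ∧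
    ∫ y : Fin n → ℝ, |logStep 1 y + 1 / (2 * n)| ^ 3 ∂(Measure.pi fun _ => γ) ≤
      (d + 300 * cubeConst b + 1) / (n * √n) := by
  have := h.prob
  have hn' : (0 : ℝ) < n := by positivity
  have hn1 : (1 : ℝ) ≤ n := by exact_mod_cast hn
  have hsn : 0 < √(n : ℝ) := sqrt_pos.2 hn'
  have hC := cubeConst_pos hb
  set C := cubeConst b with hCdef
  set π' := Measure.pi fun _ : Fin n => γ
  set θ := 1 / (n * √(n : ℝ)) with hθ
  have hθ0 : 0 < θ := by positivity
  have hd0 : 0 ≤ d := by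
    have h1 := (abs_nonneg _).trans h4
    by_contra hcon
    exact absurd h1 (not_le.2 (div_neg_of_neg_of_pos (not_le.1 hcon) hsn))
  have e0 : ∀ K : ℝ, K / (n * √n) = K * θ := fun K => by rw [hθ]; ring
  have hsq : 1 / (n : ℝ) ^ 2 ≤ θ := by
    rw [hθ]
    refine one_div_le_one_div_of_le (by positivity) ?_
    rw [sq]
    gcongr
    exact sqrt_le_self_iff.2 (Or.inr hn1)
  have m1 := logStep_mean h hb hn le_rfl
  have m2 := logStep_sq_mean h hb hn le_rfl
  rw [e0] at m1 m2 ⊢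
  set κ := ∫ x, x ^ 4 ∂γ
  have i1 : Integrable (fun y : Fin n → ℝ => logStep 1 y) π' := by
    simpa using integrable_logStep (n := n) h zero_le_one 1
  have i2 := integrable_logStep (n := n) h zero_le_one 2
  set E1 := ∫ y : Fin n → ℝ, logStep 1 y ∂π'
  set E2 := ∫ y : Fin n → ℝ, logStep 1 y ^ 2 ∂π'
  -- The drift of the logarithmic step is `-(κ - 1) / (4n)` and its mean square `(κ - 1) / (4n)`, up
  -- to `O(n^{-3/2})`; at the Gaussian value `κ = 3` both are `1 / (2n)` in size.
  have hk : |(κ - 3) / (4 * n)| ≤ d / 4 * θ := by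
    rw [abs_div, abs_of_pos (by positivity : (0 : ℝ) < 4 * n), div_le_iff₀ (by positivity)]
    refine h4.trans (le_of_eq ?_)
    rw [hθ]; field_simp
  have hk' := abs_le.1 hk
  have m1' := abs_le.1 m1
  have m2' := abs_le.1 m2
  have ek : (κ - 1) / (4 * n) = (κ - 3) / (4 * n) + 1 / (2 * n) := by field_simp; ring
  rw [ek] at m1' m2'
  have f1 : ∫ y : Fin n → ℝ, (logStep 1 y + 1 / (2 * n)) ∂π' = E1 + 1 / (2 * n) := by
    rw [integral_add i1 (integrable_const _), integral_const, probReal_univ, one_smul]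
  have b1 : |E1 + 1 / (2 * (n : ℝ))| ≤ (d / 4 + 16 * C) * θ := by
    rw [abs_le]; constructor <;> linarith
  have hdC : 0 ≤ d * θ := by positivity
  have hCC : 0 ≤ C * θ := by positivity
  refine ⟨?_, ?_, ?_⟩
  · rw [f1]; refine b1.trans ?_; linarith
  · have e2 : ∀ y : Fin n → ℝ, (logStep 1 y + 1 / (2 * n)) ^ 2 =
        logStep 1 y ^ 2 + (1 / n * logStep 1 y + 1 / (4 * n ^ 2)) := fun y => by ring
    have i3 : Integrable (fun y : Fin n → ℝ => 1 / n * logStep 1 y + 1 / (4 * (n : ℝ) ^ 2)) π' :=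
      (i1.const_mul _).add (integrable_const _)
    have f2 : ∫ y : Fin n → ℝ, (logStep 1 y + 1 / (2 * n)) ^ 2 ∂π' =
        E2 + (1 / n * E1 + 1 / (4 * n ^ 2)) := by
      simp only [e2]
      rw [integral_add i2 i3, integral_add (i1.const_mul _) (integrable_const _),
        integral_const_mul, integral_const, probReal_univ, one_smul]
    have e3 : 1 / n * E1 + 1 / (4 * (n : ℝ) ^ 2) =
        1 / n * (E1 + 1 / (2 * n)) - 1 / n ^ 2 / 4 := by field_simp; ring
    have b2 : |1 / n * (E1 + 1 / (2 * (n : ℝ)))| ≤ (d / 4 + 16 * C) * θ := by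
      rw [abs_mul, abs_of_pos (by positivity : (0 : ℝ) < 1 / n)]
      have h1 : 1 / (n : ℝ) ≤ 1 := by rw [div_le_one hn']; exact hn1
      calc 1 / (n : ℝ) * |E1 + 1 / (2 * (n : ℝ))| ≤ 1 * ((d / 4 + 16 * C) * θ) :=
            mul_le_mul h1 b1 (abs_nonneg _) zero_le_one
        _ = _ := one_mul _
    have b2' := abs_le.1 b2
    rw [f2, e3]
    have : 0 < 1 / (n : ℝ) ^ 2 := by positivity
    rw [abs_le]; constructor <;> linarith
  · have hcv : ∀ u w : ℝ, |u + w| ^ 3 ≤ 4 * (|u| ^ 3 + |w| ^ 3) := by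
      intro u w
      have h1 : |u + w| ^ 3 ≤ (|u| + |w|) ^ 3 := by gcongr; exact abs_add_le _ _
      have h2 := abs_nonneg u
      have h3 := abs_nonneg w
      nlinarith [mul_nonneg (add_nonneg h2 h3) (sq_nonneg (|u| - |w|))]
    have hpt : ∀ y : Fin n → ℝ, |logStep 1 y + 1 / (2 * n)| ^ 3 ≤
        256 * |sqErr y| ^ 3 + 4 * (1 / (2 * (n : ℝ))) ^ 3 := by
      intro y
      refine (hcv _ _).trans ?_
      rw [abs_of_pos (by positivity : (0 : ℝ) < 1 / (2 * n))]
      have h1 := abs_clampLog_le_abs le_rfl (sqErr y)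
      have h2 : |logStep 1 y| ^ 3 ≤ (4 * 1 * |sqErr y|) ^ 3 := by
        gcongr
        exact h1
      have h3 : (4 * 1 * |sqErr y|) ^ 3 = 64 * |sqErr y| ^ 3 := by ring
      rw [h3] at h2
      linarith
    have i3 : Integrable (fun y : Fin n → ℝ => |sqErr y| ^ 3) π' :=
      integrable_sqErr_pow (n := n) h hb hn 3
    have h3 := sqErr_abs_cube_le (n := n) h hb hn
    have h5 : ∫ y : Fin n → ℝ, |sqErr y| ^ 3 ∂π' ≤ C * θ := by
      rw [← e0]; exact h3
    have h6 : (1 / (2 * (n : ℝ))) ^ 3 ≤ θ / 8 := by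
      have e4 : (1 / (2 * (n : ℝ))) ^ 3 = 1 / n ^ 2 * (1 / n) / 8 := by field_simp; norm_num
      rw [e4]
      have h1 : 1 / (n : ℝ) ≤ 1 := by rw [div_le_one hn']; exact hn1
      have : 1 / (n : ℝ) ^ 2 * (1 / n) ≤ θ * 1 := by gcongr
      linarith
    calc _ ≤ ∫ y : Fin n → ℝ, (256 * |sqErr y| ^ 3 + 4 * (1 / (2 * (n : ℝ))) ^ 3) ∂π' :=
          integral_mono (integrable_logStep_abs_cube h _)
            ((i3.const_mul _).add (integrable_const _)) hpt
      _ = 256 * ∫ y : Fin n → ℝ, |sqErr y| ^ 3 ∂π' + 4 * (1 / (2 * (n : ℝ))) ^ 3 := by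
          rw [integral_add (i3.const_mul _) (integrable_const _), integral_const_mul,
            integral_const, probReal_univ, one_smul]
      _ ≤ 256 * (C * θ) + 4 * (θ / 8) := by gcongr
      _ ≤ _ := by linarith

/-- The mean square of the recentred logarithmic step is `O(1/n)` from every direction. -/
lemma centredStep_sq_le {μ : Measure ℝ} (hμ : IsNormalizedSubgaussian b μ) (hb : 0 < b)
    (hn : 0 < n) {x : Fin n → ℝ} (hx : ∑ j, x j ^ 2 = 1) :
    ∫ y : Fin n → ℝ, (logStep 1 y + 1 / (2 * n)) ^ 2 ∂(Measure.pi fun _ => rowLaw μ x) ≤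
      (512 / b ^ 2 + 80 * cubeConst (b / 16) + 1) / n := by
  have hrow := rowLaw_isNormalizedSubgaussian hμ hb hx
  have := hrow.prob
  have hn' : (0 : ℝ) < n := by positivity
  have hn1 : (1 : ℝ) ≤ n := by exact_mod_cast hn
  have hC := cubeConst_pos (b := b / 16) (by positivity)
  have m2 := (abs_le.1 (logStep_sq_mean hrow (by positivity) hn le_rfl)).2
  have hκ := rowLaw_fourth_moment_le hμ hb hx
  have i2 := integrable_logStep (n := n) hrow zero_le_one 2
  have hi : Integrable (fun y : Fin n → ℝ => 2 * logStep 1 y ^ 2 + 2 * (1 / (2 * (n : ℝ))) ^ 2)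
      (Measure.pi fun _ => rowLaw μ x) := (i2.const_mul _).add (integrable_const _)
  have h1 : ∫ y : Fin n → ℝ, (logStep 1 y + 1 / (2 * n)) ^ 2 ∂(Measure.pi fun _ => rowLaw μ x) ≤
      2 * ∫ y : Fin n → ℝ, logStep 1 y ^ 2 ∂(Measure.pi fun _ => rowLaw μ x) +
        2 * (1 / (2 * (n : ℝ))) ^ 2 := by
    calc _ ≤ ∫ y : Fin n → ℝ, (2 * logStep 1 y ^ 2 + 2 * (1 / (2 * (n : ℝ))) ^ 2)
          ∂(Measure.pi fun _ => rowLaw μ x) := by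
          refine integral_mono_of_nonneg (ae_of_all _ fun y => sq_nonneg _) hi
            (ae_of_all _ fun y => ?_)
          show (logStep 1 y + 1 / (2 * (n : ℝ))) ^ 2 ≤ _
          nlinarith [sq_nonneg (logStep 1 y - 1 / (2 * (n : ℝ)))]
      _ = _ := by
          rw [integral_add (i2.const_mul _) (integrable_const _), integral_const_mul,
            integral_const, probReal_univ, one_smul]
  have h2 : 1 / (n * √(n : ℝ)) ≤ 1 / n := by
    refine one_div_le_one_div_of_le hn' (le_mul_of_one_le_right hn'.le ?_)
    exact one_le_sqrt.2 hn1
  have h3 : cubeConst (b / 16) / (n * √(n : ℝ)) ≤ cubeConst (b / 16) * (1 / n) := by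
    rw [div_eq_mul_one_div]; gcongr
  have h4 : (1 / (2 * (n : ℝ))) ^ 2 ≤ 1 / 4 * (1 / n) := by
    have e : (1 / (2 * (n : ℝ))) ^ 2 = 1 / 4 * (1 / n * (1 / n)) := by field_simp; norm_num
    rw [e]
    have : 1 / (n : ℝ) ≤ 1 := by rw [div_le_one hn']; exact hn1
    have : 1 / (n : ℝ) * (1 / n) ≤ 1 / n * 1 := by gcongr
    linarith
  have h5 : (∫ g, g ^ 4 ∂(rowLaw μ x) - 1) / (4 * n) ≤ 1024 / b ^ 2 / 4 * (1 / n) := by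
    rw [div_le_iff₀ (by positivity)]
    have e : 1024 / b ^ 2 / 4 * (1 / n) * (4 * (n : ℝ)) = 1024 / b ^ 2 := by field_simp
    rw [e]; linarith
  have h6 : 0 < 1 / (n : ℝ) := by positivity
  rw [div_eq_mul_one_div (512 / b ^ 2 + 80 * cubeConst (b / 16) + 1)]
  refine h1.trans ?_
  have e : (512 / b ^ 2 + 80 * cubeConst (b / 16) + 1) * (1 / (n : ℝ)) =
    2 * (1024 / b ^ 2 / 4 * (1 / n)) + 80 * (cubeConst (b / 16) * (1 / n)) + 1 / n := by ring
  rw [e]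
  linarith

end

/-! ### The bump submartingale -/

section

variable {b c : ℝ}

/-- The squared width of the bump, `m` steps before the final time. -/
noncomputable def bumpWidth (n : ℕ) (W : ℝ) (m : ℕ) : ℝ := W ^ 2 + m * (5 * (1 / (2 * (n : ℝ))))

lemma bumpWidth_pos {n : ℕ} {W : ℝ} (hW : 0 < W) (m : ℕ) : 0 < bumpWidth n W m := by
  unfold bumpWidth; positivity

lemma sq_le_bumpWidth (n : ℕ) (W : ℝ) (m : ℕ) : W ^ 2 ≤ bumpWidth n W m := by
  have : 0 ≤ (m : ℝ) * (5 * (1 / (2 * (n : ℝ)))) := by positivity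
  unfold bumpWidth; linarith

lemma bumpWidth_mono {n : ℕ} {W : ℝ} {m m' : ℕ} (h : m ≤ m') :
    bumpWidth n W m ≤ bumpWidth n W m' := by
  have : (m : ℝ) ≤ m' := by exact_mod_cast h
  unfold bumpWidth; gcongr

/-- The bump at scale `√A`, normalized to be at most one when `W² ≤ A`. -/
noncomputable def scaledBump (W A s : ℝ) : ℝ := W ^ 2 * (bump (s / √A) / A)

lemma measurable_scaledBump (W A : ℝ) : Measurable (scaledBump W A) := by
  unfold scaledBump
  exact ((measurable_bump.comp (measurable_id.div_const _)).div_const _).const_mul _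

lemma scaledBump_nonneg {W A : ℝ} (hA : 0 < A) (s : ℝ) : 0 ≤ scaledBump W A s :=
  mul_nonneg (sq_nonneg _) (div_nonneg (bump_nonneg _) hA.le)

lemma scaledBump_le_one {W A : ℝ} (hA : 0 < A) (hWA : W ^ 2 ≤ A) (s : ℝ) :
    scaledBump W A s ≤ 1 := by
  have h1 := bump_le_one (s / √A)
  have h2 := bump_nonneg (s / √A)
  rw [scaledBump, ← mul_div_assoc, div_le_one hA]
  calc W ^ 2 * bump (s / √A) ≤ A * 1 := by gcongr
    _ = A := mul_one A

/-- Along flat directions the rescaled bumps of the recentred log-norm form a submartingale. -/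
lemma scaledBump_step (hb : 0 < b) :
    ∃ M > (0 : ℝ), ∃ η > (0 : ℝ), ∀ᶠ n : ℕ in atTop, ∀ μ : Measure ℝ,
      IsNormalizedSubgaussian b μ → ∀ x : Fin n → ℝ, ∑ j, x j ^ 2 = 1 → Flat x →
      ∀ W : ℝ, M / √n ≤ W → ∀ m : ℕ, bumpWidth n W m ≤ η * n → ∀ s : ℝ,
        scaledBump W (bumpWidth n W (m + 1)) s ≤
          ∫ y, scaledBump W (bumpWidth n W m) (s + (logStep 1 y + 1 / (2 * (n : ℝ))))
            ∂(Measure.pi fun _ : Fin n => rowLaw μ x) := by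
  have hb16 : 0 < b / 16 := by positivity
  have hC := cubeConst_pos hb16
  set K := 4 / b ^ 2 + 300 * cubeConst (b / 16) + 1 with hK
  have hK0 : 0 < K := by positivity
  have ht := tendsto_inv_sqrt.const_mul (3 * K)
  rw [mul_zero] at ht
  refine ⟨1008 * K + 36, by positivity, (1 / (144 * K)) ^ 2, by positivity, ?_⟩
  filter_upwards [ht.eventually_le_const (by norm_num : (0 : ℝ) < 1 / 24), eventually_gt_atTop 0]
    with n h3 hn μ hμ x hx hf W hW m hA s
  have hn' : (0 : ℝ) < n := by positivity
  have hsn : 0 < √(n : ℝ) := sqrt_pos.2 hn'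
  have hss : √(n : ℝ) * √n = n := mul_self_sqrt hn'.le
  have hrow := rowLaw_isNormalizedSubgaussian hμ hb hx
  have := hrow.prob
  have hW0 : 0 < W := lt_of_lt_of_le (by positivity) hW
  obtain ⟨m1, m2, m3⟩ := centredStep_moments hrow hb16 hn
    (abs_rowLaw_fourth_moment_sub_three_le hμ hb hn hx hf)
  set A := bumpWidth n W m with hAdef
  have hA0 : 0 < A := bumpWidth_pos hW0 m
  have hWA : W ^ 2 ≤ A := sq_le_bumpWidth n W m
  have hsA : 0 < √A := sqrt_pos.2 hA0
  have hMA : 1008 * K + 36 ≤ √A * √n := by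
    have h1 : W ≤ √A := le_sqrt_of_sq_le hWA
    rw [div_le_iff₀ hsn] at hW
    exact hW.trans (by gcongr)
  have hsuc : bumpWidth n W (m + 1) = A + 5 * (1 / (2 * n)) := by
    rw [hAdef]; unfold bumpWidth; push_cast; ring
  have hvA : 5 * (1 / (2 * (n : ℝ))) / A ≤ 1 / 500 := by
    rw [div_le_iff₀ hA0]
    have h1 : (36 : ℝ) ^ 2 ≤ (√A * √n) ^ 2 := by
      gcongr
      linarith
    rw [mul_pow, sq_sqrt hA0.le, sq_sqrt hn'.le] at h1
    have e : 5 * (1 / (2 * (n : ℝ))) = 5 / 2 / n := by ring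
    rw [e, div_le_iff₀ hn']
    linarith
  -- Each of the three error terms is at most `1 / 24` of `1 / (n A)`: the first because `√A` is at
  -- most a small multiple of `√n`, the last because `√A` is at least a large multiple of `1 / √n`.
  have herr : K / (n * √n) * (6 / √A + 3 / A + 42 / (A * √A)) ≤ 1 / (2 * n) / (4 * A) := by
    have hsA2 : √A * √A = A := mul_self_sqrt hA0.le
    have c1 : K * √A / √n ≤ 1 / 144 := by
      have h1 : √A ≤ 1 / (144 * K) * √n := by
        rw [sqrt_le_left (by positivity), mul_pow, sq_sqrt hn'.le]; exact hA
      rw [div_le_iff₀ hsn]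
      calc K * √A ≤ K * (1 / (144 * K) * √n) := by gcongr
        _ = 1 / 144 * √n := by field_simp
    have c3 : 42 * K / (√A * √n) ≤ 1 / 24 := by
      rw [div_le_iff₀ (by positivity)]
      linarith
    have e1 : K / (n * √n) * (6 / √A + 3 / A + 42 / (A * √A)) =
        1 / (n * A) * (6 * (K * √A / √n) + 3 * K * (1 / √n) + 42 * K / (√A * √n)) := by
      have : √A ^ 2 = A := sq_sqrt hA0.le
      field_simp
      linear_combination -6 * this
    have e2 : 1 / (2 * (n : ℝ)) / (4 * A) = 1 / (n * A) * (1 / 8) := by ring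
    rw [e1, e2]
    gcongr
    linarith
  have hmeas : Measurable fun y : Fin n → ℝ => logStep 1 y + 1 / (2 * (n : ℝ)) :=
    (measurable_logStep 1).add_const _
  have i0 : Integrable (fun y : Fin n → ℝ => logStep 1 y) (Measure.pi fun _ => rowLaw μ x) := by
    simpa using integrable_logStep (n := n) hrow zero_le_one 1
  have i1 : Integrable (fun y : Fin n → ℝ => logStep 1 y + 1 / (2 * (n : ℝ)))
      (Measure.pi fun _ => rowLaw μ x) := i0.add (integrable_const _)
  have i2 : Integrable (fun y : Fin n → ℝ => (logStep 1 y + 1 / (2 * (n : ℝ))) ^ 2)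
      (Measure.pi fun _ => rowLaw μ x) := by
    refine Integrable.of_bound (C := (1 + 1 / (2 * (n : ℝ))) ^ 2)
      (hmeas.pow_const 2).aestronglyMeasurable (ae_of_all _ fun y => ?_)
    rw [norm_of_nonneg (sq_nonneg _), ← sq_abs]
    gcongr
    refine (abs_add_le _ _).trans (add_le_add (abs_clampLog_le zero_le_one _) (le_of_eq ?_))
    exact abs_of_pos (by positivity)
  have h1 := bump_step hmeas i1 i2 (integrable_logStep_abs_cube hrow _) m1 m2 m3
    (by positivity) hA0 hvA herr s
  rw [← hsuc] at h1
  unfold scaledBump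
  rw [integral_const_mul]
  exact mul_le_mul_of_nonneg_left h1 (sq_nonneg _)

/-- Lower bound for the probability that the recentred log-norm is small at a given time. -/
lemma centred_chain_lower (hb : 0 < b) (hc0 : 0 < c) (hc : c ≤ 1 / 5) :
    ∃ M > (0 : ℝ), ∃ η > (0 : ℝ), ∀ᶠ n : ℕ in atTop, ∀ μ : Measure ℝ,
      IsNormalizedSubgaussian b μ → ∀ x₀ : Fin n → ℝ, Admissible c x₀ →
      ∀ (Ω : Type*) [MeasurableSpace Ω] (P : Measure Ω) [IsProbabilityMeasure P]
        (X : ℕ × Fin n × Fin n → Ω → ℝ), (∀ e, Measurable (X e)) → iIndepFun X P →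
        (∀ e, P.map (X e) = μ) → ∀ (T : ℕ) (W : ℝ), 1 ≤ T → M / √n ≤ W →
        bumpWidth n W T ≤ η * n →
        1 / 5 * (W ^ 2 / bumpWidth n W T) - 2 * T * exp (-((n : ℝ) ^ (1 / 4 : ℝ))) ≤
          P.real {ω | |(chainState c 1 x₀ (fun e => X e ω) T).2 + T * (1 / (2 * (n : ℝ)))| ≤ W ∧
            ∀ k < T, chainImage c 1 x₀ (fun e => X e ω) k ∉ irregular n c} := by
  obtain ⟨M, hM, η, hη, hev⟩ := scaledBump_step hb
  have hC := cubeConst_pos (b := b / 16) (by positivity)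
  set K := 512 / b ^ 2 + 80 * cubeConst (b / 16) + 1 with hK
  have hK0 : 0 < K := by positivity
  refine ⟨max M √(8 * K), lt_max_of_lt_left hM, η, hη, ?_⟩
  filter_upwards [hev, irregular_prob_le hb hc0 hc, eventually_gt_atTop 0]
    with n hev hirr hn μ hμ x₀ h0 Ω _ P _ X hX hi hlaw T W hT hW hη'
  have := hμ.prob
  have hn' : (0 : ℝ) < n := by positivity
  have hsn : 0 < √(n : ℝ) := sqrt_pos.2 hn'
  set ε := exp (-((n : ℝ) ^ (1 / 4 : ℝ))) with hε
  have hε0 : 0 < ε := exp_pos _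
  set v := 1 / (2 * (n : ℝ)) with hv
  have hWM : M / √n ≤ W := le_trans (by gcongr; exact le_max_left _ _) hW
  have hWK : √(8 * K) / √n ≤ W := le_trans (by gcongr; exact le_max_right _ _) hW
  have hW0 : 0 < W := lt_of_lt_of_le (by positivity) hWM
  set St : ℕ → Ω → (Fin n → ℝ) × ℝ := fun k ω => chainState c 1 x₀ (fun e => X e ω) k with hSt
  set Im : ℕ → Ω → (Fin n → ℝ) := fun k ω => chainImage c 1 x₀ (fun e => X e ω) k with hIm
  have hStm : ∀ k, Measurable (St k) := fun k => measurable_chainState_comp hX k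
  have hImm : ∀ k, Measurable (Im k) := fun k => measurable_chainImage_comp hX k
  have hpI : ∀ k, P.real {ω | Im k ω ∈ irregular n c} ≤ ε := fun k =>
    prob_chainImage_le hn h0 hX hi hlaw k (measurableSet_irregular n c) fun x hx =>
      hirr μ hμ x hx.1
  -- The bump whose squared width has shrunk to `W²` at time `T`, evaluated at the recentred log-
  -- norm, is a submartingale up to the event, of probability at most `ε`, that the image is
  -- irregular and the next direction possibly not flat.
  set F : ℕ → (Fin n → ℝ) × ℝ → ℝ := fun k p => scaledBump W (bumpWidth n W (T - k)) (p.2 + k * v)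
    with hF
  have hA : ∀ m, 0 < bumpWidth n W m := fun m => bumpWidth_pos hW0 m
  have hFm : ∀ k, Measurable (F k) := fun k =>
    (measurable_scaledBump _ _).comp (measurable_snd.add_const _)
  have hF0 : ∀ k p, 0 ≤ F k p := fun k p => scaledBump_nonneg (hA _) _
  have hF1 : ∀ k p, F k p ≤ 1 := fun k p => scaledBump_le_one (hA _) (sq_le_bumpWidth n W _) _
  have hstep : ∀ k, 1 ≤ k → k < T → ∫⁻ ω, ENNReal.ofReal (F k (St k ω)) ∂P ≤
      ∫⁻ ω, ENNReal.ofReal (F (k + 1) (St (k + 1) ω)) ∂P + ENNReal.ofReal ε := by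
    intro k hk hkT
    obtain ⟨j, rfl⟩ : ∃ j, k = j + 1 := ⟨k - 1, by omega⟩
    have hm : Measurable fun p : ((Fin n → ℝ) × ℝ) × (Fin n → ℝ) =>
        ENNReal.ofReal (F (j + 1 + 1) (advance c x₀ p.2, p.1.2 + logStep 1 p.2)) :=
      ((hFm _).comp (((measurable_advance c x₀).comp measurable_snd).prodMk
        (measurable_fst.snd.add ((measurable_logStep 1).comp measurable_snd)))).ennreal_ofReal
    have h1 := lintegral_chain (c := c) (L := 1) (x₀ := x₀) hX hi hlaw (j + 1) hm
    have h2 : ∫⁻ ω, ENNReal.ofReal (F (j + 1 + 1) (St (j + 1 + 1) ω)) ∂P =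
        ∫⁻ ω, ∫⁻ y, ENNReal.ofReal
          (F (j + 1 + 1) (advance c x₀ y, (St (j + 1) ω).2 + logStep 1 y))
          ∂(Measure.pi fun _ : Fin n => rowLaw μ (St (j + 1) ω).1) ∂P := h1
    rw [h2]
    have hbadm : MeasurableSet {ω | Im j ω ∈ irregular n c} :=
      hImm j (measurableSet_irregular n c)
    have hbad : ∫⁻ ω, {ω | Im j ω ∈ irregular n c}.indicator 1 ω ∂P ≤ ENNReal.ofReal ε := by
      rw [lintegral_indicator_one hbadm, ← ofReal_measureReal]
      exact ENNReal.ofReal_le_ofReal (hpI j)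
    refine le_trans ?_ (add_le_add le_rfl hbad)
    rw [← lintegral_add_right _ (measurable_one.indicator hbadm)]
    refine lintegral_mono fun ω => ?_
    show ENNReal.ofReal (F (j + 1) (St (j + 1) ω)) ≤ _
    by_cases hω : Im j ω ∈ irregular n c
    · have e1 : {ω | Im j ω ∈ irregular n c}.indicator (1 : Ω → ENNReal) ω = 1 :=
        Set.indicator_of_mem (show ω ∈ {ω | Im j ω ∈ irregular n c} from hω) _
      rw [e1]
      refine le_trans ?_ le_add_self
      exact ENNReal.ofReal_le_one.2 (hF1 _ _)
    · refine le_trans ?_ le_self_add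
      have hfl : Flat (St (j + 1) ω).1 := flat_advance hn hω
      have hadm : Admissible c (St (j + 1) ω).1 := admissible_chainState hn h0 _ _
      have hTm : T - (j + 1) = T - (j + 1 + 1) + 1 := by omega
      have h3 := hev μ hμ (St (j + 1) ω).1 hadm.1 hfl W hWM (T - (j + 1 + 1))
        ((bumpWidth_mono (by omega)).trans hη') ((St (j + 1) ω).2 + (j + 1 : ℕ) * v)
      have := (rowLaw_isNormalizedSubgaussian hμ hb hadm.1).prob
      rw [← ofReal_integral_eq_lintegral_ofReal]
      · refine ENNReal.ofReal_le_ofReal ?_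
        simp only [hF, hTm]
        refine h3.trans (le_of_eq (integral_congr_ae (ae_of_all _ fun y => ?_)))
        show scaledBump _ _ _ = scaledBump _ _ _
        congr 1
        push_cast
        ring
      · refine Integrable.of_bound (C := 1) ?_ (ae_of_all _ fun y => ?_)
        · exact ((hFm _).comp ((measurable_advance c x₀).prodMk
            ((measurable_logStep 1).const_add _))).aestronglyMeasurable
        · rw [norm_of_nonneg (hF0 _ _)]; exact hF1 _ _
      · exact ae_of_all _ fun y => hF0 _ _
  have hchain : ∀ m, m + 1 ≤ T → ∫⁻ ω, ENNReal.ofReal (F 1 (St 1 ω)) ∂P ≤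
      ∫⁻ ω, ENNReal.ofReal (F (m + 1) (St (m + 1) ω)) ∂P + m * ENNReal.ofReal ε := by
    intro m
    induction m with
    | zero => intro _; simp
    | succ m ih =>
      intro hm
      refine (ih (by omega)).trans ((add_le_add (hstep (m + 1) (by omega) (by omega)) le_rfl).trans
        (le_of_eq ?_))
      push_cast
      ring
  -- The direction `x₀` need not be flat, so the first step is treated by Chebyshev's inequality:
  -- with probability at least `1/2` it stays within `W / 2`, where the bump is at least `2/5`.
  have hfirst : ENNReal.ofReal (1 / 5 * (W ^ 2 / bumpWidth n W T)) ≤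
      ∫⁻ ω, ENNReal.ofReal (F 1 (St 1 ω)) ∂P := by
    have hrow := rowLaw_isNormalizedSubgaussian hμ hb h0.1
    have := hrow.prob
    set π' := Measure.pi fun _ : Fin n => rowLaw μ x₀ with hπ'
    set G := {y : Fin n → ℝ | |logStep 1 y + v| ≤ W / 2} with hG
    have hGm : MeasurableSet G :=
      measurableSet_le ((measurable_logStep 1).add_const _).abs measurable_const
    have hGp : 1 / 2 ≤ π'.real G := by
      have h2 := centredStep_sq_le hμ hb hn h0.1
      have i2 : Integrable (fun y : Fin n → ℝ => (logStep 1 y + v) ^ 2) π' := by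
        refine Integrable.of_bound (C := (1 + v) ^ 2)
          (((measurable_logStep 1).add_const _).pow_const 2).aestronglyMeasurable
          (ae_of_all _ fun y => ?_)
        rw [norm_of_nonneg (sq_nonneg _), ← sq_abs]
        gcongr
        refine (abs_add_le _ _).trans (add_le_add (abs_clampLog_le zero_le_one _) (le_of_eq ?_))
        exact abs_of_pos (by positivity)
      have h3 := mul_meas_ge_le_integral_of_nonneg (μ := π') (ae_of_all _ fun y => sq_nonneg _) i2
        ((W / 2) ^ 2)
      have h4 : 8 * K / n ≤ W ^ 2 := by
        have h5 : (√(8 * K) / √n) ^ 2 ≤ W ^ 2 := by gcongr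
        rwa [div_pow, sq_sqrt (by positivity), sq_sqrt hn'.le] at h5
      have h6 : Gᶜ ⊆ {y : Fin n → ℝ | (W / 2) ^ 2 ≤ (logStep 1 y + v) ^ 2} := by
        intro y hy
        have h7 : W / 2 < |logStep 1 y + v| := not_le.1 hy
        show (W / 2) ^ 2 ≤ (logStep 1 y + v) ^ 2
        rw [← sq_abs (logStep 1 y + v)]
        gcongr
      have h8 := measureReal_mono (μ := π') h6 (measure_ne_top _ _)
      rw [probReal_compl_eq_one_sub hGm] at h8
      have h9 : (W / 2) ^ 2 * π'.real {y : Fin n → ℝ | (W / 2) ^ 2 ≤ (logStep 1 y + v) ^ 2} ≤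
          W ^ 2 / 8 := by
        refine (h3.trans h2).trans ?_
        rw [mul_div_assoc] at h4
        linarith
      have h10 : π'.real {y : Fin n → ℝ | (W / 2) ^ 2 ≤ (logStep 1 y + v) ^ 2} ≤ 1 / 2 := by
        have h11 : 0 < (W / 2) ^ 2 := by positivity
        refine le_of_mul_le_mul_left (h9.trans (le_of_eq ?_)) h11
        ring
      linarith
    have hP : P {ω | Im 0 ω ∈ G} = π' G := by
      have h1 := prob_chainImage (c := c) (L := 1) (x₀ := x₀) hX hi hlaw 0 hGm
      rw [h1]
      simp only [chainState, lintegral_const, measure_univ, mul_one]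
      rfl
    have hlow : ∀ ω, Im 0 ω ∈ G → 2 / 5 * (W ^ 2 / bumpWidth n W T) ≤ F 1 (St 1 ω) := by
      intro ω hω
      have h1 : |(St 1 ω).2 + (1 : ℕ) * v| ≤ W / 2 := by
        have e : (St 1 ω).2 + (1 : ℕ) * v = logStep 1 (Im 0 ω) + v := by
          simp only [hSt, chainState_succ, chainState, hIm]; push_cast; ring
        rw [e]; exact hω
      set s := (St 1 ω).2 + (1 : ℕ) * v
      set A := bumpWidth n W (T - 1)
      have hA0 : 0 < A := hA _
      have hz : (s / √A) ^ 2 ≤ 1 / 4 := by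
        rw [div_pow, sq_sqrt hA0.le, div_le_iff₀ hA0, ← sq_abs]
        have h2 : |s| ^ 2 ≤ (W / 2) ^ 2 := by gcongr
        have h3 : W ^ 2 ≤ A := sq_le_bumpWidth n W _
        linarith
      have hbp : 2 / 5 ≤ bump (s / √A) := by
        refine le_trans ?_ (le_max_right _ _)
        have h2 : (3 / 4 : ℝ) ^ 3 ≤ (1 - (s / √A) ^ 2) ^ 3 := by gcongr; linarith
        norm_num at h2 ⊢
        linarith
      show 2 / 5 * (W ^ 2 / bumpWidth n W T) ≤ scaledBump W A s
      have hAT : A ≤ bumpWidth n W T := bumpWidth_mono (by omega)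
      calc 2 / 5 * (W ^ 2 / bumpWidth n W T) ≤ bump (s / √A) * (W ^ 2 / A) := by
            refine mul_le_mul hbp ?_ (div_nonneg (sq_nonneg _) (hA _).le) (bump_nonneg _)
            gcongr
        _ = _ := by unfold scaledBump; ring
    have hGim : MeasurableSet {ω | Im 0 ω ∈ G} := hImm 0 hGm
    calc ENNReal.ofReal (1 / 5 * (W ^ 2 / bumpWidth n W T))
        ≤ ENNReal.ofReal (2 / 5 * (W ^ 2 / bumpWidth n W T) * π'.real G) := by
          refine ENNReal.ofReal_le_ofReal ?_
          have h1 : 0 ≤ W ^ 2 / bumpWidth n W T := div_nonneg (sq_nonneg _) (hA _).le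
          have h2 := mul_le_mul_of_nonneg_left hGp h1
          linarith
      _ = ENNReal.ofReal (2 / 5 * (W ^ 2 / bumpWidth n W T)) * P {ω | Im 0 ω ∈ G} := by
          rw [ENNReal.ofReal_mul (mul_nonneg (by norm_num) (div_nonneg (sq_nonneg _) (hA _).le)),
            ofReal_measureReal (measure_ne_top _ _), hP]
      _ = ∫⁻ ω in {ω | Im 0 ω ∈ G}, ENNReal.ofReal (2 / 5 * (W ^ 2 / bumpWidth n W T)) ∂P := by
          rw [setLIntegral_const]
      _ ≤ ∫⁻ ω in {ω | Im 0 ω ∈ G}, ENNReal.ofReal (F 1 (St 1 ω)) ∂P :=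
          setLIntegral_mono' hGim fun ω hω => ENNReal.ofReal_le_ofReal (hlow ω hω)
      _ ≤ _ := setLIntegral_le_lintegral _ _
  -- At time `T` the bump has width `W`, so that it is positive only if the recentred log-norm is at
  -- most `W`.
  set E := {ω | |(St T ω).2 + T * v| ≤ W} with hE
  have hEm : MeasurableSet E :=
    measurableSet_le ((hStm T).snd.add_const _).abs measurable_const
  have hlast : ∫⁻ ω, ENNReal.ofReal (F T (St T ω)) ∂P ≤ ENNReal.ofReal (P.real E) := by
    rw [ofReal_measureReal (measure_ne_top _ _), ← lintegral_indicator_one hEm]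
    refine lintegral_mono fun ω => ?_
    show ENNReal.ofReal (F T (St T ω)) ≤ _
    by_cases hω : ω ∈ E
    · rw [Set.indicator_of_mem hω]
      exact ENNReal.ofReal_le_one.2 (hF1 _ _)
    · rw [Set.indicator_of_notMem hω]
      refine (ENNReal.ofReal_eq_zero.2 ?_).le
      by_contra hpos
      push Not at hpos
      apply hω
      have e1 : bumpWidth n W (T - T) = W ^ 2 := by unfold bumpWidth; simp
      simp only [hF, e1, scaledBump, sqrt_sq hW0.le] at hpos
      have h1 : 0 < bump (((St T ω).2 + T * v) / W) := by
        rcases (bump_nonneg (((St T ω).2 + T * v) / W)).eq_or_lt' with h | h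
        · rw [h] at hpos; simp at hpos
        · exact h
      have h2 := lt_of_bump_pos h1
      have h3 : |((St T ω).2 + T * v) / W| ≤ 1 := abs_le_one_iff_mul_self_le_one.2 (by nlinarith)
      rw [abs_div, abs_of_pos hW0, div_le_one hW0] at h3
      exact h3
  have hsum : 1 / 5 * (W ^ 2 / bumpWidth n W T) ≤ P.real E + T * ε := by
    have h1 := hchain (T - 1) (by omega)
    rw [Nat.sub_add_cancel hT] at h1
    have h2 := hfirst.trans (h1.trans (add_le_add hlast le_rfl))
    have h3 : ((T - 1 : ℕ) : ENNReal) * ENNReal.ofReal ε ≤ ENNReal.ofReal (T * ε) := by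
      rw [ENNReal.ofReal_mul (Nat.cast_nonneg _), ENNReal.ofReal_natCast]
      gcongr
      omega
    have h4 := h2.trans (add_le_add le_rfl h3)
    rw [← ENNReal.ofReal_add measureReal_nonneg (by positivity)] at h4
    exact (ENNReal.ofReal_le_ofReal_iff (add_nonneg measureReal_nonneg (by positivity))).1 h4
  have hirrT : P.real (⋃ k ∈ Finset.range T, {ω | Im k ω ∈ irregular n c}) ≤ T * ε := by
    refine (measureReal_biUnion_finset_le _ _).trans ((Finset.sum_le_sum fun k _ => hpI k).trans ?_)
    rw [Finset.sum_const, Finset.card_range, nsmul_eq_mul]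
  have hsub : E ⊆ {ω | |(St T ω).2 + T * v| ≤ W ∧ ∀ k < T, Im k ω ∉ irregular n c} ∪
      ⋃ k ∈ Finset.range T, {ω | Im k ω ∈ irregular n c} := by
    intro ω hω
    by_cases h : ∀ k < T, Im k ω ∉ irregular n c
    · exact Or.inl ⟨hω, h⟩
    · push Not at h
      obtain ⟨k, hk, hk2⟩ := h
      exact Or.inr (Set.mem_biUnion (Finset.mem_range.2 hk) hk2)
  have h1 := (measureReal_mono (μ := P) hsub (measure_ne_top _ _)).trans (measureReal_union_le _ _)
  show _ ≤ P.real {ω | |(St T ω).2 + T * v| ≤ W ∧ ∀ k < T, Im k ω ∉ irregular n c}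
  linarith

end

/-! ### The last step -/

section

variable {b c : ℝ} {n : ℕ} {μ : Measure ℝ}

lemma tailEnergy_of_flat (hn : 0 < n) (hc : c ≤ 1 / 4) {x : Fin n → ℝ} (hx : Flat x) :
    tailEnergy ((n : ℝ) ^ (-c)) x = ∑ j, x j ^ 2 := by
  have hn1 : (1 : ℝ) ≤ n := by exact_mod_cast hn
  refine Finset.sum_congr rfl fun j _ => if_pos ((hx j).trans ?_)
  exact rpow_le_rpow_of_exponent_le hn1 (by linarith)

/-- Lower bound for the probability of a joint event for the state and the next image. -/
lemma prob_step_ge {Ω : Type*} [MeasurableSpace Ω] {P : Measure Ω} [IsProbabilityMeasure P]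
    {X : ℕ × Fin n × Fin n → Ω → ℝ} {L : ℝ} {x₀ : Fin n → ℝ} [IsProbabilityMeasure μ]
    (hn : 0 < n) (h0 : Admissible c x₀) (hX : ∀ e, Measurable (X e)) (hi : iIndepFun X P)
    (hμ : ∀ e, P.map (X e) = μ) (k : ℕ) {D : Set ((Fin n → ℝ) × ℝ)} (hD : MeasurableSet D)
    {R : Set (((Fin n → ℝ) × ℝ) × (Fin n → ℝ))} (hR : MeasurableSet R) {q : ℝ} (hq : 0 ≤ q)
    (h : ∀ p ∈ D, Admissible c p.1 →
      q ≤ (Measure.pi fun _ : Fin n => rowLaw μ p.1).real {y | (p, y) ∈ R}) :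
    q * P.real {ω | chainState c L x₀ (fun e => X e ω) k ∈ D} ≤
      P.real {ω | (chainState c L x₀ (fun e => X e ω) k,
        chainImage c L x₀ (fun e => X e ω) k) ∈ R} := by
  have h1 := lintegral_chain (c := c) (L := L) (x₀ := x₀) hX hi hμ k
    (f := R.indicator 1) (measurable_one.indicator hR)
  have hmS := measurable_chainState_comp (c := c) (L := L) (x₀ := x₀) hX k
  have hmI := measurable_chainImage_comp (c := c) (L := L) (x₀ := x₀) hX k
  have hRm : MeasurableSet {ω | (chainState c L x₀ (fun e => X e ω) k,
      chainImage c L x₀ (fun e => X e ω) k) ∈ R} := (hmS.prodMk hmI) hR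
  have hDm : MeasurableSet {ω | chainState c L x₀ (fun e => X e ω) k ∈ D} := hmS hD
  have e1 : (fun ω => R.indicator (1 : ((Fin n → ℝ) × ℝ) × (Fin n → ℝ) → ENNReal)
      (chainState c L x₀ (fun e => X e ω) k,
      chainImage c L x₀ (fun e => X e ω) k)) =
      {ω | (chainState c L x₀ (fun e => X e ω) k,
        chainImage c L x₀ (fun e => X e ω) k) ∈ R}.indicator 1 := rfl
  rw [e1, lintegral_indicator_one hRm] at h1
  have h2 : ENNReal.ofReal q * P {ω | chainState c L x₀ (fun e => X e ω) k ∈ D} ≤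
      P {ω | (chainState c L x₀ (fun e => X e ω) k,
        chainImage c L x₀ (fun e => X e ω) k) ∈ R} := by
    rw [h1, ← setLIntegral_const]
    refine (setLIntegral_mono' hDm fun ω hω => ?_).trans (setLIntegral_le_lintegral _ _)
    set p := chainState c L x₀ (fun e => X e ω) k
    have hsec : MeasurableSet {y | (p, y) ∈ R} := measurable_prodMk_left hR
    have e2 : (fun y => R.indicator (1 : ((Fin n → ℝ) × ℝ) × (Fin n → ℝ) → ENNReal) (p, y)) =
      {y | (p, y) ∈ R}.indicator 1 := rfl
    rw [e2, lintegral_indicator_one hsec, ← ofReal_measureReal (measure_ne_top _ _)]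
    exact ENNReal.ofReal_le_ofReal (h p hω (admissible_chainState hn h0 _ k))
  rw [measureReal_def, measureReal_def, ← ENNReal.toReal_ofReal hq, ← ENNReal.toReal_mul]
  exact ENNReal.toReal_mono (measure_ne_top _ _) h2

/-- When the target is much wider than one step, one more step stays in it with probability at
least `1/2`, by Chebyshev's inequality. -/
lemma last_step_wide (hb : 0 < b) :
    ∃ M > (0 : ℝ), ∀ n : ℕ, 0 < n → ∀ μ : Measure ℝ, IsNormalizedSubgaussian b μ →
      ∀ x : Fin n → ℝ, ∑ j, x j ^ 2 = 1 → ∀ w S : ℝ, M / √n ≤ w → |S| ≤ 5 / 8 * w →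
        1 / 2 ≤ (Measure.pi fun _ : Fin n => rowLaw μ x).real {y | |S + logStep 1 y| < w} := by
  have hC := cubeConst_pos (b := b / 16) (by positivity)
  set K := 512 / b ^ 2 + 80 * cubeConst (b / 16) + 1 with hK
  have hK0 : 0 < K := by positivity
  refine ⟨8 * √(8 * K) + 8, by positivity, ?_⟩
  intro n hn μ hμ x hx w S hw hS
  have hrow := rowLaw_isNormalizedSubgaussian hμ hb hx
  have := hrow.prob
  have hn' : (0 : ℝ) < n := by positivity
  have hn1 : (1 : ℝ) ≤ n := by exact_mod_cast hn
  have hsn : 0 < √(n : ℝ) := sqrt_pos.2 hn'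
  set π' := Measure.pi fun _ : Fin n => rowLaw μ x
  set v := 1 / (2 * (n : ℝ)) with hv
  have hw8 : 8 / √n ≤ w := le_trans (by gcongr; linarith [sqrt_nonneg (8 * K)]) hw
  have hwK : 8 * √(8 * K) / √n ≤ w := le_trans (by gcongr; linarith) hw
  have hw0 : 0 < w := lt_of_lt_of_le (by positivity) hw8
  have hvw : v ≤ w / 16 := by
    have h1 : 1 / (n : ℝ) ≤ 1 / √n :=
      one_div_le_one_div_of_le hsn (sqrt_le_self_iff.2 (Or.inr hn1))
    have h2 : v = 1 / n / 2 := by rw [hv]; ring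
    have h3 : 8 / √(n : ℝ) = 8 * (1 / √n) := by ring
    rw [h2]
    rw [h3] at hw8
    linarith
  have hv0 : 0 < v := by positivity
  have h2 := centredStep_sq_le hμ hb hn hx
  have i2 : Integrable (fun y : Fin n → ℝ => (logStep 1 y + v) ^ 2) π' := by
    refine Integrable.of_bound (C := (1 + v) ^ 2)
      (((measurable_logStep 1).add_const _).pow_const 2).aestronglyMeasurable
      (ae_of_all _ fun y => ?_)
    rw [norm_of_nonneg (sq_nonneg _), ← sq_abs]
    gcongr
    refine (abs_add_le _ _).trans (add_le_add (abs_clampLog_le zero_le_one _) (le_of_eq ?_))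
    exact abs_of_pos (by positivity)
  have h3 := mul_meas_ge_le_integral_of_nonneg (μ := π') (ae_of_all _ fun y => sq_nonneg _) i2
    ((w / 4) ^ 2)
  -- The deviation `w / 4` is many times the standard deviation `O(1 / √n)` of the step.
  have h4 : 32 * (K / n) ≤ (w / 4) ^ 2 := by
    have h5 : (8 * √(8 * K) / √n) ^ 2 ≤ w ^ 2 := by gcongr
    rw [div_pow, mul_pow, sq_sqrt (by positivity), sq_sqrt hn'.le] at h5
    have h6 : 8 ^ 2 * (8 * K) / (n : ℝ) = 512 * (K / n) := by ring
    rw [h6] at h5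
    linarith
  set G := {y : Fin n → ℝ | |S + logStep 1 y| < w} with hG
  have hGm : MeasurableSet G :=
    measurableSet_lt ((measurable_logStep 1).const_add _).abs measurable_const
  have h6 : Gᶜ ⊆ {y : Fin n → ℝ | (w / 4) ^ 2 ≤ (logStep 1 y + v) ^ 2} := by
    intro y hy
    have h7 : w ≤ |S + logStep 1 y| := not_lt.1 hy
    have h8 : w / 4 ≤ |logStep 1 y + v| := by
      have e : S + logStep 1 y = S + ((logStep 1 y + v) - v) := by ring
      rw [e] at h7
      have h9 := abs_add_le S ((logStep 1 y + v) - v)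
      have h10 := abs_sub (logStep 1 y + v) v
      rw [abs_of_pos hv0] at h10
      linarith
    show (w / 4) ^ 2 ≤ (logStep 1 y + v) ^ 2
    rw [← sq_abs (logStep 1 y + v)]
    gcongr
  have h8 := measureReal_mono (μ := π') h6 (measure_ne_top _ _)
  rw [probReal_compl_eq_one_sub hGm] at h8
  have h9 : (w / 4) ^ 2 * π'.real {y : Fin n → ℝ | (w / 4) ^ 2 ≤ (logStep 1 y + v) ^ 2} ≤
      (w / 4) ^ 2 * (1 / 2) := by
    have h10 : 0 ≤ K / (n : ℝ) := by positivity
    refine (h3.trans h2).trans ?_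
    show K / n ≤ _
    linarith
  have h10 := le_of_mul_le_mul_left h9 (by positivity)
  linarith

/-- When the target is as narrow as `w ≥ 1 / n`, one more step hits it with probability at least
of order `w² n^{1-2c}`. -/
lemma last_step_narrow (hb : 0 < b) (hc0 : 0 < c) {a : ℝ} (ha : 0 < a) :
    ∃ k > (0 : ℝ), ∀ᶠ n : ℕ in atTop, ∀ μ : Measure ℝ, IsNormalizedSubgaussian b μ →
      ∀ x : Fin n → ℝ, ∑ j, x j ^ 2 = 1 → 1 / 16 ≤ tailEnergy ((n : ℝ) ^ (-c)) x →
      ∀ w S : ℝ, 1 / n ≤ w → w ≤ a / √n → |S| ≤ a / √n →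
        k * (w ^ 2 * (n : ℝ) ^ (1 - 2 * c)) ≤
          (Measure.pi fun _ : Fin n => rowLaw μ x).real {y | |S + logStep 1 y| < w} := by
  obtain ⟨k, hk, hev⟩ := near_level_prob (A := 4 * a) (C := a / 4) hb hc0 (by positivity)
  refine ⟨k / 16, by positivity, ?_⟩
  have ht := tendsto_inv_sqrt.const_mul a
  rw [mul_zero] at ht
  filter_upwards [hev, ht.eventually_le_const (by norm_num : (0 : ℝ) < 1 / 16),
    eventually_gt_atTop 0] with n hev hsmall hn μ hμ x hx hE w S hw1 hw2 hS
  have hn' : (0 : ℝ) < n := by positivity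
  have hsn : 0 < √(n : ℝ) := sqrt_pos.2 hn'
  rw [← div_eq_mul_one_div] at hsmall
  have hw0 : 0 < w := lt_of_lt_of_le (by positivity) hw1
  have hrow := rowLaw_isNormalizedSubgaussian hμ hb hx
  have := hrow.prob
  have hexp : ∀ u : ℝ, |u| ≤ 1 / 8 → |exp u - 1| ≤ 2 * |u| := fun u hu =>
    abs_exp_sub_one_le (hu.trans (by norm_num))
  have h2S : |(-2) * S| = 2 * |S| := by rw [abs_mul]; norm_num
  have he1 : |exp (-2 * S) - 1| ≤ 4 * |S| := by
    refine (hexp _ (by rw [h2S]; linarith)).trans (le_of_eq ?_)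
    rw [h2S]; ring
  have hl : |n * exp (-2 * S) - n| ≤ 4 * a * √n := by
    have e : n * exp (-2 * S) - n = n * (exp (-2 * S) - 1) := by ring
    rw [e, abs_mul, abs_of_pos hn']
    calc (n : ℝ) * |exp (-2 * S) - 1| ≤ n * (4 * (a / √n)) := by gcongr; linarith
      _ = 4 * a * (n / √n) := by ring
      _ = 4 * a * √n := by rw [div_sqrt]
  have hH1 : 1 / 4 ≤ w * n / 4 := by
    rw [div_le_iff₀ hn'] at hw1
    linarith
  have hH2 : w * n / 4 ≤ a / 4 * √n := by
    have h1 : w * n ≤ a / √n * n := by gcongr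
    have h2 : a / √n * n = a * √n := by rw [div_mul_eq_mul_div, mul_div_assoc, div_sqrt]
    linarith
  -- The log-norm returns to zero when `‖y‖²` is near `n e^{-2S}`, a level within `O(√n)` of `n`; a
  -- deviation `H = w n / 4` there is worth at most `w / 2` on the logarithmic scale.
  have h1 := hev μ hμ x hx hE _ hl _ hH1 hH2
  refine le_trans (le_of_eq ?_) (h1.trans (measureReal_mono ?_ (measure_ne_top _ _)))
  · have e : (n : ℝ) ^ (1 - 2 * c) = n * (n : ℝ) ^ (-(2 * c)) := by
      rw [sub_eq_add_neg, rpow_add hn', rpow_one]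
    rw [e]; field_simp; norm_num
  · intro y hy
    have hy' : |∑ i, y i ^ 2 - n * exp (-2 * S)| ≤ w * n / 4 := hy
    show |S + logStep 1 y| < w
    set Q := 1 + sqErr y with hQ
    have eQ : Q = (∑ i, y i ^ 2) / n := by rw [hQ, sqErr]; ring
    have hQd : |Q - exp (-2 * S)| ≤ w / 4 := by
      have e : Q - exp (-2 * S) = (∑ i, y i ^ 2 - n * exp (-2 * S)) / n := by
        rw [eQ]; field_simp
      rw [e, abs_div, abs_of_pos hn', div_le_iff₀ hn']
      linarith
    have hw16 : w ≤ 1 / 16 := hw2.trans hsmall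
    have hQ1 : |sqErr y| ≤ 1 / 2 := by
      have e : sqErr y = (Q - exp (-2 * S)) + (exp (-2 * S) - 1) := by rw [hQ]; ring
      rw [e]
      refine (abs_add_le _ _).trans ?_
      linarith
    have hQ0 : 0 < Q := by
      have := (abs_le.1 hQ1).1
      rw [hQ]; linarith
    have hlog : S + logStep 1 y = log (Q * exp (2 * S)) / 2 := by
      rw [logStep, clampLog_eq_of_near_one le_rfl hQ1, log_mul hQ0.ne' (exp_pos _).ne', log_exp]
      ring
    set u := Q * exp (2 * S) - 1 with hu
    have hu1 : |u| ≤ w / 2 := by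
      have e : u = (Q - exp (-2 * S)) * exp (2 * S) := by
        rw [hu, sub_mul, ← exp_add]; norm_num
      have he2 : exp (2 * S) ≤ 2 := by
        have h3 : |2 * S| ≤ 1 / 8 := by rw [abs_mul, abs_two]; linarith
        have := (abs_le.1 ((hexp _ h3).trans (by linarith : 2 * |2 * S| ≤ 1))).2
        linarith
      rw [e, abs_mul, abs_of_pos (exp_pos _)]
      calc |Q - exp (-2 * S)| * exp (2 * S) ≤ w / 4 * 2 := by gcongr
        _ = w / 2 := by ring
    have h4 : |log (1 + u) / 2| ≤ |u| := by
      rw [← clampLog_eq_of_near_one le_rfl (by linarith : |u| ≤ 1 / 2)]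
      exact abs_clampLog_le_of_near_one le_rfl (by linarith)
    have e5 : Q * exp (2 * S) = 1 + u := by rw [hu]; ring
    rw [hlog, e5]
    linarith

end

/-! ### Lower bounds in the slow regime -/

section

variable {b c : ℝ}

lemma tendsto_log_sq_mul_rpow_neg {a : ℝ} (ha : 0 < a) :
    Tendsto (fun n : ℕ => log (n : ℝ) ^ 2 * (n : ℝ) ^ (-a)) atTop (𝓝 0) := by
  have h1 := ((isLittleO_log_rpow_rpow_atTop 2 ha).tendsto_div_nhds_zero).comp
    tendsto_natCast_atTop_atTop
  refine h1.congr' ?_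
  filter_upwards [eventually_gt_atTop 0] with n hn
  have hn' : (0 : ℝ) < n := by positivity
  simp only [Function.comp_apply, rpow_neg hn'.le, div_eq_mul_inv]
  rw [← rpow_natCast]
  norm_num

set_option maxHeartbeats 1000000 in
/-- When the deviation allowed is too small for the concentration bound to say anything, the
log-norm stays below it with a probability at least of order `t² N n^{1-2c}`. -/
lemma slow_regime_lower (hb : 0 < b) (hc0 : 0 < c) (hc : c ≤ 1 / 5) {C : ℝ} (hC : 0 < C) :
    ∃ k > (0 : ℝ), ∀ᶠ n : ℕ in atTop, ∀ μ : Measure ℝ, IsNormalizedSubgaussian b μ →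
      ∀ x₀ : Fin n → ℝ, Admissible c x₀ → 1 / 16 ≤ tailEnergy ((n : ℝ) ^ (-c)) x₀ →
      ∀ (Ω : Type*) [MeasurableSpace Ω] (P : Measure Ω) [IsProbabilityMeasure P]
        (X : ℕ × Fin n × Fin n → Ω → ℝ), (∀ e, Measurable (X e)) → iIndepFun X P →
        (∀ e, P.map (X e) = μ) → ∀ (N : ℕ) (t : ℝ), 1 ≤ N → 1 / (n : ℝ) ≤ t →
        t ^ 2 * N * n ≤ C * log n ^ 2 →
        k * (t ^ 2 * N * (n : ℝ) ^ (1 - 2 * c)) ≤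
          P.real {ω | |(chainState c 1 x₀ (fun e => X e ω) N).2| < t * N ∧
            ∀ k < N, chainImage c 1 x₀ (fun e => X e ω) k ∉ irregular n c} := by
  obtain ⟨M₁, hM₁, η, hη, hev₁⟩ := centred_chain_lower hb hc0 hc
  obtain ⟨M₂, hM₂, hev₂⟩ := last_step_wide hb
  set M₃ := max M₂ (16 * M₁) with hM₃
  have hM₃0 : 0 < M₃ := lt_max_of_lt_left hM₂
  obtain ⟨k₃, hk₃, hev₃⟩ := last_step_narrow (a := M₁ + M₃) hb hc0 (by positivity)
  set m₀ := min (1 / 2) (M₁ ^ 2 / 5) with hm₀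
  have hm₀0 : 0 < m₀ := lt_min (by norm_num) (by positivity)
  set k₁ := min (1 / 25600) (k₃ * m₀ / 10) with hk₁
  have hk₁0 : 0 < k₁ := lt_min (by norm_num) (by positivity)
  have t1 := (tendsto_log_sq_mul_rpow_neg (a := 1 / 2) (by norm_num)).const_mul C
  have t2 := (tendsto_log_sq_mul_rpow_neg (a := 2 * c) (by positivity)).const_mul C
  have t3 := (tendsto_rpow_mul_exp_neg_rpow (k := 1) (a := 1 / 4) (s := 4) one_pos
    (by norm_num)).const_mul 20
  rw [mul_zero] at t1 t2 t3
  have hη1 : 0 < min 1 (η / 4) := lt_min one_pos (by positivity)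
  refine ⟨k₁ / 2, by positivity, ?_⟩
  filter_upwards [hev₁, hev₃, irregular_prob_le hb hc0 hc,
    t1.eventually_le_const hη1, t2.eventually_le_const one_pos,
    t3.eventually_le_const (lt_min hm₀0 hk₁0 : 0 < min m₀ k₁),
    (tendsto_natCast_atTop_atTop (R := ℝ)).eventually_ge_atTop (8 * M₁ ^ 2 / η),
    eventually_gt_atTop 0]
    with n hev₁ hev₃ hirr₀ hl1 hl2 hexp hnM hn μ hμ x₀ h0 hE₀ Ω _ P _ X hX hi hlaw N t hN ht hslow
  have := hμ.prob
  have hn' : (0 : ℝ) < n := by positivity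
  have hn1 : (1 : ℝ) ≤ n := by exact_mod_cast hn
  have hsn : 0 < √(n : ℝ) := sqrt_pos.2 hn'
  have hN0 : (0 : ℝ) < N := by exact_mod_cast hN
  have hN1 : (1 : ℝ) ≤ N := by exact_mod_cast hN
  have ht0 : 0 < t := lt_of_lt_of_le (by positivity) ht
  set ε := exp (-((n : ℝ) ^ (1 / 4 : ℝ))) with hε
  have hε0 : 0 < ε := exp_pos _
  have e4 : (n : ℝ) ^ (4 : ℝ) = (n : ℝ) ^ 4 := by
    rw [← rpow_natCast]; norm_num
  rw [one_mul, e4, ← hε] at hexp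
  have hexp₁ := hexp.trans (min_le_left _ _)
  have hexp₂ := hexp.trans (min_le_right _ _)
  set l := C * log (n : ℝ) ^ 2 with hl
  have hl0 : 0 ≤ l := by positivity
  have hl1' : l ≤ √n ∧ l ≤ η / 4 * √n := by
    have e : C * (log (n : ℝ) ^ 2 * (n : ℝ) ^ (-(1 / 2) : ℝ)) = l / √n := by
      rw [rpow_neg hn'.le, ← sqrt_eq_rpow, hl]; ring
    rw [e] at hl1
    have h1 := hl1.trans (min_le_left _ _)
    have h2 := hl1.trans (min_le_right _ _)
    rw [div_le_iff₀ hsn] at h1 h2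
    exact ⟨by linarith, h2⟩
  have hsn_le : √(n : ℝ) ≤ n := sqrt_le_self_iff.2 (Or.inr hn1)
  have hss : √(n : ℝ) * √n = n := mul_self_sqrt hn'.le
  -- Since `t ≥ 1/n`, the hypothesis bounds the number of steps by `n²`, up to which the probability
  -- of an irregular step remains negligible.
  have htn : 1 ≤ t * n := by rwa [div_le_iff₀ hn'] at ht
  have hNl : (N : ℝ) ≤ l * n := by
    have h1 : (N : ℝ) ≤ N * (t * n) ^ 2 := le_mul_of_one_le_right hN0.le (one_le_pow₀ htn)
    calc (N : ℝ) ≤ N * (t * n) ^ 2 := h1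
      _ = t ^ 2 * N * n * n := by ring
      _ ≤ l * n := by gcongr
  have hNn : (N : ℝ) ≤ (n : ℝ) ^ 2 := by
    calc (N : ℝ) ≤ l * n := hNl
      _ ≤ n * n := by gcongr; linarith [hl1'.1]
      _ = _ := by ring
  obtain ⟨T, rfl⟩ : ∃ T, N = T + 1 := ⟨N - 1, by omega⟩
  have hTN : (T : ℝ) ≤ ((T + 1 : ℕ) : ℝ) := by exact_mod_cast Nat.le_succ T
  set Nr : ℝ := ((T + 1 : ℕ) : ℝ) with hNr
  set w := t * Nr with hw
  have hw0 : 0 < w := by positivity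
  have hwN : Nr / n ≤ w := by
    rw [div_le_iff₀ hn', hw]
    calc Nr ≤ Nr * (t * n) := le_mul_of_one_le_right hN0.le htn
      _ = _ := by ring
  have hw1n : 1 / (n : ℝ) ≤ w := le_trans (by gcongr) hwN
  set v := 1 / (2 * (n : ℝ)) with hv
  have hTv : T * v ≤ w / 2 := by
    calc T * v ≤ Nr * v := by gcongr
      _ = Nr / n / 2 := by rw [hv]; ring
      _ ≤ w / 2 := by gcongr
  have hTv0 : 0 ≤ T * v := by positivity
  -- Before the last step the recentred log-norm is required to be at most `W`. Undoing the
  -- recentring costs at most `w / 2`, half of the deviation allowed.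
  set W := M₁ / √n + w / 16 with hWdef
  have hW1 : M₁ / √n ≤ W := by rw [hWdef]; linarith
  have hW2 : w / 16 ≤ W := by
    have : 0 < M₁ / √n := by positivity
    rw [hWdef]; linarith
  have hW0 : 0 < W := by linarith
  set B := bumpWidth n W (T + 1) with hB
  have hB0 : 0 < B := bumpWidth_pos hW0 _
  have hBeq : B = W ^ 2 + 5 / 2 * (Nr / n) := by
    rw [hB]; unfold bumpWidth; rw [← hNr]; ring
  have hBη : B ≤ η * n := by
    have h1 : W ^ 2 ≤ 2 * (M₁ / √n) ^ 2 + 2 * (w / 16) ^ 2 := by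
      rw [hWdef, ← mul_add]; exact add_sq_le
    have h2 : (M₁ / √n) ^ 2 ≤ η / 8 * n := by
      rw [div_pow, sq_sqrt hn'.le, div_le_iff₀ hn']
      rw [div_le_iff₀ hη] at hnM
      calc M₁ ^ 2 ≤ η / 8 * n := by linarith
        _ ≤ η / 8 * n * n := le_mul_of_one_le_right (by positivity) hn1
    have h3 : w ^ 2 ≤ η / 4 * n := by
      calc w ^ 2 = t ^ 2 * Nr * n * (Nr / n) := by rw [hw]; field_simp
        _ ≤ l * l := by
            gcongr
            rw [div_le_iff₀ hn']; exact hNl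
        _ ≤ √n * (η / 4 * √n) := by gcongr; exacts [hl1'.1, hl1'.2]
        _ = η / 4 * (√n * √n) := by ring
        _ = η / 4 * n := by rw [hss]
    have h4 : Nr / n ≤ η / 4 * n := by
      rw [div_le_iff₀ hn']
      refine hNl.trans ?_
      gcongr
      exact hl1'.2.trans (by gcongr)
    have h5 : 0 < η * n := by positivity
    rw [hBeq]
    linarith
  -- The ratio `ρ` is the order of the probability, given by the bump submartingale, that the log-
  -- norm is within `W` after `T` steps.
  set ρ := W ^ 2 / B with hρ
  have hρ0 : 0 < ρ := by positivity
  have hρ1 : ρ ≤ 1 := (div_le_one hB0).2 (sq_le_bumpWidth n W _)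
  have hρ2 : 1 / 2 ≤ ρ ∨ W ^ 2 * n / 5 ≤ ρ * Nr := by
    rcases le_total (5 / 2 * (Nr / n)) (W ^ 2) with h | h
    · left
      rw [hρ, le_div_iff₀ hB0, hBeq]; linarith
    · right
      have h1 : B ≤ 5 * (Nr / n) := by rw [hBeq]; linarith
      have h2 : W ^ 2 / (5 * (Nr / n)) ≤ ρ := by rw [hρ]; gcongr
      calc W ^ 2 * n / 5 = W ^ 2 / (5 * (Nr / n)) * Nr := by field_simp
        _ ≤ _ := by gcongr
  have hρN : m₀ ≤ ρ * Nr := by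
    rcases hρ2 with h | h
    · calc m₀ ≤ 1 / 2 := min_le_left _ _
        _ ≤ ρ * 1 := by linarith
        _ ≤ _ := by gcongr
    · refine le_trans (min_le_right _ _) (le_trans ?_ h)
      have h1 : (M₁ / √n) ^ 2 ≤ W ^ 2 := by gcongr
      rw [div_pow, sq_sqrt hn'.le, div_le_iff₀ hn'] at h1
      linarith
  -- With probability of order `ρ`, the chain arrives before the last step within `W`, in a
  -- direction with enough energy in its small coordinates: a flat one, or `x₀` itself if `T = 0`.
  set δ := (n : ℝ) ^ (-c)
  set D := {p : (Fin n → ℝ) × ℝ | |p.2 + T * v| ≤ W ∧ 1 / 16 ≤ tailEnergy δ p.1} with hD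
  have hDm : MeasurableSet D :=
    (measurableSet_le (measurable_snd.add_const _).abs measurable_const).inter
      (measurableSet_le measurable_const ((measurable_tailEnergy δ).comp measurable_fst))
  have hpD : ρ / 10 ≤ P.real {ω | chainState c 1 x₀ (fun e => X e ω) T ∈ D} := by
    rcases Nat.eq_zero_or_pos T with hT | hT
    · subst hT
      have : {ω | chainState c 1 x₀ (fun e => X e ω) 0 ∈ D} = Set.univ := by
        refine Set.eq_univ_of_forall fun ω => ?_
        show |(0 : ℝ) + (0 : ℕ) * v| ≤ W ∧ 1 / 16 ≤ tailEnergy δ x₀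
        refine ⟨?_, hE₀⟩
        simpa using hW0.le
      rw [this, probReal_univ]
      linarith
    · have h1 := hev₁ μ hμ x₀ h0 Ω P X hX hi hlaw T W hT hW1
        ((bumpWidth_mono (Nat.le_succ T)).trans hBη)
      have h2 : ρ ≤ W ^ 2 / bumpWidth n W T := by
        rw [hρ]
        have := bumpWidth_pos (n := n) hW0 T
        have := bumpWidth_mono (n := n) (W := W) (Nat.le_succ T)
        gcongr
      have h3 : 2 * T * ε ≤ ρ / 10 := by
        have h4 : 20 * Nr ^ 2 * ε ≤ ρ * Nr := by
          refine le_trans ?_ hρN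
          refine le_trans ?_ hexp₁
          have h5 : Nr ^ 2 ≤ ((n : ℝ) ^ 2) ^ 2 := by gcongr
          have h6 : ((n : ℝ) ^ 2) ^ 2 = (n : ℝ) ^ 4 := by ring
          rw [h6] at h5
          have h7 := mul_le_mul_of_nonneg_right h5 hε0.le
          linarith
        have h5 : 20 * Nr * ε ≤ ρ := by
          refine le_of_mul_le_mul_right (le_trans (le_of_eq ?_) h4) hN0
          ring
        have h6 : T * ε ≤ Nr * ε := by gcongr
        linarith
      refine le_trans (by linarith) (h1.trans (measureReal_mono ?_ (measure_ne_top _ _)))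
      rintro ω ⟨h4, h5⟩
      refine ⟨h4, ?_⟩
      obtain ⟨j, rfl⟩ : ∃ j, T = j + 1 := ⟨T - 1, by omega⟩
      have h6 : Flat (chainState c 1 x₀ (fun e => X e ω) (j + 1)).1 :=
        flat_advance hn (h5 j (Nat.lt_succ_self j))
      rw [tailEnergy_of_flat hn (by linarith) h6, (admissible_chainState hn h0 _ _).1]
      norm_num
  set R := {p : ((Fin n → ℝ) × ℝ) × (Fin n → ℝ) | |p.1.2 + logStep 1 p.2| < w} with hR
  have hRm : MeasurableSet R :=
    measurableSet_lt (measurable_fst.snd.add ((measurable_logStep 1).comp measurable_snd)).abs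
      measurable_const
  have hDS : ∀ p ∈ D, |p.2| ≤ W + w / 2 := fun p hp => by
    have h1 := hp.1
    have h2 := abs_sub (p.2 + T * v) (T * v)
    rw [add_sub_cancel_right, abs_of_nonneg hTv0] at h2
    linarith
  set Y := t ^ 2 * Nr * (n : ℝ) ^ (1 - 2 * c) with hY
  have hY0 : 0 < Y := by positivity
  have hRp : k₁ * Y ≤ P.real {ω | (chainState c 1 x₀ (fun e => X e ω) T,
      chainImage c 1 x₀ (fun e => X e ω) T) ∈ R} := by
    rcases le_total (M₃ / √n) w with hcase | hcase
    -- A wide target, `w ≥ M₃ / √n`: the last step stays in it with probability `1/2`, and `ρ` is of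
    -- the required order, since `w` is at most a multiple of `W`.
    · -- a wide target
      have h1 := prob_step_ge (L := 1) hn h0 hX hi hlaw T hDm hRm (q := 1 / 2) (by norm_num)
        fun p hp hadm => by
          refine hev₂ n hn μ hμ p.1 hadm.1 w p.2
            (le_trans (by gcongr; exact le_max_left _ _) hcase) ((hDS p hp).trans ?_)
          have h2 : 16 * M₁ / √n ≤ w := le_trans (by gcongr; exact le_max_right _ _) hcase
          rw [mul_div_assoc] at h2
          rw [hWdef]; linarith
      refine le_trans ?_ h1
      have h2 : Y ≤ 1280 * ρ := by
        have hpow : (n : ℝ) ^ (1 - 2 * c) = n * (n : ℝ) ^ (-(2 * c)) := by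
          rw [sub_eq_add_neg, rpow_add hn', rpow_one]
        have hpow1 : (n : ℝ) ^ (-(2 * c)) ≤ 1 :=
          rpow_le_one_of_one_le_of_nonpos hn1 (by linarith)
        have hpow0 : 0 < (n : ℝ) ^ (-(2 * c)) := by positivity
        rcases hρ2 with h | h
        · have h3 : Y ≤ 1 := by
            calc Y = t ^ 2 * Nr * n * (n : ℝ) ^ (-(2 * c)) := by rw [hY, hpow]; ring
              _ ≤ l * (n : ℝ) ^ (-(2 * c)) := by gcongr
              _ = C * (log n ^ 2 * (n : ℝ) ^ (-(2 * c))) := by rw [hl]; ring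
              _ ≤ 1 := hl2
          linarith
        · have h3 : Y * Nr ≤ 1280 * ρ * Nr := by
            calc Y * Nr = w ^ 2 * n * (n : ℝ) ^ (-(2 * c)) := by rw [hY, hpow, hw]; ring
              _ ≤ w ^ 2 * n * 1 := by gcongr
              _ ≤ (16 * W) ^ 2 * n * 1 := by gcongr; linarith
              _ = 1280 * (W ^ 2 * n / 5) := by ring
              _ ≤ 1280 * (ρ * Nr) := by gcongr
              _ = _ := by ring
          exact le_of_mul_le_mul_right h3 hN0
      calc k₁ * Y ≤ 1 / 25600 * (1280 * ρ) := by
            gcongr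
            exact min_le_left _ _
        _ = 1 / 2 * (ρ / 10) := by ring
        _ ≤ _ := by gcongr
    -- A narrow target: the last step hits it with probability of order `w² n^{1-2c}`, which is `N`
    -- times the bound required, and `ρ N` is bounded below.
    · -- a narrow target
      have hwa : w ≤ (M₁ + M₃) / √n := hcase.trans (by gcongr; linarith)
      have h1 := prob_step_ge (L := 1) hn h0 hX hi hlaw T hDm hRm
        (q := k₃ * (w ^ 2 * (n : ℝ) ^ (1 - 2 * c))) (by positivity)
        fun p hp hadm => by
          refine hev₃ μ hμ p.1 hadm.1 hp.2 w p.2 hw1n hwa ((hDS p hp).trans ?_)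
          rw [hWdef, add_div]
          linarith
      refine le_trans ?_ h1
      have e : w ^ 2 * (n : ℝ) ^ (1 - 2 * c) = Nr * Y := by rw [hw, hY]; ring
      rw [e]
      calc k₁ * Y ≤ k₃ * m₀ / 10 * Y := by gcongr; exact min_le_right _ _
        _ ≤ k₃ * (ρ * Nr) / 10 * Y := by gcongr
        _ = k₃ * (Nr * Y) * (ρ / 10) := by ring
        _ ≤ _ := by gcongr
  -- Irregular steps are so rare that removing them costs at most half of the bound.
  have hirr : P.real (⋃ k ∈ Finset.range (T + 1),
      {ω | chainImage c 1 x₀ (fun e => X e ω) k ∈ irregular n c}) ≤ k₁ / 2 * Y := by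
    have hk : ∀ k, P.real {ω | chainImage c 1 x₀ (fun e => X e ω) k ∈ irregular n c} ≤ ε :=
      fun k => prob_chainImage_le hn h0 hX hi hlaw k (measurableSet_irregular n c) fun x hx =>
        hirr₀ μ hμ x hx.1
    refine (measureReal_biUnion_finset_le _ _).trans ((Finset.sum_le_sum fun k _ => hk k).trans ?_)
    rw [Finset.sum_const, Finset.card_range, nsmul_eq_mul, ← hNr]
    have h1 : Nr * (1 / n ^ 2) ≤ Y := by
      have h2 : 1 ≤ (n : ℝ) ^ (1 - 2 * c) := one_le_rpow hn1 (by linarith)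
      calc Nr * (1 / (n : ℝ) ^ 2) = (1 / (n : ℝ)) ^ 2 * Nr * 1 := by rw [div_pow, one_pow]; ring
        _ ≤ Y := by rw [hY]; gcongr
    have h2 : ε ≤ k₁ / 2 * (1 / n ^ 2) := by
      rw [mul_one_div, le_div_iff₀ (by positivity)]
      have h3 : (n : ℝ) ^ 2 ≤ (n : ℝ) ^ 4 := pow_le_pow_right₀ hn1 (by norm_num)
      have h4 := mul_le_mul_of_nonneg_left h3 hε0.le
      linarith
    calc Nr * ε ≤ Nr * (k₁ / 2 * (1 / n ^ 2)) := by gcongr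
      _ = k₁ / 2 * (Nr * (1 / n ^ 2)) := by ring
      _ ≤ _ := by gcongr
  have hsub : {ω | (chainState c 1 x₀ (fun e => X e ω) T,
      chainImage c 1 x₀ (fun e => X e ω) T) ∈ R} ⊆
      {ω | |(chainState c 1 x₀ (fun e => X e ω) (T + 1)).2| < w ∧
        ∀ k < T + 1, chainImage c 1 x₀ (fun e => X e ω) k ∉ irregular n c} ∪
      ⋃ k ∈ Finset.range (T + 1),
        {ω | chainImage c 1 x₀ (fun e => X e ω) k ∈ irregular n c} := by
    intro ω hω
    by_cases h : ∀ k < T + 1, chainImage c 1 x₀ (fun e => X e ω) k ∉ irregular n c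
    · exact Or.inl ⟨hω, h⟩
    · push Not at h
      obtain ⟨k, hk, hk2⟩ := h
      exact Or.inr (Set.mem_biUnion (Finset.mem_range.2 hk) hk2)
  have h1 := (measureReal_mono (μ := P) hsub (measure_ne_top _ _)).trans (measureReal_union_le _ _)
  linarith

end

/-! ### Deviation bounds in large dimension -/

section

variable {b c : ℝ}

lemma notMem_deviationEvent_of_tracked {Ω : Type*} {n : ℕ} (hn : 0 < n)
    (X : ℕ × Fin n × Fin n → Ω → ℝ) {x : EuclideanSpace ℝ (Fin n)} (hx : Admissible c x.ofLp)
    {L t : ℝ} {N : ℕ} (hN : 1 ≤ N) {ω : Ω}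
    (h : ∀ k < N, chainImage c L x.ofLp (fun e => X e ω) k ∉ untracked n c L)
    (hS : |(chainState c L x.ofLp (fun e => X e ω) N).2| < t * N) :
    ω ∉ deviationEvent X x N t := by
  have h1 := orbit_eq_of_tracked hn X x ω h
  have hadm := admissible_chainState (L := L) hn hx (fun e => X e ω) N
  set p := chainState c L x.ofLp (fun e => X e ω) N
  have hN0 : (0 : ℝ) < N := by exact_mod_cast hN
  have hnorm : ‖orbit X x N ω‖ = exp p.2 := by
    rw [EuclideanSpace.norm_eq, h1]
    simp only [Pi.smul_apply, smul_eq_mul, norm_mul, mul_pow, Real.norm_eq_abs, sq_abs]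
    rw [← Finset.mul_sum, hadm.1, mul_one, sqrt_sq (exp_pos _).le]
  rintro (h2 | h2)
  · rw [h2, norm_zero] at hnorm
    exact (exp_pos p.2).ne hnorm
  · have h3 : t ≤ |1 / (N : ℝ) * p.2| := by
      have h4 : t ≤ |1 / (N : ℝ) * log ‖orbit X x N ω‖| := h2
      rwa [hnorm, log_exp] at h4
    rw [abs_mul, abs_of_pos (by positivity : (0 : ℝ) < 1 / N), one_div_mul_eq_div,
      le_div_iff₀ hN0] at h3
    linarith

/-- The large deviation bound in large dimension. -/
lemma deviation_le_of_large_dim (hb : 0 < b) (hc0 : 0 < c) (hc : c ≤ 1 / 5) :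
    ∃ c' > (0 : ℝ), ∀ᶠ n : ℕ in atTop, ∀ μ : Measure ℝ, IsNormalizedSubgaussian b μ →
      ∀ x₀ ∈ unstructured n c,
      ∀ (Ω : Type*) [MeasurableSpace Ω] (P : Measure Ω) [IsProbabilityMeasure P]
        (X : ℕ × Fin n × Fin n → Ω → ℝ), (∀ e, Measurable (X e)) → iIndepFun X P →
        (∀ e, P.map (X e) = μ) → ∀ N : ℕ, 1 ≤ N → ∀ t : ℝ, 1 / (n : ℝ) ≤ t →
        P.real (deviationEvent X x₀ N t) ≤
          exp (-(c' * min (t ^ 2) t * ((N : ℝ) * (n : ℝ) ^ (1 - 2 * c)))) +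
            N * (n : ℝ) ^ (-(c' * n)) := by
  have hb16 : 0 < b / 16 := by positivity
  have hBc := bernsteinConst_pos hb16
  set β := bernsteinConst (b / 16) / (64 * (c / 4) ^ 2) with hβ
  have hβ0 : 0 < β := by positivity
  obtain ⟨k₁, hk₁, hev₁⟩ := prob_untracked_le hb hc0 hc
  obtain ⟨k₂, hk₂, hev₂⟩ := slow_regime_lower hb hc0 hc (C := 8192 / β) (by positivity)
  have t1 := tendsto_log_sq_mul_rpow_neg (a := 2 * c) (by positivity)
  have t2 := tendsto_natCast_rpow_neg (a := c / 2) (by positivity)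
  refine ⟨min 1 (min k₁ k₂), lt_min one_pos (lt_min hk₁ hk₂), ?_⟩
  filter_upwards [hev₁, hev₂, chain_tail hb hc0 hc,
    t1.eventually_le_const (by positivity : 0 < β / 4096),
    t2.eventually_le_const (by norm_num : (0 : ℝ) < 1 / 16), eventually_gt_atTop 1]
    with n hev₁ hev₂ hev₃ hlog hadm hn1 μ hμ x₀ hx₀ Ω _ P _ X hX hi hlaw N hN t ht
  have hn : 0 < n := by omega
  have hn' : (0 : ℝ) < n := by positivity
  have hn1' : (1 : ℝ) ≤ n := by exact_mod_cast hn
  have hN0 : (0 : ℝ) < N := by exact_mod_cast hN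
  have ht0 : 0 < t := lt_of_lt_of_le (by positivity) ht
  have hlog0 : 0 < log (n : ℝ) := log_pos (by exact_mod_cast hn1)
  obtain ⟨hx1, hxE⟩ := tailEnergy_of_unstructured hn hx₀
  have h0 : Admissible c x₀.ofLp := ⟨hx1, hadm.trans hxE⟩
  set c' := min 1 (min k₁ k₂) with hc'
  have hc'0 : 0 < c' := lt_min one_pos (lt_min hk₁ hk₂)
  have hc'1 : c' ≤ 1 := min_le_left _ _
  have hc'k₁ : c' ≤ k₁ := (min_le_right _ _).trans (min_le_left _ _)
  have hc'k₂ : c' ≤ k₂ := (min_le_right _ _).trans (min_le_right _ _)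
  set m := min (t ^ 2) t
  have hm2 : m ≤ t ^ 2 := min_le_left _ _
  have hm0 : 0 ≤ m := le_min (sq_nonneg t) ht0.le
  -- In a tracked step the norm may still change by a power of `n`, so that the logarithm is clamped
  -- at a multiple of `log n`. The price is a rate `n / (log n)²` instead of `n`; the factor
  -- `n^{-2c}` in the claim absorbs it.
  set L := c / 4 * log (n : ℝ) with hL
  set R := logRate (b / 16) L n with hR
  have hRβ : R = β * (n / log n ^ 2) := by
    rw [hR, logRate, hL, hβ]; field_simp
  set z := t ^ 2 * N * R / 2048 with hz
  have hpow : (n : ℝ) ^ (1 - 2 * c) = n * (n : ℝ) ^ (-(2 * c)) := by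
    rw [sub_eq_add_neg, rpow_add hn', rpow_one]
  rcases le_or_gt 4 z with hcase | hcase
  -- The exponent is large enough to absorb the constant factor of the tail bound.
  · -- the concentration bound
    have hsub : deviationEvent X x₀ N t ⊆
        {ω | ∃ m < N, chainImage c L x₀.ofLp (fun e => X e ω) m ∈ untracked n c L} ∪
        {ω | t * N ≤ |(chainState c L x₀.ofLp (fun e => X e ω) N).2|} := by
      intro ω hω
      by_contra hcon
      simp only [Set.mem_union, Set.mem_ofPred_eq, not_or, not_exists, not_and, not_le] at hcon
      exact notMem_deviationEvent_of_tracked hn X h0 hN hcon.1 hcon.2 hω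
    have h1 := (measureReal_mono (μ := P) hsub (measure_ne_top _ _)).trans
      (measureReal_union_le _ _)
    have h2 := hev₁ μ hμ x₀.ofLp h0 (by linarith) Ω P X hX hi hlaw N
    have h3 := hev₃ μ hμ x₀.ofLp h0 Ω P X hX hi hlaw N t ht
    have h4 : (N : ℝ) * (n : ℝ) ^ (-(k₁ * n)) ≤ N * (n : ℝ) ^ (-(c' * n)) := by
      gcongr
    have h5 : 6 * exp (-z) ≤ exp (-(z / 2)) := by
      have e : exp (-(z / 2)) = exp (z / 2) * exp (-z) := by rw [← exp_add]; congr 1; ring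
      have h6 : (6 : ℝ) ≤ exp (z / 2) := by
        have h7 : exp 2 ≤ exp (z / 2) := exp_le_exp.2 (by linarith)
        have h8 : exp (2 : ℝ) = exp 1 ^ 2 := by rw [← exp_nat_mul]; norm_num
        have := exp_one_gt_d9
        rw [h8] at h7
        nlinarith
      rw [e]
      gcongr
    have h6 : c' * m * (N * (n : ℝ) ^ (1 - 2 * c)) ≤ z / 2 := by
      have h7 : (n : ℝ) ^ (-(2 * c)) ≤ β / 4096 / log n ^ 2 := by
        rw [le_div_iff₀ (by positivity), mul_comm]; exact hlog
      calc c' * m * (N * (n : ℝ) ^ (1 - 2 * c)) ≤ 1 * t ^ 2 * (N * (n : ℝ) ^ (1 - 2 * c)) := by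
            gcongr
        _ = t ^ 2 * N * n * (n : ℝ) ^ (-(2 * c)) := by rw [hpow]; ring
        _ ≤ t ^ 2 * N * n * (β / 4096 / log n ^ 2) := by gcongr
        _ = z / 2 := by rw [hz, hRβ]; ring
    have h7 : exp (-(z / 2)) ≤ exp (-(c' * m * (N * (n : ℝ) ^ (1 - 2 * c)))) :=
      exp_le_exp.2 (neg_le_neg h6)
    linarith
  -- The tail bound exceeds one or nearly so. The claim is then of the form `1 - p ≤ exp (-p')` with
  -- `p' ≤ p`, where `p` is a lower bound for the complementary event.
  · -- too small a deviation for the concentration bound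
    have hslow : t ^ 2 * N * n ≤ 8192 / β * log n ^ 2 := by
      rw [hz, hRβ, div_lt_iff₀ (by norm_num)] at hcase
      have e : t ^ 2 * N * (β * (n / log n ^ 2)) = t ^ 2 * N * n * (β / log n ^ 2) := by ring
      rw [e, ← lt_div_iff₀ (by positivity)] at hcase
      refine hcase.le.trans (le_of_eq ?_)
      field_simp
      norm_num
    have h1 := hev₂ μ hμ x₀.ofLp h0 hxE Ω P X hX hi hlaw N t hN ht hslow
    set G := {ω | |(chainState c 1 x₀.ofLp (fun e => X e ω) N).2| < t * N ∧
            ∀ k < N, chainImage c 1 x₀.ofLp (fun e => X e ω) k ∉ irregular n c} with hG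
    have hGm : MeasurableSet G := by
      have e : G = {ω | |(chainState c 1 x₀.ofLp (fun e => X e ω) N).2| < t * N} ∩
          ⋂ k, ⋂ _ : k < N,
            {ω | chainImage c 1 x₀.ofLp (fun e => X e ω) k ∈ irregular n c}ᶜ := by
        ext ω; simp [hG]
      rw [e]
      refine (measurableSet_lt (measurable_chainState_comp hX N).snd.abs measurable_const).inter
        (MeasurableSet.iInter fun k => MeasurableSet.iInter fun _ => MeasurableSet.compl ?_)
      exact measurable_chainImage_comp hX k (measurableSet_irregular n c)
    have hsub : deviationEvent X x₀ N t ⊆ Gᶜ := by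
      intro ω hω hωG
      exact notMem_deviationEvent_of_tracked hn X h0 hN
        (fun k hk hu => hωG.2 k hk (Or.inl hu)) hωG.1 hω
    have h2 := measureReal_mono (μ := P) hsub (measure_ne_top _ _)
    rw [probReal_compl_eq_one_sub hGm] at h2
    set Y := t ^ 2 * N * (n : ℝ) ^ (1 - 2 * c)
    have h3 : c' * m * (N * (n : ℝ) ^ (1 - 2 * c)) ≤ k₂ * Y := by
      calc c' * m * (N * (n : ℝ) ^ (1 - 2 * c)) ≤ k₂ * t ^ 2 * (N * (n : ℝ) ^ (1 - 2 * c)) := by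
            gcongr
        _ = _ := by ring
    have h4 := add_one_le_exp (-(k₂ * Y))
    have h5 : exp (-(k₂ * Y)) ≤ exp (-(c' * m * (N * (n : ℝ) ^ (1 - 2 * c)))) :=
      exp_le_exp.2 (neg_le_neg h3)
    have h6 : 0 ≤ (N : ℝ) * (n : ℝ) ^ (-(c' * n)) := by positivity
    linarith

end

/-! ### Deviation bounds in bounded dimension -/

section

variable {b c : ℝ}

/-- The bound `K` on the mean square of `‖A x‖²`. -/
noncomputable def normSqConst (b : ℝ) : ℝ := 1 + 1024 / b ^ 2

lemma one_le_normSqConst (hb : 0 < b) : 1 ≤ normSqConst b := by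
  have : 0 < 1024 / b ^ 2 := by positivity
  unfold normSqConst; linarith

/-- By a second moment argument, `‖A x‖²` is of order one with a probability bounded below. -/
lemma prob_normSq_moderate (hb : 0 < b) {n : ℕ} (hn : 0 < n) {μ : Measure ℝ}
    (hμ : IsNormalizedSubgaussian b μ) {x : Fin n → ℝ} (hx : ∑ j, x j ^ 2 = 1) :
    1 / (4 * normSqConst b) ≤ (Measure.pi fun _ : Fin n => rowLaw μ x).real
      {y | 1 / 2 ≤ 1 + sqErr y ∧ 1 + sqErr y ≤ 4 * normSqConst b} := by
  have hK := one_le_normSqConst hb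
  set K := normSqConst b with hKdef
  have hrow := rowLaw_isNormalizedSubgaussian hμ hb hx
  have := hrow.prob
  have hn' : (0 : ℝ) < n := by positivity
  have hn1 : (1 : ℝ) ≤ n := by exact_mod_cast hn
  set π' := Measure.pi fun _ : Fin n => rowLaw μ x
  obtain ⟨m1, m2⟩ := sqErr_mean_and_sq (n := n) hrow (by positivity) hn
  have i1 : Integrable (fun y : Fin n → ℝ => sqErr y) π' := by
    have h1 : Integrable (fun y : Fin n → ℝ => |sqErr y| ^ 1) π' :=
      integrable_sqErr_pow (n := n) hrow (by positivity) hn 1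
    refine h1.mono' measurable_sqErr.aestronglyMeasurable (ae_of_all _ fun y => ?_)
    rw [pow_one, Real.norm_eq_abs]
  have i2 : Integrable (fun y : Fin n → ℝ => sqErr y ^ 2) π' := by
    have h1 : Integrable (fun y : Fin n → ℝ => |sqErr y| ^ 2) π' :=
      integrable_sqErr_pow (n := n) hrow (by positivity) hn 2
    simpa only [sq_abs] using h1
  set G := {y : Fin n → ℝ | 1 / 2 ≤ 1 + sqErr y ∧ 1 + sqErr y ≤ 4 * K} with hG
  have hGm : MeasurableSet G :=
    (measurableSet_le measurable_const (measurable_sqErr.const_add 1)).inter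
      (measurableSet_le (measurable_sqErr.const_add 1) measurable_const)
  have hpt : ∀ y : Fin n → ℝ, 1 / 2 + sqErr y ≤
      (1 + 2 * sqErr y + sqErr y ^ 2) / (4 * K) + G.indicator (fun _ => K) y := by
    intro y
    have hp : 0 ≤ (1 + 2 * sqErr y + sqErr y ^ 2) / (4 * K) := by
      have : 1 + 2 * sqErr y + sqErr y ^ 2 = (1 + sqErr y) ^ 2 := by ring
      rw [this]; positivity
    by_cases hy : y ∈ G
    · rw [Set.indicator_of_mem hy, ← sub_le_iff_le_add, le_div_iff₀ (by positivity)]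
      -- Here `u ≤ K + u² / (4K)`, for `u = 1 + sqErr y`.
      nlinarith [sq_nonneg (1 + sqErr y - 2 * K)]
    · rw [Set.indicator_of_notMem hy, add_zero]
      rcases le_or_gt (1 / 2) (1 + sqErr y) with h | h
      · have h2 : 4 * K < 1 + sqErr y := not_le.1 fun h2 => hy ⟨h, h2⟩
        rw [le_div_iff₀ (by positivity)]
        nlinarith
      · linarith
  have j0 : Integrable (fun y : Fin n → ℝ => 1 / 2 + sqErr y) π' := (integrable_const _).add i1
  have j1 : Integrable (fun y : Fin n → ℝ => 1 + 2 * sqErr y) π' :=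
    (integrable_const _).add (i1.const_mul 2)
  have j2 : Integrable (fun y : Fin n → ℝ => 1 + 2 * sqErr y + sqErr y ^ 2) π' := j1.add i2
  have j3 : Integrable (G.indicator fun _ : Fin n → ℝ => K) π' :=
    (integrable_const _).indicator hGm
  have h1 := integral_mono j0 ((j2.div_const (4 * K)).add j3) hpt
  simp only [Pi.add_apply] at h1
  rw [integral_add (integrable_const _) i1, integral_add (j2.div_const _) j3,
    integral_div (4 * K) fun y : Fin n → ℝ => 1 + 2 * sqErr y + sqErr y ^ 2,
    integral_add j1 i2, integral_add (integrable_const _) (i1.const_mul 2), integral_const_mul,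
    m1, integral_indicator hGm] at h1
  simp only [integral_const, probReal_univ, smul_eq_mul, measureReal_restrict_apply_univ,
    one_mul] at h1
  have h2 : ∫ y : Fin n → ℝ, sqErr y ^ 2 ∂π' ≤ K - 1 := by
    rw [m2, div_le_iff₀ hn']
    have h3 := rowLaw_fourth_moment_le hμ hb hx
    have h4 : K - 1 = 1024 / b ^ 2 := by rw [hKdef]; unfold normSqConst; ring
    rw [h4]
    have : 0 < 1024 / b ^ 2 := by positivity
    nlinarith
  have h5 : (1 + 2 * 0 + ∫ y : Fin n → ℝ, sqErr y ^ 2 ∂π') / (4 * K) ≤ 1 / 4 := by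
    rw [div_le_iff₀ (by positivity)]; linarith
  rw [div_le_iff₀ (by positivity)]
  linarith

/-- In bounded dimension the bound is trivial, except for one factor and a large deviation, where
it follows from the second moment argument. -/
lemma deviation_le_of_small_dim (hb : 0 < b) (hc0 : 0 < c) (n₀ : ℕ) :
    ∃ c' > (0 : ℝ), ∀ n : ℕ, 1 ≤ n → n ≤ n₀ → ∀ μ : Measure ℝ, IsNormalizedSubgaussian b μ →
      ∀ x₀ ∈ unstructured n c,
      ∀ (Ω : Type*) [MeasurableSpace Ω] (P : Measure Ω) [IsProbabilityMeasure P]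
        (X : ℕ × Fin n × Fin n → Ω → ℝ), (∀ e, Measurable (X e)) → iIndepFun X P →
        (∀ e, P.map (X e) = μ) → ∀ N : ℕ, 1 ≤ N → ∀ t : ℝ, 1 / (n : ℝ) ≤ t →
        P.real (deviationEvent X x₀ N t) ≤
          exp (-(c' * min (t ^ 2) t * ((N : ℝ) * (n : ℝ) ^ (1 - 2 * c)))) +
            N * (n : ℝ) ^ (-(c' * n)) := by
  have hK := one_le_normSqConst hb
  set K := normSqConst b with hKdef
  set p := 1 / (4 * K) with hp
  have hp0 : 0 < p := by positivity
  have hp1 : p ≤ 1 / 4 := by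
    rw [hp, div_le_div_iff₀ (by positivity) (by norm_num)]; linarith
  have hlogp : 0 < log (1 / (1 - p)) := log_pos (by rw [lt_div_iff₀ (by linarith)]; linarith)
  have hlogK : 0 < log (4 * K) := log_pos (by linarith)
  -- The choice of `c₁` makes `n^{-c' n} ≥ 1 - p` for `n ≤ n₀`, and that of `c₂` makes the first
  -- term at least `1/2` as long as `t ≤ log (4 K)`.
  set c₁ := log (1 / (1 - p)) / ((n₀ : ℝ) + 1) ^ 2 with hc₁
  set c₂ := 1 / (2 * log (4 * K) * ((n₀ : ℝ) + 1)) with hc₂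
  have hc₁0 : 0 < c₁ := by positivity
  have hc₂0 : 0 < c₂ := by positivity
  refine ⟨min c₁ c₂, lt_min hc₁0 hc₂0, ?_⟩
  intro n hn hnn₀ μ hμ x₀ hx₀ Ω _ P _ X hX hi hlaw N hN t ht
  have := hμ.prob
  set c' := min c₁ c₂
  have hc'0 : 0 < c' := lt_min hc₁0 hc₂0
  have hn' : (0 : ℝ) < n := by positivity
  have hn1 : (1 : ℝ) ≤ n := by exact_mod_cast hn
  have hnn : (n : ℝ) ≤ n₀ + 1 := by
    have : (n : ℝ) ≤ n₀ := by exact_mod_cast hnn₀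
    linarith
  have ht0 : 0 < t := lt_of_lt_of_le (by positivity) ht
  set m := min (t ^ 2) t
  have hmt : m ≤ t := min_le_right _ _
  have hm0 : 0 ≤ m := le_min (sq_nonneg t) ht0.le
  have hpow : 1 - p ≤ (n : ℝ) ^ (-(c' * n)) := by
    have h1 : log n * (c' * n) ≤ log (1 / (1 - p)) := by
      have h2 : log (n : ℝ) ≤ n := (log_le_sub_one_of_pos hn').trans (by linarith)
      have h3 : 0 ≤ log (n : ℝ) := log_nonneg hn1
      calc log n * (c' * n) ≤ n * (c₁ * n) := by gcongr; exact min_le_left _ _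
        _ = c₁ * n ^ 2 := by ring
        _ ≤ c₁ * ((n₀ : ℝ) + 1) ^ 2 := by gcongr
        _ = log (1 / (1 - p)) := by rw [hc₁]; field_simp
    rw [rpow_def_of_pos hn']
    have h4 : 1 - p = exp (-log (1 / (1 - p))) := by
      rw [exp_neg, exp_log (by rw [one_div]; exact inv_pos.2 (by linarith)), one_div, inv_inv]
    rw [h4]
    refine exp_le_exp.2 ?_
    linarith
  have hpow0 : 0 ≤ exp (-(c' * m * ((N : ℝ) * (n : ℝ) ^ (1 - 2 * c)))) := (exp_pos _).le
  have hP1 : P.real (deviationEvent X x₀ N t) ≤ 1 := measureReal_le_one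
  -- With two or more factors the second term is at least `2 (1 - p) ≥ 1`.
  rcases lt_or_ge 1 N with hN2 | hN2
  · have h1 : (2 : ℝ) ≤ N := by exact_mod_cast hN2
    have h2 : (2 : ℝ) * (1 - p) ≤ N * (n : ℝ) ^ (-(c' * n)) :=
      mul_le_mul h1 hpow (by linarith) (by linarith)
    linarith
  obtain rfl : N = 1 := le_antisymm hN2 hN
  rw [Nat.cast_one, one_mul, one_mul]
  rw [Nat.cast_one, one_mul] at hpow0
  -- With one factor and a small deviation the two terms together exceed one; a large deviation has
  -- probability at most `1 - p`.
  rcases le_or_gt t (log (4 * K)) with hcase | hcase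
  · have h1 : c' * m * (n : ℝ) ^ (1 - 2 * c) ≤ 1 / 2 := by
      have h2 : (n : ℝ) ^ (1 - 2 * c) ≤ n := by
        calc (n : ℝ) ^ (1 - 2 * c) ≤ (n : ℝ) ^ (1 : ℝ) :=
              rpow_le_rpow_of_exponent_le hn1 (by linarith)
          _ = n := rpow_one _
      calc c' * m * (n : ℝ) ^ (1 - 2 * c) ≤ c₂ * log (4 * K) * (n₀ + 1) := by
            gcongr
            · exact min_le_right _ _
            · exact hmt.trans hcase
            · exact h2.trans hnn
        _ = 1 / 2 := by rw [hc₂]; field_simp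
    have h3 := add_one_le_exp (-(c' * m * (n : ℝ) ^ (1 - 2 * c)))
    linarith
  · obtain ⟨hx1, -⟩ := tailEnergy_of_unstructured hn hx₀
    have hmod := prob_normSq_moderate hb hn hμ hx1
    rw [← hKdef, ← hp] at hmod
    set G := {y : Fin n → ℝ | 1 / 2 ≤ 1 + sqErr y ∧ 1 + sqErr y ≤ 4 * K} with hG
    have hGm : MeasurableSet G :=
      (measurableSet_le measurable_const (measurable_sqErr.const_add 1)).inter
        (measurableSet_le (measurable_sqErr.const_add 1) measurable_const)
    have hprob := prob_chainImage (c := c) (L := 1) (x₀ := x₀.ofLp) hX hi hlaw 0 hGm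
    have hprob' : P {ω | chainImage c 1 x₀.ofLp (fun e => X e ω) 0 ∈ G} =
        (Measure.pi fun _ : Fin n => rowLaw μ x₀.ofLp) G := by
      rw [hprob]
      simp only [chainState, lintegral_const, measure_univ, mul_one]
    have hEm : MeasurableSet {ω | chainImage c 1 x₀.ofLp (fun e => X e ω) 0 ∈ G} :=
      measurable_chainImage_comp hX 0 hGm
    have hsub : deviationEvent X x₀ 1 t ⊆
        {ω | chainImage c 1 x₀.ofLp (fun e => X e ω) 0 ∈ G}ᶜ := by
      intro ω hω hωG
      set y := chainImage c 1 x₀.ofLp (fun e => X e ω) 0 with hy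
      have hyi : ∀ i, y i = ∑ j, X (0, i, j) ω * x₀.ofLp j := fun i => rfl
      have horb : ‖orbit X x₀ 1 ω‖ ^ 2 = 1 + sqErr y := by
        rw [EuclideanSpace.norm_sq_eq]
        have e : ∀ i, (orbit X x₀ 1 ω).ofLp i = y i / √n := fun i => by
          simp only [orbit, matrixProduct, mul_one, scaledMatrix, Matrix.mulVec, dotProduct,
            Matrix.of_apply, hyi, Finset.sum_div]
          exact Finset.sum_congr rfl fun j _ => by ring
        simp only [e, Real.norm_eq_abs, sq_abs, div_pow, sq_sqrt hn'.le]
        rw [← Finset.sum_div, sqErr]; ring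
      obtain ⟨g1, g2⟩ := hωG
      have hpos : 0 < ‖orbit X x₀ 1 ω‖ := by
        rcases (norm_nonneg (orbit X x₀ 1 ω)).eq_or_lt' with h | h
        · rw [h] at horb; norm_num at horb; linarith
        · exact h
      rcases hω with h | h
      · rw [h, norm_zero] at hpos; exact lt_irrefl _ hpos
      · have h' : t ≤ |log ‖orbit X x₀ 1 ω‖| := by
          have h'' : t ≤ |1 / ((1 : ℕ) : ℝ) * log ‖orbit X x₀ 1 ω‖| := h
          simpa using h''
        have h1 : log (1 + sqErr y) = 2 * log ‖orbit X x₀ 1 ω‖ := by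
          rw [← horb, log_pow]; norm_num
        have h2 := log_le_log (by linarith) g2
        have h3 := log_le_log (by norm_num) g1
        have h4 : -log (4 * K) ≤ log (1 / 2) := by
          rw [one_div, log_inv]
          exact neg_le_neg (log_le_log (by norm_num) (by linarith))
        have h5 : |log ‖orbit X x₀ 1 ω‖| ≤ log (4 * K) := by
          rw [abs_le]; constructor <;> linarith
        linarith
    have h1 := measureReal_mono (μ := P) hsub (measure_ne_top _ _)
    rw [probReal_compl_eq_one_sub hEm] at h1
    have h2 : p ≤ P.real {ω | chainImage c 1 x₀.ofLp (fun e => X e ω) 0 ∈ G} := by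
      rw [measureReal_def, hprob', ← measureReal_def]; exact hmod
    linarith

end

/-! ### Deviation bounds in every dimension -/

section

universe u

variable {b c : ℝ}

/-- The bound in every dimension, for entries that are everywhere measurable. -/
lemma deviation_le (hb : 0 < b) (hc0 : 0 < c) (hc : c ≤ 1 / 5) :
    ∃ c' > (0 : ℝ), ∀ n : ℕ, 1 ≤ n → ∀ μ : Measure ℝ, IsNormalizedSubgaussian b μ →
      ∀ x₀ ∈ unstructured n c,
      ∀ (Ω : Type u) [MeasurableSpace Ω] (P : Measure Ω) [IsProbabilityMeasure P]
        (X : ℕ × Fin n × Fin n → Ω → ℝ), (∀ e, Measurable (X e)) → iIndepFun X P →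
        (∀ e, P.map (X e) = μ) → ∀ N : ℕ, 1 ≤ N → ∀ t : ℝ, 1 / (n : ℝ) ≤ t →
        P.real (deviationEvent X x₀ N t) ≤
          exp (-(c' * min (t ^ 2) t * ((N : ℝ) * (n : ℝ) ^ (1 - 2 * c)))) +
            N * (n : ℝ) ^ (-(c' * n)) := by
  obtain ⟨c₁, hc₁, h₁⟩ := deviation_le_of_large_dim.{u} hb hc0 hc
  obtain ⟨n₀, hn₀⟩ := eventually_atTop.1 h₁
  obtain ⟨c₂, hc₂, h₂⟩ := deviation_le_of_small_dim.{u} hb hc0 n₀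
  refine ⟨min c₁ c₂, lt_min hc₁ hc₂, ?_⟩
  intro n hn μ hμ x₀ hx₀ Ω _ P _ X hX hi hlaw N hN t ht
  have hn1 : (1 : ℝ) ≤ n := by exact_mod_cast hn
  have ht0 : 0 < t := lt_of_lt_of_le (by positivity) ht
  have hm0 : 0 ≤ min (t ^ 2) t := le_min (sq_nonneg t) ht0.le
  have mono : ∀ a, min c₁ c₂ ≤ a →
      exp (-(a * min (t ^ 2) t * ((N : ℝ) * (n : ℝ) ^ (1 - 2 * c)))) + N * (n : ℝ) ^ (-(a * n)) ≤
      exp (-(min c₁ c₂ * min (t ^ 2) t * ((N : ℝ) * (n : ℝ) ^ (1 - 2 * c)))) +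
        N * (n : ℝ) ^ (-(min c₁ c₂ * n)) := by
    intro a ha
    have h1 : min c₁ c₂ * min (t ^ 2) t * ((N : ℝ) * (n : ℝ) ^ (1 - 2 * c)) ≤
        a * min (t ^ 2) t * ((N : ℝ) * (n : ℝ) ^ (1 - 2 * c)) := by gcongr
    have h2 : (n : ℝ) ^ (-(a * n)) ≤ (n : ℝ) ^ (-(min c₁ c₂ * n)) :=
      rpow_le_rpow_of_exponent_le hn1 (neg_le_neg (by gcongr))
    gcongr
  rcases le_total n₀ n with h | h
  · exact (hn₀ n h μ hμ x₀ hx₀ Ω P X hX hi hlaw N hN t ht).trans (mono c₁ (min_le_left _ _))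
  · exact (h₂ n hn h μ hμ x₀ hx₀ Ω P X hX hi hlaw N hN t ht).trans (mono c₂ (min_le_right _ _))

/-- The law of a sub-Gaussian atom. -/
lemma IsSubgaussianAtom.isNormalizedSubgaussian_map {Ω₀ : Type*} [MeasurableSpace Ω₀]
    {P₀ : Measure Ω₀} [IsProbabilityMeasure P₀] {ξ : Ω₀ → ℝ} {K C₀ : ℝ} (hK : 0 < K)
    (h : IsSubgaussianAtom P₀ ξ K C₀) :
    IsNormalizedSubgaussian (1 / (2 * K * max C₀ 1)) (P₀.map ξ) := by
  obtain ⟨hi, hle⟩ := exp_sq_moment_le_two_of_tail h.aemeasurable hK (le_max_right C₀ 1)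
    fun s hs => (h.tail_le s hs).trans
      (mul_le_mul_of_nonneg_right (le_max_left C₀ 1) (exp_pos _).le)
  refine ⟨Measure.isProbabilityMeasure_map h.aemeasurable, ?_, ?_, ?_, ?_⟩
  · rw [integral_map h.aemeasurable (by fun_prop)]; exact h.mean_eq_zero
  · rw [integral_map h.aemeasurable (by fun_prop),
      ← variance_of_integral_eq_zero h.aemeasurable h.mean_eq_zero]
    exact h.variance_eq_one
  · rw [integrable_map_measure (by fun_prop) h.aemeasurable]; exact hi
  · rw [integral_map h.aemeasurable (by fun_prop)]; exact hle

/-- The probability of a deviation depends on the entries only up to almost sure equality. -/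
lemma deviationEvent_ae_eq {Ω : Type*} [MeasurableSpace Ω] {P : Measure Ω} {n : ℕ}
    {X Y : ℕ × Fin n × Fin n → Ω → ℝ} (h : ∀ e, X e =ᵐ[P] Y e) (x : EuclideanSpace ℝ (Fin n))
    (N : ℕ) (t : ℝ) : deviationEvent X x N t =ᵐ[P] deviationEvent Y x N t := by
  filter_upwards [ae_all_iff.2 h] with ω hω
  have h1 : ∀ k, matrixProduct X k ω = matrixProduct Y k ω := by
    intro k
    induction k with
    | zero => rfl
    | succ k ih => simp only [matrixProduct, scaledMatrix, ih, hω]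
  have h2 : orbit X x N ω = orbit Y x N ω := by simp only [orbit, h1]
  change (orbit X x N ω = 0 ∨ t ≤ |1 / (N : ℝ) * log ‖orbit X x N ω‖|) =
    (orbit Y x N ω = 0 ∨ t ≤ |1 / (N : ℝ) * log ‖orbit Y x N ω‖|)
  rw [h2]

end

end LyapunovTop

theorem lemma5p1 :
    ∃ c₀ : ℝ, 0 < c₀ ∧ ∀ c : ℝ, 0 < c → c < c₀ → ∀ K C₀ : ℝ, 0 < K → 0 < C₀ →
      ∃ c' : ℝ, 0 < c' ∧
        ∀ (Ω₀ : Type*) [MeasurableSpace Ω₀] (P₀ : Measure Ω₀) [IsProbabilityMeasure P₀]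
          (ξ : Ω₀ → ℝ), LyapunovTop.IsSubgaussianAtom P₀ ξ K C₀ →
        ∀ (n : ℕ), 1 ≤ n →
        ∀ (Ω : Type*) [MeasurableSpace Ω] (P : Measure Ω) [IsProbabilityMeasure P]
          (X : ℕ × Fin n × Fin n → Ω → ℝ),
          iIndepFun X P → (∀ e, IdentDistrib (X e) ξ P P₀) →
        ∀ x₀ ∈ LyapunovTop.unstructured n c, ∀ N : ℕ, 1 ≤ N → ∀ t : ℝ, 1 / (n : ℝ) ≤ t →
          P.real (LyapunovTop.deviationEvent X x₀ N t) ≤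
            Real.exp (-(c' * min (t ^ 2) t * ((N : ℝ) * (n : ℝ) ^ (1 - 2 * c))))
              + (N : ℝ) * (n : ℝ) ^ (-(c' * (n : ℝ))) := by
  refine ⟨1 / 5, by norm_num, fun c hc0 hc K C₀ hK _ => ?_⟩
  have hb : 0 < 1 / (2 * K * max C₀ 1) := by positivity
  obtain ⟨c', hc', key⟩ := LyapunovTop.deviation_le hb hc0 hc.le
  refine ⟨c', hc', ?_⟩
  intro Ω₀ _ P₀ _ ξ hξ n hn Ω _ P _ X hi hident x₀ hx₀ N hN t ht
  have hX : ∀ e, AEMeasurable (X e) P := fun e => (hident e).aemeasurable_fst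
  have hae : ∀ e, X e =ᵐ[P] (hX e).mk (X e) := fun e => (hX e).ae_eq_mk
  rw [measureReal_congr (LyapunovTop.deviationEvent_ae_eq hae x₀ N t)]
  exact key n hn _ (hξ.isNormalizedSubgaussian_map hK) x₀ hx₀ Ω P _
    (fun e => (hX e).measurable_mk) (hi.congr hae)
    (fun e => (Measure.map_congr (hae e).symm).trans (hident e).map_eq) N hN t ht
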